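/- Let $d\in\{2,3\}$, and let $\mathbb H^d$ be $d$-dimensional hyperbolic space of curvature $-1$ in the Poincaré ball model, with origin $o$, hyperbolic distance $\mathrm{dist}$ and hyperbolic volume $\mathrm dx$. Let $\varphi:\mathbb H^d\times\mathbb H^d\to[0,1]$ be measurable, symmetric, and invariant under translations: $\varphi(t_{u,v}(x),t_{u,v}(y))=\varphi(x,y)$ for all $u,v,x,y\in\mathbb H^d$, where $t_{u,v}$ is the translation isometry along the geodesic through $u$ and $v$ that takes $u$ to $v$. Assume that $$\lim_{R\to\infty}\operatorname*{ess\,sup}_{x:\ \mathrm{dist}(x,o)\ge R}\varphi(x,o)<1 .$$ For $\lambda\ge 0$ let $\eta$ be a Poisson point process on $\mathbb H^d$ with intensity measure $\lambda\,\mathrm dx$. Let $\xi^o$ be the random graph with vertex set $\eta\cup\{o\}$ in which each pair of distinct vertices $u,v$ is joined by an edge with probability $\varphi(u,v)$, independently for all pairs given the vertices. Let $\mathscr C=\mathscr C(o,\xi^o)$ be the set of vertices in the connected component of $o$, and $\#\mathscr C$ the number of its elements. For $q\in(0,1)$ declare each vertex (including $o$) a ghost independently with probability $q$, independently of everything else;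 let $\mathcal G$ be the set of ghosts, and write $o\leftrightarrow\mathcal G$ for $\mathscr C\cap\mathcal G\neq\emptyset$. Write $\mathbb P_\lambda,\mathbb E_\lambda$ and $\mathbb P_{\lambda,q},\mathbb E_{\lambda,q}$ for probability and expectation in these models. Set $$\lambda_c=\inf\{\lambda>0:\ \mathbb P_\lambda(\#\mathscr C=\infty)>0\}\in[0,\infty].$$ Then for every $r>0$ there is a constant $\kappa=\kappa(d,\varphi,r)\in(0,\infty)$ such that for every closed half-space $H\subset\mathbb H^d$ with $o\in H$ and $\mathrm{dist}(\partial H,o)=r$, every $\lambda\in[0,\lambda_c)$ and every $q\in(0,1)$, the following inequalities hold in $[0,\infty]$: $$\mathbb E_\lambda[\#\mathscr C]\le\kappa\,\mathbb E_\lambda\big[\#\mathscr C\,\mathbf 1_{\{\mathscr C\subset H\}}\big],$$ $$\mathbb E_{\lambda,q}\big[\#\mathscr C\,\mathbf 1_{\{\mathscr C\cap\mathcal G=\emptyset\}}\big]\le\kappa\,\mathbb E_{\lambda,q}\big[\#\mathscr C\,\mathbf 1_{\{\mathscr C\cap\mathcal G=\emptyset\}}\mathbf 1_{\{\mathscr C\subset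 H\}}\big],$$ $$\mathbb P_{\lambda,q}(o\leftrightarrow\mathcal G)\le\kappa\,\mathbb P_{\lambda,q}(o\leftrightarrow\mathcal G,\ \mathscr C\subset H).$$ -/

import Mathlib

open MeasureTheory ProbabilityTheory Set Filter Topology
open scoped ENNReal NNReal

noncomputable section

namespace HypRCM

/-! ## Hyperbolic space in the Poincaré ball model -/

/-- The Poincaré ball model of `d`-dimensional hyperbolic space: the open Euclidean unit ball.
Its Borel structure is the Euclidean one; hyperbolic distance and volume are defined below. -/
abbrev Hyp (d : ℕ) : Type := Metric.ball (0 : EuclideanSpace ℝ (Fin d)) 1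

/-- The origin of the Poincaré ball. -/
def origin (d : ℕ) : Hyp d := ⟨0, by simp⟩

instance (d : ℕ) : Nonempty (Hyp d) := ⟨origin d⟩

/-- Hyperbolic distance (curvature `-1`). -/
def hdist {d : ℕ} (x y : Hyp d) : ℝ :=
  Real.arcosh (1 + 2 * ‖(x : EuclideanSpace ℝ (Fin d)) - y‖ ^ 2 /
    ((1 - ‖(x : EuclideanSpace ℝ (Fin d))‖ ^ 2) * (1 - ‖(y : EuclideanSpace ℝ (Fin d))‖ ^ 2)))

/-- Hyperbolic volume: the Riemannian volume of the metric tensor `4 ‖dy‖² / (1 - ‖y‖²)²`. -/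
def hvol (d : ℕ) : Measure (Hyp d) :=
  (Measure.comap (Subtype.val : Hyp d → EuclideanSpace ℝ (Fin d))
      (volume : Measure (EuclideanSpace ℝ (Fin d)))).withDensity
    fun x => ENNReal.ofReal ((2 / (1 - ‖(x : EuclideanSpace ℝ (Fin d))‖ ^ 2)) ^ d)

instance (d : ℕ) : SFinite (hvol d) := by
  have : IsFiniteMeasure (Measure.comap (Subtype.val : Hyp d → EuclideanSpace ℝ (Fin d))
      (volume : Measure (EuclideanSpace ℝ (Fin d)))) := by
    constructor
    rw [(MeasurableEmbedding.subtype_coe measurableSet_ball).comap_apply, image_univ,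
      Subtype.range_coe]
    exact measure_ball_lt_top
  unfold hvol
  infer_instance

/-- The Euclidean formula for the hyperbolic translation (Möbius addition) taking `0` to `a`. -/
def moebiusAdd {E : Type*} [NormedAddCommGroup E] [InnerProductSpace ℝ E] (a x : E) : E :=
  (1 + 2 * inner ℝ a x + ‖a‖ ^ 2 * ‖x‖ ^ 2)⁻¹ •
    ((1 + 2 * inner ℝ a x + ‖x‖ ^ 2) • a + (1 - ‖a‖ ^ 2) • x)

theorem norm_moebiusAdd_lt_one {E : Type*} [NormedAddCommGroup E] [InnerProductSpace ℝ E]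
    {a x : E} (ha : ‖a‖ < 1) (hx : ‖x‖ < 1) : ‖moebiusAdd a x‖ < 1 := by
  have hA := norm_nonneg a
  have hX := norm_nonneg x
  have hs := abs_le.mp (abs_real_inner_le_norm a x)
  have hD : 0 < 1 + 2 * inner ℝ a x + ‖a‖ ^ 2 * ‖x‖ ^ 2 := by
    have h1 : ‖a‖ * ‖x‖ < 1 := by nlinarith
    nlinarith [hs.1, mul_pos (sub_pos.2 h1) (sub_pos.2 h1)]
  have hnum : ‖(1 + 2 * inner ℝ a x + ‖x‖ ^ 2) • a + (1 - ‖a‖ ^ 2) • x‖ ^ 2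
      < (1 + 2 * inner ℝ a x + ‖a‖ ^ 2 * ‖x‖ ^ 2) ^ 2 := by
    have hpos : 0 < (1 - ‖a‖ ^ 2) * (1 - ‖x‖ ^ 2) := by
      apply mul_pos <;> nlinarith
    have key := mul_pos hpos hD
    rw [norm_add_sq_real, norm_smul, norm_smul, inner_smul_left, inner_smul_right, mul_pow,
      mul_pow, Real.norm_eq_abs, Real.norm_eq_abs, sq_abs, sq_abs]
    simp only [conj_trivial]
    nlinarith [key]
  have hlt := lt_of_pow_lt_pow_left₀ 2 hD.le hnum
  rw [moebiusAdd, norm_smul, norm_inv, Real.norm_of_nonneg hD.le, inv_mul_lt_iff₀ hD]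
  simpa using hlt

/-- Translation of hyperbolic space along the geodesic through the origin and `a`, taking the
origin to `a`. -/
def translateOrigin {d : ℕ} (a x : Hyp d) : Hyp d :=
  ⟨moebiusAdd (a : EuclideanSpace ℝ (Fin d)) x, by
    have ha := a.2
    have hx := x.2
    rw [mem_ball_zero_iff] at ha hx ⊢
    exact norm_moebiusAdd_lt_one ha hx⟩

/-- The inverse point `-u` of the Poincaré ball. -/
def negPt {d : ℕ} (u : Hyp d) : Hyp d :=
  ⟨-(u : EuclideanSpace ℝ (Fin d)), by
    have hu := u.2
    rw [mem_ball_zero_iff] at hu ⊢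
    simpa using hu⟩

/-- The translation isometry `t_{u,v}` along the geodesic through `u` and `v`, taking `u` to `v`:
move `u` to the origin by `t_{o,-u}`, translate there (along a diameter) by the image of `v`, and
move back by `t_{o,u}`. -/
def translation {d : ℕ} (u v x : Hyp d) : Hyp d :=
  translateOrigin u
    (translateOrigin (translateOrigin (negPt u) v) (translateOrigin (negPt u) x))

/-- A closed half-space. In the Poincaré ball the hyperplanes are the intersections of the ball
with linear hyperplanes (`offset = 0`) and with spheres orthogonal to the unit sphere
(`offset ≠ 0`: centre `normal / offset`, squared radius `‖normal‖² / offset² - 1`). Both are given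
by the equation `2 ⟨normal, x⟩ = offset (1 + ‖x‖²)` with `|offset| < ‖normal‖`. -/
structure HalfSpace (d : ℕ) where
  normal : EuclideanSpace ℝ (Fin d)
  offset : ℝ
  abs_offset_lt : |offset| < ‖normal‖

/-- The points of a closed half-space. -/
def HalfSpace.carrier {d : ℕ} (H : HalfSpace d) : Set (Hyp d) :=
  {x | H.offset * (1 + ‖(x : EuclideanSpace ℝ (Fin d))‖ ^ 2)
    ≤ 2 * inner ℝ H.normal (x : EuclideanSpace ℝ (Fin d))}

/-- The boundary hyperplane of a half-space. -/
def HalfSpace.boundary {d : ℕ} (H : HalfSpace d) : Set (Hyp d) :=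
  {x | H.offset * (1 + ‖(x : EuclideanSpace ℝ (Fin d))‖ ^ 2)
    = 2 * inner ℝ H.normal (x : EuclideanSpace ℝ (Fin d))}

/-- The hyperbolic distance of a point from a (nonempty) set. -/
def hinfDist {d : ℕ} (x : Hyp d) (S : Set (Hyp d)) : ℝ := sInf (hdist x '' S)

/-! ## The random connection model -/

/-- A connection function: a measurable symmetric function on pairs of points with values in
`[0, 1]` which is invariant under all translation isometries. -/
structure ConnectionFn (d : ℕ) where
  toFun : Hyp d → Hyp d → unitInterval
  measurable_toFun : Measurable (Function.uncurry toFun)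
  symm : ∀ x y, toFun x y = toFun y x
  translation_inv : ∀ u v x y, toFun (translation u v x) (translation u v y) = toFun x y

/-- The assumption `lim_{R → ∞} ess sup_{x ∉ B_R(o)} φ(x, o) < 1`. -/
def ConnectionFn.LongDistance {d : ℕ} (φ : ConnectionFn d) : Prop :=
  ∃ L : ℝ≥0∞, L < 1 ∧
    Tendsto (fun R : ℝ =>
      essSup (fun x => ENNReal.ofReal (φ.toFun x (origin d) : ℝ))
        ((hvol d).restrict {x | hdist x (origin d) < R}ᶜ)) atTop (𝓝 L)

/-- Labels of the potential vertices. `none` is the added vertex `o`; `some (n, i)` is the `i`-th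
point of the `n`-th layer of the Poisson process. -/
abbrev Label : Type := Option (ℕ × ℕ)

/-- The randomness of the model: the numbers of points in the layers, the positions of the
points, one mark for each unordered pair of labels (deciding about the edge), and one mark for
each label (deciding about being a ghost vertex). -/
abbrev Sample (d : ℕ) : Type :=
  (ℕ → ℕ) × (ℕ × ℕ → Hyp d) × (Sym2 Label → unitInterval) × (Label → unitInterval)

/-- The `n`-th layer of hyperbolic volume: finite measures with sum `hvol d`. -/
def layer (d n : ℕ) : FiniteMeasure (Hyp d) := ⟨sfiniteSeq (hvol d) n, inferInstance⟩

/-- The law of the randomness at intensity `lam`. Layer `n` has a Poisson number of points with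
mean `lam` times the mass of the layer, placed independently according to the normalized layer.
Thus each layer is a Poisson process with intensity measure `lam • layer d n`, and their
independent superposition is a Poisson process with intensity measure `lam • hvol d`. All the marks
are uniform on `[0, 1]`, and everything is independent. -/
def law (d : ℕ) (lam : ℝ≥0) : Measure (Sample d) :=
  (Measure.infinitePi fun n : ℕ => poissonMeasure (lam * (layer d n).mass)).prod
    ((Measure.infinitePi fun p : ℕ × ℕ => ((layer d p.1).normalize : Measure (Hyp d))).prod
      ((Measure.infinitePi fun _ : Sym2 Label => (volume : Measure unitInterval)).prod
        (Measure.infinitePi fun _ : Label => (volume : Measure unitInterval))))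

instance (d : ℕ) (lam : ℝ≥0) : IsProbabilityMeasure (law d lam) := by
  unfold law
  infer_instance

/-- The labels which are vertices of the model with the added vertex `o`. -/
def present {d : ℕ} (ω : Sample d) : Label → Prop
  | none => True
  | some (n, i) => i < ω.1 n

/-- The location of a vertex. -/
def position {d : ℕ} (ω : Sample d) : Label → Hyp d
  | none => origin d
  | some p => ω.2.1 p

/-- The random graph `ξ^o`: two different vertices are joined if the (uniform) mark of the pair is
at most the value of the connection function, hence with the probability given by that value. -/
def graph {d : ℕ} (φ : ConnectionFn d) (ω : Sample d) : SimpleGraph Label where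
  Adj a b := a ≠ b ∧ present ω a ∧ present ω b ∧
    ω.2.2.1 s(a, b) ≤ φ.toFun (position ω a) (position ω b)
  symm := ⟨fun a b h => ⟨h.1.symm, h.2.2.1, h.2.1, by
    rw [Sym2.eq_swap, φ.symm]
    exact h.2.2.2⟩⟩
  loopless := ⟨fun _ h => h.1 rfl⟩

/-- The cluster of `o` in `ξ^o`, as a set of vertices. -/
def cluster {d : ℕ} (φ : ConnectionFn d) (ω : Sample d) : Set Label :=
  {a | (graph φ ω).Reachable none a}

/-- The number of vertices of the cluster of `o`. -/
def clusterSize {d : ℕ} (φ : ConnectionFn d) (ω : Sample d) : ℝ≥0∞ :=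
  ((cluster φ ω).encard : ℝ≥0∞)

/-- The event that the cluster of `o` lies in a set `S`. -/
def clusterIn {d : ℕ} (φ : ConnectionFn d) (S : Set (Hyp d)) : Set (Sample d) :=
  {ω | ∀ a ∈ cluster φ ω, position ω a ∈ S}

/-- The ghost labels: each label is a ghost independently with probability `q`. -/
def ghosts {d : ℕ} (q : ℝ) (ω : Sample d) : Set Label := {a | (ω.2.2.2 a : ℝ) < q}

/-- The event that the cluster of `o` contains no ghost vertex. -/
def ghostFree {d : ℕ} (φ : ConnectionFn d) (q : ℝ) : Set (Sample d) :=
  {ω | cluster φ ω ∩ ghosts q ω = ∅}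

/-- The event that `o` is connected to a ghost vertex. -/
def connectedToGhost {d : ℕ} (φ : ConnectionFn d) (q : ℝ) : Set (Sample d) :=
  {ω | ∃ a ∈ ghosts q ω, (graph φ ω).Reachable none a}

/-- The percolation function `θ`. -/
def percolation {d : ℕ} (φ : ConnectionFn d) (lam : ℝ≥0) : ℝ≥0∞ :=
  law d lam {ω | clusterSize φ ω = ∞}

/-- The critical intensity `λ_c = inf {λ > 0 : θ(λ) > 0}` (infinite if there is no such `λ`). -/
def criticalIntensity {d : ℕ} (φ : ConnectionFn d) : ℝ≥0∞ :=
  sInf {l : ℝ≥0∞ | ∃ lam : ℝ≥0, l = lam ∧ 0 < lam ∧ 0 < percolation φ lam}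

end HypRCM

end

/-! ## Infinite product measures and Poisson laws -/

section InfiniteProducts

variable {ι κ X : Type*} [MeasurableSpace X] (μ : ι → Measure X) [∀ i, IsProbabilityMeasure (μ i)]

/-! Write S_N for the expectation of the cluster size on {cluster size ≤ N}, and W_N(H) for the same
expectation restricted to clusters inside H (`sizeSum`). Everything reduces to one estimate,
`exists_sizeSum_le`: c S_N ≤ W_N(H) with c > 0 uniform in N, in the half-space H containing the
origin, and in the subcritical intensity. Below criticality the cluster is almost surely finite, and
each of the three expectations is a sum over M of w_M (M+1) times the probability that the cluster
has M+1 vertices (and lies in H), where w_M is 1, (1-q)^(M+1) or (1-(1-q)^(M+1))/(M+1). These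
weights are antitone, so Abel summation turns the bound on partial sums into the three inequalities
with κ = 1/c.

Law of a finite cluster. The Mecke formula (`mecke`), applied one vertex at a time (`peel_step`),
writes the law of a cluster with M+1 vertices as an iterated integral over positions. Its integrand
is explicit: the given points form a connected graph and no further Poisson point is joined to them
(`expect_clus_eq`). Two quantities satisfying the same recursion are compared by comparing these
integrands (`peel_compare`). This gives invariance under isometries, mass transport over the cluster
(`expect_sum_cluster`), and a lower bound for attaching one more vertex to a cluster
(`le_expect_attach`).

Far half-spaces. In a finite subset of hyperbolic space a positive fraction of the points is close
to a hyperplane having the whole set on one side, apart from points with many others nearby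
(`encard_le_nearSupport`). In the upper half-space model a point failing this has points of the set
below two different children of its dyadic cube, so its cell is a branching point of the dyadic
tree, and a tree has at most as many branching points as leaves. Mass transport turns the fraction
into a probability for the root. A finite net of half-spaces and rotation invariance then give a
fixed far half-space (`exists_sizeMean_nearSupport_le`); crowding is controlled by the Mecke
formula. Rotations are automorphisms because translation invariance forces the connection function
to be radial (`ConnectionFn.radial`).

From far to near half-spaces. Removing the root gives S_(N+1) ≤ 1 + lam Φ S_N, with Φ the expected
degree at intensity 1. Conversely, the root can be attached to the cluster of a neighbour w lying
deeper in H, as seen from which H is farther away; this costs a factor exp(-lam Φ), and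
uncrowdedness bounds the number of w producing the same cluster. Hence a bound at depth s + 2τ
yields one at depth s (`HalfSpaceBound.step`), and finitely many steps reach depth 0.

Bounded intensities. The constants depend on an upper bound Λ for lam. If clusters are almost surely
finite, the far half-space argument makes the probability of lying in a fixed half-space at least of
order 1/lam for large lam. But to stay in a half-space some step of a descent towards and across its
boundary must fail, which has probability at most (1 + lam A) exp(-lam β). So lam ≤ Λ
(`exists_intensity_bound`). The degenerate cases Φ = 0 and Φ = ∞ are treated directly. -/

theorem measurable_piecewise_pair (s : Set ι) [DecidablePred (· ∈ s)] :
    Measurable (fun p : (ι → X) × (ι → X) => s.piecewise p.1 p.2) := by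
  refine measurable_pi_lambda _ fun i => ?_
  by_cases hi : i ∈ s
  · simp only [hi, piecewise_eq_of_mem]
    fun_prop
  · simp only [hi, not_false_eq_true, piecewise_eq_of_notMem]
    fun_prop

/-- Mixing two independent samples along a set of coordinates does not change a product law.
Resampling of one coordinate and factorization over complementary sets of coordinates both come from
this. -/
theorem infinitePi_map_piecewise (s : Set ι) [DecidablePred (· ∈ s)] :
    ((Measure.infinitePi μ).prod (Measure.infinitePi μ)).map (fun p => s.piecewise p.1 p.2)
      = Measure.infinitePi μ := by
  refine Measure.eq_infinitePi μ fun F t ht => ?_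
  rw [Measure.map_apply (measurable_piecewise_pair s)
    (MeasurableSet.pi F.countable_toSet fun i _ => ht i)]
  have : (fun p : (ι → X) × (ι → X) => s.piecewise p.1 p.2) ⁻¹' (Set.pi F t)
      = (Set.pi (F.filter (· ∈ s)) t) ×ˢ (Set.pi (F.filter (· ∉ s)) t) := by
    ext ⟨x, y⟩
    simp only [mem_preimage, Set.mem_pi, mem_prod, Finset.coe_filter, mem_ofPred_eq,
      SetLike.mem_coe]
    constructor
    · intro h
      exact ⟨fun i hi => by simpa [hi.2] using h i hi.1, fun i hi => by simpa [hi.2] using h i hi.1⟩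
    · intro h i hi
      by_cases his : i ∈ s
      · simpa [his] using h.1 i ⟨hi, his⟩
      · simpa [his] using h.2 i ⟨hi, his⟩
  rw [this, Measure.prod_prod, Measure.infinitePi_pi μ (fun i _ => ht i),
    Measure.infinitePi_pi μ (fun i _ => ht i), Finset.prod_filter_mul_prod_filter_not]

theorem infinitePi_map_comp_injective (e : κ → ι) (he : Function.Injective e) :
    (Measure.infinitePi μ).map (fun f => f ∘ e) = Measure.infinitePi (fun k => μ (e k)) := by
  classical
  refine Measure.eq_infinitePi _ fun F t ht => ?_
  rw [Measure.map_apply (by fun_prop) (MeasurableSet.pi F.countable_toSet fun i _ => ht i)]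
  rcases isEmpty_or_nonempty κ with hκ | hκ
  · have : F = ∅ := Finset.eq_empty_of_isEmpty F
    subst this
    simp
  have hinv : ∀ k, Function.invFun e (e k) = k := Function.leftInverse_invFun he
  have : (fun f : ι → X => f ∘ e) ⁻¹' (Set.pi F t)
      = Set.pi (F.image e) (fun i => t (Function.invFun e i)) := by
    ext x
    simp [Set.mem_pi, hinv]
  rw [this, Measure.infinitePi_pi μ (fun i _ => ht _), Finset.prod_image he.injOn]
  simp [hinv]

theorem lintegral_infinitePi_comp_injective (e : κ → ι) (he : Function.Injective e)
    {F : (κ → X) → ℝ≥0∞} (hF : Measurable F) :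
    ∫⁻ f, F (f ∘ e) ∂(Measure.infinitePi μ) = ∫⁻ f, F f ∂(Measure.infinitePi fun k => μ (e k)) := by
  rw [← infinitePi_map_comp_injective μ e he, lintegral_map hF (by fun_prop)]

theorem lintegral_infinitePi_comp_perm (σ : ι → ι) (hσ : Function.Injective σ)
    (hμ : ∀ i, μ (σ i) = μ i) {F : (ι → X) → ℝ≥0∞} (hF : Measurable F) :
    ∫⁻ f, F (f ∘ σ) ∂(Measure.infinitePi μ) = ∫⁻ f, F f ∂(Measure.infinitePi μ) := by
  rw [lintegral_infinitePi_comp_injective μ σ hσ hF]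
  simp [hμ]

theorem lintegral_infinitePi_update [DecidableEq ι] (q : ι) {F : (ι → X) → ℝ≥0∞} (hF : Measurable F) :
    ∫⁻ f, F f ∂(Measure.infinitePi μ)
      = ∫⁻ f, ∫⁻ y, F (Function.update f q y) ∂(μ q) ∂(Measure.infinitePi μ) := by
  have hm : Measurable fun p : (ι → X) × X => Function.update p.1 q p.2 := by
    refine measurable_pi_lambda _ fun i => ?_
    rcases eq_or_ne i q with rfl | hi
    · simpa using measurable_snd
    · simp only [Function.update_of_ne hi]
      fun_prop
  have hpw : ∀ f g : ι → X, ({q}ᶜ : Set ι).piecewise f g = Function.update f q (g q) := by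
    intro f g
    ext i
    rcases eq_or_ne i q with rfl | hi
    · simp
    · simp [hi]
  conv_lhs => rw [← infinitePi_map_piecewise μ ({q}ᶜ)]
  rw [lintegral_map hF (measurable_piecewise_pair _),
    lintegral_prod (fun p => F (({q}ᶜ : Set ι).piecewise p.1 p.2))
      (hF.comp (measurable_piecewise_pair _)).aemeasurable]
  refine lintegral_congr fun f => ?_
  simp only [hpw]
  rw [← (measurePreserving_eval_infinitePi μ q).map_eq, lintegral_map _ (measurable_pi_apply q)]
  exact (hF.comp hm).comp measurable_prodMk_left

theorem lintegral_infinitePi_eval (q : ι) {F : X → ℝ≥0∞} (hF : Measurable F) :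
    ∫⁻ f, F (f q) ∂(Measure.infinitePi μ) = ∫⁻ y, F y ∂(μ q) := by
  rw [← (measurePreserving_eval_infinitePi μ q).map_eq, lintegral_map hF (measurable_pi_apply q)]

theorem lintegral_infinitePi_mul (s : Set ι) {f g : (ι → X) → ℝ≥0∞} (hf : Measurable f)
    (hg : Measurable g) (hfs : DependsOn f s) (hgs : DependsOn g sᶜ) :
    ∫⁻ u, f u * g u ∂(Measure.infinitePi μ)
      = (∫⁻ u, f u ∂(Measure.infinitePi μ)) * ∫⁻ u, g u ∂(Measure.infinitePi μ) := by
  classical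
  conv_lhs => rw [← infinitePi_map_piecewise μ s]
  rw [lintegral_map (f := fun u => f u * g u) (hf.mul hg) (measurable_piecewise_pair _)]
  have h1 : ∀ p : (ι → X) × (ι → X), f (s.piecewise p.1 p.2) = f p.1 := fun p =>
    hfs fun i hi => by simp [hi]
  have h2 : ∀ p : (ι → X) × (ι → X), g (s.piecewise p.1 p.2) = g p.2 := fun p =>
    hgs fun i hi => by
      rw [mem_compl_iff] at hi
      simp [hi]
  simp only [h1, h2]
  exact lintegral_prod_mul hf.aemeasurable hg.aemeasurable

theorem lintegral_infinitePi_prod_blocks {κ : Type*} (T : Finset κ) (s : κ → Set ι)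
    (f : κ → (ι → X) → ℝ≥0∞) (hf : ∀ k, Measurable (f k)) (hfs : ∀ k, DependsOn (f k) (s k))
    (hs : Pairwise (fun a b => Disjoint (s a) (s b))) :
    ∫⁻ u, ∏ k ∈ T, f k u ∂(Measure.infinitePi μ)
      = ∏ k ∈ T, ∫⁻ u, f k u ∂(Measure.infinitePi μ) := by
  classical
  induction T using Finset.induction_on with
  | empty => simp
  | insert a T ha ih =>
    simp only [Finset.prod_insert ha]
    rw [lintegral_infinitePi_mul μ (s a) (hf a) (Finset.measurable_prod _ fun k _ => hf k)
      (hfs a), ih]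
    intro x y hxy
    refine Finset.prod_congr rfl fun k hk => hfs k fun i hi => hxy i ?_
    have : k ≠ a := fun h => ha (h ▸ hk)
    exact fun hia => (hs this).le_bot ⟨hi, hia⟩

theorem lintegral_infinitePi_prod (T : Finset ι) (f : ι → X → ℝ≥0∞) (hf : ∀ i, Measurable (f i)) :
    ∫⁻ u, ∏ i ∈ T, f i (u i) ∂(Measure.infinitePi μ) = ∏ i ∈ T, ∫⁻ y, f i y ∂(μ i) := by
  rw [lintegral_infinitePi_prod_blocks μ T (fun i => {i}) (fun i u => f i (u i))
    (fun i => (hf i).comp (measurable_pi_apply i))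
    (fun i x y h => by simp [h i rfl]) (fun a b hab => by simpa using hab)]
  exact Finset.prod_congr rfl fun i _ => lintegral_infinitePi_eval μ i (hf i)

end InfiniteProducts

/-! ### Size biasing and generating function of the Poisson law -/

section Poisson

theorem lintegral_poissonMeasure (r : ℝ≥0) (f : ℕ → ℝ≥0∞) :
    ∫⁻ k, f k ∂(poissonMeasure r)
      = ∑' k, ENNReal.ofReal (Real.exp (-r) * r ^ k / (k.factorial)) * f k := by
  rw [poissonMeasure, lintegral_sum_measure]
  simp [lintegral_smul_measure, lintegral_dirac]

/-- The identity k · r^k / k! = r · r^(k-1) / (k-1)!; it is the one-layer core of the Mecke formula.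
The factor `k` removes the term `k = 0`, so the truncated `k - 1` is harmless. -/
theorem lintegral_poissonMeasure_size_bias (r : ℝ≥0) (f : ℕ → ℝ≥0∞) :
    ∫⁻ k, k * f (k - 1) ∂(poissonMeasure r) = r * ∫⁻ k, f k ∂(poissonMeasure r) := by
  rw [lintegral_poissonMeasure, lintegral_poissonMeasure, tsum_eq_zero_add' ENNReal.summable,
    ← ENNReal.tsum_mul_left]
  simp only [Nat.cast_zero, zero_mul, mul_zero, zero_add, Nat.add_sub_cancel]
  refine tsum_congr fun k => ?_
  rw [← mul_assoc, ← mul_assoc]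
  congr 1
  have h1 : ((k + 1 : ℕ) : ℝ≥0∞) = ENNReal.ofReal ((k : ℝ) + 1) := by
    rw [← ENNReal.ofReal_natCast]
    push_cast
    rfl
  have h2 : (r : ℝ≥0∞) = ENNReal.ofReal (r : ℝ) := by simp
  rw [h1, h2, ← ENNReal.ofReal_mul (by positivity), ← ENNReal.ofReal_mul (by positivity)]
  congr 1
  rw [Nat.factorial_succ, pow_succ]
  push_cast
  field_simp

/-- With `z` the probability that one point avoids a set of connections, this is the probability
that all points of a layer do: the source of the void probabilities. -/
theorem lintegral_poissonMeasure_pow (r : ℝ≥0) (z : ℝ≥0∞) (hz : z ≤ 1) :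
    ∫⁻ k, z ^ k ∂(poissonMeasure r) = ENNReal.ofReal (Real.exp (-(r * (1 - z.toReal)))) := by
  have hzt : z ≠ ∞ := ne_top_of_le_ne_top ENNReal.one_ne_top hz
  rw [lintegral_poissonMeasure]
  have h : ∀ k : ℕ, ENNReal.ofReal (Real.exp (-r) * r ^ k / (k.factorial)) * z ^ k
      = ENNReal.ofReal (Real.exp (-r) * ((r * z.toReal) ^ k / (k.factorial))) := by
    intro k
    rw [← ENNReal.ofReal_toReal (ENNReal.pow_ne_top (n := k) hzt),
      ← ENNReal.ofReal_mul (by positivity), ENNReal.toReal_pow, mul_pow]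
    congr 1
    ring
  simp only [h]
  have hs := (NormedSpace.expSeries_div_hasSum_exp ((r : ℝ) * z.toReal)).mul_left (Real.exp (-r))
  rw [← ENNReal.ofReal_tsum_of_nonneg (fun k => by positivity) hs.summable, hs.tsum_eq,
    ← Real.exp_eq_exp_ℝ, ← Real.exp_add]
  congr 2
  ring

end Poisson

noncomputable section
namespace HypRCM

/-! ## Random connection graphs on labelled configurations -/

/-- Labels: `Sum.inl j` are deterministic added points, `Sum.inr (n, i)` is the `i`-th point of
the `n`-th layer of the Poisson process. -/
abbrev Node : Type := ℕ ⊕ (ℕ × ℕ)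

/-- A symmetric measurable connection function on a measurable space. -/
structure SymKernel (X : Type*) [MeasurableSpace X] where
  toFun : X → X → unitInterval
  measurable_toFun : Measurable (Function.uncurry toFun)
  symm : ∀ x y, toFun x y = toFun y x

/-- A configuration: the set of vertices, their positions, and the marks of the pairs. -/
abbrev Conf (X : Type*) : Type _ := Set Node × (Node → X) × (Sym2 Node → unitInterval)

section Graph

variable {X : Type*}

open Classical in
/-- Delete a set of vertices (the positions of deleted labels are normalized). -/
def del [Nonempty X] (E : Set Node) (ω : Conf X) : Conf X :=
  (ω.1 \ E, fun p => if p ∈ E then Classical.arbitrary X else ω.2.1 p, ω.2.2)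

/-- Relabel a configuration. -/
def act (σ : Equiv.Perm Node) (ω : Conf X) : Conf X :=
  (σ ⁻¹' ω.1, ω.2.1 ∘ σ, ω.2.2 ∘ Sym2.map σ)

theorem del_act [Nonempty X] (σ : Equiv.Perm Node) (E : Set Node) (ω : Conf X) :
    del E (act σ ω) = act σ (del (σ.symm ⁻¹' E) ω) := by
  refine Prod.ext ?_ (Prod.ext ?_ rfl)
  · ext p
    simp [del, act]
  · funext p
    have h : σ p ∈ σ.symm ⁻¹' E ↔ p ∈ E := by simp
    by_cases hp : p ∈ E
    · simp only [del, act, Function.comp_apply, if_pos hp, if_pos (h.2 hp)]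
    · simp only [del, act, Function.comp_apply, if_neg hp, if_neg (mt h.1 hp)]

variable [MeasurableSpace X] (φ : SymKernel X)

/-- The random connection graph of a configuration. -/
def cgraph (ω : Conf X) : SimpleGraph Node where
  Adj a b := a ≠ b ∧ a ∈ ω.1 ∧ b ∈ ω.1 ∧ ω.2.2 s(a, b) ≤ φ.toFun (ω.2.1 a) (ω.2.1 b)
  symm := ⟨fun a b h => ⟨h.1.symm, h.2.2.1, h.2.1, by
    rw [Sym2.eq_swap, φ.symm]
    exact h.2.2.2⟩⟩
  loopless := ⟨fun _ h => h.1 rfl⟩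

/-- The cluster of a vertex. -/
def clus (ω : Conf X) (p : Node) : Set Node := {q | (cgraph φ ω).Reachable p q}

/-- The number of vertices of the cluster of a vertex. -/
def csize (ω : Conf X) (p : Node) : ℝ≥0∞ := ((clus φ ω p).encard : ℝ≥0∞)

@[simp] theorem cgraph_adj (ω : Conf X) (a b : Node) : (cgraph φ ω).Adj a b ↔
    a ≠ b ∧ a ∈ ω.1 ∧ b ∈ ω.1 ∧ ω.2.2 s(a, b) ≤ φ.toFun (ω.2.1 a) (ω.2.1 b) := Iff.rfl

theorem self_mem_clus (ω : Conf X) (p : Node) : p ∈ clus φ ω p := SimpleGraph.Reachable.refl p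

theorem clus_eq_of_mem {ω : Conf X} {p q : Node} (h : q ∈ clus φ ω p) :
    clus φ ω q = clus φ ω p := by
  ext r
  exact ⟨fun hr => SimpleGraph.Reachable.trans h hr,
    fun hr => SimpleGraph.Reachable.trans (SimpleGraph.Reachable.symm h) hr⟩

theorem mem_of_reachable {ω : Conf X} {p q : Node} (h : (cgraph φ ω).Reachable p q) (hpq : p ≠ q) :
    q ∈ ω.1 := by
  obtain ⟨w⟩ := h.symm
  cases w with
  | nil => exact absurd rfl hpq
  | cons hadj _ => exact hadj.2.1

theorem clus_subset {ω : Conf X} {p : Node} (hp : p ∈ ω.1) : clus φ ω p ⊆ ω.1 := by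
  intro q hq
  rcases eq_or_ne p q with rfl | h
  · exact hp
  · exact mem_of_reachable φ hq h

theorem cgraph_act (σ : Equiv.Perm Node) (ω : Conf X) :
    cgraph φ (act σ ω) = (cgraph φ ω).comap σ := by
  ext a b
  simp [act]

theorem adj_act (σ : Equiv.Perm Node) (ω : Conf X) (a b : Node) :
    (cgraph φ (act σ ω)).Adj a b ↔ (cgraph φ ω).Adj (σ a) (σ b) := by
  rw [cgraph_act]
  rfl

theorem clus_act (σ : Equiv.Perm Node) (ω : Conf X) (p : Node) :
    clus φ (act σ ω) p = σ ⁻¹' clus φ ω (σ p) := by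
  ext q
  simp only [clus, mem_preimage, mem_ofPred_eq, cgraph_act]
  exact (SimpleGraph.Iso.comap σ (cgraph φ ω)).reachable_iff.symm

theorem encard_preimage_perm (σ : Equiv.Perm Node) (s : Set Node) :
    (σ ⁻¹' s).encard = s.encard := by
  rw [← Equiv.image_symm_eq_preimage, σ.symm.injective.encard_image]

theorem csize_act (σ : Equiv.Perm Node) (ω : Conf X) (p : Node) :
    csize φ (act σ ω) p = csize φ ω (σ p) := by
  rw [csize, clus_act, encard_preimage_perm, csize]

theorem adj_del [Nonempty X] (E : Set Node) (ω : Conf X) (a b : Node) :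
    (cgraph φ (del E ω)).Adj a b ↔ (cgraph φ ω).Adj a b ∧ a ∉ E ∧ b ∉ E := by
  by_cases ha : a ∈ E
  · simp [del, ha]
  by_cases hb : b ∈ E
  · simp [del, hb]
  simp [del, ha, hb]

theorem cgraph_del_le [Nonempty X] (E : Set Node) (ω : Conf X) :
    cgraph φ (del E ω) ≤ cgraph φ ω := fun a b h => ((adj_del φ E ω a b).1 h).1

theorem clus_del_subset [Nonempty X] (E : Set Node) (ω : Conf X) (p : Node) :
    clus φ (del E ω) p ⊆ clus φ ω p := fun _ hq => hq.mono (cgraph_del_le φ E ω)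

end Graph

/-! ### Measurability of clusters -/

section Measurability

/-- Reachability is a countable union over the length of a walk, and a walk of length n + 1 is split
at its first step. -/
theorem measurableSet_reachable {Z V : Type*} [MeasurableSpace Z] [Countable V]
    (G : Z → SimpleGraph V) (hG : ∀ a b, MeasurableSet {z | (G z).Adj a b}) (a b : V) :
    MeasurableSet {z | (G z).Reachable a b} := by
  have key : ∀ n : ℕ, ∀ a, MeasurableSet {z | ∃ w : (G z).Walk a b, w.length = n} := by
    intro n
    induction n with
    | zero =>
      intro a
      by_cases h : a = b
      · subst h
        have : {z | ∃ w : (G z).Walk a a, w.length = 0} = univ :=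
          eq_univ_of_forall fun z => ⟨.nil, rfl⟩
        rw [this]
        exact MeasurableSet.univ
      · have : {z | ∃ w : (G z).Walk a b, w.length = 0} = ∅ :=
          eq_empty_of_forall_notMem fun z ⟨w, hw⟩ => h (SimpleGraph.Walk.eq_of_length_eq_zero hw)
        rw [this]
        exact MeasurableSet.empty
    | succ n ih =>
      intro a
      have : {z | ∃ w : (G z).Walk a b, w.length = n + 1}
          = ⋃ c, {z | (G z).Adj a c} ∩ {z | ∃ w : (G z).Walk c b, w.length = n} := by
        ext z
        simp only [mem_iUnion]
        constructor
        · rintro ⟨w, hw⟩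
          cases w with
          | nil => simp at hw
          | cons h p => exact ⟨_, h, p, by simpa using hw⟩
        · rintro ⟨c, h, p, hp⟩
          exact ⟨.cons h p, by simpa using hp⟩
      rw [this]
      exact MeasurableSet.iUnion fun c => (hG a c).inter (ih c)
  have : {z | (G z).Reachable a b} = ⋃ n : ℕ, {z | ∃ w : (G z).Walk a b, w.length = n} := by
    ext z
    simp only [mem_iUnion]
    exact ⟨fun ⟨w⟩ => ⟨_, w, rfl⟩, fun ⟨_, w, _⟩ => ⟨w⟩⟩
  rw [this]
  exact MeasurableSet.iUnion fun n => key n a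

theorem measurable_encard {Z V : Type*} [MeasurableSpace Z] [Countable V] (s : Z → Set V)
    (hs : ∀ v, MeasurableSet {z | v ∈ s z}) :
    Measurable fun z => ((s z).encard : ℝ≥0∞) := by
  classical
  have : (fun z => ((s z).encard : ℝ≥0∞))
      = fun z => ∑' v, ({z | v ∈ s z}).indicator (fun _ => (1 : ℝ≥0∞)) z := by
    ext z
    rw [← ENNReal.tsum_set_one, tsum_subtype (s z) (fun _ => (1 : ℝ≥0∞))]
    rfl
  rw [this]
  exact Measurable.tsum fun v => measurable_const.indicator (hs v)

variable {X : Type*} [MeasurableSpace X] (φ : SymKernel X)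

theorem measurableSet_vertex (a : Node) : MeasurableSet {ω : Conf X | a ∈ ω.1} :=
  measurable_fst (measurableSet_mem a)

theorem measurable_loc (a : Node) : Measurable fun ω : Conf X => ω.2.1 a :=
  (measurable_pi_apply a).comp (measurable_fst.comp measurable_snd)

theorem measurableSet_adj (a b : Node) : MeasurableSet {ω : Conf X | (cgraph φ ω).Adj a b} := by
  have h1 : Measurable fun ω : Conf X => ω.2.2 s(a, b) :=
    (measurable_pi_apply _).comp (measurable_snd.comp measurable_snd)
  have h2 : Measurable fun ω : Conf X => φ.toFun (ω.2.1 a) (ω.2.1 b) :=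
    φ.measurable_toFun.comp ((measurable_loc a).prodMk (measurable_loc b))
  by_cases hab : a = b
  · subst hab
    simp
  · have : {ω : Conf X | (cgraph φ ω).Adj a b} = {ω | a ∈ ω.1} ∩ {ω | b ∈ ω.1} ∩
        {ω | ω.2.2 s(a, b) ≤ φ.toFun (ω.2.1 a) (ω.2.1 b)} := by
      ext ω
      simp [hab, and_assoc]
    rw [this]
    exact ((measurableSet_vertex a).inter (measurableSet_vertex b)).inter
      (measurableSet_le h1 h2)

theorem measurable_del [Nonempty X] (E : Set Node) :
    Measurable (del E : Conf X → Conf X) := by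
  refine Measurable.prodMk ?_ (Measurable.prodMk ?_ (measurable_snd.comp measurable_snd))
  · rw [measurable_set_iff]
    intro a
    by_cases ha : a ∈ E
    · simp [ha]
    · simp only [Set.mem_sdiff, ha, not_false_eq_true, and_true]
      exact (measurable_set_mem a).comp measurable_fst
  · refine measurable_pi_lambda _ fun a => ?_
    by_cases ha : a ∈ E
    · simp [ha]
    · simpa only [ha, if_false] using measurable_loc a

theorem measurableSet_mem_clus (a b : Node) : MeasurableSet {ω : Conf X | b ∈ clus φ ω a} :=
  measurableSet_reachable (cgraph φ) (measurableSet_adj φ) a b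

end Measurability

/-! ### Configurations with added points, and relabelling -/

section MkConf

variable {X : Type*} [Nonempty X]

open Classical in
/-- The configuration with active added points `D`, active Poisson labels `P`, positions `a` of
the added points and `x` of the others, and marks `u`. Positions of inactive labels are
normalized. -/
def mkConf (D : Set ℕ) (P : Set (ℕ × ℕ)) (a : ℕ → X) (x : ℕ × ℕ → X)
    (u : Sym2 Node → unitInterval) : Conf X :=
  ({p | Sum.elim (· ∈ D) (· ∈ P) p},
    Sum.elim (fun j => if j ∈ D then a j else Classical.arbitrary X)
      (fun q => if q ∈ P then x q else Classical.arbitrary X), u)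

@[simp] theorem inl_mem_mkConf (D : Set ℕ) (P : Set (ℕ × ℕ)) (a : ℕ → X) (x : ℕ × ℕ → X)
    (u : Sym2 Node → unitInterval) (j : ℕ) : Sum.inl j ∈ (mkConf D P a x u).1 ↔ j ∈ D := Iff.rfl

@[simp] theorem inr_mem_mkConf (D : Set ℕ) (P : Set (ℕ × ℕ)) (a : ℕ → X) (x : ℕ × ℕ → X)
    (u : Sym2 Node → unitInterval) (q : ℕ × ℕ) : Sum.inr q ∈ (mkConf D P a x u).1 ↔ q ∈ P :=
  Iff.rfl

theorem loc_mkConf_inl {D : Set ℕ} (P : Set (ℕ × ℕ)) (a : ℕ → X) (x : ℕ × ℕ → X)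
    (u : Sym2 Node → unitInterval) {j : ℕ} (hj : j ∈ D) :
    (mkConf D P a x u).2.1 (Sum.inl j) = a j := by simp [mkConf, hj]

theorem loc_mkConf_inr (D : Set ℕ) {P : Set (ℕ × ℕ)} (a : ℕ → X) (x : ℕ × ℕ → X)
    (u : Sym2 Node → unitInterval) {q : ℕ × ℕ} (hq : q ∈ P) :
    (mkConf D P a x u).2.1 (Sum.inr q) = x q := by simp [mkConf, hq]

@[simp] theorem marks_mkConf (D : Set ℕ) (P : Set (ℕ × ℕ)) (a : ℕ → X) (x : ℕ × ℕ → X)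
    (u : Sym2 Node → unitInterval) : (mkConf D P a x u).2.2 = u := rfl

theorem mkConf_congr {D : Set ℕ} {P : Set (ℕ × ℕ)} {a a' : ℕ → X} {x x' : ℕ × ℕ → X}
    (u : Sym2 Node → unitInterval) (ha : ∀ j ∈ D, a j = a' j) (hx : ∀ q ∈ P, x q = x' q) :
    mkConf D P a x u = mkConf D P a' x' u := by
  refine Prod.ext rfl (Prod.ext ?_ rfl)
  funext p
  rcases p with j | q
  · by_cases hj : j ∈ D
    · simp [mkConf, hj, ha j hj]
    · simp [mkConf, hj]
  · by_cases hq : q ∈ P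
    · simp [mkConf, hq, hx q hq]
    · simp [mkConf, hq]

theorem del_mkConf_inl (D E : Set ℕ) (P : Set (ℕ × ℕ)) (a : ℕ → X) (x : ℕ × ℕ → X)
    (u : Sym2 Node → unitInterval) :
    del (Sum.inl '' E) (mkConf D P a x u) = mkConf (D \ E) P a x u := by
  refine Prod.ext ?_ (Prod.ext ?_ rfl)
  · ext p
    rcases p with j | q <;> simp [del]
  · funext p
    rcases p with j | q
    · by_cases hE : j ∈ E
      · simp [del, mkConf, hE]
      · by_cases hD : j ∈ D
        · simp [del, mkConf, hE, hD]
        · simp [del, mkConf, hE, hD]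
    · simp [del, mkConf]

/-- Exchanging labels turns the Poisson point `q` into the added point `k`, which is how an added
point arises in the Mecke formula. Normalizing the positions of inactive labels makes this an
equality of configurations. -/
theorem act_swap_inl_inr {D : Set ℕ} {P : Set (ℕ × ℕ)} (a : ℕ → X) (x : ℕ × ℕ → X)
    (u : Sym2 Node → unitInterval) {k : ℕ} (hk : k ∉ D) {q : ℕ × ℕ} (hq : q ∈ P) :
    act (Equiv.swap (Sum.inl k) (Sum.inr q)) (mkConf D P a x u)
      = mkConf (insert k D) (P \ {q}) (Function.update a k (x q)) x
          (u ∘ Sym2.map (Equiv.swap (Sum.inl k) (Sum.inr q))) := by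
  classical
  refine Prod.ext ?_ (Prod.ext ?_ rfl)
  · ext p
    rcases p with j | r
    · rcases eq_or_ne j k with rfl | hj
      · simp [act, hq]
      · simp [act, Equiv.swap_apply_of_ne_of_ne, hj]
    · rcases eq_or_ne r q with rfl | hr
      · simp [act, hk]
      · simp [act, Equiv.swap_apply_of_ne_of_ne, hr]
  · funext p
    rcases p with j | r
    · rcases eq_or_ne j k with rfl | hj
      · simp [act, mkConf, hq]
      · simp [act, mkConf, Equiv.swap_apply_of_ne_of_ne, hj]
    · rcases eq_or_ne r q with rfl | hr
      · simp [act, mkConf, hk]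
      · simp [act, mkConf, Equiv.swap_apply_of_ne_of_ne, hr]

/-- It does not matter which label of a Poisson point is missing; later the missing label is made
the last one of its layer. -/
theorem act_swap_inr_inr (D : Set ℕ) {P : Set (ℕ × ℕ)} (a : ℕ → X) (x : ℕ × ℕ → X)
    (u : Sym2 Node → unitInterval) {q r : ℕ × ℕ} (hq : q ∈ P) (hr : r ∈ P) :
    act (Equiv.swap (Sum.inr q) (Sum.inr r)) (mkConf D (P \ {q}) a x u)
      = mkConf D (P \ {r}) a (x ∘ Equiv.swap q r)
          (u ∘ Sym2.map (Equiv.swap (Sum.inr q) (Sum.inr r))) := by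
  classical
  rcases eq_or_ne q r with rfl | hqr
  · simp [act]
    rfl
  refine Prod.ext ?_ (Prod.ext ?_ rfl)
  · ext p
    rcases p with j | t
    · simp [act, Equiv.swap_apply_of_ne_of_ne]
    · rcases eq_or_ne t q with rfl | htq
      · simp [act, hr, hqr, hq, hqr.symm]
      · rcases eq_or_ne t r with rfl | htr
        · simp [act]
        · simp [act, Equiv.swap_apply_of_ne_of_ne, htq, htr]
  · funext p
    rcases p with j | t
    · simp [act, mkConf, Equiv.swap_apply_of_ne_of_ne]
    · rcases eq_or_ne t q with rfl | htq
      · simp [act, mkConf, hr, hqr, hq, hqr.symm]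
      · rcases eq_or_ne t r with rfl | htr
        · simp [act, mkConf]
        · simp [act, mkConf, Equiv.swap_apply_of_ne_of_ne, htq, htr]

theorem act_sumCongr (D : Set ℕ) (P : Set (ℕ × ℕ)) (a : ℕ → X) (x : ℕ × ℕ → X)
    (u : Sym2 Node → unitInterval) (τ : Equiv.Perm ℕ) :
    act (Equiv.sumCongr τ (Equiv.refl _)) (mkConf D P a x u)
      = mkConf (τ ⁻¹' D) P (a ∘ τ) x (u ∘ Sym2.map (Equiv.sumCongr τ (Equiv.refl _))) := by
  refine Prod.ext ?_ (Prod.ext ?_ rfl)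
  · ext p
    rcases p with j | q <;> simp [act]
  · funext p
    rcases p with j | q
    · by_cases hj : τ j ∈ D <;> simp [act, mkConf, hj]
    · simp [act, mkConf]

end MkConf

/-! ## The layered Poisson model and the Mecke formula -/

section Mecke

variable {X : Type*} [MeasurableSpace X]

/-- The law of the numbers of points of the layers. -/
def countLaw (ν : ℕ → FiniteMeasure X) (lam : ℝ≥0) : Measure (ℕ → ℕ) :=
  Measure.infinitePi fun n : ℕ => poissonMeasure (lam * (ν n).mass)

instance (ν : ℕ → FiniteMeasure X) (lam : ℝ≥0) : IsProbabilityMeasure (countLaw ν lam) := by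
  unfold countLaw
  infer_instance

/-- The law of the marks of the pairs. -/
def markLaw : Measure (Sym2 Node → unitInterval) :=
  Measure.infinitePi fun _ => (volume : Measure unitInterval)

instance : IsProbabilityMeasure markLaw := by
  unfold markLaw
  infer_instance

/-- The labels of the Poisson points which are present. -/
def pts (c : ℕ → ℕ) : Set (ℕ × ℕ) := {q | q.2 < c q.1}

@[simp] theorem mem_pts (c : ℕ → ℕ) (q : ℕ × ℕ) : q ∈ pts c ↔ q.2 < c q.1 := Iff.rfl

theorem measurable_update_snd {Z : Type*} [MeasurableSpace Z] {κ : Type*} [DecidableEq κ]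
    {a : Z → κ → X} {y : Z → X} (ha : Measurable a) (hy : Measurable y) (k : κ) :
    Measurable fun z => Function.update (a z) k (y z) := by
  refine measurable_pi_lambda _ fun j => ?_
  rcases eq_or_ne j k with rfl | hj
  · simpa using hy
  · simp only [Function.update_of_ne hj]
    fun_prop

/-- Resampling the `n`-th count reduces this to the size bias of a single Poisson variable. -/
theorem lintegral_countLaw_size_bias (ν : ℕ → FiniteMeasure X) (lam : ℝ≥0) (n : ℕ) {F : (ℕ → ℕ) → ℝ≥0∞} (hF : Measurable F) :
    ∫⁻ c, (c n : ℝ≥0∞) * F (Function.update c n (c n - 1)) ∂(countLaw ν lam)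
      = (lam * (ν n).mass : ℝ≥0) * ∫⁻ c, F c ∂(countLaw ν lam) := by
  classical
  have hm : Measurable fun c : ℕ → ℕ => Function.update c n (c n - 1) := by
    refine measurable_pi_lambda _ fun j => ?_
    rcases eq_or_ne j n with rfl | hj
    · simp only [Function.update_self]
      fun_prop
    · simp only [Function.update_of_ne hj]
      fun_prop
  have hm2 : Measurable fun c : ℕ → ℕ => (c n : ℝ≥0∞) :=
    (measurable_of_countable (fun k : ℕ => (k : ℝ≥0∞))).comp (measurable_pi_apply n)
  unfold countLaw
  rw [lintegral_infinitePi_update _ n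
    (F := fun c : ℕ → ℕ => (c n : ℝ≥0∞) * F (Function.update c n (c n - 1))) (hm2.mul (hF.comp hm)),
    lintegral_infinitePi_update _ n hF, ← lintegral_const_mul]
  · refine lintegral_congr fun c => ?_
    simp only [Function.update_self, Function.update_idem]
    exact lintegral_poissonMeasure_size_bias _ fun k => F (Function.update c n k)
  · refine Measurable.lintegral_prod_right' (f := fun p : (ℕ → ℕ) × ℕ =>
      F (Function.update p.1 n p.2)) ?_
    exact hF.comp (measurable_update_snd measurable_fst measurable_snd n)

variable [Nonempty X]

/-- The law of the positions of the Poisson points. -/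
def posLaw (ν : ℕ → FiniteMeasure X) : Measure (ℕ × ℕ → X) :=
  Measure.infinitePi fun p : ℕ × ℕ => ((ν p.1).normalize : Measure X)

instance (ν : ℕ → FiniteMeasure X) : IsProbabilityMeasure (posLaw ν) := by
  unfold posLaw
  infer_instance

/-- Expectation in the model with added points `a j`, `j ∈ D`. -/
def expect (ν : ℕ → FiniteMeasure X) (lam : ℝ≥0) (D : Set ℕ) (a : ℕ → X)
    (f : Conf X → ℝ≥0∞) : ℝ≥0∞ :=
  ∫⁻ c, ∫⁻ x, ∫⁻ u, f (mkConf D (pts c) a x u) ∂markLaw ∂(posLaw ν) ∂(countLaw ν lam)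

theorem measurable_mkConf (D : Set ℕ) :
    Measurable fun z : (ℕ → X) × Set (ℕ × ℕ) × (ℕ × ℕ → X) × (Sym2 Node → unitInterval) =>
      mkConf D z.2.1 z.1 z.2.2.1 z.2.2.2 := by
  refine Measurable.prodMk ?_ (Measurable.prodMk ?_ (by fun_prop))
  · rw [measurable_set_iff]
    rintro (j | q)
    · exact measurable_const
    · exact (measurable_set_mem q).comp (measurable_fst.comp measurable_snd)
  · refine measurable_pi_lambda _ ?_
    rintro (j | q)
    · by_cases hj : j ∈ D
      · simp only [Sum.elim_inl, hj, if_true]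
        fun_prop
      · simp [hj]
    · simp only [Sum.elim_inr]
      refine Measurable.ite ?_ (by fun_prop) measurable_const
      exact (measurable_fst.comp measurable_snd) (measurableSet_mem q)

theorem measurable_pts : Measurable pts := by
  rw [measurable_set_iff]
  intro q
  exact measurableSet_setOfPred.1
    (measurableSet_lt measurable_const (measurable_pi_apply q.1) : MeasurableSet {c | q ∈ pts c})

theorem measurable_conf {Z : Type*} [MeasurableSpace Z] (D : Set ℕ) {a : Z → ℕ → X}
    {P : Z → Set (ℕ × ℕ)} {x : Z → ℕ × ℕ → X} {u : Z → Sym2 Node → unitInterval}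
    (ha : Measurable a) (hP : Measurable P) (hx : Measurable x) (hu : Measurable u) :
    Measurable fun z => mkConf D (P z) (a z) (x z) (u z) :=
  (measurable_mkConf D).comp (ha.prodMk (hP.prodMk (hx.prodMk hu)))

variable (ν : ℕ → FiniteMeasure X) (lam : ℝ≥0)

theorem measurable_expect {Z : Type*} [MeasurableSpace Z] (D : Set ℕ) {a : Z → ℕ → X}
    (ha : Measurable a) {f : Conf X → ℝ≥0∞} (hf : Measurable f) :
    Measurable fun z => expect ν lam D (a z) f := by
  unfold expect
  refine Measurable.lintegral_prod_right' (f := fun p : Z × (ℕ → ℕ) =>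
    ∫⁻ x, ∫⁻ u, f (mkConf D (pts p.2) (a p.1) x u) ∂markLaw ∂(posLaw ν)) ?_
  refine Measurable.lintegral_prod_right' (f := fun p : (Z × (ℕ → ℕ)) × (ℕ × ℕ → X) =>
    ∫⁻ u, f (mkConf D (pts p.1.2) (a p.1.1) p.2 u) ∂markLaw) ?_
  refine Measurable.lintegral_prod_right'
    (f := fun p : ((Z × (ℕ → ℕ)) × (ℕ × ℕ → X)) × (Sym2 Node → unitInterval) =>
      f (mkConf D (pts p.1.1.2) (a p.1.1.1) p.1.2 p.2)) ?_
  exact hf.comp (measurable_conf D (by fun_prop) (measurable_pts.comp (by fun_prop))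
    (by fun_prop) (by fun_prop))

theorem expect_mono {D : Set ℕ} {a : ℕ → X} {f g : Conf X → ℝ≥0∞}
    (h : ∀ c x u, f (mkConf D (pts c) a x u) ≤ g (mkConf D (pts c) a x u)) :
    expect ν lam D a f ≤ expect ν lam D a g :=
  lintegral_mono fun c => lintegral_mono fun x => lintegral_mono fun u => h c x u

theorem expect_congr {D : Set ℕ} {a : ℕ → X} {f g : Conf X → ℝ≥0∞}
    (h : ∀ c x u, f (mkConf D (pts c) a x u) = g (mkConf D (pts c) a x u)) :
    expect ν lam D a f = expect ν lam D a g := by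
  simp only [expect, h]

theorem measurable_marks_integrand {D : Set ℕ} {f : Conf X → ℝ≥0∞} (hf : Measurable f)
    (P : Set (ℕ × ℕ)) (a : ℕ → X) (x : ℕ × ℕ → X) :
    Measurable fun u => f (mkConf D P a x u) :=
  hf.comp (measurable_conf D measurable_const measurable_const measurable_const measurable_id)

theorem measurable_pos_integrand {D : Set ℕ} {f : Conf X → ℝ≥0∞} (hf : Measurable f)
    (P : Set (ℕ × ℕ)) (a : ℕ → X) :
    Measurable fun x => ∫⁻ u, f (mkConf D P a x u) ∂markLaw := by
  refine Measurable.lintegral_prod_right'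
    (f := fun p : (ℕ × ℕ → X) × (Sym2 Node → unitInterval) => f (mkConf D P a p.1 p.2)) ?_
  exact hf.comp (measurable_conf D measurable_const measurable_const measurable_fst measurable_snd)

theorem measurable_count_integrand {D : Set ℕ} {f : Conf X → ℝ≥0∞} (hf : Measurable f)
    (a : ℕ → X) :
    Measurable fun c => ∫⁻ x, ∫⁻ u, f (mkConf D (pts c) a x u) ∂markLaw ∂(posLaw ν) := by
  refine Measurable.lintegral_prod_right' (f := fun p : (ℕ → ℕ) × (ℕ × ℕ → X) =>
    ∫⁻ u, f (mkConf D (pts p.1) a p.2 u) ∂markLaw) ?_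
  refine Measurable.lintegral_prod_right'
    (f := fun p : ((ℕ → ℕ) × (ℕ × ℕ → X)) × (Sym2 Node → unitInterval) =>
      f (mkConf D (pts p.1.1) a p.1.2 p.2)) ?_
  exact hf.comp (measurable_conf D measurable_const (measurable_pts.comp (by fun_prop))
    (by fun_prop) (by fun_prop))

theorem expect_add {D : Set ℕ} {a : ℕ → X} {f g : Conf X → ℝ≥0∞} (hf : Measurable f) :
    expect ν lam D a (fun ω => f ω + g ω) = expect ν lam D a f + expect ν lam D a g := by
  unfold expect
  rw [← lintegral_add_left (measurable_count_integrand ν hf a)]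
  refine lintegral_congr fun c => ?_
  rw [← lintegral_add_left (measurable_pos_integrand hf _ a)]
  refine lintegral_congr fun x => ?_
  rw [← lintegral_add_left (measurable_marks_integrand hf _ a x)]

theorem expect_tsum {κ : Type*} [Countable κ] {D : Set ℕ} {a : ℕ → X} {f : κ → Conf X → ℝ≥0∞}
    (hf : ∀ k, Measurable (f k)) :
    expect ν lam D a (fun ω => ∑' k, f k ω) = ∑' k, expect ν lam D a (f k) := by
  unfold expect
  rw [← lintegral_tsum fun k => (measurable_count_integrand ν (hf k) a).aemeasurable]
  refine lintegral_congr fun c => ?_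
  rw [← lintegral_tsum fun k => (measurable_pos_integrand (hf k) _ a).aemeasurable]
  refine lintegral_congr fun x => ?_
  rw [← lintegral_tsum fun k => (measurable_marks_integrand (hf k) _ a x).aemeasurable]

theorem expect_const_mul {D : Set ℕ} {a : ℕ → X} {f : Conf X → ℝ≥0∞} (hf : Measurable f)
    (r : ℝ≥0∞) :
    expect ν lam D a (fun ω => r * f ω) = r * expect ν lam D a f := by
  unfold expect
  rw [← lintegral_const_mul _ (measurable_count_integrand ν hf a)]
  refine lintegral_congr fun c => ?_
  rw [← lintegral_const_mul _ (measurable_pos_integrand hf _ a)]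
  refine lintegral_congr fun x => ?_
  rw [← lintegral_const_mul _ (measurable_marks_integrand hf _ a x)]

theorem expect_const {D : Set ℕ} {a : ℕ → X} (r : ℝ≥0∞) :
    expect ν lam D a (fun _ => r) = r := by
  simp [expect]

theorem sym2_map_injective (σ : Equiv.Perm Node) : Function.Injective (Sym2.map σ) :=
  Sym2.map.injective σ.injective

theorem lintegral_markLaw_perm (σ : Equiv.Perm Node) {F : (Sym2 Node → unitInterval) → ℝ≥0∞}
    (hF : Measurable F) : ∫⁻ u, F (u ∘ Sym2.map σ) ∂markLaw = ∫⁻ u, F u ∂markLaw :=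
  lintegral_infinitePi_comp_perm _ _ (sym2_map_injective σ) (fun _ => rfl) hF

/-- Equivariance of a functional under relabelings which fix the added points `D`. -/
def Equivariant (D : Set ℕ) (f : Conf X → Node → ℝ≥0∞) : Prop :=
  ∀ σ : Equiv.Perm Node, (∀ j ∈ D, σ (Sum.inl j) = Sum.inl j) → ∀ ω p,
    f (act σ ω) p = f ω (σ p)

/-- The present labels of a layer form an initial segment, so only the removal of the last one
leaves a set of the form `pts`. For `c n = 0` both sides are `pts c`. -/
theorem pts_diff_last {c : ℕ → ℕ} {n : ℕ} :
    pts c \ {(n, c n - 1)} = pts (Function.update c n (c n - 1)) := by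
  ext ⟨m, i⟩
  rcases eq_or_ne m n with rfl | hm
  · simp only [Set.mem_sdiff, mem_pts, mem_singleton_iff, Prod.mk.injEq, true_and,
      Function.update_self]
    omega
  · simp [hm]

/-- The Poisson point (n, i) is independent of the other points, so it may be treated as an added
point at an independent position `y`, with one point fewer in layer `n`. The result does not depend
on `i`. -/
theorem lintegral_single_point {D : Set ℕ} {k : ℕ} (hk : k ∉ D) (a : ℕ → X)
    {f : Conf X → Node → ℝ≥0∞} (hf : ∀ p, Measurable fun ω => f ω p) (hinv : Equivariant D f)
    (c : ℕ → ℕ) {n i : ℕ} (hi : i < c n) :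
    ∫⁻ x, ∫⁻ u, f (mkConf D (pts c) a x u) (Sum.inr (n, i)) ∂markLaw ∂(posLaw ν)
      = ∫⁻ y, ∫⁻ x, ∫⁻ u, f (mkConf (insert k D) (pts (Function.update c n (c n - 1)))
          (Function.update a k y) x u) (Sum.inl k) ∂markLaw ∂(posLaw ν)
            ∂((ν n).normalize : Measure X) := by
  classical
  set q : ℕ × ℕ := (n, i) with hq
  set r : ℕ × ℕ := (n, c n - 1) with hr
  have hqc : q ∈ pts c := hi
  have hrc : r ∈ pts c := by
    simp only [hr, mem_pts]
    omega
  set g : Conf X → ℝ≥0∞ := fun ω => f ω (Sum.inl k) with hg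
  have hgm : Measurable g := hf _
  -- The Poisson point `q` becomes the added point `k`, located at `x q`.
  have h1 : ∀ x u, f (mkConf D (pts c) a x u) (Sum.inr q)
      = g (mkConf (insert k D) (pts c \ {q}) (Function.update a k (x q)) x
          (u ∘ Sym2.map (Equiv.swap (Sum.inl k) (Sum.inr q)))) := by
    intro x u
    rw [hg, ← act_swap_inl_inr a x u hk hqc]
    simp only
    rw [hinv]
    · simp
    · intro j hj
      exact Equiv.swap_apply_of_ne_of_ne (fun h => hk (Sum.inl_injective h ▸ hj)) (by simp)
  -- The gap at label `q` is moved to the last label `r` of the same layer, whose points have the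
  -- same law.
  have h2 : ∀ y x u, g (mkConf (insert k D) (pts c \ {q}) (Function.update a k y) x u)
      = g (mkConf (insert k D) (pts c \ {r}) (Function.update a k y) (x ∘ Equiv.swap q r)
          (u ∘ Sym2.map (Equiv.swap (Sum.inr q) (Sum.inr r)))) := by
    intro y x u
    rw [hg, ← act_swap_inr_inr (insert k D) (Function.update a k y) x u hqc hrc]
    simp only
    rw [hinv]
    · rw [Equiv.swap_apply_of_ne_of_ne (by simp) (by simp)]
    · intro j _
      exact Equiv.swap_apply_of_ne_of_ne (by simp) (by simp)
  have hjoint : ∀ P : Set (ℕ × ℕ), Measurable fun z : X × (ℕ × ℕ → X) =>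
      ∫⁻ u, g (mkConf (insert k D) P (Function.update a k z.1) z.2 u) ∂markLaw := by
    intro P
    refine Measurable.lintegral_prod_right'
      (f := fun p : (X × (ℕ × ℕ → X)) × (Sym2 Node → unitInterval) =>
        g (mkConf (insert k D) P (Function.update a k p.1.1) p.1.2 p.2)) ?_
    exact hgm.comp (measurable_conf _ (measurable_update_snd measurable_const (by fun_prop) k)
      measurable_const (by fun_prop) (by fun_prop))
  have hjq : Measurable fun x : ℕ × ℕ → X =>
      ∫⁻ u, g (mkConf (insert k D) (pts c \ {q}) (Function.update a k (x q)) x u) ∂markLaw := by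
    have hm : Measurable fun x : ℕ × ℕ → X => (x q, x) :=
      (measurable_pi_apply q).prodMk measurable_id
    exact (hjoint (pts c \ {q})).comp hm
  calc ∫⁻ x, ∫⁻ u, f (mkConf D (pts c) a x u) (Sum.inr q) ∂markLaw ∂(posLaw ν)
      = ∫⁻ x, ∫⁻ u, g (mkConf (insert k D) (pts c \ {q}) (Function.update a k (x q)) x u)
          ∂markLaw ∂(posLaw ν) := by
        refine lintegral_congr fun x => ?_
        simp only [h1]
        exact lintegral_markLaw_perm _ (measurable_marks_integrand hgm _ _ _)
    _ = ∫⁻ x, ∫⁻ y, ∫⁻ u, g (mkConf (insert k D) (pts c \ {q}) (Function.update a k y) x u)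
          ∂markLaw ∂((ν n).normalize : Measure X) ∂(posLaw ν) := by
        -- The position `x q` now occurs only as the position of the added point, because the label
        -- `q` is absent; resampling it yields an independent `y`.
        rw [posLaw, lintegral_infinitePi_update _ q
          (F := fun x => ∫⁻ u, g (mkConf (insert k D) (pts c \ {q}) (Function.update a k (x q)) x u)
          ∂markLaw) hjq]
        refine lintegral_congr fun x => lintegral_congr fun y => lintegral_congr fun u => ?_
        rw [Function.update_self]
        congr 1
        refine mkConf_congr u (fun _ _ => rfl) fun t ht => ?_
        have : t ≠ q := ht.2
        simp [this]
    _ = ∫⁻ y, ∫⁻ x, ∫⁻ u, g (mkConf (insert k D) (pts c \ {q}) (Function.update a k y) x u)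
          ∂markLaw ∂(posLaw ν) ∂((ν n).normalize : Measure X) := by
        rw [lintegral_lintegral_swap]
        exact ((hjoint _).comp measurable_swap).aemeasurable
    _ = _ := by
        refine lintegral_congr fun y => ?_
        rw [← pts_diff_last]
        simp only [h2]
        refine Eq.trans ?_ (lintegral_infinitePi_comp_perm _ (Equiv.swap q r)
          (Equiv.swap q r).injective ?_ (F := fun x => ∫⁻ u, g (mkConf (insert k D) (pts c \ {r})
            (Function.update a k y) x u) ∂markLaw) ?_)
        · refine lintegral_congr fun x => ?_
          exact lintegral_markLaw_perm (Equiv.swap (Sum.inr q) (Sum.inr r))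
            (F := fun u => g (mkConf (insert k D) (pts c \ {r}) (Function.update a k y)
              (x ∘ Equiv.swap q r) u)) (measurable_marks_integrand hgm _ _ _)
        · intro t
          rcases eq_or_ne t q with rfl | htq
          · simp [hq, hr]
          · rcases eq_or_ne t r with rfl | htr
            · simp [hq, hr]
            · rw [Equiv.swap_apply_of_ne_of_ne htq htr]
        · exact (hjoint _).comp (measurable_const.prodMk measurable_id)

theorem mass_mul_lintegral_normalize (ρ : FiniteMeasure X) (F : X → ℝ≥0∞) :
    (ρ.mass : ℝ≥0∞) * ∫⁻ y, F y ∂(ρ.normalize : Measure X) = ∫⁻ y, F y ∂(ρ : Measure X) := by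
  conv_rhs => rw [FiniteMeasure.self_eq_mass_smul_normalize ρ]
  rw [FiniteMeasure.toMeasure_smul, lintegral_smul_measure]
  rfl

/-- The Mecke formula. -/
theorem mecke {D : Set ℕ} {k : ℕ} (hk : k ∉ D) (a : ℕ → X)
    {f : Conf X → Node → ℝ≥0∞} (hf : ∀ p, Measurable fun ω => f ω p) (hinv : Equivariant D f) :
    expect ν lam D a (fun ω => ∑' q : ℕ × ℕ,
        ({ω : Conf X | Sum.inr q ∈ ω.1}).indicator (fun ω => f ω (Sum.inr q)) ω)
      = lam * ∫⁻ y, expect ν lam (insert k D) (Function.update a k y) (fun ω => f ω (Sum.inl k))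
          ∂(Measure.sum fun n => (ν n : Measure X)) := by
  classical
  rw [expect_tsum ν lam fun q => (hf _).indicator (measurableSet_vertex _),
    ENNReal.tsum_prod', lintegral_sum_measure, ← ENNReal.tsum_mul_left]
  refine tsum_congr fun n => ?_
  set Ψ : (ℕ → ℕ) → ℝ≥0∞ := fun c => ∫⁻ y, ∫⁻ x, ∫⁻ u, f (mkConf (insert k D) (pts c)
    (Function.update a k y) x u) (Sum.inl k) ∂markLaw ∂(posLaw ν) ∂((ν n).normalize : Measure X)
  have hjoint : Measurable fun p : (ℕ → ℕ) × X => ∫⁻ x, ∫⁻ u, f (mkConf (insert k D) (pts p.1)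
    (Function.update a k p.2) x u) (Sum.inl k) ∂markLaw ∂(posLaw ν) := by
    refine Measurable.lintegral_prod_right' (f := fun p : ((ℕ → ℕ) × X) × (ℕ × ℕ → X) =>
      ∫⁻ u, f (mkConf (insert k D) (pts p.1.1) (Function.update a k p.1.2) p.2 u) (Sum.inl k)
        ∂markLaw) ?_
    refine Measurable.lintegral_prod_right'
      (f := fun p : (((ℕ → ℕ) × X) × (ℕ × ℕ → X)) × (Sym2 Node → unitInterval) =>
        f (mkConf (insert k D) (pts p.1.1.1) (Function.update a k p.1.1.2) p.1.2 p.2)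
          (Sum.inl k)) ?_
    exact (hf _).comp (measurable_conf _ (measurable_update_snd measurable_const (by fun_prop) k)
      (measurable_pts.comp (by fun_prop)) (by fun_prop) (by fun_prop))
  have hΨ : Measurable Ψ := Measurable.lintegral_prod_right' hjoint
  have hterm : ∀ i, expect ν lam D a (({ω : Conf X | Sum.inr (n, i) ∈ ω.1}).indicator
      (fun ω => f ω (Sum.inr (n, i))))
      = ∫⁻ c, ({c : ℕ → ℕ | i < c n}).indicator
          (fun c => Ψ (Function.update c n (c n - 1))) c ∂(countLaw ν lam) := by
    intro i
    refine lintegral_congr fun c => ?_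
    by_cases hi : i < c n
    · rw [indicator_of_mem (s := {c : ℕ → ℕ | i < c n}) hi]
      refine Eq.trans ?_ (lintegral_single_point ν hk a hf hinv c hi)
      refine lintegral_congr fun x => lintegral_congr fun u => ?_
      rw [indicator_of_mem]
      exact hi
    · rw [indicator_of_notMem (s := {c : ℕ → ℕ | i < c n}) hi]
      have : ∀ x u, ({ω : Conf X | Sum.inr (n, i) ∈ ω.1}).indicator
          (fun ω => f ω (Sum.inr (n, i))) (mkConf D (pts c) a x u) = 0 := fun x u => by
        rw [indicator_of_notMem]
        exact hi
      simp [this]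
  have hup : Measurable fun c : ℕ → ℕ => Function.update c n (c n - 1) := by
    refine measurable_pi_lambda _ fun j => ?_
    rcases eq_or_ne j n with rfl | hj
    · simp only [Function.update_self]
      fun_prop
    · simp only [Function.update_of_ne hj]
      fun_prop
  -- All `c n` points of the layer contribute the same value. The resulting factor `c n` is absorbed
  -- by size biasing, which produces the mean `lam` times the mass.
  have hsum : ∀ c : ℕ → ℕ, ∑' i, ({c : ℕ → ℕ | i < c n}).indicator
      (fun c => Ψ (Function.update c n (c n - 1))) c
      = (c n : ℝ≥0∞) * Ψ (Function.update c n (c n - 1)) := by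
    intro c
    rw [tsum_eq_sum (s := Finset.range (c n))]
    · rw [Finset.sum_congr rfl (g := fun _ => Ψ (Function.update c n (c n - 1)))]
      · simp
      · intro i hi
        rw [indicator_of_mem]
        exact Finset.mem_range.1 hi
    · intro i hi
      rw [indicator_of_notMem]
      exact fun h => hi (Finset.mem_range.2 h)
  simp only [hterm]
  rw [← lintegral_tsum]
  · simp only [hsum]
    rw [lintegral_countLaw_size_bias ν lam n hΨ, lintegral_lintegral_swap hjoint.aemeasurable,
      ENNReal.coe_mul, mul_assoc, mass_mul_lintegral_normalize]
    rfl
  · intro i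
    exact ((hΨ.comp hup).indicator (measurableSet_lt measurable_const
      (measurable_pi_apply n))).aemeasurable

/-- Relabeling of the added points. -/
theorem expect_relabel (τ : Equiv.Perm ℕ) (D : Set ℕ) (a : ℕ → X) {f : Conf X → ℝ≥0∞}
    (hf : Measurable f) :
    expect ν lam D a (fun ω => f (act (Equiv.sumCongr τ (Equiv.refl _)) ω))
      = expect ν lam (τ ⁻¹' D) (a ∘ τ) f := by
  refine lintegral_congr fun c => lintegral_congr fun x => ?_
  simp only [act_sumCongr]
  exact lintegral_markLaw_perm _ (measurable_marks_integrand hf _ _ _)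

theorem expect_congr_loc {D : Set ℕ} {a a' : ℕ → X} (h : ∀ j ∈ D, a j = a' j)
    (f : Conf X → ℝ≥0∞) : expect ν lam D a f = expect ν lam D a' f := by
  refine lintegral_congr fun c => lintegral_congr fun x => lintegral_congr fun u => ?_
  rw [mkConf_congr u h fun _ _ => rfl]

theorem expect_del (D E : Set ℕ) (a : ℕ → X) (f : Conf X → ℝ≥0∞) :
    expect ν lam D a (fun ω => f (del (Sum.inl '' E) ω)) = expect ν lam (D \ E) a f := by
  simp only [expect, del_mkConf_inl]

end Mecke

/-! ### The exponential exp(-t) with values at t = ∞ included -/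

section ExpNeg

/-- The function `t ↦ exp (-t)` on `[0, ∞]`. -/
def expNeg (t : ℝ≥0∞) : ℝ≥0∞ := EReal.exp (-(t : EReal))

theorem expNeg_top : expNeg ∞ = 0 := by simp [expNeg]

theorem expNeg_zero : expNeg 0 = 1 := by simp [expNeg]

theorem expNeg_anti {s t : ℝ≥0∞} (h : s ≤ t) : expNeg t ≤ expNeg s := by
  unfold expNeg
  rw [EReal.exp_le_exp_iff, EReal.neg_le_neg_iff]
  exact_mod_cast h

theorem expNeg_add (s t : ℝ≥0∞) : expNeg (s + t) = expNeg s * expNeg t := by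
  unfold expNeg
  rw [← EReal.exp_add]
  congr 1
  rw [EReal.coe_ennreal_add, EReal.neg_add] <;> simp [sub_eq_add_neg]

theorem expNeg_pos {t : ℝ≥0∞} (ht : t ≠ ∞) : 0 < expNeg t := by
  unfold expNeg
  rw [EReal.zero_lt_exp_iff, bot_lt_iff_ne_bot]
  simpa using ht

theorem expNeg_le_one (t : ℝ≥0∞) : expNeg t ≤ 1 := expNeg_zero ▸ expNeg_anti bot_le

theorem expNeg_ofReal {t : ℝ} (ht : 0 ≤ t) :
    expNeg (ENNReal.ofReal t) = ENNReal.ofReal (Real.exp (-t)) := by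
  unfold expNeg
  rw [EReal.coe_ennreal_ofReal, max_eq_left ht, ← EReal.coe_neg, EReal.exp_coe]

theorem continuous_expNeg : Continuous expNeg :=
  ENNReal.continuous_exp.comp (continuous_neg.comp continuous_coe_ennreal_ereal)

theorem expNeg_sum {κ : Type*} (s : Finset κ) (f : κ → ℝ≥0∞) :
    expNeg (∑ k ∈ s, f k) = ∏ k ∈ s, expNeg (f k) := by
  classical
  induction s using Finset.induction_on with
  | empty => simp [expNeg_zero]
  | insert a s ha ih => rw [Finset.sum_insert ha, Finset.prod_insert ha, expNeg_add, ih]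

theorem tendsto_prod_expNeg (f : ℕ → ℝ≥0∞) :
    Tendsto (fun L => ∏ n ∈ Finset.range L, expNeg (f n)) atTop (𝓝 (expNeg (∑' n, f n))) := by
  simp only [← expNeg_sum]
  exact (continuous_expNeg.tendsto _).comp (ENNReal.tendsto_nat_tsum f)

end ExpNeg

/-! ### Void probabilities -/

section Void

variable {X : Type*} [MeasurableSpace X]

/-- The value of a unit interval valued function in `[0, ∞]`. -/
def uval (t : unitInterval) : ℝ≥0∞ := ENNReal.ofReal (t : ℝ)

theorem measurable_uval : Measurable uval :=
  ENNReal.measurable_ofReal.comp measurable_subtype_coe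

theorem uval_le_one (t : unitInterval) : uval t ≤ 1 :=
  ENNReal.ofReal_le_one.2 t.2.2

theorem volume_Iic_unitInterval (t : unitInterval) :
    (volume : Measure unitInterval) (Iic t) = uval t := by
  rw [unitInterval.volume_Iic]
  rfl

theorem volume_Ioi_unitInterval (t : unitInterval) :
    (volume : Measure unitInterval) (Ioi t) = 1 - uval t := by
  rw [← compl_Iic, prob_compl_eq_one_sub measurableSet_Iic, volume_Iic_unitInterval]

/-- Pairs of added points. -/
def addedPairs : Set (Sym2 Node) := {e | ∃ i j : ℕ, e = s(Sum.inl i, Sum.inl j)}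

theorem mixed_notMem_addedPairs (j : ℕ) (q : ℕ × ℕ) :
    s(Sum.inl j, Sum.inr q) ∉ addedPairs := by
  rintro ⟨i, k, h⟩
  simp at h

/-- The event that no present Poisson point `q` has a mark below the value of `ψ j` for any
`j ∈ J`. -/
def voidSet (J : Finset ℕ) (ψ : ℕ → X → unitInterval) (P : Set (ℕ × ℕ)) (x : ℕ × ℕ → X) :
    Set (Sym2 Node → unitInterval) :=
  {u | ∀ q ∈ P, ∀ j ∈ J, ψ j (x q) < u s(Sum.inl j, Sum.inr q)}

/-- The probability that a point at `y` is not joined to any of the added points in `J`. -/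
def missProb (J : Finset ℕ) (ψ : ℕ → X → unitInterval) (y : X) : ℝ≥0∞ :=
  ∏ j ∈ J, (1 - uval (ψ j y))

theorem missProb_le_one {X : Type*} (J : Finset ℕ) (ψ : ℕ → X → unitInterval) (y : X) :
    missProb J ψ y ≤ 1 := Finset.prod_le_one' fun _ _ => tsub_le_self

theorem measurable_missProb (J : Finset ℕ) {ψ : ℕ → X → unitInterval}
    (hψ : ∀ j, Measurable (ψ j)) : Measurable (missProb J ψ) :=
  Finset.measurable_prod _ fun j _ => measurable_const.sub (measurable_uval.comp (hψ j))

/-- The pairs (added point, Poisson point) are distinct coordinates of the mark family and none of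
them is a pair of added points, so the events for them are independent of each other and of `g`. -/
theorem lintegral_void_marks {X : Type*} {J : Finset ℕ} {ψ : ℕ → X → unitInterval} (T : Finset (ℕ × ℕ))
    (x : ℕ × ℕ → X) {g : (Sym2 Node → unitInterval) → ℝ≥0∞} (hg : Measurable g)
    (hgd : DependsOn g addedPairs) :
    ∫⁻ u, (voidSet J ψ T x).indicator g u ∂markLaw
      = (∫⁻ u, g u ∂markLaw) * ∏ q ∈ T, missProb J ψ (x q) := by
  classical
  set F : ℕ × (ℕ × ℕ) → (Sym2 Node → unitInterval) → ℝ≥0∞ := fun k u =>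
    (Ioi (ψ k.1 (x k.2))).indicator (fun _ => (1 : ℝ≥0∞)) (u s(Sum.inl k.1, Sum.inr k.2)) with hF
  have hFm : ∀ k, Measurable (F k) := fun k =>
    (measurable_const.indicator measurableSet_Ioi).comp (measurable_pi_apply _)
  have hFd : ∀ k, DependsOn (F k) {s(Sum.inl k.1, Sum.inr k.2)} := fun k u v h => by
    simp only [hF]
    rw [h _ rfl]
  have hprod : ∀ u, (voidSet J ψ T x).indicator g u = g u * ∏ k ∈ J ×ˢ T, F k u := by
    intro u
    by_cases hu : u ∈ voidSet J ψ T x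
    · rw [indicator_of_mem hu, Finset.prod_eq_one, mul_one]
      intro k hk
      rw [Finset.mem_product] at hk
      simp only [hF]
      rw [indicator_of_mem]
      exact hu k.2 hk.2 k.1 hk.1
    · rw [indicator_of_notMem hu]
      simp only [voidSet, mem_ofPred_eq, not_forall] at hu
      obtain ⟨q, hq, j, hj, h⟩ := hu
      rw [Finset.prod_eq_zero (i := (j, q)) (Finset.mem_product.2 ⟨hj, hq⟩), mul_zero]
      simp only [hF]
      rw [indicator_of_notMem]
      exact h
  simp only [hprod]
  unfold markLaw
  rw [lintegral_infinitePi_mul _ addedPairs hg (Finset.measurable_prod _ fun k _ => hFm k) hgd,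
    lintegral_infinitePi_prod_blocks _ _ (fun k : ℕ × (ℕ × ℕ) =>
      ({s(Sum.inl k.1, Sum.inr k.2)} : Set (Sym2 Node))) F hFm hFd]
  · congr 1
    rw [Finset.prod_product_right]
    refine Finset.prod_congr rfl fun q _ => Finset.prod_congr rfl fun j _ => ?_
    simp only [hF]
    rw [lintegral_infinitePi_eval _ _ (measurable_const.indicator measurableSet_Ioi),
      lintegral_indicator_const measurableSet_Ioi, one_mul, volume_Ioi_unitInterval]
  · rintro ⟨j, q⟩ ⟨j', q'⟩ h
    rw [disjoint_singleton]
    simpa using h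
  · intro u v huv
    refine Finset.prod_congr rfl fun k _ => hFd k fun e he => huv e ?_
    rw [mem_singleton_iff] at he
    subst he
    exact mixed_notMem_addedPairs _ _

variable [Nonempty X] (ν : ℕ → FiniteMeasure X) (lam : ℝ≥0)

/-- The labels present in the first `L` layers. -/
def ptsBelow (c : ℕ → ℕ) (L : ℕ) : Finset (ℕ × ℕ) :=
  (Finset.range L).biUnion fun n => (Finset.range (c n)).map ⟨Prod.mk n, Prod.mk_right_injective n⟩

theorem mem_ptsBelow (c : ℕ → ℕ) (L : ℕ) (q : ℕ × ℕ) :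
    q ∈ ptsBelow c L ↔ q.1 < L ∧ q ∈ pts c := by
  rcases q with ⟨n, i⟩
  simp only [ptsBelow, Finset.mem_biUnion, Finset.mem_range, Finset.mem_map,
    Function.Embedding.coeFn_mk, Prod.mk.injEq, mem_pts]
  constructor
  · rintro ⟨m, hm, j, hj, rfl, rfl⟩
    exact ⟨hm, hj⟩
  · rintro ⟨h1, h2⟩
    exact ⟨n, h1, i, h2, rfl, rfl⟩

theorem prod_ptsBelow (c : ℕ → ℕ) (L : ℕ) (F : ℕ → ℝ≥0∞) :
    ∏ q ∈ ptsBelow c L, F q.1 = ∏ n ∈ Finset.range L, F n ^ c n := by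
  rw [ptsBelow, Finset.prod_biUnion]
  · simp
  · intro m _ n _ hmn
    simp only [Function.onFun]
    rw [Finset.disjoint_left]
    simp only [Finset.mem_map, not_exists, not_and]
    rintro q ⟨i, -, rfl⟩ j - h
    exact hmn (by simpa using (congrArg Prod.fst h).symm)

/-- In finitely many layers there are finitely many points. Given the counts, each point contributes
an independent factor, and the generating function of the Poisson law turns the powers into
exponentials. -/
theorem lintegral_void_below {J : Finset ℕ} {ψ : ℕ → X → unitInterval}
    (hψ : ∀ j, Measurable (ψ j)) (L : ℕ)
    {g : (Sym2 Node → unitInterval) → ℝ≥0∞} (hg : Measurable g) (hgd : DependsOn g addedPairs) :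
    ∫⁻ c, ∫⁻ x, ∫⁻ u, (voidSet J ψ (ptsBelow c L) x).indicator g u ∂markLaw ∂(posLaw ν)
        ∂(countLaw ν lam)
      = (∫⁻ u, g u ∂markLaw) * ∏ n ∈ Finset.range L,
          expNeg (lam * ∫⁻ y, (1 - missProb J ψ y) ∂(ν n : Measure X)) := by
  have hm := measurable_missProb J hψ
  have hx : ∀ c : ℕ → ℕ, ∫⁻ x, ∏ q ∈ ptsBelow c L, missProb J ψ (x q) ∂(posLaw ν)
      = ∏ n ∈ Finset.range L, (∫⁻ y, missProb J ψ y ∂((ν n).normalize : Measure X)) ^ c n := by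
    intro c
    unfold posLaw
    rw [lintegral_infinitePi_prod _ _ (fun _ => missProb J ψ) (fun _ => hm),
      prod_ptsBelow c L fun n => ∫⁻ y, missProb J ψ y ∂((ν n).normalize : Measure X)]
  have hprodm : ∀ c : ℕ → ℕ, Measurable fun x : ℕ × ℕ → X =>
      ∏ q ∈ ptsBelow c L, missProb J ψ (x q) := fun c =>
    Finset.measurable_prod _ fun q _ => hm.comp (measurable_pi_apply q)
  simp only [lintegral_void_marks _ _ hg hgd]
  have hpow : ∀ n : ℕ, Measurable fun k : ℕ =>
      (∫⁻ y, missProb J ψ y ∂((ν n).normalize : Measure X)) ^ k := fun n => measurable_of_countable _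
  have h1 : ∀ c : ℕ → ℕ, ∫⁻ x, (∫⁻ u, g u ∂markLaw) * ∏ q ∈ ptsBelow c L, missProb J ψ (x q)
      ∂(posLaw ν) = (∫⁻ u, g u ∂markLaw) *
        ∏ n ∈ Finset.range L, (∫⁻ y, missProb J ψ y ∂((ν n).normalize : Measure X)) ^ c n := by
    intro c
    rw [lintegral_const_mul _ (hprodm c), hx]
  simp only [h1]
  have hcm : Measurable fun c : ℕ → ℕ => ∏ n ∈ Finset.range L,
      (∫⁻ y, missProb J ψ y ∂((ν n).normalize : Measure X)) ^ c n :=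
    Finset.measurable_prod _ fun n _ => (hpow n).comp (measurable_pi_apply n)
  rw [lintegral_const_mul _ hcm]
  congr 1
  unfold countLaw
  rw [lintegral_infinitePi_prod _ _
    (fun n k => (∫⁻ y, missProb J ψ y ∂((ν n).normalize : Measure X)) ^ k) hpow]
  refine Finset.prod_congr rfl fun n _ => ?_
  set b := ∫⁻ y, missProb J ψ y ∂((ν n).normalize : Measure X) with hb
  have hb1 : b ≤ 1 := by
    calc b ≤ ∫⁻ _, 1 ∂((ν n).normalize : Measure X) := lintegral_mono fun y => missProb_le_one J ψ y
      _ = 1 := by simp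
  rw [lintegral_poissonMeasure_pow _ _ hb1, ← mass_mul_lintegral_normalize,
    lintegral_sub hm (ne_top_of_le_ne_top ENNReal.one_ne_top hb1)
      (ae_of_all _ fun y => missProb_le_one J ψ y), ← hb]
  simp only [lintegral_const, measure_univ, mul_one]
  rw [← expNeg_ofReal]
  · congr 1
    have h1b : 1 - b.toReal = (1 - b).toReal := by
      rw [ENNReal.toReal_sub_of_le hb1 ENNReal.one_ne_top, ENNReal.toReal_one]
    rw [h1b, ENNReal.ofReal_mul (by positivity), ENNReal.ofReal_toReal
      (ne_top_of_le_ne_top ENNReal.one_ne_top tsub_le_self)]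
    simp [mul_assoc]
  · have : b.toReal ≤ 1 := ENNReal.toReal_le_of_le_ofReal zero_le_one (by simpa using hb1)
    exact mul_nonneg (by positivity) (by linarith)

/-- The void probability, jointly with a function of the marks between the added points. -/
theorem lintegral_void {J : Finset ℕ} {ψ : ℕ → X → unitInterval}
    (hψ : ∀ j, Measurable (ψ j))
    {g : (Sym2 Node → unitInterval) → ℝ≥0∞} (hg : Measurable g) (hg1 : ∀ u, g u ≤ 1)
    (hgd : DependsOn g addedPairs) :
    ∫⁻ c, ∫⁻ x, ∫⁻ u, (voidSet J ψ (pts c) x).indicator g u ∂markLaw ∂(posLaw ν)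
        ∂(countLaw ν lam)
      = (∫⁻ u, g u ∂markLaw) *
          expNeg (lam * ∫⁻ y, (1 - missProb J ψ y) ∂(Measure.sum fun n => (ν n : Measure X))) := by
  have hle : ∀ (s : Set (Sym2 Node → unitInterval)) u, s.indicator g u ≤ 1 := fun s u =>
    (indicator_le_self s g u).trans (hg1 u)
  have hvm : ∀ L, MeasurableSet {z : (ℕ → ℕ) × (ℕ × ℕ → X) × (Sym2 Node → unitInterval) |
      z.2.2 ∈ voidSet J ψ (ptsBelow z.1 L) z.2.1} := by
    intro L
    have : {z : (ℕ → ℕ) × (ℕ × ℕ → X) × (Sym2 Node → unitInterval) |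
        z.2.2 ∈ voidSet J ψ (ptsBelow z.1 L) z.2.1} = ⋂ q : ℕ × ℕ, ⋂ j ∈ J,
        ({z | q.1 < L ∧ q ∈ pts z.1}ᶜ ∪ {z | ψ j (z.2.1 q) < z.2.2 s(Sum.inl j, Sum.inr q)}) := by
      ext z
      simp only [voidSet, SetLike.mem_coe, mem_ptsBelow, mem_ofPred_eq, mem_iInter, mem_union,
        mem_compl_iff]
      exact ⟨fun h q j hj => or_iff_not_imp_left.2 fun hq => h q (not_not.1 hq) j hj,
        fun h q hq j hj => (h q j hj).resolve_left (not_not.2 hq)⟩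
    rw [this]
    refine MeasurableSet.iInter fun q => MeasurableSet.biInter J.countable_toSet fun j _ => ?_
    refine MeasurableSet.union (MeasurableSet.compl ?_) ?_
    · by_cases hq : q.1 < L
      · simp only [hq, true_and]
        exact (measurable_pts.comp measurable_fst) (measurableSet_mem q)
      · simp [hq]
    · exact measurableSet_lt ((hψ j).comp (by fun_prop)) (by fun_prop)
  have hind : ∀ L, Measurable fun z : (ℕ → ℕ) × (ℕ × ℕ → X) × (Sym2 Node → unitInterval) =>
      (voidSet J ψ (ptsBelow z.1 L) z.2.1).indicator g z.2.2 := by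
    intro L
    have := (hg.comp (measurable_snd.comp measurable_snd)).indicator (hvm L)
    exact this
  have hlim := tendsto_prod_expNeg fun n => lam * ∫⁻ y, (1 - missProb J ψ y) ∂(ν n : Measure X)
  rw [ENNReal.tsum_mul_left, ← lintegral_sum_measure] at hlim
  have hgfin : ∫⁻ u, g u ∂markLaw ≠ ∞ := by
    refine ne_top_of_le_ne_top ENNReal.one_ne_top ?_
    calc ∫⁻ u, g u ∂markLaw ≤ ∫⁻ _, 1 ∂markLaw := lintegral_mono hg1
      _ = 1 := by simp
  have hlim2 := ENNReal.Tendsto.const_mul (a := ∫⁻ u, g u ∂markLaw) hlim (Or.inr hgfin)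
  -- The void event is the decreasing limit of the void events for the first `L` layers. Everything
  -- is bounded by 1, so dominated convergence carries the limit through the three integrals.
  refine tendsto_nhds_unique ?_ hlim2
  simp only [← lintegral_void_below ν lam hψ _ hg hgd]
  refine tendsto_lintegral_of_dominated_convergence (fun _ => 1) ?_ ?_ (by simp) ?_
  · intro L
    refine Measurable.lintegral_prod_right' (f := fun p : (ℕ → ℕ) × (ℕ × ℕ → X) =>
      ∫⁻ u, (voidSet J ψ (ptsBelow p.1 L) p.2).indicator g u ∂markLaw) ?_
    refine Measurable.lintegral_prod_right'
      (f := fun p : ((ℕ → ℕ) × (ℕ × ℕ → X)) × (Sym2 Node → unitInterval) =>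
        (voidSet J ψ (ptsBelow p.1.1 L) p.1.2).indicator g p.2) ?_
    have h3 : Measurable fun p : ((ℕ → ℕ) × (ℕ × ℕ → X)) × (Sym2 Node → unitInterval) =>
        (p.1.1, p.1.2, p.2) := (measurable_fst.comp measurable_fst).prodMk
      ((measurable_snd.comp measurable_fst).prodMk measurable_snd)
    have h4 := (hind L).comp h3
    simp only [Function.comp_def] at h4
    exact h4
  · refine fun L => ae_of_all _ fun c => ?_
    calc _ ≤ ∫⁻ _, ∫⁻ _, 1 ∂markLaw ∂(posLaw ν) :=
          lintegral_mono fun x => lintegral_mono fun u => hle _ u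
      _ = 1 := by simp
  refine ae_of_all _ fun c => ?_
  refine tendsto_lintegral_of_dominated_convergence (fun _ => 1) ?_ ?_ (by simp) ?_
  · intro L
    refine Measurable.lintegral_prod_right' (f := fun p : (ℕ × ℕ → X) × (Sym2 Node → unitInterval) =>
      (voidSet J ψ (ptsBelow c L) p.1).indicator g p.2) ?_
    have h3 : Measurable fun p : (ℕ × ℕ → X) × (Sym2 Node → unitInterval) => (c, p.1, p.2) :=
      measurable_const.prodMk (measurable_fst.prodMk measurable_snd)
    have h4 := (hind L).comp h3
    simp only [Function.comp_def] at h4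
    exact h4
  · refine fun L => ae_of_all _ fun x => ?_
    calc _ ≤ ∫⁻ _, 1 ∂markLaw := lintegral_mono fun u => hle _ u
      _ = 1 := by simp
  refine ae_of_all _ fun x => ?_
  refine tendsto_lintegral_of_dominated_convergence (fun _ => 1) ?_ ?_ (by simp) ?_
  · intro L
    have h3 : Measurable fun p : (Sym2 Node → unitInterval) => (c, x, p) :=
      measurable_const.prodMk (measurable_const.prodMk measurable_id)
    have h4 := (hind L).comp h3
    simp only [Function.comp_def] at h4
    exact h4
  · exact fun L => ae_of_all _ fun u => hle _ u
  refine ae_of_all _ fun u => ?_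
  have hanti : Antitone fun L => voidSet J ψ (ptsBelow c L) x := by
    intro L M hLM u hu q hq
    rw [SetLike.mem_coe, mem_ptsBelow] at hq
    refine hu q ?_
    rw [SetLike.mem_coe, mem_ptsBelow]
    exact ⟨hq.1.trans_le hLM, hq.2⟩
  have hInter : ⋂ L, voidSet J ψ (ptsBelow c L) x = voidSet J ψ (pts c) x := by
    ext u
    simp only [mem_iInter]
    constructor
    · intro h q hq
      refine h (q.1 + 1) q ?_
      rw [SetLike.mem_coe, mem_ptsBelow]
      exact ⟨Nat.lt_succ_self _, hq⟩
    · intro h L q hq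
      rw [SetLike.mem_coe, mem_ptsBelow] at hq
      exact h q hq.2
  rw [← hInter]
  exact (hanti.tendsto_indicator _ g u).mono_right (pure_le_nhds _)

end Void

/-! ### Propagation along walks -/

section Walks

theorem reachable_closed {V : Type*} {G : SimpleGraph V} {S : Set V} {p q : V} (hp : p ∈ S)
    (hS : ∀ a b, a ∈ S → G.Adj a b → b ∈ S) (h : G.Reachable p q) : q ∈ S := by
  obtain ⟨w⟩ := h
  induction w with
  | nil => exact hp
  | cons hadj _ ih => exact ih (hS _ _ hp hadj)

/-- Only the edges at vertices reached from `p` are needed, so the two graphs may differ elsewhere.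
-/
theorem reachable_transfer {V : Type*} {G G' : SimpleGraph V} {p q : V}
    (hG : ∀ a b, G.Reachable p a → G.Adj a b → G'.Adj a b) (h : G.Reachable p q) :
    G'.Reachable p q := by
  have : q ∈ {q | G.Reachable p q ∧ G'.Reachable p q} := by
    refine reachable_closed (G := G) (p := p) ⟨.refl _, .refl _⟩ ?_ h
    rintro a b ⟨h1, h2⟩ hab
    exact ⟨h1.trans hab.reachable, h2.trans (hG a b h1 hab).reachable⟩
  exact this.2

end Walks

theorem measurableSet_encard_eq {X : Type*} [MeasurableSpace X] {K : Conf X → Set Node}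
    (hK : ∀ p, MeasurableSet {ω | p ∈ K ω}) (n : ℕ∞) : MeasurableSet {ω | (K ω).encard = n} := by
  have h := measurable_encard K hK (measurableSet_singleton (n : ℝ≥0∞))
  have : {ω | (K ω).encard = n} = (fun ω => ((K ω).encard : ℝ≥0∞)) ⁻¹' {(n : ℝ≥0∞)} := by
    ext ω
    simp
  rwa [this]

theorem measurable_kernel_right {X : Type*} [MeasurableSpace X] (φ : SymKernel X) (x : X) : Measurable (φ.toFun x) :=
  φ.measurable_toFun.comp measurable_prodMk_left

/-! ### The peeling recursion -/

section Peeling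

variable {X : Type*} [MeasurableSpace X] [Nonempty X] (φ : SymKernel X)
  (ν : ℕ → FiniteMeasure X) (lam : ℝ≥0)

/-- The event that a random set of labels has `M + 1` elements and contains the added points with
labels at most `k`. -/
def peelSet (K : Conf X → Set Node) (M k : ℕ) : Set (Conf X) :=
  {ω | (K ω).encard = M + 1 ∧ ∀ j ≤ k, Sum.inl j ∈ K ω}

theorem measurableSet_peelSet {K : Conf X → Set Node} (hK : ∀ p, MeasurableSet {ω | p ∈ K ω})
    (M k : ℕ) : MeasurableSet (peelSet K M k) := by
  have : peelSet K M k = {ω | (K ω).encard = M + 1} ∩ ⋂ j ∈ Iic k, {ω | Sum.inl j ∈ K ω} := by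
    ext ω
    simp [peelSet]
  rw [this]
  exact (measurableSet_encard_eq hK _).inter
    (MeasurableSet.biInter (Set.to_countable _) fun j _ => hK _)

/-- The number of Poisson points in `K`: M + 1 vertices minus the k + 1 added ones. -/
theorem encard_inr_preimage {K : Set Node} {M k : ℕ} (hk : k ≤ M) (hK : K.encard = M + 1)
    (hinl : ∀ j, Sum.inl j ∈ K ↔ j ≤ k) :
    ((Sum.inr ⁻¹' K : Set (ℕ × ℕ)).encard : ℝ≥0∞) = ((M - k : ℕ) : ℝ≥0∞) := by
  have h1 : K = Sum.inl '' (Iic k) ∪ Sum.inr '' (Sum.inr ⁻¹' K : Set (ℕ × ℕ)) := by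
    ext p
    rcases p with j | q <;> simp [hinl]
  have hdisj : Disjoint (Sum.inl '' (Iic k) : Set Node) (Sum.inr '' (Sum.inr ⁻¹' K)) := by
    rw [Set.disjoint_left]
    rintro _ ⟨j, _, rfl⟩ ⟨q, _, h⟩
    simp at h
  rw [h1, encard_union_eq hdisj, Sum.inl_injective.encard_image, Sum.inr_injective.encard_image]
    at hK
  have h2 : (Iic k : Set ℕ).encard = k + 1 := by
    rw [← Finset.coe_Iic, encard_coe_eq_coe_finsetCard]
    simp
  rw [h2] at hK
  set n := (Sum.inr ⁻¹' K : Set (ℕ × ℕ)).encard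
  have hn : n ≠ ⊤ := by
    rintro h
    rw [h] at hK
    simp at hK
    exact absurd hK.symm (by exact_mod_cast ENat.natCast_ne_top (M + 1))
  obtain ⟨m, hm⟩ := ENat.ne_top_iff_exists.1 hn
  rw [← hm] at hK ⊢
  have : k + 1 + m = M + 1 := by exact_mod_cast hK
  have : m = M - k := by omega
  rw [this]
  simp

/-- One step of the peeling recursion. -/
theorem peel_step {E : Set ℕ} {K : Conf X → Set Node} {Ξ : Conf X → ℝ≥0∞} {M k : ℕ} (hk : k < M)
    (hE : ∀ j ∈ E, M < j) (hK : ∀ p, MeasurableSet {ω | p ∈ K ω}) (hΞ : Measurable Ξ)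
    (hKact : ∀ σ : Equiv.Perm Node, (∀ j ∈ insert 0 E, σ (Sum.inl j) = Sum.inl j) → ∀ ω,
      K (act σ ω) = σ ⁻¹' K ω)
    (hΞact : ∀ σ : Equiv.Perm Node, (∀ j ∈ insert 0 E, σ (Sum.inl j) = Sum.inl j) → ∀ ω,
      Ξ (act σ ω) = Ξ ω)
    (hKsub : ∀ ω : Conf X, Sum.inl 0 ∈ ω.1 → K ω ⊆ ω.1 \ Sum.inl '' E) (a : ℕ → X) :
    ((M - k : ℕ) : ℝ≥0∞) * expect ν lam (Iic k ∪ E) a ((peelSet K M k).indicator Ξ)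
      = lam * ∫⁻ y, expect ν lam (Iic (k + 1) ∪ E) (Function.update a (k + 1) y)
          ((peelSet K M (k + 1)).indicator Ξ) ∂(Measure.sum fun n => (ν n : Measure X)) := by
  classical
  -- On `peelSet K M k` the set `K ω` consists of the added points 0, …, k and of M - k Poisson
  -- points. Summing `f` over the Poisson points therefore gives the factor M - k, while the Mecke
  -- formula makes the chosen one the added point k + 1. The points of `E` lie outside `K`, and
  -- their labels exceed `M` to leave k + 1 free.
  set f : Conf X → Node → ℝ≥0∞ := fun ω p => (peelSet K M k ∩ {ω | p ∈ K ω}).indicator Ξ ω with hf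
  have hk1 : k + 1 ∉ Iic k ∪ E := by
    rintro (h | h)
    · simp at h
    · have := hE _ h
      omega
  have hsub : ∀ j ∈ insert 0 E, j ∈ Iic k ∪ E := by
    rintro j (rfl | hj)
    · exact Or.inl (Nat.zero_le _)
    · exact Or.inr hj
  have hmecke := mecke ν lam hk1 a (f := f)
    (fun p => hΞ.indicator ((measurableSet_peelSet hK M k).inter (hK p))) ?_
  · have hins : insert (k + 1) (Iic k ∪ E) = Iic (k + 1) ∪ E := by
      rw [← Set.insert_union]
      congr 1
      ext j
      simp only [mem_insert_iff, mem_Iic]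
      omega
    have hend : (fun ω => f ω (Sum.inl (k + 1))) = (peelSet K M (k + 1)).indicator Ξ := by
      funext ω
      simp only [hf]
      congr 1
      ext ω
      simp only [peelSet, mem_inter_iff, mem_ofPred_eq, and_assoc]
      refine and_congr_right fun _ => ⟨fun h j hj => ?_, fun h => ⟨fun j hj => h j (by omega),
        h _ le_rfl⟩⟩
      rcases Nat.lt_or_ge k j with h' | h'
      · obtain rfl : j = k + 1 := by omega
        exact h.2
      · exact h.1 j h'
    rw [hins, hend] at hmecke
    rw [← hmecke, ← expect_const_mul ν lam (hΞ.indicator (measurableSet_peelSet hK M k))]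
    refine expect_congr ν lam fun c x u => ?_
    set ω := mkConf (Iic k ∪ E) (pts c) a x u with hω
    have h0 : Sum.inl 0 ∈ ω.1 := Or.inl (Nat.zero_le _)
    by_cases hωS : ω ∈ peelSet K M k
    · rw [indicator_of_mem hωS]
      have hinl : ∀ j, Sum.inl j ∈ K ω ↔ j ≤ k := by
        intro j
        refine ⟨fun hj => ?_, fun hj => hωS.2 j hj⟩
        have h := hKsub ω h0 hj
        have h1 : j ∈ Iic k ∪ E := h.1
        rcases h1 with h1 | h1
        · exact h1
        · exact absurd ⟨j, h1, rfl⟩ h.2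
      rw [← encard_inr_preimage hk.le hωS.1 hinl, ← ENNReal.tsum_set_one,
        tsum_subtype (Sum.inr ⁻¹' K ω) (fun _ => (1 : ℝ≥0∞)), ← ENNReal.tsum_mul_right]
      refine tsum_congr fun q => ?_
      by_cases hq : Sum.inr q ∈ K ω
      · rw [indicator_of_mem (s := Sum.inr ⁻¹' K ω) hq, one_mul, indicator_of_mem, hf]
        · simp only
          rw [indicator_of_mem]
          exact ⟨hωS, hq⟩
        · exact (hKsub ω h0 hq).1
      · rw [indicator_of_notMem (s := Sum.inr ⁻¹' K ω) hq, zero_mul]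
        by_cases hqV : Sum.inr q ∈ ω.1
        · rw [indicator_of_mem (s := {ω : Conf X | Sum.inr q ∈ ω.1}) hqV, hf]
          simp only
          rw [indicator_of_notMem]
          exact fun h => hq h.2
        · rw [indicator_of_notMem (s := {ω : Conf X | Sum.inr q ∈ ω.1}) hqV]
    · rw [indicator_of_notMem hωS, mul_zero]
      symm
      rw [ENNReal.tsum_eq_zero]
      intro q
      have : f ω (Sum.inr q) = 0 := by
        simp only [hf]
        rw [indicator_of_notMem]
        exact fun h => hωS h.1
      by_cases hqV : ω ∈ {ω : Conf X | Sum.inr q ∈ ω.1}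
      · rw [indicator_of_mem hqV, this]
      · rw [indicator_of_notMem hqV]
  · intro σ hσ ω p
    have h1 : K (act σ ω) = σ ⁻¹' K ω := hKact σ (fun j hj => hσ j (hsub j hj)) ω
    have h2 : act σ ω ∈ peelSet K M k ∩ {ω | p ∈ K ω} ↔
        ω ∈ peelSet K M k ∩ {ω | σ p ∈ K ω} := by
      simp only [peelSet, mem_inter_iff, mem_ofPred_eq, h1, encard_preimage_perm, mem_preimage]
      refine and_congr_left fun _ => and_congr_right fun _ => forall₂_congr fun j hj => ?_
      rw [hσ j (Or.inl hj)]
    simp only [hf]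
    by_cases h : ω ∈ peelSet K M k ∩ {ω | σ p ∈ K ω}
    · rw [indicator_of_mem h, indicator_of_mem (h2.2 h),
        hΞact σ (fun j hj => hσ j (hsub j hj))]
    · rw [indicator_of_notMem h, indicator_of_notMem (mt h2.1 h)]

/-- Comparison of two solutions of the peeling recursion. -/
theorem peel_compare {A B : ℕ → (ℕ → X) → ℝ≥0∞} {m : Measure X} {M : ℕ} {r : (ℕ → X) → ℝ≥0∞}
    {T : X → X} (hT : MeasurePreserving T m m)
    (hA : ∀ k < M, ∀ a, ((M - k : ℕ) : ℝ≥0∞) * A k a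
      = lam * ∫⁻ y, A (k + 1) (Function.update a (k + 1) y) ∂m)
    (hB : ∀ k < M, ∀ a, ((M - k : ℕ) : ℝ≥0∞) * B k a
      = lam * ∫⁻ y, B (k + 1) (Function.update a (k + 1) y) ∂m)
    (hBm : ∀ k a, Measurable fun y => B k (Function.update a k y))
    (hr : ∀ k < M, ∀ a y, r (Function.update a (k + 1) y) = r a)
    (htop : ∀ a, r a * B M (T ∘ a) ≤ A M a) :
    ∀ k ≤ M, ∀ a, r a * B k (T ∘ a) ≤ A k a := by
  intro k hk
  -- For k < M the factor M - k is nonzero, so the recursion determines level k from level k + 1.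
  -- The substitution y ↦ T y, which preserves `m`, adapts the integral for `B` to the configuration
  -- `T ∘ a`; the factor `r` does not see the integrated coordinate.
  induction hk using Nat.decreasingInduction with
  | self => exact htop
  | of_succ k hk ih =>
    intro a
    have hpos : ((M - k : ℕ) : ℝ≥0∞) ≠ 0 := by
      rw [Nat.cast_ne_zero]
      omega
    rw [← ENNReal.mul_le_mul_iff_right hpos (ENNReal.natCast_ne_top _), hA k hk, mul_left_comm,
      hB k hk, mul_left_comm, ← lintegral_const_mul _ (hBm _ _)]
    refine mul_le_mul' le_rfl ?_
    rw [← hT.lintegral_comp ((hBm _ _).const_mul _)]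
    refine lintegral_mono fun y => ?_
    have := ih (Function.update a (k + 1) y)
    rw [hr k hk] at this
    convert this using 3
    funext j
    rcases eq_or_ne j (k + 1) with rfl | hj
    · simp
    · simp [hj]

end Peeling

/-! ### The law of the cluster when all its vertices are prescribed -/

section Top

variable {X : Type*} [MeasurableSpace X] [Nonempty X] (φ : SymKernel X)
  (ν : ℕ → FiniteMeasure X) (lam : ℝ≥0)

/-- The event that the added points with labels at most `M` form a connected graph. -/
def connSet (M : ℕ) (a : ℕ → X) : Set (Sym2 Node → unitInterval) :=
  {u | ∀ j ≤ M, (cgraph φ (mkConf (Iic M) ∅ a (fun _ => Classical.arbitrary X) u)).Reachable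
    (Sum.inl 0) (Sum.inl j)}

theorem measurableSet_connSet (M : ℕ) (a : ℕ → X) : MeasurableSet (connSet φ M a) := by
  have : connSet φ M a = ⋂ j ∈ Iic M, {u | (cgraph φ (mkConf (Iic M) ∅ a
      (fun _ => Classical.arbitrary X) u)).Reachable (Sum.inl 0) (Sum.inl j)} := by
    ext u
    simp [connSet]
  rw [this]
  refine MeasurableSet.biInter (Set.to_countable _) fun j _ => ?_
  have hm : Measurable fun u => mkConf (Iic M) ∅ a (fun _ => Classical.arbitrary X) u :=
    measurable_conf _ measurable_const measurable_const measurable_const measurable_id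
  exact hm (measurableSet_mem_clus φ (Sum.inl 0) (Sum.inl j))

theorem adj_mkConf_empty (M : ℕ) (a : ℕ → X) (u : Sym2 Node → unitInterval) (p q : Node) :
    (cgraph φ (mkConf (Iic M) ∅ a (fun _ => Classical.arbitrary X) u)).Adj p q ↔
      ∃ i j, i ≤ M ∧ j ≤ M ∧ i ≠ j ∧ p = Sum.inl i ∧ q = Sum.inl j ∧
        u s(Sum.inl i, Sum.inl j) ≤ φ.toFun (a i) (a j) := by
  constructor
  · rintro ⟨h1, h2, h3, h4⟩
    rcases p with i | p
    · rcases q with j | q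
      · have hi : i ∈ Iic M := h2
        have hj : j ∈ Iic M := h3
        rw [loc_mkConf_inl _ _ _ _ (mem_Iic.2 hi), loc_mkConf_inl _ _ _ _ (mem_Iic.2 hj)] at h4
        exact ⟨i, j, hi, hj, fun h => h1 (by rw [h]), rfl, rfl, h4⟩
      · exact absurd h3 (by simp)
    · exact absurd h2 (by simp)
  · rintro ⟨i, j, hi, hj, hij, rfl, rfl, h⟩
    refine ⟨by simpa using hij, hi, hj, ?_⟩
    rw [loc_mkConf_inl _ _ _ _ (mem_Iic.2 hi), loc_mkConf_inl _ _ _ _ (mem_Iic.2 hj)]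
    exact h

/-- Connectedness of the added points among themselves uses only marks of pairs of added points,
hence is independent of the void event. -/
theorem dependsOn_connSet (M : ℕ) (a : ℕ → X) :
    DependsOn (fun u => (connSet φ M a).indicator (fun _ => (1 : ℝ≥0∞)) u) addedPairs := by
  intro u v huv
  have h : cgraph φ (mkConf (Iic M) ∅ a (fun _ => Classical.arbitrary X) u)
      = cgraph φ (mkConf (Iic M) ∅ a (fun _ => Classical.arbitrary X) v) := by
    ext p q
    rw [adj_mkConf_empty, adj_mkConf_empty]
    refine exists₂_congr fun i j => ?_
    rw [huv s(Sum.inl i, Sum.inl j) ⟨i, j, rfl⟩]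
  have : u ∈ connSet φ M a ↔ v ∈ connSet φ M a := by
    simp only [connSet, mem_ofPred_eq, h]
  by_cases hu : u ∈ connSet φ M a
  · simp [hu, this.1 hu]
  · simp [hu, mt this.2 hu]

theorem connSet_comp {T : X → X} (hT : ∀ x y, φ.toFun (T x) (T y) = φ.toFun x y) (M : ℕ)
    (a : ℕ → X) : connSet φ M (T ∘ a) = connSet φ M a := by
  have h : ∀ u, cgraph φ (mkConf (Iic M) ∅ (T ∘ a) (fun _ => Classical.arbitrary X) u)
      = cgraph φ (mkConf (Iic M) ∅ a (fun _ => Classical.arbitrary X) u) := by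
    intro u
    ext p q
    simp only [adj_mkConf_empty, Function.comp_apply, hT]
  simp only [connSet, h]

/-- The cluster of the added points `0, …, M` consists exactly of these points. -/
theorem clus_eq_iff (M : ℕ) (P : Set (ℕ × ℕ)) (a : ℕ → X) (x : ℕ × ℕ → X)
    (u : Sym2 Node → unitInterval) :
    clus φ (mkConf (Iic M) P a x u) (Sum.inl 0) = Sum.inl '' Iic M ↔
      u ∈ connSet φ M a ∧ u ∈ voidSet (Finset.Iic M) (fun j => φ.toFun (a j)) P x := by
  set ω := mkConf (Iic M) P a x u with hω
  have hle : cgraph φ (mkConf (Iic M) ∅ a (fun _ => Classical.arbitrary X) u) ≤ cgraph φ ω := by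
    intro p q h
    rw [adj_mkConf_empty] at h
    obtain ⟨i, j, hi, hj, hij, rfl, rfl, h⟩ := h
    refine ⟨by simpa using hij, hi, hj, ?_⟩
    rw [hω, loc_mkConf_inl _ _ _ _ (mem_Iic.2 hi), loc_mkConf_inl _ _ _ _ (mem_Iic.2 hj)]
    exact h
  have hmix : ∀ j ≤ M, ∀ q ∈ P, ((cgraph φ ω).Adj (Sum.inl j) (Sum.inr q) ↔
      u s(Sum.inl j, Sum.inr q) ≤ φ.toFun (a j) (x q)) := by
    intro j hj q hq
    rw [cgraph_adj, hω, loc_mkConf_inl _ _ _ _ (mem_Iic.2 hj), loc_mkConf_inr _ _ _ _ hq]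
    simp [hq, hj]
  constructor
  · intro h
    refine ⟨fun j hj => ?_, fun q hq j hj => ?_⟩
    · have hjc : Sum.inl j ∈ clus φ ω (Sum.inl 0) := by
        rw [h]
        exact ⟨j, hj, rfl⟩
      refine reachable_transfer (fun p q hp hpq => ?_) hjc
      have hp' : p ∈ clus φ ω (Sum.inl 0) := hp
      have hq' : q ∈ clus φ ω (Sum.inl 0) := hp.trans hpq.reachable
      rw [h] at hp' hq'
      obtain ⟨i, hi, rfl⟩ := hp'
      obtain ⟨l, hl, rfl⟩ := hq'
      rw [adj_mkConf_empty]
      refine ⟨i, l, hi, hl, by simpa using hpq.1, rfl, rfl, ?_⟩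
      have := hpq.2.2.2
      rwa [hω, loc_mkConf_inl _ _ _ _ (mem_Iic.2 hi), loc_mkConf_inl _ _ _ _ (mem_Iic.2 hl)] at this
    · by_contra hcon
      rw [Finset.mem_Iic] at hj
      have hadj := (hmix j hj q hq).2 (not_lt.1 hcon)
      have hjc : Sum.inl j ∈ clus φ ω (Sum.inl 0) := by
        rw [h]
        exact ⟨j, hj, rfl⟩
      have : Sum.inr q ∈ clus φ ω (Sum.inl 0) :=
        SimpleGraph.Reachable.trans hjc hadj.reachable
      rw [h] at this
      obtain ⟨i, _, hi⟩ := this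
      simp at hi
  · rintro ⟨h1, h2⟩
    refine Subset.antisymm (fun p hp => ?_) ?_
    · refine reachable_closed (G := cgraph φ ω) (p := Sum.inl 0) ⟨0, Nat.zero_le _, rfl⟩ ?_ hp
      rintro _ b ⟨j, hj, rfl⟩ hadj
      rcases b with i | q
      · exact ⟨i, hadj.2.2.1, rfl⟩
      · have hq : q ∈ P := hadj.2.2.1
        exact absurd ((hmix j hj q hq).1 hadj) (not_le.2 (h2 q hq j (Finset.mem_Iic.2 hj)))
    · rintro _ ⟨j, hj, rfl⟩
      exact SimpleGraph.Reachable.mono hle (h1 j hj)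

/-- The integral of the probability that a point is joined to one of the added points in `J`. -/
def hitMass (J : Finset ℕ) (a : ℕ → X) : ℝ≥0∞ :=
  ∫⁻ y, (1 - missProb J (fun j => φ.toFun (a j)) y) ∂(Measure.sum fun n => (ν n : Measure X))

theorem hitMass_comp {T : X → X} (hT : ∀ x y, φ.toFun (T x) (T y) = φ.toFun x y)
    (hTm : MeasurePreserving T (Measure.sum fun n => (ν n : Measure X))
      (Measure.sum fun n => (ν n : Measure X))) (J : Finset ℕ) (a : ℕ → X) :
    hitMass φ ν J (T ∘ a) = hitMass φ ν J a := by
  have h := hTm.lintegral_comp (f := fun y => 1 - missProb J (fun j => φ.toFun ((T ∘ a) j)) y)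
    (measurable_const.sub (measurable_missProb J fun j => measurable_kernel_right φ _))
  unfold hitMass
  rw [← h]
  simp only [missProb, Function.comp_apply, hT]

/-- The probability that the cluster consists exactly of the added points. -/
theorem expect_clus_eq (M : ℕ) (a : ℕ → X) :
    expect ν lam (Iic M) a ({ω | clus φ ω (Sum.inl 0) = Sum.inl '' Iic M}.indicator 1)
      = markLaw (connSet φ M a) * expNeg (lam * hitMass φ ν (Finset.Iic M) a) := by
  unfold hitMass
  rw [← lintegral_indicator_one (measurableSet_connSet φ M a)]
  refine Eq.trans ?_ (lintegral_void ν lam (J := Finset.Iic M) (ψ := fun j => φ.toFun (a j))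
    (fun j => measurable_kernel_right φ _)
    (measurable_const.indicator (measurableSet_connSet φ M a)) (fun u => ?_)
    (dependsOn_connSet φ M a))
  · refine lintegral_congr fun c => lintegral_congr fun x => lintegral_congr fun u => ?_
    have := clus_eq_iff φ M (pts c) a x u
    by_cases h1 : u ∈ connSet φ M a
    · by_cases h2 : u ∈ voidSet (Finset.Iic M) (fun j => φ.toFun (a j)) (pts c) x
      · rw [indicator_of_mem (a := mkConf (Iic M) (pts c) a x u) (this.2 ⟨h1, h2⟩),
          indicator_of_mem h2, indicator_of_mem h1]
        rfl
      · rw [indicator_of_notMem h2, indicator_of_notMem]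
        exact fun h => h2 (this.1 h).2
    · rw [indicator_of_notMem]
      · by_cases h2 : u ∈ voidSet (Finset.Iic M) (fun j => φ.toFun (a j)) (pts c) x
        · rw [indicator_of_mem h2, indicator_of_notMem h1]
        · rw [indicator_of_notMem h2]
      · exact fun h => h1 (this.1 h).1
  · exact indicator_le_self' (fun _ _ => zero_le_one) u |>.trans le_rfl

end Top

/-! ### Label-free functionals of clusters, invariance and mass transport -/

section Statistics

/-- A functional of a set of labels, the positions of its elements, and a root in the set, which
does not depend on the labelling. -/
structure Statistic (X : Type*) [MeasurableSpace X] where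
  toFun : Set Node → (Node → X) → Node → ℝ≥0∞
  measurable_toFun : ∀ r, Measurable fun z : Set Node × (Node → X) => toFun z.1 z.2 r
  congr : ∀ C x x' r, r ∈ C → (∀ p ∈ C, x p = x' p) → toFun C x r = toFun C x' r
  perm : ∀ (σ : Equiv.Perm Node) C x r, toFun (σ ⁻¹' C) (x ∘ σ) r = toFun C x (σ r)

variable {X : Type*} [MeasurableSpace X] (φ : SymKernel X)

/-- The value of a statistic at the cluster of a vertex. -/
def Statistic.eval (G : Statistic X) (ω : Conf X) (p : Node) : ℝ≥0∞ :=
  G.toFun (clus φ ω p) ω.2.1 p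

theorem measurable_clus (p : Node) : Measurable fun ω : Conf X => clus φ ω p :=
  measurable_set_iff.2 fun q => measurableSet_setOfPred.1 (measurableSet_mem_clus φ p q)

theorem Statistic.measurable_eval (G : Statistic X) (p : Node) :
    Measurable fun ω => G.eval φ ω p :=
  (G.measurable_toFun p).comp
    ((measurable_clus φ p).prodMk (measurable_fst.comp measurable_snd))

theorem Statistic.eval_act (G : Statistic X) (σ : Equiv.Perm Node) (ω : Conf X) (p : Node) :
    G.eval φ (act σ ω) p = G.eval φ ω (σ p) := by
  rw [eval, clus_act, eval]
  exact G.perm σ _ _ p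

/-- The constant statistic. -/
def Statistic.one (X : Type*) [MeasurableSpace X] : Statistic X where
  toFun _ _ _ := 1
  measurable_toFun _ := measurable_const
  congr _ _ _ _ _ _ := rfl
  perm _ _ _ _ := rfl

open Classical in
/-- The indicator of a measurable property of labelled clusters. -/
def Statistic.ofSet (Q : Set Node → (Node → X) → Node → Prop)
    (hm : ∀ r, MeasurableSet {z : Set Node × (Node → X) | Q z.1 z.2 r})
    (hc : ∀ C x x' r, r ∈ C → (∀ p ∈ C, x p = x' p) → Q C x r → Q C x' r)
    (hp : ∀ (σ : Equiv.Perm Node) C x r, Q (σ ⁻¹' C) (x ∘ σ) r ↔ Q C x (σ r)) : Statistic X where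
  toFun C x r := if Q C x r then 1 else 0
  measurable_toFun r := Measurable.ite (hm r) measurable_const measurable_const
  congr C x x' r hr h := by
    have : Q C x r ↔ Q C x' r := ⟨hc _ _ _ _ hr h, hc _ _ _ _ hr fun p hp => (h p hp).symm⟩
    simp only [this]
  perm σ C x r := by simp only [hp]

/-- An automorphism of the model: it preserves the intensity measure and the connection
function. -/
structure IsAut (m : Measure X) (T : X ≃ᵐ X) : Prop where
  measurePreserving : MeasurePreserving T m m
  toFun_apply : ∀ x y, φ.toFun (T x) (T y) = φ.toFun x y

theorem IsAut.symm {m : Measure X} {T : X ≃ᵐ X} (h : IsAut φ m T) : IsAut φ m T.symm :=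
  ⟨h.1.symm, fun x y => by rw [← h.2, T.apply_symm_apply, T.apply_symm_apply]⟩

variable [Nonempty X] (ν : ℕ → FiniteMeasure X) (lam : ℝ≥0)

/-- The intensity measure of the Poisson process at `lam = 1`. -/
abbrev baseMeasure (ν : ℕ → FiniteMeasure X) : Measure X := Measure.sum fun n => (ν n : Measure X)

/-- The cluster of the added point `0`. -/
abbrev rootClus (ω : Conf X) : Set Node := clus φ ω (Sum.inl 0)

/-- The expectation of a statistic of the cluster of the added point `0` on the event that the
cluster has `M + 1` vertices, which include the added points `0, …, k`. -/
def peelMean (G : Statistic X) (M k : ℕ) (a : ℕ → X) : ℝ≥0∞ :=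
  expect ν lam (Iic k) a
    ((peelSet (rootClus φ) M k).indicator fun ω => G.eval φ ω (Sum.inl 0))

theorem measurable_peelIntegrand (G : Statistic X) (M k : ℕ) :
    Measurable ((peelSet (rootClus φ) M k).indicator fun ω => G.eval φ ω (Sum.inl 0)) :=
  (G.measurable_eval φ _).indicator (measurableSet_peelSet (measurableSet_mem_clus φ _) M k)

theorem measurable_peelMean (G : Statistic X) (M k : ℕ) {Z : Type*} [MeasurableSpace Z]
    {a : Z → ℕ → X} (ha : Measurable a) : Measurable fun z => peelMean φ ν lam G M k (a z) :=
  measurable_expect ν lam _ ha (measurable_peelIntegrand φ G M k)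

theorem measurable_peelMean_update (G : Statistic X) (M k j : ℕ) (a : ℕ → X) :
    Measurable fun y => peelMean φ ν lam G M k (Function.update a j y) :=
  measurable_peelMean φ ν lam G M k (measurable_update_snd measurable_const measurable_id j)

theorem peelMean_congr (G : Statistic X) {M k : ℕ} {a a' : ℕ → X} (h : ∀ j ≤ k, a j = a' j) :
    peelMean φ ν lam G M k a = peelMean φ ν lam G M k a' :=
  expect_congr_loc ν lam h _

theorem peelMean_step (G : Statistic X) {M k : ℕ} (hk : k < M) (a : ℕ → X) :
    ((M - k : ℕ) : ℝ≥0∞) * peelMean φ ν lam G M k a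
      = lam * ∫⁻ y, peelMean φ ν lam G M (k + 1) (Function.update a (k + 1) y)
          ∂(baseMeasure ν) := by
  have := peel_step ν lam (E := ∅) (K := rootClus φ)
    (Ξ := fun ω => G.eval φ ω (Sum.inl 0)) hk (by simp) (measurableSet_mem_clus φ _)
    (G.measurable_eval φ _)
    (fun σ hσ ω => by rw [rootClus, clus_act, hσ 0 (by simp)])
    (fun σ hσ ω => by rw [G.eval_act, hσ 0 (by simp)])
    (fun ω h => by simpa using clus_subset φ h) a
  simp only [union_empty] at this
  exact this

theorem peelSet_top {K : Conf X → Set Node} (M : ℕ) :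
    peelSet K M M = {ω | K ω = Sum.inl '' Iic M} := by
  have hcard : (Sum.inl '' Iic M : Set Node).encard = M + 1 := by
    rw [Sum.inl_injective.encard_image, ← Finset.coe_Iic, encard_coe_eq_coe_finsetCard]
    simp
  ext ω
  constructor
  · rintro ⟨h1, h2⟩
    refine (Set.Finite.eq_of_subset_of_encard_le ?_ ?_ ?_).symm
    · exact (finite_Iic M).image _
    · rintro _ ⟨j, hj, rfl⟩
      exact h2 j hj
    · rw [h1, hcard]
  · intro h
    have h' : K ω = Sum.inl '' Iic M := h
    refine ⟨by rw [h', hcard], fun j hj => ?_⟩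
    rw [h']
    exact ⟨j, hj, rfl⟩

/-- Positions of labels given by positions of added points. -/
def addedLoc (a : ℕ → X) : Node → X := Sum.elim a fun _ => Classical.arbitrary X

theorem eval_of_clus_eq (G : Statistic X) {M : ℕ} {D : Set ℕ} (hD : Iic M ⊆ D)
    {P : Set (ℕ × ℕ)} {a : ℕ → X} {x : ℕ × ℕ → X} {u : Sym2 Node → unitInterval} :
    G.toFun (Sum.inl '' Iic M) (mkConf D P a x u).2.1 (Sum.inl 0)
      = G.toFun (Sum.inl '' Iic M) (addedLoc a) (Sum.inl 0) := by
  refine G.congr _ _ _ _ ⟨0, Nat.zero_le _, rfl⟩ ?_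
  rintro _ ⟨j, hj, rfl⟩
  exact loc_mkConf_inl _ _ _ _ (hD hj)

theorem measurableSet_clus_eq (p : Node) (S : Set Node) :
    MeasurableSet {ω : Conf X | clus φ ω p = S} := by
  have : {ω : Conf X | clus φ ω p = S} = ⋂ q, {ω | q ∈ clus φ ω p ↔ q ∈ S} := by
    ext ω
    simp [Set.ext_iff]
  rw [this]
  refine MeasurableSet.iInter fun q => ?_
  by_cases hq : q ∈ S
  · simp only [hq, iff_true]
    exact measurableSet_mem_clus φ p q
  · simp only [hq, iff_false]
    exact (measurableSet_mem_clus φ p q).compl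

/-- At level `M` there is nothing left to integrate: the cluster is the set of added points, so the
statistic is a constant and the probability is explicit. -/
theorem peelMean_top (G : Statistic X) (M : ℕ) (a : ℕ → X) :
    peelMean φ ν lam G M M a
      = G.toFun (Sum.inl '' Iic M) (addedLoc a) (Sum.inl 0)
        * (markLaw (connSet φ M a) * expNeg (lam * hitMass φ ν (Finset.Iic M) a)) := by
  rw [← expect_clus_eq, ← expect_const_mul ν lam
    (measurable_one.indicator (measurableSet_clus_eq φ _ _)), peelMean, peelSet_top]
  refine expect_congr ν lam fun c x u => ?_
  set ω := mkConf (Iic M) (pts c) a x u with hω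
  by_cases h : clus φ ω (Sum.inl 0) = Sum.inl '' Iic M
  · rw [indicator_of_mem (s := {ω | rootClus φ ω = Sum.inl '' Iic M}) h,
      indicator_of_mem (s := {ω | clus φ ω (Sum.inl 0) = Sum.inl '' Iic M}) h,
      Statistic.eval, h, hω, eval_of_clus_eq G subset_rfl]
    simp
  · rw [indicator_of_notMem (s := {ω | rootClus φ ω = Sum.inl '' Iic M}) h,
      indicator_of_notMem (s := {ω | clus φ ω (Sum.inl 0) = Sum.inl '' Iic M}) h, mul_zero]

/-- At the top level the connection event, the hit mass and the statistic are all carried over by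
`T`; the recursion transports this downwards. The opposite inequality comes from `T.symm`. -/
theorem peelMean_comp_le (G G' : Statistic X) {T : X ≃ᵐ X} (hT : IsAut φ (baseMeasure ν) T)
    (hG : ∀ C x r, G.toFun C (T ∘ x) r = G'.toFun C x r) {M k : ℕ} (hk : k ≤ M) (a : ℕ → X) :
    peelMean φ ν lam G M k (T ∘ a) ≤ peelMean φ ν lam G' M k a := by
  have := peel_compare lam (A := peelMean φ ν lam G' M) (B := peelMean φ ν lam G M)
    (r := fun _ => 1) hT.1 (fun k hk a => peelMean_step φ ν lam G' hk a)
    (fun k hk a => peelMean_step φ ν lam G hk a)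
    (fun k a => measurable_peelMean_update φ ν lam G M k k a) (fun _ _ _ _ => rfl)
    (fun a => ?_) k hk a
  · simpa using this
  · rw [one_mul, peelMean_top, peelMean_top, connSet_comp φ hT.2, hitMass_comp φ ν hT.2 hT.1]
    refine mul_le_mul' (le_of_eq ?_) le_rfl
    rw [← hG]
    refine G.congr _ _ _ _ ⟨0, Nat.zero_le _, rfl⟩ ?_
    rintro _ ⟨j, hj, rfl⟩
    rfl

/-- Invariance under automorphisms. -/
theorem peelMean_comp (G G' : Statistic X) {T : X ≃ᵐ X} (hT : IsAut φ (baseMeasure ν) T)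
    (hG : ∀ C x r, G.toFun C (T ∘ x) r = G'.toFun C x r) {M k : ℕ} (hk : k ≤ M) (a : ℕ → X) :
    peelMean φ ν lam G M k (T ∘ a) = peelMean φ ν lam G' M k a := by
  refine le_antisymm (peelMean_comp_le φ ν lam G G' hT hG hk a) ?_
  have h := peelMean_comp_le φ ν lam G' G hT.symm
    (fun C x r => by rw [← hG, ← Function.comp_assoc]; simp) hk (T ∘ a)
  rwa [← Function.comp_assoc, MeasurableEquiv.symm_comp_self, Function.id_comp] at h

/-- The expectation of a statistic of the cluster of `x` when it has `M + 1` vertices. -/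
def sizeMean (G : Statistic X) (M : ℕ) (x : X) : ℝ≥0∞ := peelMean φ ν lam G M 0 fun _ => x

theorem measurable_sizeMean (G : Statistic X) (M : ℕ) : Measurable (sizeMean φ ν lam G M) :=
  measurable_peelMean φ ν lam G M 0 (measurable_pi_lambda _ fun _ => measurable_id)

theorem sizeMean_aut (G G' : Statistic X) {T : X ≃ᵐ X} (hT : IsAut φ (baseMeasure ν) T)
    (hG : ∀ C x r, G.toFun C (T ∘ x) r = G'.toFun C x r) (M : ℕ) (x : X) :
    sizeMean φ ν lam G M (T x) = sizeMean φ ν lam G' M x :=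
  peelMean_comp φ ν lam G G' hT hG (Nat.zero_le M) fun _ => x

theorem sizeMean_eq (G : Statistic X) (M : ℕ) (x : X) : sizeMean φ ν lam G M x
    = expect ν lam {0} (fun _ => x)
        ({ω | (rootClus φ ω).encard = M + 1}.indicator fun ω => G.eval φ ω (Sum.inl 0)) := by
  have h : (Iic 0 : Set ℕ) = {0} := by ext; simp
  rw [sizeMean, peelMean, h]
  congr 2
  ext ω
  simp only [peelSet, mem_ofPred_eq, Nat.le_zero, and_iff_left_iff_imp]
  rintro _ j rfl
  exact self_mem_clus φ ω _

/-- Relabelling: a statistic rooted at another point of the cluster. -/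
theorem expect_root_swap (G : Statistic X) (M : ℕ) (a : ℕ → X) :
    expect ν lam (Iic 1) a ((peelSet (rootClus φ) M 1).indicator fun ω => G.eval φ ω (Sum.inl 1))
      = peelMean φ ν lam G M 1 (a ∘ Equiv.swap 0 1) := by
  have hpre : (Equiv.swap 0 1 : Equiv.Perm ℕ) ⁻¹' (Iic 1) = Iic 1 := by
    ext j
    by_cases h0 : j = 0
    · simp [h0]
    by_cases h1 : j = 1
    · simp [h1]
    simp [Equiv.swap_apply_of_ne_of_ne h0 h1]
  have h := expect_relabel ν lam (Equiv.swap 0 1) (Iic 1) a (measurable_peelIntegrand φ G M 1)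
  rw [hpre] at h
  rw [peelMean, ← h]
  refine congrArg _ (funext fun ω => ?_)
  set σ : Equiv.Perm Node := Equiv.sumCongr (Equiv.swap 0 1) (Equiv.refl _) with hσ
  have h0 : σ (Sum.inl 0) = Sum.inl 1 := by simp [hσ]
  have h1 : σ (Sum.inl 1) = Sum.inl 0 := by simp [hσ]
  have hforall : ∀ Q : ℕ → Prop, (∀ j ≤ 1, Q j) ↔ Q 0 ∧ Q 1 := fun Q =>
    ⟨fun h => ⟨h 0 (by omega), h 1 le_rfl⟩, fun h j hj => by
      interval_cases j
      exacts [h.1, h.2]⟩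
  have hmem : act σ ω ∈ peelSet (rootClus φ) M 1 ↔ ω ∈ peelSet (rootClus φ) M 1 := by
    simp only [peelSet, rootClus, mem_ofPred_eq, clus_act, encard_preimage_perm, hforall,
      mem_preimage, h0, h1]
    have key : Sum.inl 0 ∈ clus φ ω (Sum.inl 1) ↔ Sum.inl 1 ∈ clus φ ω (Sum.inl 0) :=
      ⟨SimpleGraph.Reachable.symm, SimpleGraph.Reachable.symm⟩
    simp only [self_mem_clus, true_and, key]
    refine and_congr_left fun h => ?_
    rw [clus_eq_of_mem φ h]
  by_cases hω : ω ∈ peelSet (rootClus φ) M 1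
  · rw [indicator_of_mem hω, indicator_of_mem (hmem.2 hω), G.eval_act, h0]
  · rw [indicator_of_notMem hω, indicator_of_notMem (mt hmem.1 hω)]

/-- Mass transport over the vertices of the cluster. -/
theorem expect_sum_cluster (G : Statistic X) {o : X} {T : X → X ≃ᵐ X} {inv : X → X}
    (hT : ∀ y, IsAut φ (baseMeasure ν) (T y)) (hTy : ∀ y, T y y = o) (hTo : ∀ y, T y o = inv y)
    (hinv : MeasurePreserving inv (baseMeasure ν) (baseMeasure ν))
    (hG : ∀ y C x r, G.toFun C (T y ∘ x) r = G.toFun C x r) (M : ℕ) :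
    expect ν lam {0} (fun _ => o) ({ω | (rootClus φ ω).encard = M + 1}.indicator fun ω =>
        ∑' p, {ω | p ∈ rootClus φ ω}.indicator (fun ω => G.eval φ ω p) ω)
      = (M + 1) * sizeMean φ ν lam G M o := by
  classical
  have hmK := fun p => measurableSet_mem_clus φ (X := X) (Sum.inl 0) p
  have hmE : MeasurableSet {ω : Conf X | (rootClus φ ω).encard = M + 1} :=
    measurableSet_encard_eq hmK _
  set f : Conf X → Node → ℝ≥0∞ := fun ω p =>
    ({ω | (rootClus φ ω).encard = M + 1} ∩ {ω | p ∈ rootClus φ ω}).indicator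
      (fun ω => G.eval φ ω p) ω with hf
  have hfm : ∀ p, Measurable fun ω => f ω p := fun p =>
    (G.measurable_eval φ p).indicator (hmE.inter (hmK p))
  have hfinv : Equivariant {0} f := by
    intro σ hσ ω p
    have h0 := hσ 0 rfl
    have : act σ ω ∈ {ω | (rootClus φ ω).encard = M + 1} ∩ {ω | p ∈ rootClus φ ω} ↔
        ω ∈ {ω | (rootClus φ ω).encard = M + 1} ∩ {ω | σ p ∈ rootClus φ ω} := by
      simp only [mem_inter_iff, mem_ofPred_eq, rootClus, clus_act, h0, encard_preimage_perm,
        mem_preimage]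
    simp only [hf]
    by_cases h : ω ∈ {ω | (rootClus φ ω).encard = M + 1} ∩ {ω | σ p ∈ rootClus φ ω}
    · rw [indicator_of_mem h, indicator_of_mem (this.2 h), G.eval_act]
    · rw [indicator_of_notMem h, indicator_of_notMem (mt this.1 h)]
  have hm := mecke ν lam (D := {0}) (k := 1) (by simp) (fun _ => o) hfm hfinv
  -- The sum over the cluster is split into the root and the Poisson points; the Mecke formula
  -- applies to the latter.
  have hsplit : expect ν lam {0} (fun _ => o) ({ω | (rootClus φ ω).encard = M + 1}.indicator
      fun ω => ∑' p, {ω | p ∈ rootClus φ ω}.indicator (fun ω => G.eval φ ω p) ω)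
      = expect ν lam {0} (fun _ => o) (fun ω => f ω (Sum.inl 0) + ∑' q : ℕ × ℕ,
        ({ω : Conf X | Sum.inr q ∈ ω.1}).indicator (fun ω => f ω (Sum.inr q)) ω) := by
    refine expect_congr ν lam fun c x u => ?_
    set ω := mkConf {0} (pts c) (fun _ => o) x u with hω
    have hsub : rootClus φ ω ⊆ ω.1 := clus_subset φ rfl
    by_cases h : ω ∈ {ω | (rootClus φ ω).encard = M + 1}
    · have hval : ∀ p, {ω | p ∈ rootClus φ ω}.indicator (fun ω => G.eval φ ω p) ω = f ω p := by
        intro p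
        by_cases hp : ω ∈ {ω | p ∈ rootClus φ ω}
        · rw [indicator_of_mem hp, hf]
          simp only
          rw [indicator_of_mem (show ω ∈ _ ∩ _ from ⟨h, hp⟩)]
        · rw [indicator_of_notMem hp, hf]
          simp only
          rw [indicator_of_notMem fun h' => hp h'.2]
      have hzero : ∀ p, p ∉ ω.1 → f ω p = 0 := fun p hp =>
        indicator_of_notMem (fun h' => hp (hsub h'.2)) _
      rw [indicator_of_mem h]
      simp only [hval]
      rw [ENNReal.summable.tsum_sum ENNReal.summable]
      congr 1
      · refine tsum_eq_single 0 fun j hj => hzero _ ?_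
        simpa [hω] using hj
      · refine tsum_congr fun q => ?_
        by_cases hq : ω ∈ {ω : Conf X | Sum.inr q ∈ ω.1}
        · rw [indicator_of_mem hq]
        · rw [indicator_of_notMem hq, hzero _ hq]
    · have hzero : ∀ p, f ω p = 0 := fun p => indicator_of_notMem (fun h' => h h'.1) _
      rw [indicator_of_notMem h, hzero, zero_add]
      symm
      rw [ENNReal.tsum_eq_zero]
      intro q
      by_cases hq : ω ∈ {ω : Conf X | Sum.inr q ∈ ω.1}
      · rw [indicator_of_mem hq, hzero]
      · rw [indicator_of_notMem hq]
  rw [hsplit, expect_add ν lam (hfm _), hm]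
  have hroot : expect ν lam {0} (fun _ => o) (fun ω => f ω (Sum.inl 0))
      = sizeMean φ ν lam G M o := by
    rw [sizeMean_eq]
    congr 1
    funext ω
    simp only [hf]
    congr 1
    ext ω
    simp [rootClus, self_mem_clus]
  have hins : (insert 1 {0} : Set ℕ) = Iic 1 := by
    ext j
    simp only [mem_insert_iff, mem_singleton_iff, mem_Iic]
    omega
  -- The statistic is rooted at the new point `y`. Exchanging the labels 0 and 1 makes `y` the root
  -- and the origin the second prescribed vertex.
  have hsec : ∀ y, expect ν lam (insert 1 {0}) (Function.update (fun _ => o) 1 y)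
      (fun ω => f ω (Sum.inl 1))
      = peelMean φ ν lam G M 1 (Function.update (fun _ => y) 1 o) := by
    intro y
    rw [hins]
    have : (fun ω => f ω (Sum.inl 1))
        = (peelSet (rootClus φ) M 1).indicator fun ω => G.eval φ ω (Sum.inl 1) := by
      funext ω
      simp only [hf]
      congr 1
      ext ω
      simp only [peelSet, mem_inter_iff, mem_ofPred_eq]
      refine and_congr_right fun _ => ⟨fun h j hj => ?_, fun h => h 1 le_rfl⟩
      interval_cases j
      exacts [self_mem_clus φ ω _, h]
    rw [this, expect_root_swap]
    refine peelMean_congr φ ν lam G fun j hj => ?_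
    interval_cases j <;> simp
  simp only [hsec]
  rw [hroot, add_mul, one_mul, add_comm]
  congr 1
  -- A cluster with a single vertex cannot contain two added points, so for `M = 0` the integral
  -- vanishes. For `M > 0` the recursion at level 0 applies.
  rcases Nat.eq_zero_or_pos M with rfl | hM
  · have hz : ∀ a, peelMean φ ν lam G 0 1 a = 0 := by
      intro a
      have : peelSet (rootClus φ (X := X)) 0 1 = ∅ := by
        refine eq_empty_of_forall_notMem fun ω h => ?_
        have h1 : (rootClus φ ω).encard = 1 := by simpa using h.1
        obtain ⟨p, hp⟩ := encard_eq_one.1 h1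
        have h2 := h.2 0 (by omega)
        have h3 := h.2 1 le_rfl
        rw [hp] at h2 h3
        simp only [mem_singleton_iff] at h2 h3
        rw [← h2] at h3
        simp at h3
      rw [peelMean, this, indicator_empty]
      exact expect_const ν lam 0
    simp [hz]
  · have h1 : ∀ y, peelMean φ ν lam G M 1 (Function.update (fun _ => y) 1 o)
        = peelMean φ ν lam G M 1 (Function.update (fun _ => o) 1 (inv y)) := by
      intro y
      rw [← peelMean_comp φ ν lam G G (hT y) (hG y) hM]
      refine peelMean_congr φ ν lam G fun j hj => ?_
      interval_cases j <;> simp [hTy, hTo]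
    simp only [h1]
    rw [hinv.lintegral_comp (f := fun y => peelMean φ ν lam G M 1 (Function.update (fun _ => o) 1 y))
      (measurable_peelMean_update φ ν lam G M 1 1 _)]
    have := peelMean_step φ ν lam G hM fun _ => o
    simp only [Nat.sub_zero, zero_add] at this
    rw [← this, sizeMean]

end Statistics

/-! ### Truncated mean cluster sizes and their recursive upper bound -/

section Truncated

variable {X : Type*} [MeasurableSpace X] (φ : SymKernel X)

open Classical in
/-- The number of vertices of a cluster if it is at most `N`, and `0` otherwise. -/
def truncSize (N : ℕ) (ω : Conf X) (p : Node) : ℝ≥0∞ :=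
  if (clus φ ω p).encard ≤ N then csize φ ω p else 0

theorem truncSize_act (N : ℕ) (σ : Equiv.Perm Node) (ω : Conf X) (p : Node) :
    truncSize φ N (act σ ω) p = truncSize φ N ω (σ p) := by
  simp only [truncSize, csize_act, clus_act, encard_preimage_perm]

/-- A cluster contains its root, so the possible finite sizes are M + 1 with M ≥ 0, and size at most
`N` means M < N. -/
theorem truncSize_eq_sum (N : ℕ) (ω : Conf X) (p : Node) :
    truncSize φ N ω p = ∑ M ∈ Finset.range N,
      {ω | (clus φ ω p).encard = M + 1}.indicator (fun _ => ((M : ℝ≥0∞) + 1)) ω := by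
  classical
  by_cases h : (clus φ ω p).encard ≤ N
  · obtain ⟨n, hn⟩ := ENat.ne_top_iff_exists.1 (ne_top_of_le_ne_top (ENat.natCast_ne_top N) h)
    have hn0 : n ≠ 0 := by
      rintro rfl
      rw [Nat.cast_zero, eq_comm, encard_eq_zero] at hn
      exact (hn ▸ self_mem_clus φ ω p : p ∈ (∅ : Set Node))
    obtain ⟨M, rfl⟩ := Nat.exists_eq_succ_of_ne_zero hn0
    have hM : M < N := by
      rw [← hn] at h
      have : M.succ ≤ N := by exact_mod_cast h
      omega
    rw [Finset.sum_eq_single M]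
    · rw [indicator_of_mem (s := {ω | (clus φ ω p).encard = M + 1})
          (show (clus φ ω p).encard = M + 1 by rw [← hn]; push_cast; rfl),
        truncSize, if_pos h, csize, ← hn]
      simp
    · intro M' _ hM'
      refine indicator_of_notMem (fun h' => hM' ?_) _
      have h'' : (clus φ ω p).encard = M' + 1 := h'
      rw [← hn] at h''
      have : M.succ = M' + 1 := by exact_mod_cast h''
      omega
    · intro h'
      exact absurd (Finset.mem_range.2 hM) h'
  · rw [truncSize, if_neg h, eq_comm]
    refine Finset.sum_eq_zero fun M hM => indicator_of_notMem (fun h' => h ?_) _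
    have h'' : (clus φ ω p).encard = M + 1 := h'
    rw [h'']
    have := Finset.mem_range.1 hM
    exact_mod_cast this

theorem measurable_truncSize (N : ℕ) (p : Node) : Measurable fun ω => truncSize φ N ω p := by
  simp only [truncSize_eq_sum]
  exact Finset.measurable_sum _ fun M _ => measurable_const.indicator
    (measurableSet_encard_eq (measurableSet_mem_clus φ p) _)

variable [Nonempty X] (ν : ℕ → FiniteMeasure X) (lam : ℝ≥0)

theorem expect_finset_sum {κ : Type*} (s : Finset κ) {D : Set ℕ} {a : ℕ → X}
    {f : κ → Conf X → ℝ≥0∞} (hf : ∀ k, Measurable (f k)) :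
    expect ν lam D a (fun ω => ∑ k ∈ s, f k ω) = ∑ k ∈ s, expect ν lam D a (f k) := by
  classical
  induction s using Finset.induction_on with
  | empty =>
    simp only [Finset.sum_empty]
    exact expect_const ν lam 0
  | insert k s hk ih =>
    simp only [Finset.sum_insert hk]
    rw [expect_add ν lam (hf k), ih]

/-- The expectation of the cluster size, weighted with a statistic, over the event that the
cluster has at most `N` vertices. -/
def sizeSum (G : Statistic X) (N : ℕ) (x : X) : ℝ≥0∞ :=
  ∑ M ∈ Finset.range N, ((M : ℝ≥0∞) + 1) * sizeMean φ ν lam G M x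

theorem sizeSum_eq (G : Statistic X) (N : ℕ) (x : X) : sizeSum φ ν lam G N x
    = expect ν lam {0} (fun _ => x)
        fun ω => truncSize φ N ω (Sum.inl 0) * G.eval φ ω (Sum.inl 0) := by
  have hm : ∀ M : ℕ, Measurable
      ({ω | (rootClus φ ω).encard = M + 1}.indicator fun ω => G.eval φ ω (Sum.inl 0)) := fun M =>
    (G.measurable_eval φ _).indicator (measurableSet_encard_eq (measurableSet_mem_clus φ _) _)
  simp only [sizeSum, sizeMean_eq]
  simp only [← expect_const_mul ν lam (hm _)]
  rw [← expect_finset_sum ν lam _ fun M => (hm M).const_mul _]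
  congr 1
  funext ω
  rw [truncSize_eq_sum, Finset.sum_mul]
  refine Finset.sum_congr rfl fun M _ => ?_
  by_cases h : ω ∈ {ω | (rootClus φ ω).encard = M + 1}
  · rw [indicator_of_mem h, indicator_of_mem h]
  · rw [indicator_of_notMem h, indicator_of_notMem h, mul_zero, zero_mul]

theorem sizeSum_one_eq (N : ℕ) (x : X) : sizeSum φ ν lam (Statistic.one X) N x
    = expect ν lam {0} (fun _ => x) fun ω => truncSize φ N ω (Sum.inl 0) := by
  rw [sizeSum_eq]
  simp [Statistic.eval, Statistic.one]

/-- The root may carry another label. -/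
theorem expect_root_label (j : ℕ) (a : ℕ → X) {f : Conf X → Node → ℝ≥0∞}
    (hf : ∀ p, Measurable fun ω => f ω p)
    (hinv : ∀ (σ : Equiv.Perm Node) ω p, f (act σ ω) p = f ω (σ p)) :
    expect ν lam {j} a (fun ω => f ω (Sum.inl j))
      = expect ν lam {0} (fun _ => a j) (fun ω => f ω (Sum.inl 0)) := by
  have h := expect_relabel ν lam (Equiv.swap 0 j) {j} a (hf (Sum.inl 0))
  have hpre : (Equiv.swap 0 j : Equiv.Perm ℕ) ⁻¹' {j} = {0} := by
    ext i
    rw [mem_preimage, mem_singleton_iff, Equiv.swap_apply_eq_iff, Equiv.swap_apply_right,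
      mem_singleton_iff]
  rw [hpre] at h
  simp only [hinv] at h
  rw [expect_congr_loc ν lam (a := a ∘ _) (a' := fun _ => a j)
    (by rintro i rfl; simp)] at h
  rw [← h]
  simp

/-- A mark which is not used by a functional is independent of it. -/
theorem expect_mark_mul {D : Set ℕ} {a : ℕ → X} (e : Sym2 Node) (t : unitInterval)
    {f : Conf X → ℝ≥0∞} (hf : Measurable f)
    (hdep : ∀ c x, DependsOn (fun u => f (mkConf D (pts c) a x u)) {e}ᶜ) :
    expect ν lam D a (fun ω => (Iic t).indicator 1 (ω.2.2 e) * f ω)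
      = uval t * expect ν lam D a f := by
  rw [← expect_const_mul ν lam hf]
  refine lintegral_congr fun c => lintegral_congr fun x => ?_
  simp only [marks_mkConf]
  have hm : Measurable fun u : Sym2 Node → unitInterval =>
      (Iic t).indicator (1 : unitInterval → ℝ≥0∞) (u e) :=
    (measurable_one.indicator measurableSet_Iic).comp (measurable_pi_apply e)
  rw [lintegral_const_mul _ (measurable_marks_integrand hf _ a x)]
  refine (lintegral_infinitePi_mul _ {e} hm (measurable_marks_integrand hf _ a x) ?_
    (hdep c x)).trans ?_
  · intro u v h
    simp only [h e rfl]
  · congr 1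
    rw [lintegral_infinitePi_eval (fun _ => (volume : Measure unitInterval)) e
      (F := (Iic t).indicator 1) (measurable_one.indicator measurableSet_Iic),
      lintegral_indicator_one measurableSet_Iic, volume_Iic_unitInterval]

/-- The cluster of a neighbour after deletion of `p` misses `p` itself. This is why the truncation
level drops by one in the recursion. -/
theorem encard_clus_le_of_del {ω : Conf X} {p q : Node} (hpq : (cgraph φ ω).Adj p q) :
    (clus φ (del {p} ω) q).encard + 1 ≤ (clus φ ω p).encard := by
  have hp : p ∉ clus φ (del {p} ω) q := fun h => by
    have := mem_of_reachable φ h hpq.1.symm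
    simp [del] at this
  rw [← encard_insert_of_notMem hp]
  refine encard_le_encard (insert_subset (self_mem_clus φ ω p) ?_)
  refine (clus_del_subset φ {p} ω q).trans ?_
  rw [clus_eq_of_mem φ (show q ∈ clus φ ω p from hpq.reachable)]

theorem mem_clus_iff_del {ω : Conf X} {p r : Node} (h : r ∈ clus φ ω p) :
    r = p ∨ ∃ q, (cgraph φ ω).Adj p q ∧ r ∈ clus φ (del {p} ω) q := by
  refine reachable_closed (G := cgraph φ ω) (p := p)
    (S := {r | r = p ∨ ∃ q, (cgraph φ ω).Adj p q ∧ r ∈ clus φ (del {p} ω) q}) (Or.inl rfl) ?_ h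
  rintro a b ha hab
  by_cases hb : b = p
  · exact Or.inl hb
  rcases ha with rfl | ⟨q, hq, ha⟩
  · exact Or.inr ⟨b, hab, self_mem_clus φ _ _⟩
  · by_cases hap : a = p
    · subst hap
      exact Or.inr ⟨b, hab, self_mem_clus φ _ _⟩
    · exact Or.inr ⟨q, hq, SimpleGraph.Reachable.trans ha
        (SimpleGraph.Adj.reachable ((adj_del φ {p} ω a b).2 ⟨hab, hap, hb⟩))⟩

-- Every vertex of the cluster other than `p` is reached, without returning to `p`, from some
-- neighbour of `p`. Counting it once for each such neighbour gives an upper bound.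
open Classical in
theorem truncSize_succ_le (N : ℕ) (ω : Conf X) (p : Node) :
    truncSize φ (N + 1) ω p ≤ 1 + ∑' q, if (cgraph φ ω).Adj p q then
      truncSize φ N (del {p} ω) q else 0 := by
  by_cases h : (clus φ ω p).encard ≤ (N + 1 : ℕ)
  · rw [truncSize, if_pos h]
    have h1 : ∀ q, (cgraph φ ω).Adj p q →
        truncSize φ N (del {p} ω) q = csize φ (del {p} ω) q := by
      intro q hq
      rw [truncSize, if_pos]
      have := (encard_clus_le_of_del φ hq).trans h
      rw [Nat.cast_add, Nat.cast_one] at this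
      exact (ENat.add_le_add_iff_right ENat.one_ne_top).1 this
    have hcs : ∀ (ω : Conf X) p, csize φ ω p = ∑' r, if r ∈ clus φ ω p then (1 : ℝ≥0∞) else 0 := by
      intro ω p
      rw [csize, ← ENNReal.tsum_set_one, tsum_subtype (clus φ ω p) (fun _ => (1 : ℝ≥0∞))]
      rfl
    have h2 : ∀ q, (if (cgraph φ ω).Adj p q then truncSize φ N (del {p} ω) q else 0)
        = ∑' r, if (cgraph φ ω).Adj p q ∧ r ∈ clus φ (del {p} ω) q then (1 : ℝ≥0∞) else 0 := by
      intro q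
      by_cases hq : (cgraph φ ω).Adj p q
      · simp only [hq, if_true, h1, hcs, true_and]
      · simp only [hq, if_false, false_and, tsum_zero]
    simp only [h2]
    rw [ENNReal.tsum_comm, hcs]
    have h3 : (1 : ℝ≥0∞) = ∑' r, if r = p then 1 else 0 := by
      rw [tsum_ite_eq]
    conv_rhs => lhs; rw [h3]
    rw [← ENNReal.tsum_add]
    refine ENNReal.tsum_le_tsum fun r => ?_
    by_cases hr : r ∈ clus φ ω p
    · rw [if_pos hr]
      rcases mem_clus_iff_del φ hr with rfl | ⟨q, hq⟩
      · simp
      · refine le_add_left (le_trans ?_ (ENNReal.le_tsum q))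
        rw [if_pos hq]
    · rw [if_neg hr]
      exact bot_le
  · rw [truncSize, if_neg h]
    exact bot_le

/-- The mark of a pair containing an absent label is not used; it is therefore independent of the
cluster. -/
theorem clus_del_marks {D : Set ℕ} {j : ℕ} (hj : j ∉ D) (P : Set (ℕ × ℕ)) (a : ℕ → X)
    (x : ℕ × ℕ → X) (p q : Node) {u v : Sym2 Node → unitInterval}
    (huv : ∀ e ∈ ({s(Sum.inl j, p)} : Set (Sym2 Node))ᶜ, u e = v e) :
    clus φ (mkConf D P a x u) q = clus φ (mkConf D P a x v) q := by
  have : cgraph φ (mkConf D P a x u) = cgraph φ (mkConf D P a x v) := by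
    ext b c
    simp only [cgraph_adj]
    have hV : (mkConf D P a x u).1 = (mkConf D P a x v).1 := rfl
    have hL : (mkConf D P a x u).2.1 = (mkConf D P a x v).2.1 := rfl
    rw [hV, hL]
    refine and_congr_right fun _ => and_congr_right fun hb => and_congr_right fun hc => ?_
    rw [marks_mkConf, marks_mkConf, huv]
    intro h
    rw [mem_singleton_iff, Sym2.eq_iff] at h
    rcases h with ⟨rfl, _⟩ | ⟨_, rfl⟩
    · exact hj hb
    · exact hj hc
  simp only [clus, this]

/-- The recursive bound for the truncated mean cluster size. -/
theorem sizeSum_succ_le (N : ℕ) (o : X) :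
    sizeSum φ ν lam (Statistic.one X) (N + 1) o
      ≤ 1 + lam * ∫⁻ y, uval (φ.toFun o y) * sizeSum φ ν lam (Statistic.one X) N y
          ∂(baseMeasure ν) := by
  classical
  set f : Conf X → Node → ℝ≥0∞ := fun ω p =>
    {ω | (cgraph φ ω).Adj (Sum.inl 0) p}.indicator
      (fun ω => truncSize φ N (del (Sum.inl '' {0}) ω) p) ω with hf
  have hfm : ∀ p, Measurable fun ω => f ω p := fun p =>
    ((measurable_truncSize φ N p).comp (measurable_del _)).indicator (measurableSet_adj φ _ _)
  have hfinv : Equivariant {0} f := by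
    intro σ hσ ω p
    have h0 := hσ 0 rfl
    have h1 : σ.symm ⁻¹' (Sum.inl '' {0}) = (Sum.inl '' {0} : Set Node) := by
      ext r
      simp only [image_singleton, mem_preimage, mem_singleton_iff]
      rw [Equiv.symm_apply_eq, h0]
    have h2 : act σ ω ∈ {ω | (cgraph φ ω).Adj (Sum.inl 0) p} ↔
        ω ∈ {ω | (cgraph φ ω).Adj (Sum.inl 0) (σ p)} := by
      simp only [mem_ofPred_eq, adj_act, h0]
    simp only [hf]
    by_cases h : ω ∈ {ω | (cgraph φ ω).Adj (Sum.inl 0) (σ p)}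
    · rw [indicator_of_mem h, indicator_of_mem (h2.2 h), del_act, h1, truncSize_act]
    · rw [indicator_of_notMem h, indicator_of_notMem (mt h2.1 h)]
  have hm := mecke ν lam (D := {0}) (k := 1) (by simp) (fun _ => o) hfm hfinv
  rw [sizeSum_one_eq]
  have hle : expect ν lam {0} (fun _ => o) (fun ω => truncSize φ (N + 1) ω (Sum.inl 0))
      ≤ expect ν lam {0} (fun _ => o) (fun ω => 1 + ∑' q : ℕ × ℕ,
        ({ω : Conf X | Sum.inr q ∈ ω.1}).indicator (fun ω => f ω (Sum.inr q)) ω) := by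
    refine expect_mono ν lam fun c x u => (truncSize_succ_le φ N _ _).trans ?_
    set ω := mkConf {0} (pts c) (fun _ => o) x u with hω
    refine add_le_add le_rfl ?_
    rw [ENNReal.summable.tsum_sum ENNReal.summable]
    have hz : ∑' j : ℕ, (if (cgraph φ ω).Adj (Sum.inl 0) (Sum.inl j) then
        truncSize φ N (del {Sum.inl 0} ω) (Sum.inl j) else 0) = 0 := by
      rw [ENNReal.tsum_eq_zero]
      intro j
      rw [if_neg]
      rintro ⟨h1, _, h3, _⟩
      have : j = 0 := h3
      exact h1 (by rw [this])
    rw [hz, zero_add]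
    refine ENNReal.tsum_le_tsum fun q => ?_
    by_cases hq : (cgraph φ ω).Adj (Sum.inl 0) (Sum.inr q)
    · rw [if_pos hq, indicator_of_mem (s := {ω : Conf X | Sum.inr q ∈ ω.1}) hq.2.2.1, hf]
      simp only
      rw [indicator_of_mem (s := {ω | (cgraph φ ω).Adj (Sum.inl 0) (Sum.inr q)}) hq,
        image_singleton]
    · rw [if_neg hq]
      exact bot_le
  refine hle.trans ?_
  rw [expect_add ν lam measurable_const, expect_const, hm]
  refine add_le_add le_rfl (mul_le_mul' le_rfl (lintegral_mono fun y => ?_))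
  set a : ℕ → X := Function.update (fun _ => o) 1 y with ha
  have h01 : (Sum.inl 0 : Node) ≠ Sum.inl 1 := by simp
  have hdel : (insert 1 {0} \ {0} : Set ℕ) = {1} := by
    ext j
    simp only [Set.mem_sdiff, mem_insert_iff, mem_singleton_iff]
    omega
  -- The edge between the root and `y` depends on one mark, which the cluster of `y` without the
  -- root does not use. So the two factors are independent.
  have hrw : expect ν lam (insert 1 {0}) a (fun ω => f ω (Sum.inl 1))
      = expect ν lam (insert 1 {0}) a (fun ω => (Iic (φ.toFun o y)).indicator 1
          (ω.2.2 s(Sum.inl 0, Sum.inl 1))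
            * truncSize φ N (del (Sum.inl '' {0}) ω) (Sum.inl 1)) := by
    refine expect_congr ν lam fun c x u => ?_
    simp only [hf, marks_mkConf]
    have l0 : (mkConf (insert 1 {0}) (pts c) a x u).2.1 (Sum.inl 0) = o := by
      rw [loc_mkConf_inl _ _ _ _ (by simp)]
      simp [ha]
    have l1 : (mkConf (insert 1 {0}) (pts c) a x u).2.1 (Sum.inl 1) = y := by
      rw [loc_mkConf_inl _ _ _ _ (by simp)]
      simp [ha]
    have hiff : (cgraph φ (mkConf (insert 1 {0}) (pts c) a x u)).Adj (Sum.inl 0) (Sum.inl 1) ↔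
        u s(Sum.inl 0, Sum.inl 1) ≤ φ.toFun o y := by
      rw [cgraph_adj, l0, l1]
      simp
    by_cases h : u s(Sum.inl 0, Sum.inl 1) ≤ φ.toFun o y
    · rw [indicator_of_mem (show _ ∈ {ω | (cgraph φ ω).Adj (Sum.inl 0) (Sum.inl 1)} from hiff.2 h),
        indicator_of_mem (s := Iic (φ.toFun o y)) h]
      simp
    · rw [indicator_of_notMem (show _ ∉ {ω | (cgraph φ ω).Adj (Sum.inl 0) (Sum.inl 1)} from
        mt hiff.1 h), indicator_of_notMem (s := Iic (φ.toFun o y)) h, zero_mul]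
  have hme : Measurable fun ω : Conf X => truncSize φ N (del (Sum.inl '' {0}) ω) (Sum.inl 1) :=
    (measurable_truncSize φ N _).comp (measurable_del _)
  rw [hrw, expect_mark_mul ν lam _ _ hme]
  · rw [expect_del ν lam _ _ a (fun ω => truncSize φ N ω (Sum.inl 1)), hdel,
      expect_root_label ν lam 1 a (measurable_truncSize φ N) (truncSize_act φ N),
      sizeSum_one_eq]
    simp [ha]
  · intro c x u v huv
    simp only [del_mkConf_inl, hdel, truncSize, csize]
    rw [clus_del_marks φ (j := 0) (by simp) (pts c) a x (Sum.inl 1) (Sum.inl 1) huv]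

end Truncated

/-! ### Crowded vertices -/

section Crowding

variable {X : Type*} [MeasurableSpace X] (φ : SymKernel X)

/-- The product of two statistics. -/
def Statistic.mul (G G' : Statistic X) : Statistic X where
  toFun C x r := G.toFun C x r * G'.toFun C x r
  measurable_toFun r := (G.measurable_toFun r).mul (G'.measurable_toFun r)
  congr C x x' r hr h := by rw [G.congr C x x' r hr h, G'.congr C x x' r hr h]
  perm σ C x r := by rw [G.perm, G'.perm]

theorem measurable_fst_mem (p : Node) :
    MeasurableSet {z : Set Node × (Node → X) | p ∈ z.1} :=
  measurable_fst (measurableSet_mem p)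

theorem measurable_snd_apply (p : Node) :
    Measurable fun z : Set Node × (Node → X) => z.2 p :=
  (measurable_pi_apply p).comp measurable_snd

/-- The indicator that the cluster lies in a measurable set. -/
def Statistic.inside (A : Set X) (hA : MeasurableSet A) : Statistic X :=
  .ofSet (fun C x _ => ∀ p ∈ C, x p ∈ A)
    (fun r => by
      have : {z : Set Node × (Node → X) | ∀ p ∈ z.1, z.2 p ∈ A}
          = ⋂ p, ({z | p ∈ z.1}ᶜ ∪ {z | z.2 p ∈ A}) := by
        ext z
        simp [imp_iff_not_or]
      rw [this]
      exact MeasurableSet.iInter fun p => (measurable_fst_mem p).compl.union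
        (measurable_snd_apply p hA))
    (fun C x x' r _ h hQ p hp => h p hp ▸ hQ p hp)
    (fun σ C x r => ⟨fun h p hp => by simpa using h (σ.symm p) (by simpa using hp),
      fun h p hp => h (σ p) hp⟩)

/-- The other labels of the cluster whose positions are related to that of the root. -/
def relatedTo (R : Set (X × X)) (C : Set Node) (x : Node → X) (r : Node) : Set Node :=
  {q | q ∈ C ∧ q ≠ r ∧ (x r, x q) ∈ R}

theorem relatedTo_perm (R : Set (X × X)) (σ : Equiv.Perm Node) (C : Set Node) (x : Node → X)
    (r : Node) : relatedTo R (σ ⁻¹' C) (x ∘ σ) r = σ ⁻¹' relatedTo R C x (σ r) := by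
  ext q
  simp only [relatedTo, mem_ofPred_eq, mem_preimage, Function.comp_apply, ne_eq,
    EmbeddingLike.apply_eq_iff_eq]

theorem relatedTo_congr (R : Set (X × X)) {C : Set Node} {x x' : Node → X} {r : Node}
    (hr : r ∈ C) (h : ∀ p ∈ C, x p = x' p) : relatedTo R C x r = relatedTo R C x' r := by
  ext q
  refine and_congr_right fun hq => ?_
  rw [h r hr, h q hq]

theorem measurable_encard_relatedTo {R : Set (X × X)} (hR : MeasurableSet R) (r : Node) :
    Measurable fun z : Set Node × (Node → X) => ((relatedTo R z.1 z.2 r).encard : ℝ≥0∞) := by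
  refine measurable_encard _ fun q => ?_
  have h1 : MeasurableSet {z : Set Node × (Node → X) | (z.2 r, z.2 q) ∈ R} :=
    ((measurable_snd_apply r).prodMk (measurable_snd_apply q)) hR
  by_cases hq : q = r
  · have : {z : Set Node × (Node → X) | q ∈ relatedTo R z.1 z.2 r} = ∅ :=
      eq_empty_of_forall_notMem fun z hz => hz.2.1 hq
    rw [this]
    exact MeasurableSet.empty
  · have : {z : Set Node × (Node → X) | q ∈ relatedTo R z.1 z.2 r}
        = {z | q ∈ z.1} ∩ {z | (z.2 r, z.2 q) ∈ R} := by
      ext z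
      simp [relatedTo, hq]
    rw [this]
    exact (measurable_fst_mem q).inter h1

/-- The indicator that the root is related to at least `K` other elements of the cluster. -/
def Statistic.crowd (R : Set (X × X)) (hR : MeasurableSet R) (K : ℕ) : Statistic X :=
  .ofSet (fun C x r => (K : ℝ≥0∞) ≤ ((relatedTo R C x r).encard : ℝ≥0∞))
    (fun r => measurableSet_le measurable_const (measurable_encard_relatedTo hR r))
    (fun C x x' r hr h hQ => by rwa [← relatedTo_congr R hr h])
    (fun σ C x r => by rw [relatedTo_perm, encard_preimage_perm])

/-- The indicator that the root is related to less than `K` other elements of the cluster. -/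
def Statistic.few (R : Set (X × X)) (hR : MeasurableSet R) (K : ℕ) : Statistic X :=
  .ofSet (fun C x r => ((relatedTo R C x r).encard : ℝ≥0∞) < K)
    (fun r => measurableSet_lt (measurable_encard_relatedTo hR r) measurable_const)
    (fun C x x' r hr h hQ => by rwa [← relatedTo_congr R hr h])
    (fun σ C x r => by rw [relatedTo_perm, encard_preimage_perm])

variable [Nonempty X] (ν : ℕ → FiniteMeasure X) (lam : ℝ≥0)

theorem sizeMean_mono {G G' : Statistic X} (h : ∀ C x r, G.toFun C x r ≤ G'.toFun C x r) (M : ℕ)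
    (x : X) : sizeMean φ ν lam G M x ≤ sizeMean φ ν lam G' M x :=
  expect_mono ν lam fun _ _ _ => indicator_le_indicator (h _ _ _)

theorem sizeMean_le_add {G G₁ G₂ : Statistic X}
    (h : ∀ C x r, G.toFun C x r ≤ G₁.toFun C x r + G₂.toFun C x r) (M : ℕ) (x : X) :
    sizeMean φ ν lam G M x ≤ sizeMean φ ν lam G₁ M x + sizeMean φ ν lam G₂ M x := by
  rw [sizeMean, sizeMean, sizeMean, peelMean, peelMean, peelMean,
    ← expect_add ν lam (measurable_peelIntegrand φ G₁ M 0)]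
  refine expect_mono ν lam fun c y u => ?_
  set ω := mkConf (Iic 0) (pts c) (fun _ => x) y u
  by_cases hω : ω ∈ peelSet (rootClus φ) M 0
  · simp only [indicator_of_mem hω]
    exact h _ _ _
  · simp only [indicator_of_notMem hω, add_zero, le_refl]

/-- A walk from `p` is followed from its last visit to `p` or `q` on, and there it avoids the other
of the two vertices. -/
theorem clus_subset_union_del (ω : Conf X) {p q : Node} (hpq : p ≠ q) :
    clus φ ω p ⊆ clus φ (del {q} ω) p ∪ clus φ (del {p} ω) q := by
  intro r hr
  refine reachable_closed (G := cgraph φ ω) (p := p) (Or.inl (self_mem_clus φ _ _)) ?_ hr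
  intro a b ha hab
  by_cases hbp : b = p
  · exact hbp ▸ Or.inl (self_mem_clus φ _ _)
  by_cases hbq : b = q
  · exact hbq ▸ Or.inr (self_mem_clus φ _ _)
  rcases ha with ha | ha
  · have haq : a ≠ q := by
      rintro rfl
      have := mem_of_reachable φ ha hpq
      simp [del] at this
    exact Or.inl (SimpleGraph.Reachable.trans ha
      (SimpleGraph.Adj.reachable ((adj_del φ {q} ω a b).2 ⟨hab, haq, hbq⟩)))
  · have hap : a ≠ p := by
      rintro rfl
      have := mem_of_reachable φ ha hpq.symm
      simp [del] at this
    exact Or.inr (SimpleGraph.Reachable.trans ha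
      (SimpleGraph.Adj.reachable ((adj_del φ {p} ω a b).2 ⟨hab, hap, hbp⟩)))

/-- Removing `p` or `q` decouples them: each term on the right is the cluster size in a model with
one of the two points absent. Both clusters on the right lie in the cluster on the left, so the
truncation is inherited. -/
theorem truncSize_le_add_del (N : ℕ) {ω : Conf X} {p q : Node} (hpq : p ≠ q)
    (h : q ∈ clus φ ω p) :
    truncSize φ N ω p ≤ truncSize φ N (del {q} ω) p + truncSize φ N (del {p} ω) q := by
  by_cases hN : (clus φ ω p).encard ≤ N
  · have h1 := (encard_le_encard (clus_del_subset φ {q} ω p)).trans hN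
    have h2 := (encard_le_encard (clus_del_subset φ {p} ω q)).trans
      ((clus_eq_of_mem φ h).symm ▸ hN)
    rw [truncSize, truncSize, truncSize, if_pos hN, if_pos h1, if_pos h2, csize, csize, csize]
    have := (encard_le_encard (clus_subset_union_del φ ω hpq)).trans (encard_union_le _ _)
    exact_mod_cast this
  · rw [truncSize, if_neg hN]
    exact bot_le

/-- Crowding is unlikely, even after weighting with the truncated cluster size. -/
theorem sizeSum_crowd_le {R : Set (X × X)} (hR : MeasurableSet R) (K N : ℕ) (o : X) :
    K * sizeSum φ ν lam (.crowd R hR K) N o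
      ≤ lam * ∫⁻ y in {y | (o, y) ∈ R}, (sizeSum φ ν lam (.one X) N o
          + sizeSum φ ν lam (.one X) N y) ∂(baseMeasure ν) := by
  classical
  set S : Node → Set (Conf X) := fun p =>
    {ω | p ∈ rootClus φ ω ∧ (ω.2.1 (Sum.inl 0), ω.2.1 p) ∈ R} with hS
  have hSm : ∀ p, MeasurableSet (S p) := fun p =>
    (measurableSet_mem_clus φ _ p).inter
      (((measurable_loc (Sum.inl 0)).prodMk (measurable_loc p)) hR)
  set f : Conf X → Node → ℝ≥0∞ := fun ω p =>
    (S p).indicator (fun ω => truncSize φ N ω (Sum.inl 0)) ω with hf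
  have hfm : ∀ p, Measurable fun ω => f ω p := fun p =>
    (measurable_truncSize φ N _).indicator (hSm p)
  have hfinv : Equivariant {0} f := by
    intro σ hσ ω p
    have h0 := hσ 0 rfl
    have h2 : act σ ω ∈ S p ↔ ω ∈ S (σ p) := by
      simp only [hS, mem_ofPred_eq, rootClus, clus_act, h0, mem_preimage]
      simp only [act, Function.comp_apply, h0]
    simp only [hf]
    by_cases h : ω ∈ S (σ p)
    · rw [indicator_of_mem h, indicator_of_mem (h2.2 h), truncSize_act, h0]
    · rw [indicator_of_notMem h, indicator_of_notMem (mt h2.1 h)]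
  have hm := mecke ν lam (D := {0}) (k := 1) (by simp) (fun _ => o) hfm hfinv
  have hmp : Measurable fun ω : Conf X => truncSize φ N ω (Sum.inl 0)
      * (Statistic.crowd R hR K).eval φ ω (Sum.inl 0) :=
    (measurable_truncSize φ N _).mul (Statistic.measurable_eval φ _ _)
  rw [sizeSum_eq, ← expect_const_mul ν lam hmp]
  -- Markov's inequality: a crowded root has at least `K` related cluster vertices, and their number
  -- is a sum to which the Mecke formula applies.
  have hle : expect ν lam {0} (fun _ => o) (fun ω => K * (truncSize φ N ω (Sum.inl 0)
        * (Statistic.crowd R hR K).eval φ ω (Sum.inl 0)))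
      ≤ expect ν lam {0} (fun _ => o) (fun ω => ∑' q : ℕ × ℕ,
        ({ω : Conf X | Sum.inr q ∈ ω.1}).indicator (fun ω => f ω (Sum.inr q)) ω) := by
    refine expect_mono ν lam fun c x u => ?_
    set ω := mkConf {0} (pts c) (fun _ => o) x u with hω
    have hsub : rootClus φ ω ⊆ ω.1 := clus_subset φ rfl
    rw [Statistic.eval, Statistic.crowd, Statistic.ofSet]
    simp only
    split_ifs with hK
    · rw [mul_one, mul_comm]
      refine (mul_le_mul' le_rfl hK).trans ?_
      set T := relatedTo R (clus φ ω (Sum.inl 0)) ω.2.1 (Sum.inl 0) with hT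
      have hTinr : T ⊆ Sum.inr '' (Sum.inr ⁻¹' T : Set (ℕ × ℕ)) := by
        intro p hp
        rcases p with j | q
        · have h1 : j = 0 := hsub hp.1
          exact absurd (by rw [h1]) hp.2.1
        · exact ⟨q, hp, rfl⟩
      have hcard : (T.encard : ℝ≥0∞) ≤ ((Sum.inr ⁻¹' T : Set (ℕ × ℕ)).encard : ℝ≥0∞) := by
        have := (encard_le_encard hTinr).trans (encard_image_le _ _)
        exact_mod_cast this
      refine (mul_le_mul' le_rfl hcard).trans ?_
      rw [← ENNReal.tsum_set_one, tsum_subtype (Sum.inr ⁻¹' T) (fun _ => (1 : ℝ≥0∞)),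
        ← ENNReal.tsum_mul_left]
      refine ENNReal.tsum_le_tsum fun q => ?_
      by_cases hq : q ∈ (Sum.inr ⁻¹' T : Set (ℕ × ℕ))
      · have hq' : Sum.inr q ∈ T := hq
        rw [indicator_of_mem hq, mul_one, indicator_of_mem (s := {ω : Conf X | Sum.inr q ∈ ω.1})
          (hsub hq'.1), hf]
        simp only
        rw [indicator_of_mem]
        exact ⟨hq'.1, hq'.2.2⟩
      · rw [indicator_of_notMem hq, mul_zero]
        exact bot_le
    · simp
  refine hle.trans ?_
  rw [hm]
  refine mul_le_mul' le_rfl ?_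
  have hRm : MeasurableSet {y | (o, y) ∈ R} := measurable_prodMk_left hR
  rw [← lintegral_indicator hRm]
  refine lintegral_mono fun y => ?_
  set a : ℕ → X := Function.update (fun _ => o) 1 y with ha
  have l0 : ∀ c x u, (mkConf (insert 1 {0}) (pts c) a x u).2.1 (Sum.inl 0) = o := by
    intro c x u
    rw [loc_mkConf_inl _ _ _ _ (by simp)]
    simp [ha]
  have l1 : ∀ c x u, (mkConf (insert 1 {0}) (pts c) a x u).2.1 (Sum.inl 1) = y := by
    intro c x u
    rw [loc_mkConf_inl _ _ _ _ (by simp)]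
    simp [ha]
  by_cases hy : y ∈ {y | (o, y) ∈ R}
  · rw [indicator_of_mem hy]
    have hd0 : (insert 1 {0} \ {0} : Set ℕ) = {1} := by
      ext j
      simp only [Set.mem_sdiff, mem_insert_iff, mem_singleton_iff]
      omega
    have hd1 : (insert 1 {0} \ {1} : Set ℕ) = {0} := by
      ext j
      simp only [Set.mem_sdiff, mem_insert_iff, mem_singleton_iff]
      omega
    -- Deleting either added point leaves the model with one root, at `o` or at `y`.
    have e0 : sizeSum φ ν lam (.one X) N o = expect ν lam (insert 1 {0}) a
        (fun ω => truncSize φ N (del (Sum.inl '' {1}) ω) (Sum.inl 0)) := by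
      rw [expect_del ν lam _ _ a (fun ω => truncSize φ N ω (Sum.inl 0)), hd1, sizeSum_one_eq]
      exact expect_congr_loc ν lam (by rintro j rfl; simp [ha]) _
    have e1 : sizeSum φ ν lam (.one X) N y = expect ν lam (insert 1 {0}) a
        (fun ω => truncSize φ N (del (Sum.inl '' {0}) ω) (Sum.inl 1)) := by
      rw [expect_del ν lam _ _ a (fun ω => truncSize φ N ω (Sum.inl 1)), hd0,
        expect_root_label ν lam 1 a (measurable_truncSize φ N) (truncSize_act φ N),
        sizeSum_one_eq]
      simp [ha]
    have hme : Measurable fun ω : Conf X => truncSize φ N (del (Sum.inl '' {1}) ω) (Sum.inl 0) :=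
      (measurable_truncSize φ N _).comp (measurable_del _)
    rw [e0, e1, ← expect_add ν lam hme]
    refine expect_mono ν lam fun c x u => ?_
    simp only [hf]
    by_cases h : mkConf (insert 1 {0}) (pts c) a x u ∈ S (Sum.inl 1)
    · rw [indicator_of_mem h, image_singleton, image_singleton]
      exact truncSize_le_add_del φ N (by simp) h.1
    · rw [indicator_of_notMem h]
      exact bot_le
  · rw [indicator_of_notMem hy, nonpos_iff_eq_zero]
    refine (expect_congr ν lam fun c x u => ?_).trans (expect_const ν lam 0)
    simp only [hf]
    refine indicator_of_notMem (fun h => hy ?_) _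
    have := h.2
    rwa [l0, l1] at this

end Crowding

/-! ### Attaching a vertex to a cluster -/

section Insertion

variable {X : Type*} [MeasurableSpace X] [Nonempty X] (φ : SymKernel X)
  (ν : ℕ → FiniteMeasure X) (lam : ℝ≥0)

/-- The expected degree of a vertex at `x` at intensity `1`. -/
def degMass (x : X) : ℝ≥0∞ := ∫⁻ y, uval (φ.toFun x y) ∂(baseMeasure ν)

/-- The union bound 1 - (1 - t) s ≤ (1 - s) + t. After exponentiation, the cost of forbidding the
further neighbours of one more point is at most exp(-lam · degree). -/
theorem hitMass_insert_le {J : Finset ℕ} {e : ℕ} (he : e ∉ J) (a : ℕ → X) :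
    hitMass φ ν (insert e J) a ≤ hitMass φ ν J a + degMass φ ν (a e) := by
  unfold hitMass degMass
  have hm : Measurable fun y => 1 - missProb J (fun j => φ.toFun (a j)) y :=
    measurable_const.sub (measurable_missProb J fun j => measurable_kernel_right φ _)
  rw [← lintegral_add_left hm]
  refine lintegral_mono fun y => ?_
  have h : missProb (insert e J) (fun j => φ.toFun (a j)) y
      = (1 - uval (φ.toFun (a e) y)) * missProb J (fun j => φ.toFun (a j)) y := by
    rw [missProb, Finset.prod_insert he]
    rfl
  rw [h]
  set s := missProb J (fun j => φ.toFun (a j)) y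
  set t := uval (φ.toFun (a e) y)
  have hs : s ≤ 1 := missProb_le_one _ _ _
  have ht : t ≤ 1 := uval_le_one _
  rw [tsub_le_iff_right]
  calc (1 : ℝ≥0∞) = 1 - s + s := (tsub_add_cancel_of_le hs).symm
    _ = 1 - s + (t + (1 - t)) * s := by rw [add_tsub_cancel_of_le ht, one_mul]
    _ ≤ 1 - s + (t + (1 - t) * s) := by
        rw [add_mul]
        gcongr
        exact mul_le_of_le_one_right' hs
    _ = 1 - s + t + (1 - t) * s := by rw [add_assoc]

theorem hitMass_singleton (a : ℕ → X) :
    hitMass φ ν (Finset.Iic 0) a = degMass φ ν (a 0) := by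
  have : Finset.Iic 0 = {0} := by ext; simp
  unfold hitMass degMass missProb
  rw [this]
  simp only [Finset.prod_singleton]
  refine lintegral_congr fun y => ?_
  exact ENNReal.sub_sub_cancel ENNReal.one_ne_top (uval_le_one _)

/-- The probability that the cluster of a point is a singleton. -/
theorem sizeMean_zero (G : Statistic X) (x : X) : sizeMean φ ν lam G 0 x
    = G.toFun {Sum.inl 0} (fun _ => x) (Sum.inl 0) * expNeg (lam * degMass φ ν x) := by
  have hI : (Iic 0 : Set ℕ) = {0} := by ext; simp
  rw [sizeMean, peelMean_top, hitMass_singleton]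
  have : connSet φ 0 (fun _ => x) = univ := by
    refine eq_univ_of_forall fun u j hj => ?_
    obtain rfl : j = 0 := by omega
    exact .refl _
  rw [this, measure_univ, one_mul, hI, image_singleton]
  congr 1
  refine G.congr _ _ _ _ rfl ?_
  rintro _ rfl
  rfl

/-- The label `e` lies beyond the points 0, …, M, so its edge to the point 0 is independent of their
connectedness. -/
theorem dependsOn_connSet_off (M : ℕ) (a : ℕ → X) {e : ℕ} (he : M < e) :
    DependsOn (fun u => (connSet φ M a).indicator (fun _ => (1 : ℝ≥0∞)) u)
      ({s(Sum.inl e, Sum.inl 0)} : Set (Sym2 Node))ᶜ := by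
  intro u v huv
  have h : cgraph φ (mkConf (Iic M) ∅ a (fun _ => Classical.arbitrary X) u)
      = cgraph φ (mkConf (Iic M) ∅ a (fun _ => Classical.arbitrary X) v) := by
    ext p q
    rw [adj_mkConf_empty, adj_mkConf_empty]
    refine exists₂_congr fun i j => and_congr_right fun hi => and_congr_right fun hj => ?_
    rw [huv s(Sum.inl i, Sum.inl j)]
    intro h
    rw [mem_singleton_iff, Sym2.eq_iff] at h
    simp only [Sum.inl.injEq] at h
    omega
  have : u ∈ connSet φ M a ↔ v ∈ connSet φ M a := by
    simp only [connSet, mem_ofPred_eq, h]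
  by_cases hu : u ∈ connSet φ M a
  · simp [hu, this.1 hu]
  · simp [hu, mt this.2 hu]

theorem lintegral_conn_mark {M e : ℕ} (he : M < e) (a : ℕ → X) (t : unitInterval) :
    ∫⁻ u, (Iic t).indicator 1 (u s(Sum.inl e, Sum.inl 0))
        * (connSet φ M a).indicator (fun _ => (1 : ℝ≥0∞)) u ∂markLaw
      = uval t * markLaw (connSet φ M a) := by
  have hm : Measurable fun u : Sym2 Node → unitInterval =>
      (Iic t).indicator (1 : unitInterval → ℝ≥0∞) (u s(Sum.inl e, Sum.inl 0)) :=
    (measurable_one.indicator measurableSet_Iic).comp (measurable_pi_apply _)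
  refine (lintegral_infinitePi_mul _ {s(Sum.inl e, Sum.inl 0)} hm
    (measurable_const.indicator (measurableSet_connSet φ M a)) ?_
    (dependsOn_connSet_off φ M a he)).trans ?_
  · intro u v h
    simp only [h _ rfl]
  · congr 1
    · rw [lintegral_infinitePi_eval (fun _ => (volume : Measure unitInterval)) _
        (F := (Iic t).indicator 1) (measurable_one.indicator measurableSet_Iic),
        lintegral_indicator_one measurableSet_Iic, volume_Iic_unitInterval]
    · exact lintegral_indicator_one (measurableSet_connSet φ M a)

/-- The event that `e` is joined to `p` and to no vertex outside the cluster of `p` without `e`. -/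
def attachSet (e p : Node) : Set (Conf X) :=
  {ω | (cgraph φ ω).Adj e p ∧ ∀ q, (cgraph φ ω).Adj e q → q ∈ clus φ (del {e} ω) p}

theorem measurableSet_attachSet (e p : Node) : MeasurableSet (attachSet (X := X) φ e p) := by
  have : attachSet (X := X) φ e p = {ω | (cgraph φ ω).Adj e p} ∩
      ⋂ q, ({ω | (cgraph φ ω).Adj e q}ᶜ ∪ del {e} ⁻¹' {ω | q ∈ clus φ ω p}) := by
    ext ω
    simp [attachSet, imp_iff_not_or]
  rw [this]
  exact (measurableSet_adj φ e p).inter (MeasurableSet.iInter fun q =>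
    (measurableSet_adj φ e q).compl.union (measurable_del _ (measurableSet_mem_clus φ p q)))

theorem attachSet_act (σ : Equiv.Perm Node) {e : Node} (he : σ e = e) (p : Node) (ω : Conf X) :
    act σ ω ∈ attachSet φ e p ↔ ω ∈ attachSet φ e (σ p) := by
  have h1 : σ.symm ⁻¹' {e} = ({e} : Set Node) := by
    ext r
    rw [mem_preimage, mem_singleton_iff, mem_singleton_iff, Equiv.symm_apply_eq, he]
  simp only [attachSet, mem_ofPred_eq, adj_act, he, del_act, h1, clus_act, mem_preimage]
  refine and_congr_right fun _ => ⟨fun h q hq => ?_, fun h q hq => h _ hq⟩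
  have := h (σ.symm q) (by simpa using hq)
  simpa using this

/-- All edges at `e` lead into the cluster of `p`, so adding `e` merges no other cluster with it. -/
theorem clus_of_attach {ω : Conf X} {e p : Node} (h : ω ∈ attachSet φ e p) :
    clus φ ω e = insert e (clus φ (del {e} ω) p) := by
  refine Subset.antisymm (fun r hr => ?_) ?_
  · refine reachable_closed (G := cgraph φ ω) (p := e) (mem_insert _ _) ?_ hr
    rintro a b (rfl | ha) hab
    · exact Or.inr (h.2 b hab)
    · by_cases hb : b = e
      · exact Or.inl hb
      by_cases hae : a = e
      · subst hae
        exact Or.inr (h.2 b hab)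
      · exact Or.inr (SimpleGraph.Reachable.trans ha
          (SimpleGraph.Adj.reachable ((adj_del φ {e} ω a b).2 ⟨hab, hae, hb⟩)))
  · refine insert_subset (self_mem_clus φ _ _) ((clus_del_subset φ {e} ω p).trans ?_)
    rw [clus_eq_of_mem φ (show p ∈ clus φ ω e from h.1.reachable)]

theorem notMem_clus_del {ω : Conf X} {e p : Node} (h : e ≠ p) : e ∉ clus φ (del {e} ω) p :=
  fun h' => by
    have := mem_of_reachable φ h' h.symm
    simp [del] at this

/-- Lower bound for attaching a further vertex to a cluster. -/
theorem le_expect_attach (G : Statistic X) (M : ℕ) (a : ℕ → X) :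
    uval (φ.toFun (a (M + 1)) (a 0)) * expNeg (lam * degMass φ ν (a (M + 1)))
        * peelMean φ ν lam G M 0 a
      ≤ expect ν lam (Iic 0 ∪ {M + 1}) a
        ((peelSet (fun ω => clus φ (del (Sum.inl '' {M + 1}) ω) (Sum.inl 0)) M 0).indicator
          fun ω => (attachSet φ (Sum.inl (M + 1)) (Sum.inl 0)).indicator
            (fun ω => G.eval φ (del (Sum.inl '' {M + 1}) ω) (Sum.inl 0)) ω) := by
  set E : Set ℕ := {M + 1} with hE
  set e : Node := Sum.inl (M + 1) with he
  have hEe : (Sum.inl '' E : Set Node) = {e} := image_singleton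
  set K : Conf X → Set Node := fun ω => clus φ (del (Sum.inl '' E) ω) (Sum.inl 0) with hK
  set Ξ : Conf X → ℝ≥0∞ := fun ω => (attachSet φ e (Sum.inl 0)).indicator
    (fun ω => G.eval φ (del (Sum.inl '' E) ω) (Sum.inl 0)) ω with hΞ
  have hKm : ∀ p, MeasurableSet {ω | p ∈ K ω} := fun p =>
    measurable_del _ (measurableSet_mem_clus φ (Sum.inl 0) p)
  have hGm : Measurable fun ω : Conf X => G.eval φ (del (Sum.inl '' E) ω) (Sum.inl 0) :=
    (G.measurable_eval φ _).comp (measurable_del _)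
  have hΞm : Measurable Ξ := hGm.indicator (measurableSet_attachSet φ _ _)
  have hpre : ∀ σ : Equiv.Perm Node, (∀ j ∈ insert 0 E, σ (Sum.inl j) = Sum.inl j) →
      σ.symm ⁻¹' (Sum.inl '' E) = (Sum.inl '' E : Set Node) := by
    intro σ hσ
    rw [hEe]
    ext r
    rw [mem_preimage, mem_singleton_iff, mem_singleton_iff, Equiv.symm_apply_eq,
      hσ (M + 1) (by simp [hE])]
  have hstep : ∀ k < M, ∀ a, ((M - k : ℕ) : ℝ≥0∞)
      * expect ν lam (Iic k ∪ E) a ((peelSet K M k).indicator Ξ)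
      = lam * ∫⁻ y, expect ν lam (Iic (k + 1) ∪ E) (Function.update a (k + 1) y)
          ((peelSet K M (k + 1)).indicator Ξ) ∂(baseMeasure ν) := by
    intro k hk a
    refine peel_step ν lam hk (by simp [hE]) hKm hΞm ?_ ?_ ?_ a
    · intro σ hσ ω
      simp only [hK, del_act, hpre σ hσ, clus_act, hσ 0 (by simp)]
    · intro σ hσ ω
      have h1 := attachSet_act φ σ (e := e) (hσ (M + 1) (by simp [hE])) (Sum.inl 0) ω
      rw [hσ 0 (by simp)] at h1
      simp only [hΞ]
      by_cases h : ω ∈ attachSet φ e (Sum.inl 0)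
      · rw [indicator_of_mem h, indicator_of_mem (h1.2 h), del_act, hpre σ hσ, G.eval_act,
          hσ 0 (by simp)]
      · rw [indicator_of_notMem h, indicator_of_notMem (mt h1.1 h)]
    · intro ω h0
      refine (clus_subset φ ?_).trans subset_rfl
      refine ⟨h0, ?_⟩
      simp [hE]
  -- Both sides satisfy the peeling recursion, the left one after multiplication by `r`, which
  -- depends only on the positions of 0 and M + 1. It remains to compare them when the cluster is
  -- the set of points 0, …, M.
  refine peel_compare lam (A := fun k a => expect ν lam (Iic k ∪ E) a ((peelSet K M k).indicator Ξ))
    (B := peelMean φ ν lam G M)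
    (r := fun a => uval (φ.toFun (a (M + 1)) (a 0)) * expNeg (lam * degMass φ ν (a (M + 1))))
    (T := id) (MeasurePreserving.id (baseMeasure ν)) hstep
    (fun k hk a => peelMean_step φ ν lam G hk a)
    (fun k a => measurable_peelMean_update φ ν lam G M k k a) ?_ ?_ 0 (Nat.zero_le M) a
  · intro k hk a y
    rw [Function.update_of_ne (by omega), Function.update_of_ne (by omega)]
  · intro a
    rw [Function.id_comp, peelMean_top]
    set g0 := G.toFun (Sum.inl '' Iic M) (addedLoc a) (Sum.inl 0) with hg0
    have hIic : Iic M ∪ E = Iic (M + 1) := by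
      ext j
      simp only [hE, mem_union, mem_Iic, mem_singleton_iff]
      omega
    have hdiff : Iic (M + 1) \ E = Iic M := by
      ext j
      simp only [hE, Set.mem_sdiff, mem_Iic, mem_singleton_iff]
      omega
    have hFin : Finset.Iic (M + 1) = insert (M + 1) (Finset.Iic M) := by
      ext j
      simp only [Finset.mem_Iic, Finset.mem_insert]
      omega
    set t := φ.toFun (a (M + 1)) (a 0) with ht
    set g : (Sym2 Node → unitInterval) → ℝ≥0∞ := fun u =>
      (Iic t).indicator 1 (u s(e, Sum.inl 0))
        * (connSet φ M a).indicator (fun _ => (1 : ℝ≥0∞)) u with hg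
    have hgm : Measurable g :=
      ((measurable_one.indicator measurableSet_Iic).comp (measurable_pi_apply _)).mul
        (measurable_const.indicator (measurableSet_connSet φ M a))
    have hg1 : ∀ u, g u ≤ 1 := fun u =>
      mul_le_one' (indicator_le_self' (fun _ _ => zero_le_one) _)
        (indicator_le_self' (fun _ _ => zero_le_one) _)
    have hgd : DependsOn g addedPairs := by
      intro u v huv
      simp only [hg]
      rw [huv s(e, Sum.inl 0) ⟨M + 1, 0, rfl⟩]
      congr 1
      exact dependsOn_connSet φ M a huv
    have hvoid := lintegral_void ν lam (J := Finset.Iic (M + 1)) (ψ := fun j => φ.toFun (a j))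
      (fun j => measurable_kernel_right φ _) hgm hg1 hgd
    have hint : ∫⁻ u, g u ∂markLaw = uval t * markLaw (connSet φ M a) :=
      lintegral_conn_mark φ (Nat.lt_succ_self M) a t
    rw [hint] at hvoid
    -- The right side is the probability that 0, …, M are connected, that `e` is joined to 0, and
    -- that no Poisson point is joined to any of 0, …, M + 1. Only a lower bound for the original
    -- event is needed, so `e` may or may not be joined to the points 1, …, M.
    have hlow : uval t * expNeg (lam * degMass φ ν (a (M + 1)))
        * (g0 * (markLaw (connSet φ M a) * expNeg (lam * hitMass φ ν (Finset.Iic M) a)))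
        ≤ g0 * (uval t * markLaw (connSet φ M a)
          * expNeg (lam * hitMass φ ν (Finset.Iic (M + 1)) a)) := by
      have h1 : expNeg (lam * hitMass φ ν (Finset.Iic M) a)
          * expNeg (lam * degMass φ ν (a (M + 1)))
          ≤ expNeg (lam * hitMass φ ν (Finset.Iic (M + 1)) a) := by
        rw [← expNeg_add, ← mul_add, hFin]
        exact expNeg_anti (mul_le_mul' le_rfl (hitMass_insert_le φ ν (by simp) a))
      calc _ = g0 * (uval t * markLaw (connSet φ M a)
            * (expNeg (lam * hitMass φ ν (Finset.Iic M) a)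
              * expNeg (lam * degMass φ ν (a (M + 1))))) := by ring
        _ ≤ _ := by gcongr
    refine hlow.trans ?_
    rw [hIic]
    have hconst : ∀ (F : (ℕ → ℕ) → (ℕ × ℕ → X) → (Sym2 Node → unitInterval) → ℝ≥0∞) (r : ℝ≥0∞),
        r * ∫⁻ c, ∫⁻ x, ∫⁻ u, F c x u ∂markLaw ∂(posLaw ν) ∂(countLaw ν lam)
          ≤ ∫⁻ c, ∫⁻ x, ∫⁻ u, r * F c x u ∂markLaw ∂(posLaw ν) ∂(countLaw ν lam) := fun F r =>
      (lintegral_const_mul_le _ _).trans (lintegral_mono fun c =>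
        (lintegral_const_mul_le _ _).trans (lintegral_mono fun x => lintegral_const_mul_le _ _))
    rw [hitMass, ← hvoid]
    refine (hconst _ g0).trans ?_
    refine lintegral_mono fun c => lintegral_mono fun x => lintegral_mono fun u => ?_
    set ω := mkConf (Iic (M + 1)) (pts c) a x u with hω
    by_cases h1 : u ∈ voidSet (Finset.Iic (M + 1)) (fun j => φ.toFun (a j)) (pts c) x
    swap
    · rw [indicator_of_notMem h1, mul_zero]
      exact bot_le
    rw [indicator_of_mem h1]
    simp only [hg]
    by_cases h2 : u s(e, Sum.inl 0) ≤ t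
    swap
    · rw [indicator_of_notMem (s := Iic t) h2, zero_mul, mul_zero]
      exact bot_le
    by_cases h3 : u ∈ connSet φ M a
    swap
    · rw [indicator_of_notMem h3, mul_zero, mul_zero]
      exact bot_le
    rw [indicator_of_mem (s := Iic t) h2, indicator_of_mem h3, Pi.one_apply, mul_one, mul_one]
    have hdel : del (Sum.inl '' E) ω = mkConf (Iic M) (pts c) a x u := by
      rw [hω, del_mkConf_inl, hdiff]
    have hKω : K ω = Sum.inl '' Iic M := by
      simp only [hK, hdel]
      refine (clus_eq_iff φ M (pts c) a x u).2 ⟨h3, fun q hq j hj => h1 q hq j ?_⟩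
      rw [Finset.mem_Iic] at hj ⊢
      omega
    have hpeel : ω ∈ peelSet K M M := by
      rw [peelSet_top]
      exact hKω
    have hatt : ω ∈ attachSet φ e (Sum.inl 0) := by
      refine ⟨⟨by simp [he], ?_, Nat.zero_le _, ?_⟩, ?_⟩
      · exact le_refl (M + 1)
      · rw [hω, he, loc_mkConf_inl _ _ _ _ (mem_Iic.2 le_rfl),
          loc_mkConf_inl _ _ _ _ (mem_Iic.2 (Nat.zero_le _))]
        exact h2
      · rintro (j | q) ⟨hne, _, hmem, hadj⟩
        · have hj : j ≤ M + 1 := hmem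
          rw [← hEe]
          change _ ∈ K ω
          rw [hKω]
          refine ⟨j, ?_, rfl⟩
          have : M + 1 ≠ j := fun h => hne (by rw [he, h])
          rw [mem_Iic]
          omega
        · have hq : q ∈ pts c := hmem
          rw [hω, he, loc_mkConf_inl _ _ _ _ (mem_Iic.2 le_rfl), loc_mkConf_inr _ _ _ _ hq] at hadj
          exact absurd hadj (not_le.2 (h1 q hq (M + 1) (Finset.mem_Iic.2 le_rfl)))
    rw [indicator_of_mem hpeel]
    simp only [hΞ]
    rw [indicator_of_mem hatt, Statistic.eval]
    have : clus φ (del (Sum.inl '' E) ω) (Sum.inl 0) = Sum.inl '' Iic M := hKω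
    rw [this, hdel, eval_of_clus_eq G subset_rfl]

end Insertion

/-! ### Passing a half-space comparison from neighbours to the root -/

section Comparison

variable {X : Type*} [MeasurableSpace X] [Nonempty X] (φ : SymKernel X)
  (ν : ℕ → FiniteMeasure X) (lam : ℝ≥0)

theorem tsum_le_encard_of_le_one {κ : Type*} (F : κ → ℝ≥0∞) (hF : ∀ q, F q ≤ 1) (T : Set κ)
    (hT : ∀ q, F q ≠ 0 → q ∈ T) : ∑' q, F q ≤ (T.encard : ℝ≥0∞) := by
  rw [← ENNReal.tsum_set_one, tsum_subtype T (fun _ => (1 : ℝ≥0∞))]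
  refine ENNReal.tsum_le_tsum fun q => ?_
  by_cases hq : q ∈ T
  · rw [indicator_of_mem hq]
    exact hF q
  · rw [indicator_of_notMem hq, nonpos_iff_eq_zero]
    by_contra h
    exact hq (hT q h)

theorem Statistic.ofSet_le_one {Q : Set Node → (Node → X) → Node → Prop} {hm hc hp}
    (C : Set Node) (x : Node → X) (r : Node) : (Statistic.ofSet Q hm hc hp).toFun C x r ≤ 1 := by
  rw [Statistic.ofSet]
  simp only
  split_ifs <;> simp

theorem Statistic.ofSet_ne_zero {Q : Set Node → (Node → X) → Node → Prop} {hm hc hp}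
    {C : Set Node} {x : Node → X} {r : Node} :
    (Statistic.ofSet Q hm hc hp).toFun C x r ≠ 0 ↔ Q C x r := by
  rw [Statistic.ofSet]
  simp

theorem Statistic.ofSet_eq_one {Q : Set Node → (Node → X) → Node → Prop} {hm hc hp}
    {C : Set Node} {x : Node → X} {r : Node} (h : Q C x r) :
    (Statistic.ofSet Q hm hc hp).toFun C x r = 1 := by
  rw [Statistic.ofSet]
  simp [h]

/-- Attaching a vertex to the clusters of its potential neighbours in `B`. -/
theorem attach_le {R : Set (X × X)} (hR : MeasurableSet R) {A : Set X} (hA : MeasurableSet A)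
    {o : X} (ho : o ∈ A) {B : Set X} (hB : MeasurableSet B)
    (hBR : ∀ w ∈ B, ∀ w' ∈ B, (w, w') ∈ R) (K M : ℕ) :
    lam * (expNeg (lam * degMass φ ν o) * ∫⁻ w in B, uval (φ.toFun o w)
        * sizeMean φ ν lam ((Statistic.inside A hA).mul (.few R hR K)) M w ∂(baseMeasure ν))
      ≤ K * sizeMean φ ν lam (.inside A hA) (M + 1) o := by
  classical
  set G := (Statistic.inside A hA).mul (.few R hR K) with hG
  have hG1 : ∀ C x r, G.toFun C x r ≤ 1 := fun C x r =>
    mul_le_one' (Statistic.ofSet_le_one _ _ _) (Statistic.ofSet_le_one _ _ _)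
  -- The point at `o` carries the label M + 1; the labels 0, …, M remain for the cluster to which it
  -- is attached.
  set e : Node := Sum.inl (M + 1) with he
  have hEe : (Sum.inl '' {M + 1} : Set Node) = {e} := image_singleton
  set S : Node → Set (Conf X) := fun p => attachSet φ e p ∩ {ω | ω.2.1 p ∈ B}
    ∩ {ω | (clus φ (del {e} ω) p).encard = M + 1} with hS
  have hSm : ∀ p, MeasurableSet (S p) := fun p =>
    ((measurableSet_attachSet φ e p).inter (measurable_loc p hB)).inter
      (measurable_del {e} (measurableSet_encard_eq (measurableSet_mem_clus φ p) _))
  set f : Conf X → Node → ℝ≥0∞ := fun ω p =>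
    (S p).indicator (fun ω => G.eval φ (del {e} ω) p) ω with hf
  have hfm : ∀ p, Measurable fun ω => f ω p := fun p =>
    ((G.measurable_eval φ p).comp (measurable_del _)).indicator (hSm p)
  have hfinv : Equivariant {M + 1} f := by
    intro σ hσ ω p
    have h0 : σ e = e := hσ _ rfl
    have h1 : σ.symm ⁻¹' {e} = ({e} : Set Node) := by
      ext r
      rw [mem_preimage, mem_singleton_iff, mem_singleton_iff, Equiv.symm_apply_eq, h0]
    have h2 : act σ ω ∈ S p ↔ ω ∈ S (σ p) := by
      simp only [hS, mem_inter_iff, mem_ofPred_eq, attachSet_act φ σ h0, del_act, h1, clus_act,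
        encard_preimage_perm]
      simp only [act, Function.comp_apply]
    simp only [hf]
    by_cases h : ω ∈ S (σ p)
    · rw [indicator_of_mem h, indicator_of_mem (h2.2 h), del_act, h1, G.eval_act]
    · rw [indicator_of_notMem h, indicator_of_notMem (mt h2.1 h)]
  have hm := mecke ν lam (D := {M + 1}) (k := 0) (by simp) (fun _ => o) hfm hfinv
  set F : Conf X → Node → ℝ≥0∞ := fun ω p =>
    {ω | (clus φ ω p).encard = (M + 1 : ℕ) + 1}.indicator
      (fun ω => (Statistic.inside A hA).eval φ ω p) ω with hF
  have hFm : ∀ p, Measurable fun ω => F ω p := fun p =>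
    (Statistic.measurable_eval φ _ p).indicator
      (measurableSet_encard_eq (measurableSet_mem_clus φ p) _)
  have hFact : ∀ (σ : Equiv.Perm Node) ω p, F (act σ ω) p = F ω (σ p) := by
    intro σ ω p
    have : act σ ω ∈ {ω | (clus φ ω p).encard = (M + 1 : ℕ) + 1} ↔
        ω ∈ {ω | (clus φ ω (σ p)).encard = (M + 1 : ℕ) + 1} := by
      simp only [mem_ofPred_eq, clus_act, encard_preimage_perm]
    simp only [hF]
    by_cases h : ω ∈ {ω | (clus φ ω (σ p)).encard = (M + 1 : ℕ) + 1}
    · rw [indicator_of_mem h, indicator_of_mem (this.2 h), Statistic.eval_act]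
    · rw [indicator_of_notMem h, indicator_of_notMem (mt this.1 h)]
  have hroot : sizeMean φ ν lam (.inside A hA) (M + 1) o
      = expect ν lam {M + 1} (fun _ => o) (fun ω => F ω e) := by
    rw [sizeMean_eq, expect_root_label ν lam (M + 1) _ hFm hFact]
  rw [hroot, ← expect_const_mul ν lam (hFm e)]
  -- If `f` is nonzero at some Poisson point, then the cluster of `o` is that point's cluster with
  -- `o` added: it has M + 2 vertices and lies in `A`. It remains to bound the number of points at
  -- which this can happen.
  have hupper : expect ν lam {M + 1} (fun _ => o) (fun ω => ∑' q : ℕ × ℕ,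
        ({ω : Conf X | Sum.inr q ∈ ω.1}).indicator (fun ω => f ω (Sum.inr q)) ω)
      ≤ expect ν lam {M + 1} (fun _ => o) (fun ω => K * F ω e) := by
    refine expect_mono ν lam fun c x u => ?_
    set ω := mkConf {M + 1} (pts c) (fun _ => o) x u with hω
    by_cases hex : ∃ q : ℕ × ℕ, f ω (Sum.inr q) ≠ 0
    · obtain ⟨q₀, hq₀⟩ := hex
      have key : ∀ q : ℕ × ℕ, f ω (Sum.inr q) ≠ 0 →
          ω ∈ S (Sum.inr q) ∧ G.eval φ (del {e} ω) (Sum.inr q) ≠ 0 := by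
        intro q hq
        by_cases h : ω ∈ S (Sum.inr q)
        · refine ⟨h, ?_⟩
          simpa only [hf, indicator_of_mem h] using hq
        · simp only [hf, indicator_of_notMem h] at hq
          exact absurd rfl hq
      obtain ⟨hS₀, hG₀⟩ := key q₀ hq₀
      have hne : e ≠ Sum.inr q₀ := by simp [he]
      have hloc : ∀ q : ℕ × ℕ, (del {e} ω).2.1 (Sum.inr q) = ω.2.1 (Sum.inr q) := by
        intro q
        simp [del, he]
      have hclus := clus_of_attach φ hS₀.1.1
      have hnot := notMem_clus_del φ (ω := ω) hne
      obtain ⟨hin, hfew⟩ := mul_ne_zero_iff.1 hG₀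
      have hin' := Statistic.ofSet_ne_zero.1 hin
      have hfew' := Statistic.ofSet_ne_zero.1 hfew
      have hFe : F ω e = 1 := by
        simp only [hF]
        rw [indicator_of_mem]
        · refine Statistic.ofSet_eq_one ?_
          rw [hclus]
          rintro p (rfl | hp)
          · rw [he, hω, loc_mkConf_inl _ _ _ _ (mem_singleton _)]
            exact ho
          · have hpe : p ≠ e := fun h => hnot (h ▸ hp)
            have := hin' p hp
            simpa [del, hpe] using this
        · have h1 : (clus φ (del {e} ω) (Sum.inr q₀)).encard = M + 1 := hS₀.2
          rw [mem_ofPred_eq, hclus, encard_insert_of_notMem hnot, h1]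
          push_cast
          rfl
      rw [hFe, mul_one]
      set C₀ := clus φ (del {e} ω) (Sum.inr q₀) with hC₀
      set T := relatedTo R C₀ (del {e} ω).2.1 (Sum.inr q₀) with hT
      -- Every such point is a neighbour of `o`, hence in the cluster of `q₀`, and it lies in `B`,
      -- hence is related to `q₀`. There are fewer than `K` such points besides `q₀`, so at most `K`
      -- in all.
      have hTK : ((insert (Sum.inr q₀) T : Set Node).encard : ℝ≥0∞) ≤ K := by
        have h1 : (T.encard : ℝ≥0∞) < K := hfew'
        have h2 : T.encard < K := by exact_mod_cast h1
        have h3 : (insert (Sum.inr q₀) T).encard ≤ K :=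
          (encard_insert_le _ _).trans (Order.add_one_le_of_lt h2)
        exact_mod_cast h3
      have hpre : ((Sum.inr ⁻¹' (insert (Sum.inr q₀) T) : Set (ℕ × ℕ)).encard : ℝ≥0∞)
          ≤ ((insert (Sum.inr q₀) T : Set Node).encard : ℝ≥0∞) := by
        have := (Sum.inr_injective (α := ℕ)).encard_image (Sum.inr ⁻¹' (insert (Sum.inr q₀) T) : Set (ℕ × ℕ))
        have h2 := encard_le_encard (image_preimage_subset Sum.inr
          (insert (Sum.inr q₀) T : Set Node))
        rw [this] at h2
        exact_mod_cast h2
      refine le_trans (tsum_le_encard_of_le_one _ (fun q => ?_) _ (fun q hq => ?_))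
        (hpre.trans hTK)
      · refine indicator_le_self' (fun _ _ => bot_le) _ |>.trans ?_
        refine (indicator_le_self' (fun _ _ => bot_le) _).trans (hG1 _ _ _)
      · have hq' : f ω (Sum.inr q) ≠ 0 := by
          intro h0
          refine hq ?_
          by_cases h : ω ∈ {ω : Conf X | Sum.inr q ∈ ω.1}
          · rw [indicator_of_mem h, h0]
          · rw [indicator_of_notMem h]
        obtain ⟨hSq, -⟩ := key q hq'
        rw [mem_preimage, mem_insert_iff]
        by_cases hqq : q = q₀
        · exact Or.inl (by rw [hqq])
        · refine Or.inr ⟨hS₀.1.1.2 _ hSq.1.1.1, fun h => hqq (Sum.inr_injective h), ?_⟩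
          rw [hloc, hloc]
          exact hBR _ hS₀.1.2 _ hSq.1.2
    · push Not at hex
      refine le_trans (b := 0) (le_of_eq ?_) bot_le
      rw [ENNReal.tsum_eq_zero]
      intro q
      by_cases h : ω ∈ {ω : Conf X | Sum.inr q ∈ ω.1}
      · rw [indicator_of_mem h, hex]
      · rw [indicator_of_notMem h]
  refine le_trans ?_ hupper
  rw [hm]
  refine mul_le_mul' le_rfl ?_
  have hint : Measurable fun w => uval (φ.toFun o w) * sizeMean φ ν lam G M w :=
    (measurable_uval.comp (measurable_kernel_right φ o)).mul (measurable_sizeMean φ ν lam G M)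
  rw [← lintegral_const_mul _ hint, ← lintegral_indicator hB]
  refine lintegral_mono fun y => ?_
  by_cases hy : y ∈ B
  swap
  · rw [indicator_of_notMem hy]
    exact bot_le
  rw [indicator_of_mem hy]
  set a : ℕ → X := Function.update (fun _ => o) 0 y with ha
  have h0 : a 0 = y := by simp [ha]
  have h1 : a (M + 1) = o := by simp [ha]
  have hlow := le_expect_attach φ ν lam G M a
  rw [h0, h1, hEe] at hlow
  have hsm : peelMean φ ν lam G M 0 a = sizeMean φ ν lam G M y :=
    peelMean_congr φ ν lam G fun j hj => by
      obtain rfl : j = 0 := by omega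
      exact h0
  rw [hsm] at hlow
  have hset : insert 0 {M + 1} = Iic 0 ∪ {M + 1} := by
    ext j
    simp only [mem_insert_iff, mem_singleton_iff, mem_union, mem_Iic]
    omega
  rw [hset]
  calc _ = uval (φ.toFun o y) * expNeg (lam * degMass φ ν o) * sizeMean φ ν lam G M y := by ring
    _ ≤ _ := hlow
    _ = _ := by
      refine expect_congr ν lam fun c x u => ?_
      set ω := mkConf (Iic 0 ∪ {M + 1}) (pts c) a x u with hω
      have hl : ω.2.1 (Sum.inl 0) = y := by
        rw [hω, loc_mkConf_inl _ _ _ _ (Or.inl (mem_Iic.2 le_rfl)), h0]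
      have hself : ∀ j ≤ 0, Sum.inl j ∈ clus φ (del {e} ω) (Sum.inl 0) := by
        intro j hj
        obtain rfl : j = 0 := by omega
        exact self_mem_clus φ _ _
      simp only [hf]
      by_cases hc : (clus φ (del {e} ω) (Sum.inl 0)).encard = M + 1
      · rw [indicator_of_mem (s := peelSet (fun ω => clus φ (del {e} ω) (Sum.inl 0)) M 0)
          ⟨hc, hself⟩]
        by_cases hatt : ω ∈ attachSet φ e (Sum.inl 0)
        · rw [indicator_of_mem hatt, indicator_of_mem]
          exact ⟨⟨hatt, by rw [mem_ofPred_eq, hl]; exact hy⟩, hc⟩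
        · rw [indicator_of_notMem hatt, indicator_of_notMem]
          exact fun h => hatt h.1.1
      · rw [indicator_of_notMem (s := peelSet (fun ω => clus φ (del {e} ω) (Sum.inl 0)) M 0)
          fun h => hc h.1, indicator_of_notMem]
        exact fun h => hc h.2

theorem sizeMean_one_le_one (M : ℕ) (x : X) : sizeMean φ ν lam (.one X) M x ≤ 1 := by
  rw [sizeMean_eq]
  refine (expect_mono ν lam fun c y u => ?_).trans (expect_const ν lam 1).le
  exact indicator_le_self' (fun _ _ => bot_le) _

theorem sizeSum_one_ne_top (N : ℕ) (x : X) : sizeSum φ ν lam (.one X) N x ≠ ∞ := by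
  refine ENNReal.sum_ne_top.2 fun M _ => ENNReal.mul_ne_top ?_
    (ne_top_of_le_ne_top ENNReal.one_ne_top (sizeMean_one_le_one φ ν lam M x))
  exact ENNReal.add_ne_top.2 ⟨ENNReal.natCast_ne_top M, ENNReal.one_ne_top⟩

theorem sizeSum_le_add {G G₁ G₂ : Statistic X}
    (h : ∀ C x r, G.toFun C x r ≤ G₁.toFun C x r + G₂.toFun C x r) (N : ℕ) (x : X) :
    sizeSum φ ν lam G N x ≤ sizeSum φ ν lam G₁ N x + sizeSum φ ν lam G₂ N x := by
  rw [sizeSum, sizeSum, sizeSum, ← Finset.sum_add_distrib]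
  refine Finset.sum_le_sum fun M _ => ?_
  rw [← mul_add]
  exact mul_le_mul' le_rfl (sizeMean_le_add φ ν lam h M x)

/-- A comparison at the points of `B` is passed on to `o`. -/
theorem sizeSum_compare {R : Set (X × X)} (hR : MeasurableSet R) {A : Set X}
    (hA : MeasurableSet A) {o : X} (ho : o ∈ A) {B : Set X} (hB : MeasurableSet B)
    (hBR : ∀ w ∈ B, ∀ w' ∈ B, (w, w') ∈ R) (K N : ℕ) {c c' : ℝ≥0∞} (hc : c ≠ ∞)
    (hhom : ∀ y, sizeSum φ ν lam (.one X) N y = sizeSum φ ν lam (.one X) N o)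
    (hcmp : ∀ w ∈ B, (c + c) * sizeSum φ ν lam (.one X) N o
      ≤ sizeSum φ ν lam (.inside A hA) N w)
    (hcrowd : ∀ w ∈ B, sizeSum φ ν lam (.crowd R hR K) N w ≤ c * sizeSum φ ν lam (.one X) N o)
    (h1 : c' ≤ K)
    (h2 : c' * degMass φ ν o ≤ c * ∫⁻ w in B, uval (φ.toFun o w) ∂(baseMeasure ν)) :
    c' * expNeg (lam * degMass φ ν o) * sizeSum φ ν lam (.one X) (N + 1) o
      ≤ K * sizeSum φ ν lam (.inside A hA) (N + 1) o := by
  set S := sizeSum φ ν lam (.one X) N o with hS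
  set ε := expNeg (lam * degMass φ ν o) with hε
  set G := (Statistic.inside A hA).mul (.few R hR K) with hG
  set β := ∫⁻ w in B, uval (φ.toFun o w) ∂(baseMeasure ν) with hβ
  have hSt : c * S ≠ ∞ := ENNReal.mul_ne_top hc (sizeSum_one_ne_top φ ν lam N o)
  -- The hypothesis provides `c + c`; one half is given up for the crowded roots.
  have hfew : ∀ w ∈ B, c * S ≤ sizeSum φ ν lam G N w := by
    intro w hw
    have h3 : sizeSum φ ν lam (.inside A hA) N w
        ≤ sizeSum φ ν lam G N w + sizeSum φ ν lam (.crowd R hR K) N w := by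
      refine sizeSum_le_add φ ν lam (fun C x r => ?_) N w
      by_cases hi : (Statistic.inside A hA).toFun C x r = 0
      · rw [hi]
        exact bot_le
      rcases lt_or_ge ((relatedTo R C x r).encard : ℝ≥0∞) K with h | h
      · refine le_add_right ?_
        change _ ≤ _ * (Statistic.few R hR K).toFun C x r
        rw [show (Statistic.few R hR K).toFun C x r = 1 from Statistic.ofSet_eq_one h, mul_one]
      · refine le_add_left ?_
        rw [show (Statistic.crowd R hR K).toFun C x r = 1 from Statistic.ofSet_eq_one h]
        exact Statistic.ofSet_le_one _ _ _
    have h4 := ((hcmp w hw).trans h3).trans (add_le_add le_rfl (hcrowd w hw))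
    rw [add_mul] at h4
    exact (ENNReal.add_le_add_iff_right hSt).1 h4
  have hatt : lam * (ε * (β * (c * S)))
      ≤ K * ∑ M ∈ Finset.range N, ((M : ℝ≥0∞) + 1) * sizeMean φ ν lam (.inside A hA) (M + 1) o := by
    have hm1 : Measurable fun w => uval (φ.toFun o w) :=
      measurable_uval.comp (measurable_kernel_right φ o)
    have hm : ∀ M, Measurable fun w => uval (φ.toFun o w) * sizeMean φ ν lam G M w := fun M =>
      hm1.mul (measurable_sizeMean φ ν lam G M)
    calc lam * (ε * (β * (c * S)))
        ≤ lam * (ε * ∫⁻ w in B, uval (φ.toFun o w) * sizeSum φ ν lam G N w ∂(baseMeasure ν)) := by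
          gcongr
          rw [hβ, ← lintegral_mul_const _ hm1]
          refine setLIntegral_mono_ae' hB (ae_of_all _ fun w hw => ?_)
          exact mul_le_mul' le_rfl (hfew w hw)
      _ = ∑ M ∈ Finset.range N, ((M : ℝ≥0∞) + 1) * (lam * (ε * ∫⁻ w in B, uval (φ.toFun o w)
            * sizeMean φ ν lam G M w ∂(baseMeasure ν))) := by
          have : ∀ w, uval (φ.toFun o w) * sizeSum φ ν lam G N w
              = ∑ M ∈ Finset.range N, ((M : ℝ≥0∞) + 1)
                * (uval (φ.toFun o w) * sizeMean φ ν lam G M w) := by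
            intro w
            rw [sizeSum, Finset.mul_sum]
            exact Finset.sum_congr rfl fun M _ => by ring
          simp only [this]
          rw [lintegral_finsetSum _ fun M _ => (hm M).const_mul _, Finset.mul_sum,
            Finset.mul_sum]
          refine Finset.sum_congr rfl fun M _ => ?_
          rw [lintegral_const_mul _ (hm M)]
          ring
      _ ≤ ∑ M ∈ Finset.range N, ((M : ℝ≥0∞) + 1)
            * (K * sizeMean φ ν lam (.inside A hA) (M + 1) o) :=
          Finset.sum_le_sum fun M _ =>
            mul_le_mul' le_rfl (attach_le φ ν lam hR hA ho hB hBR K M)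
      _ = _ := by
          rw [Finset.mul_sum]
          exact Finset.sum_congr rfl fun M _ => by ring
  have hzero : sizeMean φ ν lam (.inside A hA) 0 o = ε := by
    rw [sizeMean_zero, show (Statistic.inside A hA).toFun {Sum.inl 0} (fun _ => o) (Sum.inl 0) = 1
      from Statistic.ofSet_eq_one fun p _ => ho, one_mul]
  -- The singleton cluster contributes `ε`. A cluster with M + 2 vertices is counted here with the
  -- smaller weight M + 1.
  have hW : ε + ∑ M ∈ Finset.range N, ((M : ℝ≥0∞) + 1)
      * sizeMean φ ν lam (.inside A hA) (M + 1) o ≤ sizeSum φ ν lam (.inside A hA) (N + 1) o := by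
    rw [sizeSum, Finset.sum_range_succ', hzero, add_comm]
    refine add_le_add (Finset.sum_le_sum fun M _ => mul_le_mul' ?_ le_rfl) (by simp)
    push_cast
    exact le_self_add
  have hS1 := sizeSum_succ_le φ ν lam N o
  simp only [hhom] at hS1
  have hm1 : Measurable fun y => uval (φ.toFun o y) :=
    measurable_uval.comp (measurable_kernel_right φ o)
  rw [lintegral_mul_const _ hm1] at hS1
  -- The recursive bound has the two terms 1 and lam Φ S. The first is matched with the singleton
  -- cluster through `c' ≤ K`, the second with the attached clusters through `h2`.
  calc c' * ε * sizeSum φ ν lam (.one X) (N + 1) o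
      ≤ c' * ε * (1 + lam * (degMass φ ν o * S)) := mul_le_mul' le_rfl hS1
    _ = c' * ε + lam * (ε * ((c' * degMass φ ν o) * S)) := by ring
    _ ≤ K * ε + lam * (ε * ((c * β) * S)) := by gcongr
    _ = K * ε + lam * (ε * (β * (c * S))) := by ring
    _ ≤ K * ε + K * ∑ M ∈ Finset.range N, ((M : ℝ≥0∞) + 1)
          * sizeMean φ ν lam (.inside A hA) (M + 1) o := by gcongr
    _ ≤ _ := by
      rw [← mul_add]
      gcongr

/-- A pointwise bound for the number of vertices of a finite cluster becomes a bound for the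
probability of its size. -/
theorem sizeMean_one_le_of_pointwise {G G' : Statistic X} {o : X} {T : X → X ≃ᵐ X} {inv : X → X}
    (hT : ∀ y, IsAut φ (baseMeasure ν) (T y)) (hTy : ∀ y, T y y = o) (hTo : ∀ y, T y o = inv y)
    (hinv : MeasurePreserving inv (baseMeasure ν) (baseMeasure ν))
    (hG : ∀ y C x r, G.toFun C (T y ∘ x) r = G.toFun C x r)
    (hG' : ∀ y C x r, G'.toFun C (T y ∘ x) r = G'.toFun C x r) {L : ℝ≥0∞}
    (hpt : ∀ (C : Set Node) (x : Node → X), C.Finite → (C.encard : ℝ≥0∞)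
      ≤ L * ∑' p, C.indicator (fun p => G.toFun C x p) p
        + ∑' p, C.indicator (fun p => G'.toFun C x p) p) (M : ℕ) :
    sizeMean φ ν lam (.one X) M o
      ≤ L * sizeMean φ ν lam G M o + sizeMean φ ν lam G' M o := by
  have hpos : ((M : ℝ≥0∞) + 1) ≠ 0 := by simp
  have htop : ((M : ℝ≥0∞) + 1) ≠ ∞ :=
    ENNReal.add_ne_top.2 ⟨ENNReal.natCast_ne_top M, ENNReal.one_ne_top⟩
  -- Multiplied by M + 1, the two terms on the right become, by mass transport, expectations of sums
  -- over the cluster, to which the pointwise bound applies.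
  rw [← ENNReal.mul_le_mul_iff_right hpos htop, mul_add, mul_left_comm _ L,
    ← expect_sum_cluster φ ν lam G hT hTy hTo hinv hG M,
    ← expect_sum_cluster φ ν lam G' hT hTy hTo hinv hG' M]
  have hmE : MeasurableSet {ω : Conf X | (rootClus φ ω).encard = M + 1} :=
    measurableSet_encard_eq (measurableSet_mem_clus φ _) _
  have hm : ∀ G : Statistic X, Measurable ({ω : Conf X | (rootClus φ ω).encard = M + 1}.indicator
      fun ω => ∑' p, {ω | p ∈ rootClus φ ω}.indicator (fun ω => G.eval φ ω p) ω) := fun G =>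
    (Measurable.tsum fun p => (G.measurable_eval φ p).indicator
      (measurableSet_mem_clus φ _ p)).indicator hmE
  rw [← expect_const_mul ν lam (hm G), ← expect_add ν lam ((hm G).const_mul L), sizeMean_eq,
    ← expect_const_mul ν lam ((Statistic.measurable_eval φ _ _).indicator hmE)]
  refine expect_mono ν lam fun c x u => ?_
  set ω := mkConf {0} (pts c) (fun _ => o) x u
  by_cases h : ω ∈ {ω | (rootClus φ ω).encard = M + 1}
  · simp only [indicator_of_mem h]
    have hcard : (rootClus φ ω).encard = M + 1 := h
    have hfin : (rootClus φ ω).Finite := by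
      refine Set.encard_ne_top_iff.1 ?_
      rw [hcard]
      exact_mod_cast ENat.natCast_ne_top (M + 1)
    have := hpt (rootClus φ ω) ω.2.1 hfin
    rw [hcard] at this
    have hrew : ∀ (G : Statistic X) p, {ω | p ∈ rootClus φ ω}.indicator
        (fun ω => G.eval φ ω p) ω
        = (rootClus φ ω).indicator (fun p => G.toFun (rootClus φ ω) ω.2.1 p) p := by
      intro G p
      by_cases hp : p ∈ rootClus φ ω
      · rw [indicator_of_mem hp, indicator_of_mem (s := {ω | p ∈ rootClus φ ω}) hp,
          Statistic.eval, clus_eq_of_mem φ hp]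
      · rw [indicator_of_notMem hp, indicator_of_notMem (s := {ω | p ∈ rootClus φ ω}) hp]
    simp only [hrew]
    have h1 : (Statistic.one X).eval φ ω (Sum.inl 0) = 1 := rfl
    rw [h1, mul_one]
    refine le_trans (le_of_eq ?_) this
    simp
  · simp only [indicator_of_notMem h, mul_zero]
    exact bot_le

end Comparison

/-! ### Clusters which fail to leave a set -/

section Escape

variable {X : Type*} [MeasurableSpace X] [Nonempty X] (φ : SymKernel X)
  (ν : ℕ → FiniteMeasure X) (lam : ℝ≥0)

/-- The event that `p` has no neighbour related to it, apart from the added point `0`. -/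
def isolatedSet (R : Set (X × X)) (p : Node) : Set (Conf X) :=
  {ω | ∀ q, q ≠ Sum.inl 0 → (cgraph φ ω).Adj p q → (ω.2.1 p, ω.2.1 q) ∉ R}

theorem measurableSet_isolatedSet {R : Set (X × X)} (hR : MeasurableSet R) (p : Node) :
    MeasurableSet (isolatedSet φ R p) := by
  have : isolatedSet φ R p = ⋂ q ∈ ({Sum.inl 0}ᶜ : Set Node), ({ω | (cgraph φ ω).Adj p q}ᶜ ∪
      {ω | (ω.2.1 p, ω.2.1 q) ∈ R}ᶜ) := by
    ext ω
    simp [isolatedSet, imp_iff_not_or]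
  rw [this]
  exact MeasurableSet.biInter (Set.to_countable _) fun q _ =>
    (measurableSet_adj φ p q).compl.union
      (((measurable_loc p).prodMk (measurable_loc q)) hR).compl

/-- An edge requires a mark at most the connection probability, so a pair of connection probability
0 is joined when its mark is 0. This null event has to be excluded. -/
theorem ae_markLaw_pos : ∀ᵐ u ∂markLaw, ∀ e, 0 < u e := by
  rw [ae_all_iff]
  intro e
  have h := lintegral_infinitePi_eval (fun _ : Sym2 Node => (volume : Measure unitInterval)) e
    (F := (Iic 0).indicator 1) (measurable_one.indicator measurableSet_Iic)
  rw [lintegral_indicator_one measurableSet_Iic, volume_Iic_unitInterval] at h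
  have h0 : uval 0 = 0 := by simp [uval]
  have hm : Measurable fun u : Sym2 Node → unitInterval =>
      (Iic 0).indicator (1 : unitInterval → ℝ≥0∞) (u e) :=
    (measurable_one.indicator measurableSet_Iic).comp (measurable_pi_apply _)
  rw [h0, lintegral_eq_zero_iff hm] at h
  filter_upwards [h] with u hu
  by_contra hcon
  rw [indicator_of_mem (s := Iic 0) (not_lt.1 hcon)] at hu
  simp at hu

/-- A void probability for the connection function cut off outside `R`. The exemption of the added
point 0 leaves only Poisson points to be avoided, also when the vertex comes from the Mecke formula
beside the root. -/
theorem expect_isolated_le {R : Set (X × X)} (hR : MeasurableSet R) {D : Set ℕ} {k : ℕ}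
    (hk : k ∈ D) (a : ℕ → X) :
    expect ν lam D a ((isolatedSet φ R (Sum.inl k)).indicator 1)
      ≤ expNeg (lam * ∫⁻ y in {y | (a k, y) ∈ R}, uval (φ.toFun (a k) y) ∂(baseMeasure ν)) := by
  classical
  have hRm : MeasurableSet {y | (a k, y) ∈ R} := measurable_prodMk_left hR
  set ψ : ℕ → X → unitInterval := fun _ y => if (a k, y) ∈ R then φ.toFun (a k) y else 0 with hψ
  have hψm : ∀ j, Measurable (ψ j) := fun j =>
    Measurable.ite hRm (measurable_kernel_right φ _) measurable_const
  have hv := lintegral_void ν lam (J := {k}) hψm (g := fun _ => 1) measurable_const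
    (fun _ => le_rfl) (fun _ _ _ => rfl)
  have hmass : ∫⁻ y, (1 - missProb {k} ψ y) ∂(baseMeasure ν)
      = ∫⁻ y in {y | (a k, y) ∈ R}, uval (φ.toFun (a k) y) ∂(baseMeasure ν) := by
    rw [← lintegral_indicator hRm]
    refine lintegral_congr fun y => ?_
    rw [missProb, Finset.prod_singleton, ENNReal.sub_sub_cancel ENNReal.one_ne_top (uval_le_one _)]
    by_cases hy : (a k, y) ∈ R
    · rw [indicator_of_mem (s := {y | (a k, y) ∈ R}) hy]
      simp only [hψ, if_pos hy]
    · rw [indicator_of_notMem (s := {y | (a k, y) ∈ R}) hy]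
      simp only [hψ, if_neg hy]
      simp [uval]
  rw [lintegral_const, measure_univ, one_mul, one_mul, hmass] at hv
  rw [← hv]
  refine lintegral_mono fun c => lintegral_mono fun x => lintegral_mono_ae ?_
  filter_upwards [ae_markLaw_pos] with u hu
  by_cases h : mkConf D (pts c) a x u ∈ isolatedSet φ R (Sum.inl k)
  · rw [indicator_of_mem h, indicator_of_mem]
    · rfl
    · intro q hq j hj
      obtain rfl : j = k := by simpa using hj
      simp only [hψ]
      split_ifs with hxR
      · by_contra hcon
        refine h (Sum.inr q) (by simp) ⟨by simp, hk, hq, ?_⟩ ?_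
        · rw [loc_mkConf_inl _ _ _ _ hk, loc_mkConf_inr _ _ _ _ hq]
          exact not_lt.1 hcon
        · rwa [loc_mkConf_inl _ _ _ _ hk, loc_mkConf_inr _ _ _ _ hq]
      · exact hu _
  · rw [indicator_of_notMem h]
    exact bot_le

/-- A cluster which stays in `A` contains a point at which one of the steps of an escape from `A`
fails. -/
theorem sum_sizeMean_inside_le {R : Set (X × X)} (hR : MeasurableSet R) {A : Set X}
    (hA : MeasurableSet A) {o : X} {U : ℕ → Set X} (hU : ∀ i, MeasurableSet (U i)) (n : ℕ)
    (ho : o ∈ U 0) (hn : U n ∩ A = ∅)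
    (hstep : ∀ i, ∀ w ∈ U i ∩ A, ∀ y, (w, y) ∈ R → y ∈ U (i + 1)) {t : ℝ≥0∞} (hoA : o ∈ A)
    (ht : ∀ w ∈ A, t ≤ ∫⁻ y in {y | (w, y) ∈ R}, uval (φ.toFun w y) ∂(baseMeasure ν)) (N : ℕ) :
    ∑ M ∈ Finset.range N, sizeMean φ ν lam (.inside A hA) M o
      ≤ (1 + lam * ∑ i ∈ Finset.range n, baseMeasure ν (U i ∩ A)) * expNeg (lam * t) := by
  classical
  set f : ℕ → Conf X → Node → ℝ≥0∞ := fun i ω p =>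
    ({ω | ω.2.1 p ∈ U i ∩ A} ∩ isolatedSet φ R p).indicator 1 ω with hf
  have hfm : ∀ i p, Measurable fun ω => f i ω p := fun i p =>
    measurable_one.indicator ((measurable_loc p ((hU i).inter hA)).inter
      (measurableSet_isolatedSet φ hR p))
  have hmE : ∀ M : ℕ, MeasurableSet {ω : Conf X | (rootClus φ ω).encard = M + 1} := fun M =>
    measurableSet_encard_eq (measurableSet_mem_clus φ _) _
  simp only [sizeMean_eq]
  rw [← expect_finset_sum ν lam _ fun M => (Statistic.measurable_eval φ _ _).indicator (hmE M)]
  have hfinv : ∀ i, Equivariant {0} (f i) := by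
    intro i σ hσ ω p
    have h0 : σ (Sum.inl 0) = Sum.inl 0 := hσ 0 rfl
    have : act σ ω ∈ {ω | ω.2.1 p ∈ U i ∩ A} ∩ isolatedSet φ R p ↔
        ω ∈ {ω | ω.2.1 (σ p) ∈ U i ∩ A} ∩ isolatedSet φ R (σ p) := by
      refine and_congr Iff.rfl ⟨fun h q hq hadj => ?_, fun h q hq hadj => ?_⟩
      · have := h (σ.symm q) (fun h' => hq (by rw [← h0, ← h', σ.apply_symm_apply]))
          ((adj_act φ σ ω _ _).2 (by rwa [σ.apply_symm_apply]))
        simpa [act] using this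
      · exact h (σ q) (fun h' => hq (σ.injective (h'.trans h0.symm)))
          ((adj_act φ σ ω _ _).1 hadj)
    simp only [hf]
    by_cases h : ω ∈ {ω | ω.2.1 (σ p) ∈ U i ∩ A} ∩ isolatedSet φ R (σ p)
    · rw [indicator_of_mem h, indicator_of_mem (this.2 h)]
      rfl
    · rw [indicator_of_notMem h, indicator_of_notMem (mt this.1 h)]
  set g : ℕ → Conf X → ℝ≥0∞ := fun i ω => ∑' q : ℕ × ℕ,
    ({ω : Conf X | Sum.inr q ∈ ω.1}).indicator (fun ω => f i ω (Sum.inr q)) ω with hg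
  have hgm : ∀ i, Measurable (g i) := fun i =>
    Measurable.tsum fun q => (hfm i _).indicator (measurableSet_vertex _)
  have h0m : Measurable ((isolatedSet φ R (Sum.inl 0)).indicator (1 : Conf X → ℝ≥0∞)) :=
    measurable_one.indicator (measurableSet_isolatedSet φ hR _)
  calc _ ≤ expect ν lam {0} (fun _ => o) (fun ω =>
        (isolatedSet φ R (Sum.inl 0)).indicator 1 ω + ∑ i ∈ Finset.range n, g i ω) := by
        refine expect_mono ν lam fun c x u => ?_
        set ω := mkConf {0} (pts c) (fun _ => o) x u with hω
        by_cases hin : (Statistic.inside A hA).eval φ ω (Sum.inl 0) = 0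
        · refine le_trans (b := 0) (le_of_eq (Finset.sum_eq_zero fun M _ => ?_)) bot_le
          by_cases h : ω ∈ {ω | (rootClus φ ω).encard = M + 1}
          · rw [indicator_of_mem h, hin]
          · rw [indicator_of_notMem h]
        have hin' := Statistic.ofSet_ne_zero.1 hin
        have hle1 : ∑ M ∈ Finset.range N, {ω | (rootClus φ ω).encard = M + 1}.indicator
            (fun ω => (Statistic.inside A hA).eval φ ω (Sum.inl 0)) ω ≤ 1 := by
          refine (ENNReal.sum_le_tsum _).trans ((tsum_le_encard_of_le_one _ (fun M => ?_)
            {M : ℕ | (rootClus φ ω).encard = M + 1} fun M hM => ?_).trans ?_)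
          · exact (indicator_le_self' (fun _ _ => bot_le) _).trans (Statistic.ofSet_le_one _ _ _)
          · by_contra h
            exact hM (indicator_of_notMem (s := {ω | (rootClus φ ω).encard = M + 1}) h _)
          · have : ({M : ℕ | (rootClus φ ω).encard = M + 1}).encard ≤ 1 := by
              rw [encard_le_one_iff]
              intro M M' h h'
              have h1 : (rootClus φ ω).encard = M + 1 := h
              have h2 : (rootClus φ ω).encard = M' + 1 := h'
              rw [h1] at h2
              have : M + 1 = M' + 1 := by exact_mod_cast h2
              omega
            exact_mod_cast this
        refine hle1.trans ?_
        by_cases hiso : ω ∈ isolatedSet φ R (Sum.inl 0)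
        · rw [indicator_of_mem hiso]
          exact le_self_add
        by_cases hbad : ∃ i < n, ∃ q ∈ pts c,
            ω ∈ {ω | ω.2.1 (Sum.inr q) ∈ U i ∩ A} ∩ isolatedSet φ R (Sum.inr q)
        · obtain ⟨i, hi, q, hq, hmem⟩ := hbad
          refine le_add_left (le_trans ?_ (Finset.single_le_sum (f := fun i => g i ω)
            (fun _ _ => bot_le) (Finset.mem_range.2 hi)))
          refine le_trans (le_of_eq ?_) (ENNReal.le_tsum q)
          rw [indicator_of_mem (s := {ω : Conf X | Sum.inr q ∈ ω.1}) hq]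
          simp only [hf]
          rw [indicator_of_mem hmem, Pi.one_apply]
        · exfalso
          push Not at hbad
          -- If no cluster vertex met on the way is isolated, each one has a related neighbour in
          -- the next `U i`. After `n` steps the cluster has a vertex in `U n`, which lies outside
          -- `A`.
          have hchain : ∀ i ≤ n, ∃ p ∈ clus φ ω (Sum.inl 0), ω.2.1 p ∈ U i := by
            intro i
            induction i with
            | zero =>
              intro _
              refine ⟨Sum.inl 0, self_mem_clus φ _ _, ?_⟩
              rwa [hω, loc_mkConf_inl _ _ _ _ (mem_singleton _)]
            | succ i ih =>
              intro hi
              obtain ⟨p, hp, hpU⟩ := ih (by omega)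
              have hpA := hin' p hp
              have hnot : ω ∉ isolatedSet φ R p := by
                rcases p with j | q
                · have hj : j = 0 := clus_subset φ (show Sum.inl 0 ∈ ω.1 from rfl) hp
                  rw [hj]
                  exact hiso
                · have hq : q ∈ pts c := clus_subset φ (show Sum.inl 0 ∈ ω.1 from rfl) hp
                  exact fun h => hbad i (by omega) q hq ⟨⟨hpU, hpA⟩, h⟩
              simp only [isolatedSet, mem_ofPred_eq] at hnot
              push Not at hnot
              obtain ⟨q, -, hadj, hqR⟩ := hnot
              exact ⟨q, SimpleGraph.Reachable.trans hp hadj.reachable,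
                hstep i _ ⟨hpU, hpA⟩ _ hqR⟩
          obtain ⟨p, hp, hpU⟩ := hchain n le_rfl
          have hmem : ω.2.1 p ∈ U n ∩ A := ⟨hpU, hin' p hp⟩
          rw [hn] at hmem
          exact hmem
    _ = expect ν lam {0} (fun _ => o) ((isolatedSet φ R (Sum.inl 0)).indicator 1)
        + ∑ i ∈ Finset.range n, expect ν lam {0} (fun _ => o) (g i) := by
        rw [expect_add ν lam h0m, expect_finset_sum ν lam _ hgm]
    -- Union bound over the first failing step. The root has a single chance to fail; the Poisson
    -- points in `U i ∩ A` are counted by the Mecke formula, and each fails with probability at most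
    -- exp(-lam t).
    _ ≤ expNeg (lam * t) + ∑ i ∈ Finset.range n,
        lam * (baseMeasure ν (U i ∩ A) * expNeg (lam * t)) := by
        refine add_le_add ?_ (Finset.sum_le_sum fun i _ => ?_)
        · exact (expect_isolated_le φ ν lam hR (mem_singleton 0) _).trans
            (expNeg_anti (mul_le_mul' le_rfl (ht o hoA)))
        · rw [hg]
          simp only
          rw [mecke ν lam (D := {0}) (k := 1) (by simp) (fun _ => o) (hfm i) (hfinv i)]
          refine mul_le_mul' le_rfl ?_
          rw [mul_comm, ← setLIntegral_const, ← lintegral_indicator ((hU i).inter hA)]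
          refine lintegral_mono fun y => ?_
          set a : ℕ → X := Function.update (fun _ => o) 1 y with ha
          have h1 : a 1 = y := by simp [ha]
          have hl : ∀ c x u, (mkConf (insert 1 {0}) (pts c) a x u).2.1 (Sum.inl 1) = y := by
            intro c x u
            rw [loc_mkConf_inl _ _ _ _ (by simp), h1]
          by_cases hy : y ∈ U i ∩ A
          · rw [indicator_of_mem hy]
            refine le_trans (expect_mono ν lam (g := (isolatedSet φ R (Sum.inl 1)).indicator 1)
              fun c x u => ?_) ((expect_isolated_le φ ν lam hR
                (mem_insert 1 {0}) a).trans (expNeg_anti (mul_le_mul' le_rfl ?_)))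
            · exact indicator_le_indicator_of_subset inter_subset_right (fun _ => bot_le) _
            · rw [h1]
              exact ht y hy.2
          · rw [indicator_of_notMem hy, nonpos_iff_eq_zero]
            refine (expect_congr ν lam fun c x u => ?_).trans (expect_const ν lam 0)
            refine indicator_of_notMem (fun h => hy ?_) _
            have : _ ∈ U i ∩ A := h.1
            rwa [hl] at this
    _ = _ := by
        rw [add_mul, one_mul, Finset.mul_sum, Finset.sum_mul]
        simp only [mul_assoc]

end Escape

/-! ### Möbius addition -/

section Moebius

variable {E : Type*} [NormedAddCommGroup E] [InnerProductSpace ℝ E]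

/-- The denominator of Möbius addition. -/
def moebiusDenom (a x : E) : ℝ := 1 + 2 * inner ℝ a x + ‖a‖ ^ 2 * ‖x‖ ^ 2

theorem moebiusDenom_pos {a x : E} (ha : ‖a‖ < 1) (hx : ‖x‖ < 1) : 0 < moebiusDenom a x := by
  have hA := norm_nonneg a
  have hX := norm_nonneg x
  have hs := abs_le.mp (abs_real_inner_le_norm a x)
  have h1 : ‖a‖ * ‖x‖ < 1 := by nlinarith
  unfold moebiusDenom
  nlinarith [hs.1, mul_pos (sub_pos.2 h1) (sub_pos.2 h1)]

theorem moebiusAdd_eq (a x : E) : moebiusAdd a x = (moebiusDenom a x)⁻¹ •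
    ((1 + 2 * inner ℝ a x + ‖x‖ ^ 2) • a + (1 - ‖a‖ ^ 2) • x) := rfl

theorem inner_moebiusAdd (n a x : E) : inner ℝ n (moebiusAdd a x) = (moebiusDenom a x)⁻¹ *
    ((1 + 2 * inner ℝ a x + ‖x‖ ^ 2) * inner ℝ n a + (1 - ‖a‖ ^ 2) * inner ℝ n x) := by
  rw [moebiusAdd_eq, inner_smul_right, inner_add_right, inner_smul_right, inner_smul_right]

theorem inner_moebiusAdd_left (n a x : E) : inner ℝ (moebiusAdd a x) n = (moebiusDenom a x)⁻¹ *
    ((1 + 2 * inner ℝ a x + ‖x‖ ^ 2) * inner ℝ a n + (1 - ‖a‖ ^ 2) * inner ℝ x n) := by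
  rw [real_inner_comm, inner_moebiusAdd, real_inner_comm a n, real_inner_comm x n]

theorem norm_sq_moebiusAdd {a x : E} (h : moebiusDenom a x ≠ 0) : ‖moebiusAdd a x‖ ^ 2
    = 1 - (1 - ‖a‖ ^ 2) * (1 - ‖x‖ ^ 2) / moebiusDenom a x := by
  rw [← real_inner_self_eq_norm_sq, inner_moebiusAdd, inner_moebiusAdd_left,
    inner_moebiusAdd_left, real_inner_self_eq_norm_sq, real_inner_self_eq_norm_sq,
    real_inner_comm a x]
  field_simp
  unfold moebiusDenom
  ring

theorem one_sub_norm_sq_moebiusAdd {a x : E} (h : moebiusDenom a x ≠ 0) :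
    1 - ‖moebiusAdd a x‖ ^ 2 = (1 - ‖a‖ ^ 2) / moebiusDenom a x * (1 - ‖x‖ ^ 2) := by
  rw [norm_sq_moebiusAdd h]
  ring

theorem norm_sq_moebiusAdd_sub {a x y : E} (hx : moebiusDenom a x ≠ 0)
    (hy : moebiusDenom a y ≠ 0) : ‖moebiusAdd a x - moebiusAdd a y‖ ^ 2
    = (1 - ‖a‖ ^ 2) ^ 2 * ‖x - y‖ ^ 2 / (moebiusDenom a x * moebiusDenom a y) := by
  rw [norm_sub_sq_real, norm_sub_sq_real, norm_sq_moebiusAdd hx, norm_sq_moebiusAdd hy,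
    inner_moebiusAdd, inner_moebiusAdd_left, inner_moebiusAdd_left,
    real_inner_self_eq_norm_sq, real_inner_comm a x]
  field_simp
  unfold moebiusDenom
  ring

theorem moebiusAdd_neg_cancel {a x : E} (ha : ‖a‖ < 1) (hx : ‖x‖ < 1) :
    moebiusAdd (-a) (moebiusAdd a x) = x := by
  have hD := (moebiusDenom_pos ha hx).ne'
  have hy := norm_moebiusAdd_lt_one ha hx
  have hD' := (moebiusDenom_pos (by rwa [norm_neg] : ‖-a‖ < 1) hy).ne'
  have hden : moebiusDenom (-a) (moebiusAdd a x) * moebiusDenom a x = (1 - ‖a‖ ^ 2) ^ 2 := by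
    rw [moebiusDenom, inner_neg_left, inner_moebiusAdd, norm_neg, norm_sq_moebiusAdd hD,
      real_inner_self_eq_norm_sq]
    field_simp
    unfold moebiusDenom
    ring
  have ha1 : (1 - ‖a‖ ^ 2) ≠ 0 := by
    have := norm_nonneg a
    nlinarith
  have hcoef : 1 + 2 * inner ℝ (-a) (moebiusAdd a x) + ‖moebiusAdd a x‖ ^ 2
      = (1 - ‖a‖ ^ 2) * (1 + 2 * inner ℝ a x + ‖x‖ ^ 2) / moebiusDenom a x := by
    rw [inner_neg_left, inner_moebiusAdd, norm_sq_moebiusAdd hD, real_inner_self_eq_norm_sq]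
    field_simp
    unfold moebiusDenom
    ring
  have hinv : (moebiusDenom (-a) (moebiusAdd a x))⁻¹ = moebiusDenom a x / (1 - ‖a‖ ^ 2) ^ 2 := by
    rw [← hden]
    field_simp
  rw [moebiusAdd_eq (-a), hcoef, hinv, norm_neg]
  conv_lhs => rw [moebiusAdd_eq a x]
  match_scalars <;> field_simp
  ring

theorem map_moebiusAdd {F : Type*} [NormedAddCommGroup F] [InnerProductSpace ℝ F]
    (R : E →ₗᵢ[ℝ] F) (a x : E) : R (moebiusAdd a x) = moebiusAdd (R a) (R x) := by
  simp [moebiusAdd, R.norm_map, R.inner_map_map]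

theorem moebiusAdd_zero (a : E) : moebiusAdd a 0 = a := by
  simp [moebiusAdd]

theorem zero_moebiusAdd (x : E) : moebiusAdd 0 x = x := by
  simp [moebiusAdd]

/-- Möbius addition in a plane. -/
theorem moebiusAdd_complex {a x : ℂ} (ha : ‖a‖ < 1) (hx : ‖x‖ < 1) :
    moebiusAdd a x = (a + x) / (1 + (starRingEnd ℂ) a * x) := by
  have hD := (moebiusDenom_pos ha hx).ne'
  have hinner : (2 * inner ℝ a x : ℂ) = (starRingEnd ℂ) a * x + a * (starRingEnd ℂ) x := by
    have := Complex.add_conj ((starRingEnd ℂ) a * x)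
    rw [map_mul, Complex.conj_conj] at this
    rw [this, Complex.inner, mul_comm x]
    push_cast
    rfl
  have hsq : ∀ z : ℂ, ((‖z‖ : ℂ)) ^ 2 = z * (starRingEnd ℂ) z := fun z => by
    rw [Complex.mul_conj, Complex.normSq_eq_norm_sq]
    push_cast
    rfl
  have hden : (moebiusDenom a x : ℂ)
      = (1 + (starRingEnd ℂ) a * x) * (1 + a * (starRingEnd ℂ) x) := by
    unfold moebiusDenom
    push_cast
    rw [hinner, hsq, hsq]
    ring
  have hD' : (moebiusDenom a x : ℂ) ≠ 0 := by exact_mod_cast hD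
  rw [hden] at hD'
  obtain ⟨h1, h2⟩ := mul_ne_zero_iff.1 hD'
  rw [moebiusAdd_eq, Complex.real_smul, Complex.real_smul, Complex.real_smul]
  push_cast
  rw [hden, hinner, hsq, hsq]
  field_simp
  ring

end Moebius

/-! ### Translations and rotations preserve hyperbolic volume -/

section Isometries

theorem Hyp.norm_lt_one {d : ℕ} (x : Hyp d) : ‖(x : EuclideanSpace ℝ (Fin d))‖ < 1 :=
  mem_ball_zero_iff.1 x.2

theorem Hyp.one_sub_norm_sq_pos {d : ℕ} (x : Hyp d) :
    0 < 1 - ‖(x : EuclideanSpace ℝ (Fin d))‖ ^ 2 := by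
  have := x.norm_lt_one
  have := norm_nonneg (x : EuclideanSpace ℝ (Fin d))
  nlinarith

theorem Hyp.moebiusDenom_pos {d : ℕ} (a x : Hyp d) :
    0 < moebiusDenom (a : EuclideanSpace ℝ (Fin d)) x :=
  HypRCM.moebiusDenom_pos a.norm_lt_one x.norm_lt_one

/-- The distance identity is exact at finite distance; dividing by the distance along a ray through
`x` and passing to the limit shows that the differential is `k x` times an isometry. -/
theorem norm_fderiv_eq {E : Type*} [NormedAddCommGroup E] [NormedSpace ℝ E] {F : E → E}
    {k : E → ℝ} {x : E} {L : E →L[ℝ] E} (hF : HasFDerivAt F L x) (hk : ContinuousAt k x)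
    (hk0 : 0 < k x) (hdist : ∀ᶠ y in 𝓝 x, ‖F y - F x‖ ^ 2 = k y * k x * ‖y - x‖ ^ 2) (v : E) :
    ‖L v‖ = k x * ‖v‖ := by
  have h1 : Tendsto (fun c : ℝ => ‖c • (F (x + c⁻¹ • v) - F x)‖ ^ 2) atTop (𝓝 (‖L v‖ ^ 2)) :=
    ((hF.lim_real v).norm).pow 2
  have hlim : Tendsto (fun c : ℝ => x + c⁻¹ • v) atTop (𝓝 x) := by
    have : Tendsto (fun c : ℝ => x + c⁻¹ • v) atTop (𝓝 (x + (0 : ℝ) • v)) :=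
      tendsto_const_nhds.add (tendsto_inv_atTop_zero.smul_const v)
    simpa using this
  have h2 : Tendsto (fun c : ℝ => k (x + c⁻¹ • v) * k x * ‖v‖ ^ 2) atTop
      (𝓝 (k x * k x * ‖v‖ ^ 2)) :=
    ((hk.tendsto.comp hlim).mul_const _).mul_const _
  have h3 : ∀ᶠ c : ℝ in atTop, ‖c • (F (x + c⁻¹ • v) - F x)‖ ^ 2
      = k (x + c⁻¹ • v) * k x * ‖v‖ ^ 2 := by
    filter_upwards [hlim.eventually hdist, eventually_gt_atTop 0] with c hc hc0
    rw [norm_smul, mul_pow, hc, add_sub_cancel_left, norm_smul, norm_inv, mul_pow, inv_pow]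
    have : ‖c‖ ^ 2 ≠ 0 := by
      rw [Real.norm_eq_abs, sq_abs]
      positivity
    generalize k (x + c⁻¹ • v) = K
    generalize ‖c‖ ^ 2 = C at this
    field_simp
  have h4 := tendsto_nhds_unique (h2.congr' (h3.mono fun _ h => h.symm)) h1
  have h5 : ‖L v‖ ^ 2 = (k x * ‖v‖) ^ 2 := by
    rw [← h4]
    ring
  exact (pow_left_inj₀ (norm_nonneg _) (by positivity) two_ne_zero).1 h5

theorem abs_det_of_norm_eq {d : ℕ} {L : EuclideanSpace ℝ (Fin d) →L[ℝ] EuclideanSpace ℝ (Fin d)}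
    {c : ℝ} (hc : 0 < c) (hL : ∀ v, ‖L v‖ = c * ‖v‖) : |L.det| = c ^ d := by
  set U : EuclideanSpace ℝ (Fin d) →ₗᵢ[ℝ] EuclideanSpace ℝ (Fin d) :=
    { toLinearMap := c⁻¹ • L.toLinearMap
      norm_map' := fun v => by
        rw [LinearMap.smul_apply, norm_smul, ContinuousLinearMap.coe_coe, hL, norm_inv,
          Real.norm_of_nonneg hc.le, inv_mul_cancel_left₀ hc.ne'] } with hU
  have h1 : |U.toLinearMap.det| = 1 := by
    rw [← LinearMap.normDet_eq_abs_det, U.normDet_eq_one]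
  have h2 : L.toLinearMap = c • U.toLinearMap := by
    rw [hU]
    simp [smul_smul, hc.ne']
  rw [ContinuousLinearMap.det, h2, LinearMap.det_smul, abs_mul, h1, mul_one, abs_pow,
    abs_of_pos hc, finrank_euclideanSpace_fin]

theorem hvol_apply (d : ℕ) {s : Set (Hyp d)} (hs : MeasurableSet s) : hvol d s
    = ∫⁻ x in Subtype.val '' s, ENNReal.ofReal ((2 / (1 - ‖x‖ ^ 2)) ^ d) := by
  have he := MeasurableEmbedding.subtype_coe
    (measurableSet_ball : MeasurableSet (Metric.ball (0 : EuclideanSpace ℝ (Fin d)) 1))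
  rw [hvol, withDensity_apply _ hs]
  have hs' : MeasurableSet (Subtype.val '' s) := he.measurableSet_image.2 hs
  have h1 : ((Measure.comap (Subtype.val : Hyp d → EuclideanSpace ℝ (Fin d)) volume).restrict s).map
      Subtype.val = (volume : Measure (EuclideanSpace ℝ (Fin d))).restrict (Subtype.val '' s) := by
    have h2 := he.restrict_map (Measure.comap Subtype.val volume) (Subtype.val '' s)
    rw [preimage_image_eq s Subtype.val_injective, he.map_comap,
      Measure.restrict_restrict hs', Subtype.range_coe,
      inter_eq_left.2 (Subtype.coe_image_subset _ _)] at h2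
    exact h2.symm
  rw [← h1, he.lintegral_map]

/-- A map of the ball which is conformal for the hyperbolic metric preserves the hyperbolic
volume. -/
theorem measurePreserving_of_conformal {d : ℕ} (T : Hyp d ≃ᵐ Hyp d)
    {F : EuclideanSpace ℝ (Fin d) → EuclideanSpace ℝ (Fin d)} (hT : ∀ x : Hyp d, (T x : _) = F x)
    {k : EuclideanSpace ℝ (Fin d) → ℝ}
    (hF : ∀ x : Hyp d, DifferentiableAt ℝ F x) (hk : ∀ x : Hyp d, ContinuousAt k x)
    (hk0 : ∀ x : Hyp d, 0 < k x)
    (hdist : ∀ x y : Hyp d, ‖F y - F x‖ ^ 2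
      = k y * k x * ‖(y : EuclideanSpace ℝ (Fin d)) - x‖ ^ 2)
    (hone : ∀ x : Hyp d, 1 - ‖F x‖ ^ 2 = k x * (1 - ‖(x : EuclideanSpace ℝ (Fin d))‖ ^ 2)) :
    MeasurePreserving T (hvol d) (hvol d) := by
  have he := MeasurableEmbedding.subtype_coe
    (measurableSet_ball : MeasurableSet (Metric.ball (0 : EuclideanSpace ℝ (Fin d)) 1))
  have himg : ∀ s : Set (Hyp d), MeasurableSet s → hvol d (T '' s) = hvol d s := by
    intro s hs
    rw [hvol_apply d hs, hvol_apply d (T.measurableSet_image.2 hs)]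
    have hval : Subtype.val '' (T '' s) = F '' (Subtype.val '' s) := by
      rw [image_image, image_image]
      exact image_congr fun x _ => hT x
    have hinj : InjOn F (Subtype.val '' s) := by
      rintro _ ⟨x, _, rfl⟩ _ ⟨y, _, rfl⟩ h
      rw [← hT, ← hT] at h
      rw [T.injective (Subtype.val_injective h)]
    rw [hval, lintegral_image_eq_lintegral_abs_det_fderiv_mul volume
      (he.measurableSet_image.2 hs) (f' := fderiv ℝ F)
      (by
        rintro _ ⟨x, _, rfl⟩
        exact (hF x).hasFDerivAt.hasFDerivWithinAt) hinj]
    refine setLIntegral_congr_fun (he.measurableSet_image.2 hs) ?_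
    rintro _ ⟨x, _, rfl⟩
    have hnorm : ∀ v, ‖fderiv ℝ F x v‖ = k x * ‖v‖ := by
      refine norm_fderiv_eq (hF x).hasFDerivAt (hk x) (hk0 x) ?_
      filter_upwards [Metric.isOpen_ball.mem_nhds x.2] with y hy
      exact hdist x ⟨y, hy⟩
    have hx := Hyp.one_sub_norm_sq_pos x
    simp only
    rw [abs_det_of_norm_eq (hk0 x) hnorm, hone x, ← ENNReal.ofReal_mul (pow_nonneg (hk0 x).le _),
      ← mul_pow]
    congr 2
    have := (hk0 x).ne'
    field_simp
  refine ⟨T.measurable, ?_⟩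
  ext s hs
  rw [T.map_apply, ← himg _ (T.measurable hs), T.image_preimage]

theorem translateOrigin_neg_cancel {d : ℕ} (a x : Hyp d) :
    translateOrigin (negPt a) (translateOrigin a x) = x :=
  Subtype.ext (moebiusAdd_neg_cancel a.norm_lt_one x.norm_lt_one)

theorem negPt_negPt {d : ℕ} (a : Hyp d) : negPt (negPt a) = a := Subtype.ext (neg_neg _)

theorem translateOrigin_cancel_neg {d : ℕ} (a x : Hyp d) :
    translateOrigin a (translateOrigin (negPt a) x) = x := by
  conv_lhs => rw [← negPt_negPt a]
  rw [negPt_negPt]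
  have := translateOrigin_neg_cancel (negPt a) x
  rwa [negPt_negPt] at this

theorem differentiableAt_moebiusAdd {E : Type*} [NormedAddCommGroup E] [InnerProductSpace ℝ E]
    {a x : E} (h : moebiusDenom a x ≠ 0) : DifferentiableAt ℝ (moebiusAdd a) x := by
  unfold moebiusDenom at h
  have h1 : DifferentiableAt ℝ (fun y : E => inner ℝ a y) x :=
    (innerSL ℝ a).differentiableAt
  have h2 : DifferentiableAt ℝ (fun y : E => ‖y‖ ^ 2) x :=
    (contDiff_norm_sq ℝ (n := 1)).contDiffAt.differentiableAt one_ne_zero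
  unfold moebiusAdd
  have hden : DifferentiableAt ℝ (fun y : E => 1 + 2 * inner ℝ a y + ‖a‖ ^ 2 * ‖y‖ ^ 2) x :=
    ((h1.const_mul 2).const_add 1).add (h2.const_mul _)
  exact (hden.inv h).smul (((((h1.const_mul 2).const_add 1).add h2).smul_const a).add
    (differentiableAt_id.const_smul _))

theorem continuous_moebiusDenom {E : Type*} [NormedAddCommGroup E] [InnerProductSpace ℝ E]
    (a : E) : Continuous (moebiusDenom a) := by
  unfold moebiusDenom
  fun_prop

theorem continuous_translateOrigin {d : ℕ} (a : Hyp d) : Continuous (translateOrigin a) := by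
  have h : ContinuousOn (moebiusAdd (a : EuclideanSpace ℝ (Fin d))) (Metric.ball 0 1) :=
    fun x hx => (differentiableAt_moebiusAdd
      (a.moebiusDenom_pos ⟨x, hx⟩).ne').continuousAt.continuousWithinAt
  exact Continuous.subtype_mk h.domRestrict _

/-- The translation taking the origin to `a`, as a measurable equivalence. -/
def transl {d : ℕ} (a : Hyp d) : Hyp d ≃ᵐ Hyp d where
  toFun := translateOrigin a
  invFun := translateOrigin (negPt a)
  left_inv := translateOrigin_neg_cancel a
  right_inv := translateOrigin_cancel_neg a
  measurable_toFun := (continuous_translateOrigin a).measurable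
  measurable_invFun := (continuous_translateOrigin (negPt a)).measurable

theorem transl_apply {d : ℕ} (a x : Hyp d) : (transl a x : EuclideanSpace ℝ (Fin d))
    = moebiusAdd (a : EuclideanSpace ℝ (Fin d)) x := rfl

theorem transl_origin {d : ℕ} (a : Hyp d) : transl a (origin d) = a :=
  Subtype.ext (moebiusAdd_zero _)

theorem transl_neg_self {d : ℕ} (a : Hyp d) : transl (negPt a) a = origin d := by
  have h := translateOrigin_neg_cancel a (origin d)
  have h' : translateOrigin a (origin d) = a := transl_origin a
  rw [h'] at h
  exact h

theorem measurePreserving_transl {d : ℕ} (a : Hyp d) :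
    MeasurePreserving (transl a) (hvol d) (hvol d) := by
  have ha := a.one_sub_norm_sq_pos
  refine measurePreserving_of_conformal (transl a) (transl_apply a)
    (k := fun x => (1 - ‖(a : EuclideanSpace ℝ (Fin d))‖ ^ 2)
      / moebiusDenom (a : EuclideanSpace ℝ (Fin d)) x)
    (fun x => differentiableAt_moebiusAdd (a.moebiusDenom_pos x).ne')
    (fun x => continuousAt_const.div (continuous_moebiusDenom _).continuousAt
      (a.moebiusDenom_pos x).ne') (fun x => div_pos ha (a.moebiusDenom_pos x)) (fun x y => ?_)
    (fun x => one_sub_norm_sq_moebiusAdd (a.moebiusDenom_pos x).ne')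
  rw [norm_sq_moebiusAdd_sub (a.moebiusDenom_pos y).ne' (a.moebiusDenom_pos x).ne']
  have h1 := (a.moebiusDenom_pos x).ne'
  have h2 := (a.moebiusDenom_pos y).ne'
  field_simp

/-- A linear isometry as a measurable equivalence of hyperbolic space. -/
def rot {d : ℕ} (R : EuclideanSpace ℝ (Fin d) ≃ₗᵢ[ℝ] EuclideanSpace ℝ (Fin d)) :
    Hyp d ≃ᵐ Hyp d where
  toFun x := ⟨R x, mem_ball_zero_iff.2 (by rw [R.norm_map]; exact x.norm_lt_one)⟩
  invFun x := ⟨R.symm x, mem_ball_zero_iff.2 (by rw [R.symm.norm_map]; exact x.norm_lt_one)⟩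
  left_inv x := Subtype.ext (R.symm_apply_apply _)
  right_inv x := Subtype.ext (R.apply_symm_apply _)
  measurable_toFun := (R.continuous.comp continuous_subtype_val).measurable.subtype_mk
  measurable_invFun := (R.symm.continuous.comp continuous_subtype_val).measurable.subtype_mk

theorem rot_apply {d : ℕ} (R : EuclideanSpace ℝ (Fin d) ≃ₗᵢ[ℝ] EuclideanSpace ℝ (Fin d))
    (x : Hyp d) : (rot R x : EuclideanSpace ℝ (Fin d)) = R x := rfl

theorem rot_origin {d : ℕ} (R : EuclideanSpace ℝ (Fin d) ≃ₗᵢ[ℝ] EuclideanSpace ℝ (Fin d)) :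
    rot R (origin d) = origin d := Subtype.ext (map_zero R)

theorem measurePreserving_rot {d : ℕ}
    (R : EuclideanSpace ℝ (Fin d) ≃ₗᵢ[ℝ] EuclideanSpace ℝ (Fin d)) :
    MeasurePreserving (rot R) (hvol d) (hvol d) := by
  refine measurePreserving_of_conformal (rot R) (rot_apply R) (k := fun _ => 1)
    (fun x => R.differentiableAt) (fun x => continuousAt_const)
    (fun x => one_pos) (fun x y => ?_) (fun x => by simp)
  rw [← map_sub R, R.norm_map]
  simp

theorem measurePreserving_negPt (d : ℕ) : MeasurePreserving negPt (hvol d) (hvol d) :=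
  measurePreserving_rot (LinearIsometryEquiv.neg ℝ)

theorem translateOrigin_rot {d : ℕ}
    (R : EuclideanSpace ℝ (Fin d) ≃ₗᵢ[ℝ] EuclideanSpace ℝ (Fin d)) (a x : Hyp d) :
    translateOrigin (rot R a) (rot R x) = rot R (translateOrigin a x) :=
  Subtype.ext (map_moebiusAdd R.toLinearIsometry _ _).symm

end Isometries

/-! ### Translation invariance makes the connection function radial -/

section Kernel

variable {d : ℕ} (φ : ConnectionFn d)

/-- The connection function as a kernel. -/
def ConnectionFn.kernel : SymKernel (Hyp d) := ⟨φ.toFun, φ.measurable_toFun, φ.symm⟩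

theorem ConnectionFn.transl_inv (a x y : Hyp d) :
    φ.toFun (transl a x) (transl a y) = φ.toFun x y := by
  have h := φ.translation_inv (origin d) a x y
  have hneg : negPt (origin d) = origin d := Subtype.ext neg_zero
  have h0 : ∀ z : Hyp d, translateOrigin (origin d) z = z := fun z =>
    Subtype.ext (zero_moebiusAdd _)
  simp only [translation, hneg, h0] at h
  exact h

theorem ConnectionFn.eq_origin (x y : Hyp d) :
    φ.toFun x y = φ.toFun (origin d) (transl (negPt x) y) := by
  rw [← φ.transl_inv (negPt x), transl_neg_self]

/-- The translation by -p takes the pair (p, o) to (o, -p), and the connection function is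
symmetric. This is the rotation by π, which the gyration argument below does not cover. -/
theorem ConnectionFn.origin_neg (p : Hyp d) :
    φ.toFun (origin d) (negPt p) = φ.toFun (origin d) p := by
  rw [φ.symm (origin d) p, φ.eq_origin p (origin d), transl_origin]

/-- A composition of two translations is a translation after a rotation: a ⊕ (b ⊕ r) = (a ⊕ b) ⊕ g r
with g = (1 + a b)/(1 + a' b). Here `a'` stands for the conjugate of `a`, and `b` is its own
conjugate. -/
theorem gyration_field {F : Type*} [Field F] {a a' b r : F} (h1 : 1 + b * r ≠ 0)
    (h2 : 1 + a' * b ≠ 0) (h3 : 1 + a * b ≠ 0) :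
    (a + (b + r) / (1 + b * r)) / (1 + a' * ((b + r) / (1 + b * r)))
      = ((a + b) / (1 + a' * b) + (1 + a * b) / (1 + a' * b) * r)
        / (1 + (a' + b) / (1 + a * b) * ((1 + a * b) / (1 + a' * b) * r)) := by
  have e1 : 1 + a' * ((b + r) / (1 + b * r)) = (1 + b * r + a' * (b + r)) / (1 + b * r) := by
    rw [← mul_div_assoc, one_add_div h1]
  have e2 : 1 + (a' + b) / (1 + a * b) * ((1 + a * b) / (1 + a' * b) * r)
      = (1 + b * r + a' * (b + r)) / (1 + a' * b) := by
    rw [← mul_assoc, div_mul_div_cancel₀ h3, div_mul_eq_mul_div, one_add_div h2]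
    ring
  have e3 : a + (b + r) / (1 + b * r) = (a * (1 + b * r) + (b + r)) / (1 + b * r) := by
    rw [add_div (a * _), mul_div_cancel_right₀ _ h1]
  have e4 : (a + b) / (1 + a' * b) + (1 + a * b) / (1 + a' * b) * r
      = (a * (1 + b * r) + (b + r)) / (1 + a' * b) := by
    rw [div_mul_eq_mul_div, ← add_div]
    ring
  rw [e1, e2, e3, e4, div_div_div_cancel_right₀ h1, div_div_div_cancel_right₀ h2]

/-- The connection function is radial. -/
theorem ConnectionFn.radial {p q : Hyp d}
    (h : ‖(p : EuclideanSpace ℝ (Fin d))‖ = ‖(q : EuclideanSpace ℝ (Fin d))‖) :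
    φ.toFun (origin d) p = φ.toFun (origin d) q := by
  by_cases hpq : p = q
  · rw [hpq]
  by_cases hneg : q = negPt p
  · rw [hneg, φ.origin_neg]
  set P : EuclideanSpace ℝ (Fin d) := p.1 with hP
  set Q : EuclideanSpace ℝ (Fin d) := q.1 with hQ
  set r := ‖P‖ with hr
  have hr1 : r < 1 := p.norm_lt_one
  have hr0 : 0 < r := by
    rcases (norm_nonneg P).eq_or_lt' with h0 | h0
    · refine absurd (Subtype.ext ?_) hpq
      rw [← hP, ← hQ, norm_eq_zero.1 h0, norm_eq_zero.1 (h.symm.trans h0)]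
    · exact h0
  obtain ⟨α, hα⟩ : ∃ z : ℝ, z = inner ℝ P Q / r ^ 2 := ⟨_, rfl⟩
  have hα1 : α * r ^ 2 = inner ℝ P Q := by
    rw [hα]
    field_simp
  have hV : ‖Q - α • P‖ ^ 2 = (1 - α ^ 2) * r ^ 2 := by
    rw [norm_sub_sq_real, inner_smul_right, real_inner_comm, ← hα1, norm_smul, mul_pow, ← h,
      Real.norm_eq_abs, sq_abs]
    ring
  have hV0 : Q - α • P ≠ 0 := by
    intro h0
    rw [h0, norm_zero, zero_pow two_ne_zero] at hV
    have h1 : 1 - α ^ 2 = 0 := (mul_eq_zero.1 hV.symm).resolve_right (by positivity)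
    rcases mul_self_eq_one_iff.1 (by linarith : α * α = 1) with h2 | h2
    · rw [h2, one_smul, sub_eq_zero] at h0
      exact hpq (Subtype.ext h0.symm)
    · rw [h2, neg_smul, one_smul, sub_neg_eq_add] at h0
      exact hneg (Subtype.ext (eq_neg_of_add_eq_zero_left h0))
  obtain ⟨β, hβ⟩ : ∃ z : ℝ, z = ‖Q - α • P‖ / r := ⟨_, rfl⟩
  have hβ0 : 0 < β := hβ ▸ div_pos (norm_pos_iff.2 hV0) hr0
  have hαβ : α ^ 2 + β ^ 2 = 1 := by
    rw [hβ, div_pow, hV]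
    field_simp
    ring
  obtain ⟨e₁, he₁⟩ : ∃ z : EuclideanSpace ℝ (Fin d), z = r⁻¹ • P := ⟨_, rfl⟩
  obtain ⟨e₂, he₂⟩ : ∃ z : EuclideanSpace ℝ (Fin d), z = (r * β)⁻¹ • (Q - α • P) := ⟨_, rfl⟩
  have h11 : ‖e₁‖ = 1 := by
    rw [he₁, norm_smul, norm_inv, Real.norm_of_nonneg hr0.le, ← hr, inv_mul_cancel₀ hr0.ne']
  have h22 : ‖e₂‖ = 1 := by
    rw [he₂, norm_smul, norm_inv, Real.norm_of_nonneg (by positivity), hβ,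
      mul_div_cancel₀ _ hr0.ne', inv_mul_cancel₀ (norm_ne_zero_iff.2 hV0)]
  have h12 : inner ℝ e₁ e₂ = 0 := by
    rw [he₁, he₂, inner_smul_left, inner_smul_right, inner_sub_right, inner_smul_right,
      real_inner_self_eq_norm_sq, ← hr, hα1, sub_self, mul_zero, mul_zero]
  set J : ℂ →ₗᵢ[ℝ] EuclideanSpace ℝ (Fin d) :=
    { toFun := fun z => z.re • e₁ + z.im • e₂
      map_add' := fun z w => by
        simp only [Complex.add_re, Complex.add_im, add_smul]
        abel
      map_smul' := fun c z => by
        simp [mul_smul]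
      norm_map' := fun z => by
        rw [← pow_left_inj₀ (norm_nonneg _) (norm_nonneg _) two_ne_zero]
        change ‖z.re • e₁ + z.im • e₂‖ ^ 2 = _
        rw [norm_add_sq_real, norm_smul, norm_smul, h11, h22, inner_smul_left, inner_smul_right,
          h12, Complex.sq_norm, Complex.normSq_apply]
        simp [sq] } with hJ
  have hJa : ∀ z, J z = z.re • e₁ + z.im • e₂ := fun z => rfl
  -- In the plane of `P` and `Q`, identified with ℂ so that `P` is the positive real `r`, the point
  -- `Q` is `g * r` with |g| = 1.
  set g : ℂ := ⟨α, β⟩ with hg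
  have hJp : J (r : ℂ) = P := by
    rw [hJa, Complex.ofReal_re, Complex.ofReal_im, zero_smul, add_zero, he₁, smul_smul,
      mul_inv_cancel₀ hr0.ne', one_smul]
  have hJq : J (g * r) = Q := by
    rw [hJa, Complex.re_mul_ofReal, Complex.im_mul_ofReal, hg, he₁, he₂, smul_smul, smul_smul,
      mul_assoc, mul_inv_cancel₀ hr0.ne', mul_one, mul_comm β r,
      mul_inv_cancel₀ (by positivity), one_smul]
    abel
  have hgg : g * (starRingEnd ℂ) g = 1 := by
    rw [Complex.mul_conj, Complex.normSq_mk, ← sq, ← sq, hαβ, Complex.ofReal_one]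
  have hα2 : -1 < α := by nlinarith
  -- The gyration factor of `a` and a real `b` is (1 + ab)/(1 + conj(ab)). With ab = (g - 1)/2 it
  -- equals (1 + g)/(1 + conj g) = g. Since g ≠ -1, the modulus of (g - 1)/2 is below 1, so `b` can
  -- be chosen strictly between this modulus and 1, which makes |a| < 1.
  obtain ⟨w, hw⟩ : ∃ z : ℂ, z = (g - 1) / 2 := ⟨_, rfl⟩
  have hw1 : ‖w‖ < 1 := by
    rw [hw, norm_div, Complex.norm_ofNat, div_lt_one two_pos,
      ← pow_lt_pow_iff_left₀ (norm_nonneg _) two_pos.le two_ne_zero, Complex.sq_norm,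
      Complex.normSq_apply]
    simp only [hg, Complex.sub_re, Complex.one_re, Complex.sub_im, Complex.one_im]
    nlinarith
  obtain ⟨b, hb⟩ : ∃ z : ℝ, z = (1 + ‖w‖) / 2 := ⟨_, rfl⟩
  have hb0 : 0 < b := by
    rw [hb]
    positivity
  have hb1 : b < 1 := by linarith
  have hbw : ‖w‖ < b := by linarith
  obtain ⟨a, ha⟩ : ∃ z : ℂ, z = w / b := ⟨_, rfl⟩
  have ha1 : ‖a‖ < 1 := by
    rw [ha, norm_div, Complex.norm_real, Real.norm_of_nonneg hb0.le, div_lt_one hb0]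
    exact hbw
  have hab : a * b = w := ha ▸ div_mul_cancel₀ _ (Complex.ofReal_ne_zero.2 hb0.ne')
  have hb1' : ‖(b : ℂ)‖ < 1 := by rwa [Complex.norm_real, Real.norm_of_nonneg hb0.le]
  have hlt : ∀ z : ℂ, ‖z‖ < 1 → ‖J z‖ < 1 := fun z hz => by rwa [J.norm_map]
  have key : moebiusAdd a (moebiusAdd (b : ℂ) (r : ℂ))
      = moebiusAdd (moebiusAdd a (b : ℂ)) (g * r) := by
    have hr1' : ‖(r : ℂ)‖ < 1 := by rwa [Complex.norm_real, Real.norm_of_nonneg hr0.le]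
    have hgn : ‖g‖ = 1 := by
      rw [← pow_left_inj₀ (norm_nonneg _) zero_le_one two_ne_zero, Complex.sq_norm, hg,
        Complex.normSq_mk, ← sq, ← sq, hαβ, one_pow]
    have hgr : ‖g * r‖ < 1 := by rwa [norm_mul, hgn, one_mul]
    have hbr := norm_moebiusAdd_lt_one hb1' hr1'
    have hab' := norm_moebiusAdd_lt_one ha1 hb1'
    have hne : ∀ {x y : ℂ}, ‖x‖ < 1 → ‖y‖ < 1 → 1 + x * y ≠ 0 := by
      intro x y hx hy h0
      have h1 : ‖x * y‖ < 1 := by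
        rw [norm_mul]
        exact mul_lt_one_of_nonneg_of_lt_one_left (norm_nonneg _) hx hy.le
      rw [eq_neg_of_add_eq_zero_right h0, norm_neg, norm_one] at h1
      exact lt_irrefl _ h1
    have hconj : ∀ {x : ℂ}, ‖x‖ < 1 → ‖(starRingEnd ℂ) x‖ < 1 := fun hx => by
      rwa [RCLike.norm_conj]
    have hg1 : g * (1 + (starRingEnd ℂ) a * b) = 1 + a * b := by
      have h1 : (starRingEnd ℂ) a * b = (starRingEnd ℂ) w := by
        rw [← hab, map_mul, Complex.conj_ofReal]
      rw [h1, hab, hw, map_div₀, map_sub, map_one, map_ofNat]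
      linear_combination (1 / 2 : ℂ) * hgg
    have hn1 := hne hb1' hr1'
    have hn2 := hne (hconj ha1) hb1'
    have hn3 := hne (hconj ha1) hbr
    have hn4 := hne (hconj hab') hgr
    have hn5 := hne ha1 hb1'
    rw [moebiusAdd_complex ha1 hbr, moebiusAdd_complex hab' hgr]
    rw [moebiusAdd_complex hb1' hr1'] at hn3 ⊢
    rw [moebiusAdd_complex ha1 hb1'] at hn4 ⊢
    rw [map_div₀, map_add, map_add, map_mul, map_one, Complex.conj_conj, Complex.conj_ofReal]
      at hn4 ⊢
    rw [Complex.conj_ofReal] at hn3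
    rw [← mul_div_cancel_right₀ g hn2, hg1] at hn4 ⊢
    exact gyration_field hn1 hn2 hn5
  set A : Hyp d := ⟨J a, mem_ball_zero_iff.2 (hlt _ ha1)⟩
  set B : Hyp d := ⟨J b, mem_ball_zero_iff.2 (hlt _ hb1')⟩
  have h1 : transl A (transl B p) = transl (transl A B) q := by
    refine Subtype.ext ?_
    change moebiusAdd (J a) (moebiusAdd (J b) P) = moebiusAdd (moebiusAdd (J a) (J b)) Q
    rw [← hJp, ← hJq, ← map_moebiusAdd, ← map_moebiusAdd, ← map_moebiusAdd, ← map_moebiusAdd, key]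
  calc φ.toFun (origin d) p
      = φ.toFun (transl A (transl B (origin d))) (transl A (transl B p)) := by
        rw [φ.transl_inv, φ.transl_inv]
    _ = φ.toFun (transl (transl A B) (origin d)) (transl (transl A B) q) := by
        rw [h1, transl_origin, transl_origin]
    _ = _ := φ.transl_inv _ _ _

/-- Moving `x` to the origin leaves a function of the norm of the image of `y`, and linear
isometries commute with Möbius addition. -/
theorem ConnectionFn.rot_inv
    (R : EuclideanSpace ℝ (Fin d) ≃ₗᵢ[ℝ] EuclideanSpace ℝ (Fin d)) (x y : Hyp d) :
    φ.toFun (rot R x) (rot R y) = φ.toFun x y := by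
  have hneg : negPt (rot R x) = rot R (negPt x) := Subtype.ext (map_neg R _).symm
  rw [φ.eq_origin, φ.eq_origin x, hneg]
  refine φ.radial ?_
  have : transl (rot R (negPt x)) (rot R y) = rot R (transl (negPt x) y) :=
    translateOrigin_rot R _ _
  rw [this, rot_apply, R.norm_map]

end Kernel

/-! ### The signed distance function of a hyperplane -/

section HalfSpaceFunction

variable {E : Type*} [NormedAddCommGroup E] [InnerProductSpace ℝ E]

/-- The function `sinh` of the signed distance from the hyperplane with normal `n` and offset `b`,
if `‖n‖² = 1 + b²`. -/
def sig (n : E) (b : ℝ) (x : E) : ℝ := (2 * inner ℝ n x - b * (1 + ‖x‖ ^ 2)) / (1 - ‖x‖ ^ 2)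

theorem sig_zero (n : E) (b : ℝ) : sig n b 0 = -b := by simp [sig]

theorem one_sub_norm_sq_pos {x : E} (hx : ‖x‖ < 1) : 0 < 1 - ‖x‖ ^ 2 := by
  have := norm_nonneg x
  nlinarith

/-- The pull-back of a half-space under a translation is a half-space. -/
theorem exists_sig_moebiusAdd (n : E) {a : E} (b : ℝ) (ha : ‖a‖ < 1) :
    ∃ (n' : E) (b' : ℝ), ‖n'‖ ^ 2 - b' ^ 2 = ‖n‖ ^ 2 - b ^ 2 ∧
      ∀ x, ‖x‖ < 1 → sig n b (moebiusAdd a x) = sig n' b' x := by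
  have ha' := (one_sub_norm_sq_pos ha).ne'
  refine ⟨n + ((2 * inner ℝ n a - 2 * b) / (1 - ‖a‖ ^ 2)) • a,
    ((1 + ‖a‖ ^ 2) * b - 2 * inner ℝ n a) / (1 - ‖a‖ ^ 2), ?_, fun x hx => ?_⟩
  · rw [norm_add_sq_real, norm_smul, inner_smul_right, mul_pow, Real.norm_eq_abs, sq_abs]
    field_simp
    ring
  · have hx' := (one_sub_norm_sq_pos hx).ne'
    have hD := (moebiusDenom_pos ha hx).ne'
    rw [sig, sig, one_sub_norm_sq_moebiusAdd hD, inner_moebiusAdd, norm_sq_moebiusAdd hD,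
      inner_add_left, inner_smul_left]
    simp only [conj_trivial]
    field_simp
    unfold moebiusDenom
    ring

/-- From the origin, a step into the cap around the inward normal moves at least 2τ deeper into the
half-space, measured by `sig`. This is the gain in depth when the root is attached to a neighbour.
-/
theorem sig_add_le {n x : E} {b τ : ℝ} (h : ‖n‖ ^ 2 = 1 + b ^ 2) (hb : b ≤ 0) (hx : ‖x‖ < 1)
    (hτ : 0 < τ) (hcap : ‖x‖ ^ 2 + τ ≤ inner ℝ (‖n‖⁻¹ • n) x) : -b + 2 * τ ≤ sig n b x := by
  have hx' := one_sub_norm_sq_pos hx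
  have hn : 1 ≤ ‖n‖ := by
    rw [← abs_of_nonneg (norm_nonneg n)]
    exact one_le_sq_iff_one_le_abs _ |>.1 (by nlinarith)
  rw [inner_smul_left, conj_trivial, ← div_eq_inv_mul, le_div_iff₀ (by linarith)] at hcap
  rw [sig, le_div_iff₀ hx']
  have h1 : ‖x‖ ^ 2 + τ ≤ inner ℝ n x := le_trans (le_mul_of_one_le_right (by positivity) hn) hcap
  nlinarith [sq_nonneg ‖x‖, mul_nonneg (neg_nonneg.2 hb) (sq_nonneg ‖x‖),
    mul_nonneg hτ.le (sq_nonneg ‖x‖)]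

/-- The step in the opposite direction, used for descending towards the boundary and out of the
half-space. No sign of `b` is needed, because |b| ≤ ‖n‖. -/
theorem sig_le_sub {n x : E} {b τ : ℝ} (h : ‖n‖ ^ 2 = 1 + b ^ 2) (hx : ‖x‖ < 1)
    (hτ : 0 < τ) (hcap : ‖x‖ ^ 2 + τ ≤ inner ℝ (-(‖n‖⁻¹ • n)) x) : sig n b x ≤ -b - 2 * τ := by
  have hx' := one_sub_norm_sq_pos hx
  have hn : 1 ≤ ‖n‖ := by
    rw [← abs_of_nonneg (norm_nonneg n)]
    exact one_le_sq_iff_one_le_abs _ |>.1 (by nlinarith)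
  have hbn : -b ≤ ‖n‖ := by
    rw [← abs_of_nonneg (norm_nonneg n)]
    exact (neg_le_abs b).trans (sq_le_sq.1 (by linarith))
  rw [inner_neg_left, inner_smul_left, conj_trivial, ← div_eq_inv_mul, ← neg_div,
    le_div_iff₀ (by linarith)] at hcap
  rw [sig, div_le_iff₀ hx']
  nlinarith [mul_nonneg (sub_nonneg.2 hbn) (sq_nonneg ‖x‖), mul_nonneg hτ.le (sub_nonneg.2 hn),
    mul_nonneg hτ.le (sq_nonneg ‖x‖)]

theorem sig_nonneg_iff {n x : E} {b : ℝ} (hx : ‖x‖ < 1) :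
    0 ≤ sig n b x ↔ b * (1 + ‖x‖ ^ 2) ≤ 2 * inner ℝ n x := by
  rw [sig, le_div_iff₀ (one_sub_norm_sq_pos hx), zero_mul, sub_nonneg]

theorem exists_map_eq_of_norm_eq [FiniteDimensional ℝ E] {u v : E} (h : ‖u‖ = ‖v‖) :
    ∃ R : E ≃ₗᵢ[ℝ] E, R u = v :=
  ⟨(ℝ ∙ (u - v))ᗮ.reflection, Submodule.reflection_sub h⟩

end HalfSpaceFunction

/-! ### Half-spaces, caps and bounded regions -/

section HalfSpaces

variable {d : ℕ}

/-- The closed half-space of the points with `sig n b ≥ 0`. -/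
def halfSp (n : EuclideanSpace ℝ (Fin d)) (b : ℝ) : Set (Hyp d) := {x | 0 ≤ sig n b x}

theorem measurable_sig (n : EuclideanSpace ℝ (Fin d)) (b : ℝ) :
    Measurable fun x : Hyp d => sig n b (x : EuclideanSpace ℝ (Fin d)) := by
  unfold sig
  fun_prop

theorem measurableSet_halfSp (n : EuclideanSpace ℝ (Fin d)) (b : ℝ) :
    MeasurableSet (halfSp n b) :=
  measurableSet_le measurable_const (measurable_sig n b)

theorem HalfSpace.exists_carrier_eq (H : HalfSpace d) (ho : origin d ∈ H.carrier) :
    ∃ (n : EuclideanSpace ℝ (Fin d)) (b : ℝ), ‖n‖ ^ 2 = 1 + b ^ 2 ∧ b ≤ 0 ∧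
      H.carrier = halfSp n b := by
  have hpos : 0 < ‖H.normal‖ ^ 2 - H.offset ^ 2 := by
    rw [sub_pos, sq_lt_sq, abs_norm]
    exact H.abs_offset_lt
  set s := √(‖H.normal‖ ^ 2 - H.offset ^ 2) with hs
  have hs0 : 0 < s := Real.sqrt_pos.2 hpos
  have hs2 : s ^ 2 = ‖H.normal‖ ^ 2 - H.offset ^ 2 := Real.sq_sqrt hpos.le
  have ho' : H.offset ≤ 0 := by
    have h : H.offset * (1 + ‖(0 : EuclideanSpace ℝ (Fin d))‖ ^ 2)
      ≤ 2 * inner ℝ H.normal (0 : EuclideanSpace ℝ (Fin d)) := ho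
    simpa using h
  refine ⟨s⁻¹ • H.normal, H.offset / s, ?_, div_nonpos_of_nonpos_of_nonneg ho' hs0.le, ?_⟩
  · rw [norm_smul, norm_inv, Real.norm_of_nonneg hs0.le]
    field_simp
    rw [hs2]
    ring
  · ext x
    rw [halfSp, mem_ofPred_eq, sig_nonneg_iff x.norm_lt_one, inner_smul_left, conj_trivial,
      HalfSpace.carrier, mem_ofPred_eq, div_mul_eq_mul_div, div_le_iff₀ hs0]
    have : 2 * (s⁻¹ * inner ℝ H.normal (x : EuclideanSpace ℝ (Fin d))) * s
        = 2 * inner ℝ H.normal (x : EuclideanSpace ℝ (Fin d)) := by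
      field_simp
    rw [this]

/-- Up to rotation, half-spaces which contain the origin are ordered. -/
theorem exists_rot_halfSp_subset {n n' : EuclideanSpace ℝ (Fin d)} {b b' : ℝ}
    (h : ‖n‖ ^ 2 = 1 + b ^ 2) (h' : ‖n'‖ ^ 2 = 1 + b' ^ 2) (hb : b' ≤ b) (hb0 : b ≤ 0) :
    ∃ R : EuclideanSpace ℝ (Fin d) ≃ₗᵢ[ℝ] EuclideanSpace ℝ (Fin d),
      ∀ x, x ∈ halfSp n b → rot R x ∈ halfSp n' b' := by
  have hn : 0 < ‖n‖ := by
    by_contra h0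
    nlinarith [norm_nonneg n]
  have hn' : 0 < ‖n'‖ := by
    by_contra h0
    nlinarith [norm_nonneg n']
  obtain ⟨R, hR⟩ := exists_map_eq_of_norm_eq (u := ‖n‖⁻¹ • n) (v := ‖n'‖⁻¹ • n') (by
    rw [norm_smul, norm_smul, norm_inv, norm_inv, norm_norm, norm_norm, inv_mul_cancel₀ hn.ne',
      inv_mul_cancel₀ hn'.ne'])
  refine ⟨R, fun x hx => ?_⟩
  rw [halfSp, mem_ofPred_eq, sig_nonneg_iff x.norm_lt_one] at hx
  rw [halfSp, mem_ofPred_eq, sig_nonneg_iff (rot R x).norm_lt_one, rot_apply, R.norm_map]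
  have h1 : inner ℝ n' (R x) = ‖n'‖ / ‖n‖ * inner ℝ n (x : EuclideanSpace ℝ (Fin d)) := by
    have h2 : n' = R ((‖n'‖ / ‖n‖) • n) := by
      have : (‖n'‖ / ‖n‖) • n = ‖n'‖ • (‖n‖⁻¹ • n) := by rw [smul_smul, div_eq_mul_inv]
      rw [this, map_smul, hR, smul_smul, mul_inv_cancel₀ hn'.ne', one_smul]
    conv_lhs => rw [h2]
    rw [R.inner_map_map, inner_smul_left, conj_trivial]
  have h3 : b' * ‖n‖ ≤ b * ‖n'‖ := by
    have : (-b * ‖n'‖) ^ 2 ≤ (-b' * ‖n‖) ^ 2 := by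
      rw [mul_pow, mul_pow, h, h']
      nlinarith
    have := (sq_le_sq₀ (mul_nonneg (by linarith) hn'.le) (mul_nonneg (by linarith) hn.le)).1 this
    linarith
  rw [h1, ← mul_assoc, mul_comm (2 : ℝ), mul_assoc, div_mul_eq_mul_div, le_div_iff₀ hn]
  have h4 := mul_le_mul_of_nonneg_left hx hn'.le
  have h5 := mul_le_mul_of_nonneg_right h3 (by positivity : 0 ≤ 1 + ‖(x : EuclideanSpace ℝ (Fin d))‖ ^ 2)
  linarith

/-- The points near the origin in the direction `u`. -/
def cap (u : EuclideanSpace ℝ (Fin d)) (τ ρ : ℝ) : Set (Hyp d) :=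
  {x | ‖(x : EuclideanSpace ℝ (Fin d))‖ ≤ ρ ∧ ‖(x : EuclideanSpace ℝ (Fin d))‖ ^ 2 + τ
    ≤ inner ℝ u (x : EuclideanSpace ℝ (Fin d))}

theorem measurableSet_cap (u : EuclideanSpace ℝ (Fin d)) (τ ρ : ℝ) :
    MeasurableSet (cap u τ ρ) := by
  have h1 : MeasurableSet {x : Hyp d | ‖(x : EuclideanSpace ℝ (Fin d))‖ ≤ ρ} :=
    measurableSet_le (by fun_prop) measurable_const
  have h2 : MeasurableSet {x : Hyp d | ‖(x : EuclideanSpace ℝ (Fin d))‖ ^ 2 + τ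
    ≤ inner ℝ u (x : EuclideanSpace ℝ (Fin d))} := measurableSet_le (by fun_prop) (by fun_prop)
  exact h1.inter h2

/-- The pairs of points at bounded hyperbolic distance. -/
def nearRel (d : ℕ) (D : ℝ) : Set (Hyp d × Hyp d) :=
  {z | ‖(z.1 : EuclideanSpace ℝ (Fin d)) - z.2‖ ^ 2
    ≤ D * ((1 - ‖(z.1 : EuclideanSpace ℝ (Fin d))‖ ^ 2)
      * (1 - ‖(z.2 : EuclideanSpace ℝ (Fin d))‖ ^ 2))}

theorem measurableSet_nearRel (d : ℕ) (D : ℝ) : MeasurableSet (nearRel d D) :=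
  measurableSet_le (by fun_prop) (by fun_prop)

theorem transl_mem_nearRel {D : ℝ} (a x y : Hyp d) :
    (transl a x, transl a y) ∈ nearRel d D ↔ (x, y) ∈ nearRel d D := by
  have h1 := a.moebiusDenom_pos x
  have h2 := a.moebiusDenom_pos y
  have h3 := a.one_sub_norm_sq_pos
  simp only [nearRel, mem_ofPred_eq, transl_apply]
  rw [norm_sq_moebiusAdd_sub h1.ne' h2.ne', one_sub_norm_sq_moebiusAdd h1.ne',
    one_sub_norm_sq_moebiusAdd h2.ne']
  have h4 : 0 < (1 - ‖(a : EuclideanSpace ℝ (Fin d))‖ ^ 2) ^ 2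
    / (moebiusDenom (a : EuclideanSpace ℝ (Fin d)) x
      * moebiusDenom (a : EuclideanSpace ℝ (Fin d)) y) := by positivity
  rw [← mul_le_mul_iff_right₀ h4 (b := ‖(x : EuclideanSpace ℝ (Fin d)) - y‖ ^ 2)]
  have e : ∀ k p q s t : ℝ, D * (k / p * s * (k / q * t)) = k ^ 2 / (p * q) * (D * (s * t)) := by
    intro k p q s t
    rw [div_eq_mul_inv, div_eq_mul_inv, div_eq_mul_inv, mul_inv]
    ring
  rw [e, mul_div_right_comm]

/-- Away from the unit sphere the volume density is at most (2/ε)^d. -/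
theorem hvol_lt_top {ε : ℝ} (hε : 0 < ε) :
    hvol d {x | ε ≤ 1 - ‖(x : EuclideanSpace ℝ (Fin d))‖ ^ 2} < ∞ := by
  have hm : MeasurableSet {x : Hyp d | ε ≤ 1 - ‖(x : EuclideanSpace ℝ (Fin d))‖ ^ 2} :=
    measurableSet_le measurable_const (by fun_prop)
  rw [hvol_apply d hm]
  refine lt_of_le_of_lt (setLIntegral_mono (g := fun _ => ENNReal.ofReal ((2 / ε) ^ d))
    measurable_const ?_) ?_
  · rintro _ ⟨x, hx, rfl⟩
    refine ENNReal.ofReal_le_ofReal (pow_le_pow_left₀ ?_ ?_ d)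
    · exact div_nonneg zero_le_two (Hyp.one_sub_norm_sq_pos x).le
    · exact div_le_div_of_nonneg_left zero_le_two hε hx
  · rw [setLIntegral_const]
    refine ENNReal.mul_lt_top ENNReal.ofReal_lt_top (lt_of_le_of_lt (measure_mono ?_)
      (measure_ball_lt_top (x := (0 : EuclideanSpace ℝ (Fin d))) (r := 1)))
    exact Subtype.coe_image_subset _ _

theorem hvol_nearRel_lt_top {D : ℝ} (hD : 0 ≤ D) :
    hvol d {y | (origin d, y) ∈ nearRel d D} < ∞ := by
  refine lt_of_le_of_lt (measure_mono fun y hy => ?_)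
    (hvol_lt_top (d := d) (ε := 1 / (1 + D)) (by positivity))
  have h : ‖(0 : EuclideanSpace ℝ (Fin d)) - y‖ ^ 2
    ≤ D * ((1 - ‖(0 : EuclideanSpace ℝ (Fin d))‖ ^ 2)
      * (1 - ‖(y : EuclideanSpace ℝ (Fin d))‖ ^ 2)) := hy
  rw [zero_sub, norm_neg, norm_zero] at h
  rw [mem_ofPred_eq, div_le_iff₀ (by positivity)]
  linarith

theorem mem_nearRel_of_norm_le {ρ : ℝ} (hρ : ρ < 1) {x y : Hyp d}
    (hx : ‖(x : EuclideanSpace ℝ (Fin d))‖ ≤ ρ) (hy : ‖(y : EuclideanSpace ℝ (Fin d))‖ ≤ ρ) :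
    (x, y) ∈ nearRel d (4 / (1 - ρ ^ 2) ^ 2) := by
  have hρ0 := (norm_nonneg _).trans hx
  have h0 : 0 < 1 - ρ ^ 2 := by nlinarith
  have h1 : ∀ z : Hyp d, ‖(z : EuclideanSpace ℝ (Fin d))‖ ≤ ρ →
      1 - ρ ^ 2 ≤ 1 - ‖(z : EuclideanSpace ℝ (Fin d))‖ ^ 2 := fun z hz => by
    have := pow_le_pow_left₀ (norm_nonneg _) hz 2
    linarith
  have h2 : ‖(x : EuclideanSpace ℝ (Fin d)) - y‖ ^ 2 ≤ 4 := by
    have := (norm_sub_le (x : EuclideanSpace ℝ (Fin d)) y)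
    have h3 := norm_nonneg ((x : EuclideanSpace ℝ (Fin d)) - y)
    nlinarith
  refine h2.trans ?_
  have h4 := mul_le_mul (h1 x hx) (h1 y hy) h0.le (h0.le.trans (h1 x hx))
  rw [div_mul_eq_mul_div, le_div_iff₀ (by positivity)]
  simp only
  nlinarith

theorem hvol_singleton_origin (hd : d ≠ 0) : hvol d {origin d} = 0 := by
  have : NeZero d := ⟨hd⟩
  rw [hvol_apply d (measurableSet_singleton _), image_singleton]
  exact setLIntegral_measure_zero _ _ (measure_singleton _)

end HalfSpaces

/-! ### Isometries as automorphisms of the model -/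

section Automorphisms

variable {d : ℕ} (φ : ConnectionFn d)

theorem baseMeasure_layer (d : ℕ) : baseMeasure (layer d) = hvol d := sum_sfiniteSeq _

theorem isAut_transl (a : Hyp d) : IsAut φ.kernel (baseMeasure (layer d)) (transl a) :=
  ⟨by rw [baseMeasure_layer]; exact measurePreserving_transl a, φ.transl_inv a⟩

theorem isAut_rot (R : EuclideanSpace ℝ (Fin d) ≃ₗᵢ[ℝ] EuclideanSpace ℝ (Fin d)) :
    IsAut φ.kernel (baseMeasure (layer d)) (rot R) :=
  ⟨by rw [baseMeasure_layer]; exact measurePreserving_rot R, φ.rot_inv R⟩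

theorem measurable_uval_origin : Measurable fun y => uval (φ.toFun (origin d) y) :=
  measurable_uval.comp (φ.measurable_toFun.comp measurable_prodMk_left)

theorem lintegral_cap_map (R : EuclideanSpace ℝ (Fin d) ≃ₗᵢ[ℝ] EuclideanSpace ℝ (Fin d))
    (u : EuclideanSpace ℝ (Fin d)) (τ ρ : ℝ) :
    ∫⁻ y in cap (R u) τ ρ, uval (φ.toFun (origin d) y) ∂hvol d
      = ∫⁻ y in cap u τ ρ, uval (φ.toFun (origin d) y) ∂hvol d := by
  have hpre : rot R ⁻¹' cap (R u) τ ρ = cap u τ ρ := by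
    ext x
    simp only [cap, mem_preimage, mem_ofPred_eq, rot_apply, R.norm_map, R.inner_map_map]
  rw [← (measurePreserving_rot R).setLIntegral_comp_preimage (measurableSet_cap _ τ ρ)
    (measurable_uval_origin φ), hpre]
  refine lintegral_congr fun y => ?_
  conv_lhs => rw [← rot_origin R, φ.rot_inv]

/-- A point has many neighbours in every direction. -/
theorem exists_cap_mass (hd : d ≠ 0) (h : degMass φ.kernel (layer d) (origin d) ≠ 0) :
    ∃ (τ ρ : ℝ) (β : ℝ≥0∞), 0 < τ ∧ ρ < 1 ∧ β ≠ 0 ∧ ∀ u : EuclideanSpace ℝ (Fin d), ‖u‖ = 1 →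
      ∫⁻ y in cap u τ ρ, uval (φ.toFun (origin d) y) ∂hvol d = β := by
  set m := (hvol d).withDensity fun y => uval (φ.toFun (origin d) y) with hm
  have hmuniv : m univ ≠ 0 := by
    rw [hm, withDensity_apply _ MeasurableSet.univ, setLIntegral_univ, ← baseMeasure_layer]
    exact h
  have hm0 : m {origin d} = 0 :=
    withDensity_absolutelyContinuous _ _ (hvol_singleton_origin hd)
  -- The sets `V u` are the horoballs through the origin. They are open and cover everything except
  -- the null set consisting of the origin, so by the Lindelöf property one of them has positive
  -- mass.
  set V : {u : EuclideanSpace ℝ (Fin d) // ‖u‖ = 1} → Set (Hyp d) := fun u =>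
    {x | ‖(x : EuclideanSpace ℝ (Fin d))‖ ^ 2 < inner ℝ u.1 (x : EuclideanSpace ℝ (Fin d))} with hV
  have hVo : ∀ u, IsOpen (V u) := fun u => isOpen_lt (by fun_prop) (by fun_prop)
  have hcov : (univ : Set (Hyp d)) ⊆ {origin d} ∪ ⋃ u, V u := by
    intro x _
    by_cases hx : x = origin d
    · exact Or.inl hx
    · have hx0 : 0 < ‖(x : EuclideanSpace ℝ (Fin d))‖ :=
        norm_pos_iff.2 fun h0 => hx (Subtype.ext h0)
      refine Or.inr (mem_iUnion.2 ⟨⟨‖(x : EuclideanSpace ℝ (Fin d))‖⁻¹ • x, ?_⟩, ?_⟩)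
      · rw [norm_smul, norm_inv, norm_norm, inv_mul_cancel₀ hx0.ne']
      · simp only [hV, mem_ofPred_eq]
        rw [inner_smul_left, conj_trivial, real_inner_self_eq_norm_sq, sq, ← mul_assoc,
          inv_mul_cancel₀ hx0.ne', one_mul]
        nlinarith [x.norm_lt_one]
  obtain ⟨u, hu⟩ : ∃ u, m (V u) ≠ 0 := by
    by_contra! h0
    obtain ⟨T, hT, hTu⟩ := TopologicalSpace.isOpen_iUnion_countable V hVo
    refine hmuniv (measure_mono_null hcov (measure_union_null hm0 ?_))
    rw [← hTu]
    exact (measure_biUnion_null_iff hT).2 fun u _ => h0 u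
  -- The horoball is exhausted by caps, with τ = 1/(k+1) and ρ = 1 - 1/(k+1); one of them has
  -- positive mass, and by rotation the mass is the same in every direction.
  have hVc : V u ⊆ ⋃ k : ℕ, cap u.1 (1 / ((k : ℝ) + 1)) (1 - 1 / ((k : ℝ) + 1)) := by
    intro x hx
    obtain ⟨k, hk⟩ := exists_nat_one_div_lt (lt_min (sub_pos.2 hx) (sub_pos.2 x.norm_lt_one))
    have h1 := hk.trans_le (min_le_left _ _)
    have h2 := hk.trans_le (min_le_right _ _)
    exact mem_iUnion.2 ⟨k, by linarith, by linarith⟩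
  obtain ⟨k, hk⟩ : ∃ k : ℕ, m (cap u.1 (1 / ((k : ℝ) + 1)) (1 - 1 / ((k : ℝ) + 1))) ≠ 0 := by
    by_contra! h0
    exact hu (measure_mono_null hVc (measure_iUnion_null h0))
  refine ⟨1 / ((k : ℝ) + 1), 1 - 1 / ((k : ℝ) + 1), _, Nat.one_div_pos_of_nat,
    sub_lt_self _ Nat.one_div_pos_of_nat, hk, fun v hv => ?_⟩
  obtain ⟨R, hR⟩ := exists_map_eq_of_norm_eq (u.2.trans hv.symm)
  rw [← hR, lintegral_cap_map, hm, withDensity_apply _ (measurableSet_cap _ _ _)]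

theorem sizeMean_transl (lam : ℝ≥0) {G G' : Statistic (Hyp d)} {w : Hyp d}
    (hG : ∀ C x r, G.toFun C (transl w ∘ x) r = G'.toFun C x r) (M : ℕ) :
    sizeMean φ.kernel (layer d) lam G M w = sizeMean φ.kernel (layer d) lam G' M (origin d) := by
  conv_lhs => rw [← transl_origin w]
  exact sizeMean_aut _ _ _ _ _ (isAut_transl φ w) hG M _

theorem sizeSum_transl (lam : ℝ≥0) {G G' : Statistic (Hyp d)} {w : Hyp d}
    (hG : ∀ C x r, G.toFun C (transl w ∘ x) r = G'.toFun C x r) (N : ℕ) :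
    sizeSum φ.kernel (layer d) lam G N w = sizeSum φ.kernel (layer d) lam G' N (origin d) :=
  Finset.sum_congr rfl fun M _ => by rw [sizeMean_transl φ lam hG]

theorem sizeSum_one_eq_origin (lam : ℝ≥0) (N : ℕ) (w : Hyp d) :
    sizeSum φ.kernel (layer d) lam (.one _) N w
      = sizeSum φ.kernel (layer d) lam (.one _) N (origin d) :=
  sizeSum_transl φ lam (fun _ _ _ => rfl) N

theorem Statistic.inside_le_of_subset {X : Type*} [MeasurableSpace X] {A B : Set X}
    (hA : MeasurableSet A) (hB : MeasurableSet B) {x y : Node → X} (h : ∀ p, x p ∈ A → y p ∈ B)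
    (C : Set Node) (r : Node) :
    (Statistic.inside A hA).toFun C x r ≤ (Statistic.inside B hB).toFun C y r := by
  classical
  simp only [Statistic.inside, Statistic.ofSet]
  split_ifs with h1 h2
  · exact le_rfl
  · exact absurd (fun p hp => h p (h1 p hp)) h2
  · exact bot_le
  · exact le_rfl

/-- The probability that the cluster stays in a half-space is monotone in the distance of the
half-space. -/
theorem sizeMean_halfSp_mono (lam : ℝ≥0) {n n' : EuclideanSpace ℝ (Fin d)} {b b' : ℝ}
    (h : ‖n‖ ^ 2 = 1 + b ^ 2) (h' : ‖n'‖ ^ 2 = 1 + b' ^ 2) (hb : b' ≤ b) (hb0 : b ≤ 0) (M : ℕ) :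
    sizeMean φ.kernel (layer d) lam (.inside _ (measurableSet_halfSp n b)) M (origin d)
      ≤ sizeMean φ.kernel (layer d) lam (.inside _ (measurableSet_halfSp n' b')) M (origin d) := by
  obtain ⟨R, hR⟩ := exists_rot_halfSp_subset h h' hb hb0
  have hm : MeasurableSet (rot R ⁻¹' halfSp n' b') := (rot R).measurable (measurableSet_halfSp n' b')
  conv_rhs => rw [← rot_origin R]
  rw [sizeMean_aut _ _ _ _ (.inside _ hm) (isAut_rot φ R) (fun C x r => rfl)]
  exact sizeMean_mono _ _ _ (fun C x r =>
    Statistic.inside_le_of_subset _ hm (fun p hp => hR _ hp) C r) M _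

/-- Seen from `w`, the half-space is again a half-space, with offset minus the signed distance
function at `w`: points deeper inside see it farther away. -/
theorem exists_inside_transl {n : EuclideanSpace ℝ (Fin d)} {b : ℝ} (h : ‖n‖ ^ 2 = 1 + b ^ 2)
    (w : Hyp d) : ∃ (n' : EuclideanSpace ℝ (Fin d)) (b' : ℝ), ‖n'‖ ^ 2 = 1 + b' ^ 2 ∧
      (∀ x : Hyp d, sig n b (transl w x : EuclideanSpace ℝ (Fin d)) = sig n' b' x) ∧
      sig n b w = -b' := by
  obtain ⟨n', b', h1, h2⟩ := exists_sig_moebiusAdd n b w.norm_lt_one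
  refine ⟨n', b', by linarith, fun x => h2 x x.norm_lt_one, ?_⟩
  have := h2 0 (by simp)
  rwa [moebiusAdd_zero, sig_zero] at this

end Automorphisms

/-! ### Branching points and leaves of a tree -/

section Joints

variable {X β : Type*} (lev : X → ℤ) (key : ℤ → X → β)

/-- The cells in which the paths from two elements of `P` upwards meet. -/
def joints (P : Finset X) : Set (ℤ × β) :=
  {v | ∃ p ∈ P, ∃ q ∈ P, lev p < v.1 ∧ lev q < v.1 ∧ key v.1 p = v.2 ∧ key v.1 q = v.2 ∧
    key (v.1 - 1) p ≠ key (v.1 - 1) q}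

/-- A tree has at most as many branching points as it has leaves. -/
theorem encard_joints_le
    (hkey : ∀ {l l' : ℤ} {x y : X}, l ≤ l' → key l x = key l y → key l' x = key l' y)
    (P : Finset X) : (joints lev key P).encard ≤ P.card := by
  classical
  induction P using Finset.induction_on with
  | empty =>
    have : joints lev key (∅ : Finset X) = ∅ := by
      ext v
      simp [joints]
    simp [this]
  | insert r P hr ih =>
    have hnew : ∀ v ∈ joints lev key (insert r P) \ joints lev key P, ∃ q ∈ P, lev r < v.1 ∧
        lev q < v.1 ∧ key v.1 r = v.2 ∧ key v.1 q = v.2 ∧ key (v.1 - 1) r ≠ key (v.1 - 1) q := by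
      rintro v ⟨⟨p, hp, q, hq, h1, h2, h3, h4, h5⟩, hv⟩
      rw [Finset.mem_insert] at hp hq
      rcases hp with rfl | hp <;> rcases hq with rfl | hq
      · exact absurd rfl h5
      · exact ⟨q, hq, h1, h2, h3, h4, h5⟩
      · exact ⟨p, hp, h2, h1, h4, h3, h5.symm⟩
      · exact absurd ⟨p, hp, q, hq, h1, h2, h3, h4, h5⟩ hv
    -- A new leaf adds at most the cell where its upward path first meets the old tree. From there
    -- on the path agrees with that of an old element `q`, so a higher joint of the new leaf is
    -- already a joint of two old elements.
    have hlt : ∀ v ∈ joints lev key (insert r P) \ joints lev key P,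
        ∀ v' ∈ joints lev key (insert r P) \ joints lev key P, ¬ v.1 < v'.1 := by
      intro v hv v' hv' hlt
      obtain ⟨q, hq, -, h2, h3, h4, -⟩ := hnew v hv
      obtain ⟨q', hq', -, h2', h3', h4', h5'⟩ := hnew v' hv'
      have hqr : ∀ l, v.1 ≤ l → key l q = key l r := fun l hl => hkey hl (h4.trans h3.symm)
      refine hv'.2 ⟨q, hq, q', hq', h2.trans hlt, h2', ?_, h4', ?_⟩
      · rw [hqr _ hlt.le, h3']
      · rwa [hqr _ (by omega)]
    have hsub : (joints lev key (insert r P) \ joints lev key P).encard ≤ 1 := by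
      rw [encard_le_one_iff]
      intro v v' hv hv'
      have h : v.1 = v'.1 := le_antisymm (not_lt.1 (hlt v' hv' v hv)) (not_lt.1 (hlt v hv v' hv'))
      obtain ⟨q, -, -, -, h3, -, -⟩ := hnew v hv
      obtain ⟨q', -, -, -, h3', -, -⟩ := hnew v' hv'
      refine Prod.ext h ?_
      rw [← h3, ← h3', h]
    have h := encard_le_encard (t := joints lev key P ∪ (joints lev key (insert r P) \
      joints lev key P)) (subset_union_right.trans_eq union_sdiff_self.symm :
        joints lev key (insert r P) ⊆ _)
    refine h.trans ((encard_union_le _ _).trans ?_)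
    rw [Finset.card_insert_of_notMem hr, Nat.cast_add, Nat.cast_one]
    exact add_le_add ih hsub

/-- If every bad element is a branching point of a dyadic tree, then, up to elements in crowded
cells, the good elements have positive density. -/
theorem card_le_of_branching
    (hkey : ∀ {l l' : ℤ} {x y : X}, l ≤ l' → key l x = key l y → key l' x = key l' y)
    (C : Finset X) (good crowd : X → Prop) [DecidablePred good] [DecidablePred crowd] (K : ℕ)
    (hgood : ∀ p ∈ C, ¬ good p → ∃ q ∈ C, ∃ q' ∈ C, lev q < lev p ∧ lev q' < lev p ∧
      key (lev p) q = key (lev p) p ∧ key (lev p) q' = key (lev p) p ∧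
      key (lev p - 1) q ≠ key (lev p - 1) q')
    (hcrowd : ∀ p ∈ C, ¬ crowd p → ∀ Q ⊆ C,
      (∀ q ∈ Q, lev q = lev p ∧ key (lev p) q = key (lev p) p) → Q.card ≤ K) :
    C.card ≤ (K + 1) * (C.filter good).card + (C.filter crowd).card := by
  classical
  -- Below every element there is a good one: a bad element has an element of strictly lower level
  -- below it, and by finiteness the descent stops. The induction is on the number of elements of
  -- lower level.
  have hleaf : ∀ n : ℕ, ∀ q ∈ C, (C.filter fun r => lev r < lev q).card ≤ n →
      ∃ a ∈ C.filter good, lev a ≤ lev q ∧ key (lev q) a = key (lev q) q := by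
    intro n
    induction n with
    | zero =>
      intro q hq hn
      refine ⟨q, ?_, le_rfl, rfl⟩
      rw [Finset.mem_filter]
      refine ⟨hq, by_contra fun hg => ?_⟩
      obtain ⟨r, hr, -, -, h, -⟩ := hgood q hq hg
      have : r ∈ C.filter fun r => lev r < lev q := Finset.mem_filter.2 ⟨hr, h⟩
      rw [Nat.le_zero, Finset.card_eq_zero] at hn
      rw [hn] at this
      simp at this
    | succ n ih =>
      intro q hq hn
      by_cases hg : good q
      · exact ⟨q, Finset.mem_filter.2 ⟨hq, hg⟩, le_rfl, rfl⟩
      obtain ⟨r, hr, -, -, h, -, h1, -⟩ := hgood q hq hg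
      obtain ⟨a, ha, h2, h3⟩ := ih r hr (by
        refine Nat.lt_succ_iff.1 (lt_of_lt_of_le (Finset.card_lt_card ?_) hn)
        refine Finset.ssubset_iff_subset_ne.2 ⟨fun s hs => ?_, fun he => ?_⟩
        · rw [Finset.mem_filter] at hs ⊢
          exact ⟨hs.1, hs.2.trans h⟩
        · have : r ∈ C.filter fun s => lev s < lev r := by
            rw [he]
            exact Finset.mem_filter.2 ⟨hr, h⟩
          exact lt_irrefl _ (Finset.mem_filter.1 this).2)
      exact ⟨a, ha, h2.trans h.le, (hkey h.le h3).trans h1⟩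
  set B := C.filter fun p => ¬ good p ∧ ¬ crowd p with hB
  set cell : X → ℤ × β := fun p => (lev p, key (lev p) p) with hcell
  -- Uncrowded elements share their cell with few others, so they are counted through their cells.
  have h1 : B.card ≤ K * (B.image cell).card := by
    refine Finset.card_le_mul_card_image B K fun v hv => ?_
    obtain ⟨p, hp, rfl⟩ := Finset.mem_image.1 hv
    rw [hB, Finset.mem_filter] at hp
    refine hcrowd p hp.1 hp.2.2 _ (fun q hq => ?_) fun q hq => ?_
    · exact (Finset.mem_filter.1 (Finset.mem_filter.1 hq).1).1
    · have h := (Finset.mem_filter.1 hq).2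
      simp only [hcell, Prod.mk.injEq] at h
      exact ⟨h.1, by rw [← h.2, h.1]⟩
  -- In the cell of a bad element the paths of two elements meet which are still in different cells
  -- one level lower. Replacing them by good elements below them makes the cell a joint of good
  -- elements.
  have h2 : (B.image cell).card ≤ (C.filter good).card := by
    have h := encard_joints_le lev key hkey (C.filter good)
    rw [← ENat.natCast_le_natCast, ← encard_coe_eq_coe_finsetCard]
    refine (encard_le_encard ?_).trans h
    intro v hv
    obtain ⟨p, hp, rfl⟩ := Finset.mem_image.1 (Finset.mem_coe.1 hv)
    rw [hB, Finset.mem_filter] at hp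
    obtain ⟨q, hq, q', hq', h3, h4, h5, h6, h7⟩ := hgood p hp.1 hp.2.1
    obtain ⟨a, ha, ha1, ha2⟩ := hleaf _ q hq le_rfl
    obtain ⟨a', ha', ha1', ha2'⟩ := hleaf _ q' hq' le_rfl
    refine ⟨a, ha, a', ha', ha1.trans_lt h3, ha1'.trans_lt h4, ?_, ?_, ?_⟩
    · exact (hkey h3.le ha2).trans h5
    · exact (hkey h4.le ha2').trans h6
    · simp only [hcell]
      rwa [hkey (Int.le_sub_one_of_lt h3) ha2, hkey (Int.le_sub_one_of_lt h4) ha2']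
  have h3 : C.card ≤ ((C.filter good).card + (C.filter crowd).card) + B.card := by
    refine le_trans (Finset.card_le_card fun p hp => ?_)
      ((Finset.card_union_le _ _).trans (add_le_add (Finset.card_union_le _ _) le_rfl))
    simp only [Finset.mem_union, Finset.mem_filter, hB]
    tauto
  nlinarith [Nat.mul_le_mul_left K h2]

end Joints

/-! ### The upper half-space model -/

section UpperHalfSpace

variable {d : ℕ} (i₀ : Fin d)

/-- The boundary point which is sent to infinity. -/
def pole : EuclideanSpace ℝ (Fin d) := EuclideanSpace.single i₀ 1

/-- The coordinates of the upper half-space model, up to the sign of the vertical one. -/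
def upper (x : EuclideanSpace ℝ (Fin d)) : EuclideanSpace ℝ (Fin d) :=
  pole i₀ + (2 / ‖x - pole i₀‖ ^ 2) • (x - pole i₀)

/-- The height in the upper half-space model. -/
def height (x : EuclideanSpace ℝ (Fin d)) : ℝ := (1 - ‖x‖ ^ 2) / ‖x - pole i₀‖ ^ 2

theorem norm_pole : ‖pole i₀‖ = 1 := by simp [pole]

theorem inner_pole (x : EuclideanSpace ℝ (Fin d)) : inner ℝ x (pole i₀) = x i₀ := by
  simp [pole, EuclideanSpace.inner_single_right]

variable {i₀}

theorem norm_sub_pole_pos {x : EuclideanSpace ℝ (Fin d)} (hx : ‖x‖ < 1) :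
    0 < ‖x - pole i₀‖ ^ 2 := by
  have : 0 < ‖x - pole i₀‖ := by
    rw [norm_pos_iff, sub_ne_zero]
    rintro rfl
    rw [norm_pole] at hx
    exact lt_irrefl _ hx
  positivity

theorem norm_sub_pole_sq (x : EuclideanSpace ℝ (Fin d)) :
    ‖x - pole i₀‖ ^ 2 = ‖x‖ ^ 2 - 2 * x i₀ + 1 := by
  rw [norm_sub_sq_real, inner_pole, norm_pole, one_pow]

theorem height_pos {x : EuclideanSpace ℝ (Fin d)} (hx : ‖x‖ < 1) : 0 < height i₀ x :=
  div_pos (one_sub_norm_sq_pos hx) (norm_sub_pole_pos hx)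

theorem upper_apply_pole {x : EuclideanSpace ℝ (Fin d)} (hx : ‖x‖ < 1) :
    upper i₀ x i₀ = -height i₀ x := by
  have h := (norm_sub_pole_pos (i₀ := i₀) hx).ne'
  have h1 : upper i₀ x i₀ = 1 + 2 / ‖x - pole i₀‖ ^ 2 * (x i₀ - 1) := by
    simp [upper, pole]
  have h2 := norm_sub_pole_sq (i₀ := i₀) x
  rw [h1, height]
  generalize ‖x - pole i₀‖ ^ 2 = N at *
  field_simp
  linear_combination h2

theorem norm_upper_sub_sq {x y : EuclideanSpace ℝ (Fin d)} (hx : ‖x‖ < 1) (hy : ‖y‖ < 1) :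
    ‖upper i₀ x - upper i₀ y‖ ^ 2
      = 4 * ‖x - y‖ ^ 2 / (‖x - pole i₀‖ ^ 2 * ‖y - pole i₀‖ ^ 2) := by
  have h1 := (norm_sub_pole_pos (i₀ := i₀) hx).ne'
  have h2 := (norm_sub_pole_pos (i₀ := i₀) hy).ne'
  have h3 : x - y = (x - pole i₀) - (y - pole i₀) := by abel
  rw [h3, upper, upper, add_sub_add_left_eq_sub]
  generalize x - pole i₀ = a at *
  generalize y - pole i₀ = b at *
  rw [norm_sub_sq_real, norm_sub_sq_real, norm_smul, norm_smul, inner_smul_left, inner_smul_right,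
    mul_pow, mul_pow, Real.norm_eq_abs, Real.norm_eq_abs, sq_abs, sq_abs]
  simp only [conj_trivial]
  generalize ‖a‖ ^ 2 = A at *
  generalize ‖b‖ ^ 2 = B at *
  field_simp
  ring

/-- A hemisphere centred at the boundary of the upper half-space is a hyperplane. -/
theorem exists_sig_hemisphere {z : EuclideanSpace ℝ (Fin d)} (hz : z i₀ = 0) {s : ℝ}
    (hs : 0 < s) : ∃ (n : EuclideanSpace ℝ (Fin d)) (b : ℝ), ‖n‖ ^ 2 = 1 + b ^ 2 ∧
      ∀ x, ‖x‖ < 1 → sig n b x = (‖upper i₀ x - z‖ ^ 2 - s ^ 2) / (2 * s * height i₀ x) := by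
  -- The normal and offset come from expanding ‖upper x - z‖² = s² in ball coordinates; the factor
  -- 1/(2s) normalizes ‖n‖² - b² to 1. Positive values are outside the hemisphere.
  set Q := 1 + ‖z‖ ^ 2 - s ^ 2 with hQ
  refine ⟨(2 * s)⁻¹ • ((2 - Q) • pole i₀ - (2 : ℝ) • z), -Q / (2 * s), ?_, fun x hx => ?_⟩
  · have h : inner ℝ (pole i₀) z = 0 := by rw [real_inner_comm, inner_pole, hz]
    rw [norm_smul, mul_pow, norm_sub_sq_real, norm_smul, norm_smul, inner_smul_left,
      inner_smul_right, h, norm_pole, mul_pow, mul_pow, Real.norm_eq_abs, Real.norm_eq_abs,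
      Real.norm_eq_abs, sq_abs, sq_abs, sq_abs, mul_zero, mul_zero, mul_zero]
    field_simp
    rw [hQ]
    ring
  · have h1 := (norm_sub_pole_pos (i₀ := i₀) hx)
    have h2 := one_sub_norm_sq_pos hx
    have h3 : ‖upper i₀ x - z‖ ^ 2 = 1 + ‖z‖ ^ 2
        + 4 * (1 + (x i₀ - 1) - inner ℝ x z) / ‖x - pole i₀‖ ^ 2 := by
      have h4 : upper i₀ x - z
          = (2 / ‖x - pole i₀‖ ^ 2) • (x - pole i₀) + (pole i₀ - z) := by
        rw [upper]
        abel
      have h5 : ‖pole i₀ - z‖ ^ 2 = 1 + ‖z‖ ^ 2 := by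
        rw [norm_sub_sq_real, real_inner_comm, inner_pole, hz, norm_pole]
        ring
      have h6 : inner ℝ (x - pole i₀) (pole i₀ - z) = x i₀ - 1 - inner ℝ x z := by
        rw [inner_sub_left, inner_sub_right, inner_sub_right, inner_pole, inner_pole,
          real_inner_comm z (pole i₀), inner_pole, hz]
        simp [pole]
        ring
      rw [h4, norm_add_sq_real, h5, norm_smul, inner_smul_left, h6, mul_pow, Real.norm_eq_abs,
        sq_abs]
      simp only [conj_trivial]
      field_simp
      ring
    have h7 : inner ℝ ((2 * s)⁻¹ • ((2 - Q) • pole i₀ - (2 : ℝ) • z)) x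
        = (2 * s)⁻¹ * ((2 - Q) * x i₀ - 2 * inner ℝ x z) := by
      rw [inner_smul_left, inner_sub_left, inner_smul_left, inner_smul_left,
        real_inner_comm x (pole i₀), inner_pole, real_inner_comm x z]
      simp
    rw [sig, h3, h7, height]
    rw [norm_sub_pole_sq] at h1 ⊢
    have h1' := h1.ne'
    have h2' := h2.ne'
    have hs' := hs.ne'
    field_simp
    rw [hQ]
    ring

end UpperHalfSpace

/-! ### Dyadic cells in the upper half-space -/

section Dyadic

variable {d : ℕ} (i₀ : Fin d)

/-- The level of a point: its height is between `2 ^ l` and `2 ^ (l + 1)`. -/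
def level (x : Hyp d) : ℤ := Int.log 2 (height i₀ (x : EuclideanSpace ℝ (Fin d)))

/-- The dyadic cube of side `2 ^ l` below which a point lies. -/
def boxKey (l : ℤ) (x : Hyp d) : Fin d → ℤ := fun i =>
  if i = i₀ then 0 else ⌊upper i₀ (x : EuclideanSpace ℝ (Fin d)) i / 2 ^ l⌋

variable {i₀}

/-- Dyadic cubes are nested: the index at one level is half the index one level below, rounded down.
The vertical coordinate is frozen at 0. -/
theorem boxKey_succ (l : ℤ) (x : Hyp d) (i : Fin d) :
    boxKey i₀ l x i = boxKey i₀ (l - 1) x i / 2 := by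
  unfold boxKey
  split_ifs with h
  · rfl
  · have h1 := Int.floor_div_natCast
      (upper i₀ (x : EuclideanSpace ℝ (Fin d)) i / (2 : ℝ) ^ (l - 1)) 2
    have h2 : (2 : ℝ) ^ l = 2 ^ (l - 1) * 2 := by
      rw [← zpow_add_one₀ two_ne_zero, sub_add_cancel]
    rw [div_div, Nat.cast_ofNat, ← h2] at h1
    exact_mod_cast h1

theorem boxKey_eq_of_le {l l' : ℤ} {x y : Hyp d} (hl : l ≤ l')
    (h : boxKey i₀ l x = boxKey i₀ l y) : boxKey i₀ l' x = boxKey i₀ l' y := by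
  induction l', hl using Int.leInduction with
  | base => exact h
  | succ n _ ih =>
    funext i
    rw [boxKey_succ, boxKey_succ (n + 1) y, add_sub_cancel_right, ih]

theorem zpow_level_le (x : Hyp d) : (2 : ℝ) ^ level i₀ x ≤ height i₀ x := by
  have := Int.zpow_log_le_self (b := 2) one_lt_two (height_pos (i₀ := i₀) x.norm_lt_one)
  exact_mod_cast this

theorem height_lt (x : Hyp d) : height i₀ x < (2 : ℝ) ^ level i₀ x * 2 := by
  have := Int.lt_zpow_succ_log_self (b := 2) one_lt_two
    (height i₀ (x : EuclideanSpace ℝ (Fin d)))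
  rw [← zpow_add_one₀ two_ne_zero]
  exact_mod_cast this

theorem level_lt_iff {x : Hyp d} {l : ℤ} : level i₀ x < l ↔ height i₀ x < (2 : ℝ) ^ l := by
  have := Int.lt_zpow_iff_log_lt (b := 2) one_lt_two (x := l)
    (height_pos (i₀ := i₀) x.norm_lt_one)
  rw [level, ← this]
  norm_num

/-- Within a cell all coordinates in the upper half-space differ by at most 2^l while the heights
are at least 2^l, so the hyperbolic distance is bounded independently of the cell. -/
theorem mem_nearRel_of_cell {x y : Hyp d} (hl : level i₀ y = level i₀ x)
    (hk : boxKey i₀ (level i₀ x) y = boxKey i₀ (level i₀ x) x) : (x, y) ∈ nearRel d d := by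
  set l := level i₀ x with hl'
  have hx := x.norm_lt_one
  have hy := y.norm_lt_one
  have hpos : (0 : ℝ) < 2 ^ l := zpow_pos two_pos l
  have hcoord : ∀ i, (upper i₀ x i - upper i₀ y i) ^ 2 ≤ ((2 : ℝ) ^ l) ^ 2 := by
    intro i
    rw [sq_le_sq, abs_of_pos hpos]
    by_cases hi : i = i₀
    · rw [hi, upper_apply_pole hx, upper_apply_pole hy, abs_le]
      have h1 := zpow_level_le (i₀ := i₀) x
      have h2 := zpow_level_le (i₀ := i₀) y
      have h3 := height_lt (i₀ := i₀) x
      have h4 := height_lt (i₀ := i₀) y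
      rw [hl] at h2 h4
      constructor <;> linarith
    · have h1 := congrFun hk i
      simp only [boxKey, if_neg hi] at h1
      have h2 := Int.abs_sub_lt_one_of_floor_eq_floor h1.symm
      rw [← sub_div, abs_div, abs_of_pos hpos, div_lt_one hpos] at h2
      exact h2.le
  have hnorm : ‖upper i₀ (x : EuclideanSpace ℝ (Fin d)) - upper i₀ y‖ ^ 2
      ≤ d * ((2 : ℝ) ^ l) ^ 2 := by
    rw [EuclideanSpace.real_norm_sq_eq]
    refine (Finset.sum_le_sum fun i _ => hcoord i).trans ?_
    simp
  have hhx := zpow_level_le (i₀ := i₀) x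
  have hhy := zpow_level_le (i₀ := i₀) y
  rw [hl] at hhy
  have hhh := mul_le_mul hhx hhy hpos.le (hpos.le.trans hhx)
  have h1 := norm_sub_pole_pos (i₀ := i₀) hx
  have h2 := norm_sub_pole_pos (i₀ := i₀) hy
  rw [norm_upper_sub_sq hx hy, div_le_iff₀ (mul_pos h1 h2)] at hnorm
  have h3 : height i₀ (x : EuclideanSpace ℝ (Fin d)) * height i₀ (y : EuclideanSpace ℝ (Fin d))
      * (‖(x : EuclideanSpace ℝ (Fin d)) - pole i₀‖ ^ 2
        * ‖(y : EuclideanSpace ℝ (Fin d)) - pole i₀‖ ^ 2)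
      = (1 - ‖(x : EuclideanSpace ℝ (Fin d))‖ ^ 2) * (1 - ‖(y : EuclideanSpace ℝ (Fin d))‖ ^ 2) := by
    rw [height, height, div_mul_div_comm, div_mul_cancel₀ _ (mul_pos h1 h2).ne']
  have hd : (0 : ℝ) ≤ d := Nat.cast_nonneg d
  rw [nearRel, mem_ofPred_eq, ← h3]
  simp only
  have h4 := mul_le_mul_of_nonneg_left (mul_le_mul_of_nonneg_right hhh (mul_pos h1 h2).le) hd
  have h5 := sq_nonneg ‖(x : EuclideanSpace ℝ (Fin d)) - y‖
  linarith

theorem abs_sub_le_of_floor {a h : ℝ} {c : ℤ} (hh : 0 < h) (hc : |a - (c + 1 / 2) * h| ≤ h / 4) :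
    ⌊a / h⌋ = c := by
  rw [Int.floor_eq_iff, le_div_iff₀ hh, div_lt_iff₀ hh]
  have := abs_le.1 hc
  constructor <;> nlinarith

/-- Either there are points below a given dyadic cube in its lower half, or it can be separated by
a hyperplane from a point of the cell. -/
theorem exists_below_or_sig {ι : Type*} (C : Set ι) (x : ι → Hyp d) {p : ι} (e : ℤ) (he : e = 0 ∨ e = 1) :
    (∃ q ∈ C, level i₀ (x q) < level i₀ (x p) ∧
      ∀ i, i ≠ i₀ → boxKey i₀ (level i₀ (x p) - 1) (x q) i
        = 2 * boxKey i₀ (level i₀ (x p)) (x p) i + e) ∨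
    ∃ (n : EuclideanSpace ℝ (Fin d)) (b : ℝ), ‖n‖ ^ 2 = 1 + b ^ 2 ∧
      (∀ q ∈ C, 0 < sig n b (x q)) ∧ sig n b (x p) < 8 * d + 9 := by
  rw [or_iff_not_imp_left]
  intro hno
  push Not at hno
  set l := level i₀ (x p) with hl
  set k := boxKey i₀ l (x p) with hk
  have hpos : (0 : ℝ) < 2 ^ l := zpow_pos two_pos l
  have hhalf : (2 : ℝ) ^ (l - 1) = 2 ^ l / 2 := by rw [zpow_sub_one₀ two_ne_zero, div_eq_mul_inv]
  -- The hemisphere is centred below the middle of a corner subcube of side 2^l / 2, and its radius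
  -- is a quarter of that side. A point in it has height below 2^l and lies below this subcube, so
  -- if there is no such point all of `C` is strictly outside.
  set s : ℝ := 2 ^ l / 8 with hs
  have hs0 : 0 < s := by positivity
  set z : EuclideanSpace ℝ (Fin d) := WithLp.toLp 2 fun i =>
    if i = i₀ then 0 else (((2 * k i + e : ℤ) : ℝ) + 1 / 2) * (2 ^ l / 2) with hz
  have hz0 : z i₀ = 0 := by simp [hz]
  have hzi : ∀ i, i ≠ i₀ → z i = (((2 * k i + e : ℤ) : ℝ) + 1 / 2) * (2 ^ l / 2) := fun i hi => by
    simp [hz, hi]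
  obtain ⟨n, b, hn, hsig⟩ := exists_sig_hemisphere hz0 hs0
  refine ⟨n, b, hn, fun q hq => ?_, ?_⟩
  · have hh := height_pos (i₀ := i₀) (x q).norm_lt_one
    rw [hsig _ (x q).norm_lt_one]
    refine div_pos ?_ (by positivity)
    by_contra! hle
    have hcoord : ∀ i, |upper i₀ (x q : EuclideanSpace ℝ (Fin d)) i - z i| ≤ s := by
      intro i
      rw [← abs_of_pos hs0, ← sq_le_sq]
      refine le_trans ?_ (sub_nonpos.1 hle)
      rw [EuclideanSpace.real_norm_sq_eq]
      exact Finset.single_le_sum (f := fun i => ((upper i₀ (x q : EuclideanSpace ℝ (Fin d)) - z) i) ^ 2)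
        (fun i _ => sq_nonneg _) (Finset.mem_univ i)
    have h0 := hcoord i₀
    rw [hz0, upper_apply_pole (x q).norm_lt_one, sub_zero, abs_neg, abs_of_pos hh] at h0
    obtain ⟨i, hi, hne⟩ := hno q hq (level_lt_iff.2 (by linarith))
    refine hne ?_
    rw [boxKey, if_neg hi, hhalf]
    refine abs_sub_le_of_floor (by positivity) ?_
    rw [← hzi i hi]
    refine (hcoord i).trans ?_
    linarith
  · have hh := zpow_level_le (i₀ := i₀) (x p)
    have hlt := height_lt (i₀ := i₀) (x p)
    rw [← hl] at hh hlt
    rw [hsig _ (x p).norm_lt_one,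
      div_lt_iff₀ (mul_pos (mul_pos two_pos hs0) (height_pos (x p).norm_lt_one))]
    have hcoord : ∀ i, ((upper i₀ (x p : EuclideanSpace ℝ (Fin d)) - z) i) ^ 2
        ≤ 2 * ((2 : ℝ) ^ l) ^ 2 + if i = i₀ then 2 * ((2 : ℝ) ^ l) ^ 2 else 0 := by
      intro i
      rw [PiLp.sub_apply]
      split_ifs with hi
      · rw [hi, hz0, upper_apply_pole (x p).norm_lt_one]
        nlinarith
      · rw [hzi i hi, add_zero]
        have h1 : ⌊upper i₀ (x p : EuclideanSpace ℝ (Fin d)) i / 2 ^ l⌋ = k i := by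
          rw [hk, boxKey, if_neg hi]
        rw [Int.floor_eq_iff, le_div_iff₀ hpos, div_lt_iff₀ hpos] at h1
        have h2 : |upper i₀ (x p : EuclideanSpace ℝ (Fin d)) i
            - (((2 * k i + e : ℤ) : ℝ) + 1 / 2) * (2 ^ l / 2)| ≤ (2 : ℝ) ^ l := by
          rw [abs_le]
          push_cast
          rcases he with rfl | rfl <;> push_cast <;> constructor <;> nlinarith
        have h3 := sq_le_sq' (abs_le.1 h2).1 (abs_le.1 h2).2
        linarith [sq_nonneg ((2 : ℝ) ^ l)]
    have h1 : ‖upper i₀ (x p : EuclideanSpace ℝ (Fin d)) - z‖ ^ 2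
        ≤ (2 * d + 2) * ((2 : ℝ) ^ l) ^ 2 := by
      rw [EuclideanSpace.real_norm_sq_eq]
      refine (Finset.sum_le_sum fun i _ => hcoord i).trans ?_
      rw [Finset.sum_add_distrib]
      simp
      linarith
    -- The numerator of `sig` at `x p` is at most (2d + 2) 4^l and the denominator at least 4^l / 4,
    -- so the quotient is at most 8d + 8 < 8d + 9.
    have h2 : ((2 : ℝ) ^ l) ^ 2 / 4 ≤ 2 * s * height i₀ (x p : EuclideanSpace ℝ (Fin d)) := by
      rw [hs]
      nlinarith
    have hd : (0 : ℝ) ≤ d := Nat.cast_nonneg d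
    have h3 := mul_le_mul_of_nonneg_left h2 (by linarith : (0 : ℝ) ≤ 8 * d + 9)
    have h4 : 0 < ((2 : ℝ) ^ l) ^ 2 := by positivity
    nlinarith [sq_nonneg s]

end Dyadic

/-! ### Points near a supporting hyperplane of a finite set -/

section Good

variable {d : ℕ}

/-- The root is close to a hyperplane with the whole cluster on one side. -/
def NearSupport (S : ℝ) (C : Set Node) (x : Node → Hyp d) (r : Node) : Prop :=
  C.Finite ∧ ∃ z : EuclideanSpace ℝ (Fin d) × ℝ, 1 + z.2 ^ 2 < ‖z.1‖ ^ 2 ∧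
    (∀ q ∈ C, 0 < sig z.1 z.2 (x q)) ∧ sig z.1 z.2 (x r) < S

theorem continuous_sig (x : EuclideanSpace ℝ (Fin d)) :
    Continuous fun z : EuclideanSpace ℝ (Fin d) × ℝ => sig z.1 z.2 x := by
  unfold sig
  fun_prop

/-- For a finite set the conditions on the hyperplane are finitely many strict inequalities, so a
dense sequence of parameters suffices. This gives measurability, and is why the normalization of the
normal is replaced by a strict inequality. -/
theorem nearSupport_iff (S : ℝ) (C : Set Node) (x : Node → Hyp d) (r : Node) :
    NearSupport S C x r ↔ C.Finite ∧ ∃ k : ℕ,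
      1 + (TopologicalSpace.denseSeq (EuclideanSpace ℝ (Fin d) × ℝ) k).2 ^ 2
        < ‖(TopologicalSpace.denseSeq (EuclideanSpace ℝ (Fin d) × ℝ) k).1‖ ^ 2 ∧
      (∀ q ∈ C, 0 < sig (TopologicalSpace.denseSeq (EuclideanSpace ℝ (Fin d) × ℝ) k).1
        (TopologicalSpace.denseSeq (EuclideanSpace ℝ (Fin d) × ℝ) k).2 (x q)) ∧
      sig (TopologicalSpace.denseSeq (EuclideanSpace ℝ (Fin d) × ℝ) k).1
        (TopologicalSpace.denseSeq (EuclideanSpace ℝ (Fin d) × ℝ) k).2 (x r) < S := by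
  refine and_congr_right fun hC => ⟨fun h => ?_, fun ⟨k, hk⟩ => ⟨_, hk⟩⟩
  set O : Set (EuclideanSpace ℝ (Fin d) × ℝ) := {z | 1 + z.2 ^ 2 < ‖z.1‖ ^ 2} ∩
    ((⋂ q ∈ C, {z | 0 < sig z.1 z.2 (x q)}) ∩ {z | sig z.1 z.2 (x r) < S}) with hO
  have hopen : IsOpen O := by
    refine (isOpen_lt (by fun_prop) (by fun_prop)).inter (IsOpen.inter ?_ ?_)
    · exact hC.isOpen_biInter fun q _ => isOpen_lt continuous_const (continuous_sig _)
    · exact isOpen_lt (continuous_sig _) continuous_const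
  obtain ⟨z, h1, h2, h3⟩ := h
  obtain ⟨k, hk⟩ := (TopologicalSpace.denseRange_denseSeq
    (EuclideanSpace ℝ (Fin d) × ℝ)).exists_mem_open hopen ⟨z, h1, mem_iInter₂.2 h2, h3⟩
  exact ⟨k, hk.1, fun q hq => mem_iInter₂.1 hk.2.1 q hq, hk.2.2⟩

theorem measurableSet_nearSupport (S : ℝ) (r : Node) :
    MeasurableSet {z : Set Node × (Node → Hyp d) | NearSupport S z.1 z.2 r} := by
  have hs : ∀ (n : EuclideanSpace ℝ (Fin d)) b (q : Node),
      Measurable fun z : Set Node × (Node → Hyp d) => sig n b (z.2 q : EuclideanSpace ℝ (Fin d)) :=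
    fun n b q => (measurable_sig n b).comp (measurable_snd_apply q)
  have hset : {z : Set Node × (Node → Hyp d) | NearSupport S z.1 z.2 r} = {z | z.1.Finite} ∩
      ⋃ k : ℕ, ({_z | 1 + (TopologicalSpace.denseSeq (EuclideanSpace ℝ (Fin d) × ℝ) k).2 ^ 2
        < ‖(TopologicalSpace.denseSeq (EuclideanSpace ℝ (Fin d) × ℝ) k).1‖ ^ 2} ∩
      ((⋂ q, ({z | q ∈ z.1}ᶜ ∪
        {z | 0 < sig (TopologicalSpace.denseSeq (EuclideanSpace ℝ (Fin d) × ℝ) k).1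
          (TopologicalSpace.denseSeq (EuclideanSpace ℝ (Fin d) × ℝ) k).2 (z.2 q)})) ∩
      {z | sig (TopologicalSpace.denseSeq (EuclideanSpace ℝ (Fin d) × ℝ) k).1
        (TopologicalSpace.denseSeq (EuclideanSpace ℝ (Fin d) × ℝ) k).2 (z.2 r) < S})) := by
    ext z
    rw [mem_ofPred_eq, nearSupport_iff]
    simp [imp_iff_not_or]
  rw [hset]
  refine MeasurableSet.inter (measurable_fst MeasurableSet.setOfPred_finite)
    (MeasurableSet.iUnion fun k => (MeasurableSet.const _).inter (MeasurableSet.inter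
      (MeasurableSet.iInter fun q => ?_) (measurableSet_lt (hs _ _ r) measurable_const)))
  exact (measurable_fst_mem q).compl.union (measurableSet_lt measurable_const (hs _ _ q))

/-- The indicator that the root is close to a supporting hyperplane of the cluster. -/
def Statistic.nearSupport (d : ℕ) (S : ℝ) : Statistic (Hyp d) :=
  .ofSet (NearSupport S) (measurableSet_nearSupport S)
    (fun C x x' r hr h ⟨hC, z, h1, h2, h3⟩ =>
      ⟨hC, z, h1, fun q hq => h q hq ▸ h2 q hq, h r hr ▸ h3⟩)
    (fun σ C x r => ⟨fun ⟨hC, z, h1, h2, h3⟩ => ⟨by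
      have := hC.image σ
      rwa [image_preimage_eq _ σ.surjective] at this, z, h1, fun q hq => by
        simpa using h2 (σ.symm q) (by simpa using hq), h3⟩,
      fun ⟨hC, z, h1, h2, h3⟩ => ⟨hC.preimage σ.injective.injOn, z, h1,
        fun q hq => h2 (σ q) hq, h3⟩⟩)

theorem NearSupport.of_transl {S : ℝ} {C : Set Node} {x : Node → Hyp d} {r : Node} (w : Hyp d)
    (h : NearSupport S C (transl w ∘ x) r) : NearSupport S C x r := by
  obtain ⟨hC, ⟨n, b⟩, h1, h2, h3⟩ := h
  obtain ⟨n', b', h4, h5⟩ := exists_sig_moebiusAdd n b w.norm_lt_one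
  have h6 : ∀ q, sig n b ((transl w ∘ x) q : EuclideanSpace ℝ (Fin d)) = sig n' b' (x q) :=
    fun q => h5 _ (x q).norm_lt_one
  simp only at h1 h2 h3
  rw [h6] at h3
  exact ⟨hC, ⟨n', b'⟩, by simp only; linarith, fun q hq => h6 q ▸ h2 q hq, h3⟩

theorem nearSupport_transl_iff {S : ℝ} {C : Set Node} {x : Node → Hyp d} {r : Node} (w : Hyp d) :
    NearSupport S C (transl w ∘ x) r ↔ NearSupport S C x r := by
  refine ⟨fun h => h.of_transl w, fun h => NearSupport.of_transl (negPt w) ?_⟩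
  have : transl (negPt w) ∘ transl w ∘ x = x :=
    funext fun q => translateOrigin_neg_cancel w (x q)
  rwa [this]

/-- Scaling normal and offset by a factor slightly above 1 makes the normalization strict and keeps
the other strict inequalities. -/
theorem nearSupport_of_normalized {S : ℝ} {C : Set Node} {x : Node → Hyp d} {r : Node}
    (hC : C.Finite) {n : EuclideanSpace ℝ (Fin d)} {b : ℝ} (hn : ‖n‖ ^ 2 = 1 + b ^ 2)
    (h : ∀ q ∈ C, 0 < sig n b (x q)) (hr : sig n b (x r) < S) : NearSupport S C x r := by
  have hsig : ∀ (c : ℝ) (y : EuclideanSpace ℝ (Fin d)), sig (c • n) (c * b) y = c * sig n b y := by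
    intro c y
    rw [sig, sig, inner_smul_left, conj_trivial]
    ring
  obtain ⟨c, hc1, hc2⟩ : ∃ c : ℝ, c * sig n b (x r) < S ∧ 1 < c := by
    generalize sig n b (x r) = v at hr
    have h1 : ∀ᶠ c in 𝓝[>] (1 : ℝ), c * v < S :=
      nhdsWithin_le_nhds ((isOpen_lt (by fun_prop : Continuous fun c : ℝ => c * v)
        continuous_const).mem_nhds (by simpa using hr))
    have h2 : ∀ᶠ c in 𝓝[>] (1 : ℝ), 1 < c := eventually_mem_nhdsWithin
    exact (h1.and h2).exists
  refine ⟨hC, ⟨c • n, c * b⟩, ?_, fun q hq => ?_, ?_⟩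
  · simp only
    rw [norm_smul, mul_pow, mul_pow, hn, Real.norm_eq_abs, sq_abs]
    nlinarith
  · simp only
    rw [hsig]
    exact mul_pos (by linarith) (h q hq)
  · simp only
    rwa [hsig]

/-- In a finite set, a positive fraction of the points is close to a supporting hyperplane or
crowded. -/
theorem encard_le_nearSupport (hd : 2 ≤ d) (K : ℕ) (C : Set Node) (x : Node → Hyp d)
    (hC : C.Finite) : (C.encard : ℝ≥0∞)
      ≤ ((K : ℝ≥0∞) + 1) * ∑' p, C.indicator
          (fun p => (Statistic.nearSupport d (8 * d + 9)).toFun C x p) p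
        + ∑' p, C.indicator
          (fun p => (Statistic.crowd _ (measurableSet_nearRel d d) K).toFun C x p) p := by
  classical
  obtain ⟨C, rfl⟩ := hC.exists_finset_coe
  set i₀ : Fin d := ⟨0, by omega⟩
  set i₁ : Fin d := ⟨1, by omega⟩
  have hi : i₁ ≠ i₀ := by simp [i₀, i₁]
  obtain ⟨good, hgood⟩ : ∃ P : Node → Prop, P = NearSupport (8 * d + 9) (C : Set Node) x :=
    ⟨_, rfl⟩
  obtain ⟨crowd, hcrowd⟩ : ∃ P : Node → Prop, P = fun p =>
    (K : ℝ≥0∞) ≤ ((relatedTo (nearRel d d) (C : Set Node) x p).encard : ℝ≥0∞) := ⟨_, rfl⟩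
  have hG : ∀ p, (Statistic.nearSupport d (8 * d + 9)).toFun C x p = if good p then 1 else 0 := by
    intro p
    rw [hgood]
    rfl
  have hG' : ∀ p, (Statistic.crowd _ (measurableSet_nearRel d d) K).toFun C x p
      = if crowd p then 1 else 0 := by
    intro p
    rw [hcrowd]
    simp only [Statistic.crowd, Statistic.ofSet]
  simp only [hG, hG']
  have key := card_le_of_branching (fun p => level i₀ (x p)) (fun l p => boxKey i₀ l (x p))
    (fun hl h => boxKey_eq_of_le hl h) C good crowd K ?_ ?_
  · have hsum : ∀ P : Node → Prop, ((C.filter P).card : ℝ≥0∞)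
        ≤ ∑' p, (C : Set Node).indicator (fun p => if P p then (1 : ℝ≥0∞) else 0) p := by
      intro P
      refine le_trans (le_of_eq ?_) (ENNReal.sum_le_tsum C)
      rw [Finset.card_filter, Nat.cast_sum]
      refine Finset.sum_congr rfl fun p hp => ?_
      rw [indicator_of_mem (Finset.mem_coe.2 hp)]
      split_ifs <;> simp
    rw [encard_coe_eq_coe_finsetCard]
    calc (((C.card : ℕ) : ℕ∞) : ℝ≥0∞) = (C.card : ℝ≥0∞) := by simp
      _ ≤ (((K + 1) * (C.filter good).card + (C.filter crowd).card : ℕ) : ℝ≥0∞) := by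
        exact_mod_cast key
      _ ≤ _ := by
        push_cast
        exact add_le_add (mul_le_mul' le_rfl (hsum good)) (hsum crowd)
  · intro p hp hg
    -- A vertex which is not near a supporting hyperplane has vertices below both opposite corner
    -- subcubes. These subcubes differ because there is a horizontal coordinate `i₁`, which uses `2
    -- ≤ d`.
    have hb : ∀ e : ℤ, e = 0 ∨ e = 1 → ∃ q ∈ C, level i₀ (x q) < level i₀ (x p) ∧
        ∀ i, i ≠ i₀ → boxKey i₀ (level i₀ (x p) - 1) (x q) i
          = 2 * boxKey i₀ (level i₀ (x p)) (x p) i + e := by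
      intro e he
      rcases exists_below_or_sig (i₀ := i₀) (C : Set Node) x (p := p) e he with h | ⟨n, b, h1, h2, h3⟩
      · exact h
      · exact absurd (hgood ▸ nearSupport_of_normalized hC h1 h2 h3) hg
    have hk : ∀ e : ℤ, e = 0 ∨ e = 1 → ∀ q, (∀ i, i ≠ i₀ → boxKey i₀ (level i₀ (x p) - 1) (x q) i
          = 2 * boxKey i₀ (level i₀ (x p)) (x p) i + e) →
        boxKey i₀ (level i₀ (x p)) (x q) = boxKey i₀ (level i₀ (x p)) (x p) := by
      intro e he q hq
      funext i
      by_cases hi : i = i₀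
      · simp [boxKey, hi]
      · rw [boxKey_succ, hq i hi]
        omega
    obtain ⟨q, hq, h1, h2⟩ := hb 0 (Or.inl rfl)
    obtain ⟨q', hq', h1', h2'⟩ := hb 1 (Or.inr rfl)
    refine ⟨q, hq, q', hq', h1, h1', hk 0 (Or.inl rfl) q h2, hk 1 (Or.inr rfl) q' h2', fun he => ?_⟩
    have := congrFun he i₁
    rw [h2 i₁ hi, h2' i₁ hi] at this
    omega
  · intro p hp hc Q hQ hcell
    -- All vertices in the cell of `p` other than `p` are related to `p`. An uncrowded vertex has
    -- fewer than `K` of them, hence at most `K` in the cell including itself.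
    have h1 : ((Q.erase p : Finset Node) : Set Node) ⊆ relatedTo (nearRel d d) (C : Set Node) x p := by
      intro q hq
      rw [Finset.mem_coe, Finset.mem_erase] at hq
      exact ⟨hQ hq.2, hq.1, mem_nearRel_of_cell (hcell q hq.2).1 (hcell q hq.2).2⟩
    have h2 := encard_le_encard h1
    rw [encard_coe_eq_coe_finsetCard] at h2
    rw [hcrowd] at hc
    have h3 : ((Q.erase p).card : ℝ≥0∞) < K := by
      refine lt_of_le_of_lt ?_ (not_le.1 hc)
      have : (((Q.erase p).card : ℕ∞) : ℝ≥0∞) ≤ _ := ENat.toENNReal_le.2 h2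
      simpa using this
    have h4 : (Q.erase p).card < K := by exact_mod_cast h3
    have := Finset.pred_card_le_card_erase (s := Q) (a := p)
    omega

end Good

/-! ### The probability of crowding -/

section CrowdProbability

variable {X : Type*} [MeasurableSpace X] (φ : SymKernel X)
variable [Nonempty X] (ν : ℕ → FiniteMeasure X) (lam : ℝ≥0)

/-- Crowding is unlikely. -/
theorem sum_sizeMean_crowd_le {R : Set (X × X)} (hR : MeasurableSet R) (K N : ℕ) (o : X) :
    K * ∑ M ∈ Finset.range N, sizeMean φ ν lam (.crowd R hR K) M o
      ≤ lam * baseMeasure ν {y | (o, y) ∈ R} := by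
  classical
  set S : Node → Set (Conf X) := fun p => {ω | (ω.2.1 (Sum.inl 0), ω.2.1 p) ∈ R} with hS
  have hSm : ∀ p, MeasurableSet (S p) := fun p =>
    ((measurable_loc (Sum.inl 0)).prodMk (measurable_loc p)) hR
  set f : Conf X → Node → ℝ≥0∞ := fun ω p => (S p).indicator 1 ω with hf
  have hfm : ∀ p, Measurable fun ω => f ω p := fun p => measurable_one.indicator (hSm p)
  have hfinv : Equivariant {0} f := by
    intro σ hσ ω p
    have h0 := hσ 0 rfl
    have h2 : act σ ω ∈ S p ↔ ω ∈ S (σ p) := by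
      simp only [hS, mem_ofPred_eq]
      simp only [act, Function.comp_apply, h0]
    simp only [hf]
    by_cases h : ω ∈ S (σ p)
    · rw [indicator_of_mem h, indicator_of_mem (h2.2 h)]
      rfl
    · rw [indicator_of_notMem h, indicator_of_notMem (mt h2.1 h)]
  have hm := mecke ν lam (D := {0}) (k := 1) (by simp) (fun _ => o) hfm hfinv
  have hmE : ∀ M : ℕ, MeasurableSet {ω : Conf X | (rootClus φ ω).encard = M + 1} := fun M =>
    measurableSet_encard_eq (measurableSet_mem_clus φ _) _
  have hmi : ∀ M : ℕ, Measurable ({ω : Conf X | (rootClus φ ω).encard = M + 1}.indicator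
      fun ω => (Statistic.crowd R hR K).eval φ ω (Sum.inl 0)) := fun M =>
    (Statistic.measurable_eval φ _ _).indicator (hmE M)
  simp only [sizeMean_eq]
  rw [← expect_finset_sum ν lam _ hmi,
    ← expect_const_mul ν lam (Finset.measurable_sum _ fun M _ => hmi M)]
  have hle : expect ν lam {0} (fun _ => o) (fun ω => K * ∑ M ∈ Finset.range N,
        {ω : Conf X | (rootClus φ ω).encard = M + 1}.indicator
          (fun ω => (Statistic.crowd R hR K).eval φ ω (Sum.inl 0)) ω)
      ≤ expect ν lam {0} (fun _ => o) (fun ω => ∑' q : ℕ × ℕ,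
        ({ω : Conf X | Sum.inr q ∈ ω.1}).indicator (fun ω => f ω (Sum.inr q)) ω) := by
    refine expect_mono ν lam fun c x u => ?_
    set ω := mkConf {0} (pts c) (fun _ => o) x u with hω
    have hsub : rootClus φ ω ⊆ ω.1 := clus_subset φ rfl
    have hone : ∑ M ∈ Finset.range N, {ω : Conf X | (rootClus φ ω).encard = M + 1}.indicator
          (fun ω => (Statistic.crowd R hR K).eval φ ω (Sum.inl 0)) ω
        ≤ (Statistic.crowd R hR K).eval φ ω (Sum.inl 0) := by
      by_cases hex : ∃ M ∈ Finset.range N, (rootClus φ ω).encard = M + 1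
      · obtain ⟨M, hM, h⟩ := hex
        rw [Finset.sum_eq_single M]
        · exact indicator_le_self' (fun _ _ => bot_le) _
        · intro M' _ hne
          refine indicator_of_notMem (fun h' => hne ?_) _
          have h'' : ((M' : ℕ∞) + 1) = M + 1 := (show (rootClus φ ω).encard = M' + 1 from h').symm.trans h
          have h3 : M' + 1 = M + 1 := by exact_mod_cast h''
          omega
        · exact fun h => absurd hM h
      · push Not at hex
        refine (Finset.sum_eq_zero fun M hM => ?_).trans_le bot_le
        exact indicator_of_notMem
          (s := {ω : Conf X | (rootClus φ ω).encard = M + 1}) (hex M hM) _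
    refine (mul_le_mul' le_rfl hone).trans ?_
    rw [Statistic.eval, Statistic.crowd, Statistic.ofSet]
    simp only
    split_ifs with hK
    · rw [mul_one]
      refine hK.trans ?_
      set T := relatedTo R (clus φ ω (Sum.inl 0)) ω.2.1 (Sum.inl 0) with hT
      have hTinr : T ⊆ Sum.inr '' (Sum.inr ⁻¹' T : Set (ℕ × ℕ)) := by
        intro p hp
        rcases p with j | q
        · have h1 : j = 0 := hsub hp.1
          exact absurd (by rw [h1]) hp.2.1
        · exact ⟨q, hp, rfl⟩
      have hcard : (T.encard : ℝ≥0∞) ≤ ((Sum.inr ⁻¹' T : Set (ℕ × ℕ)).encard : ℝ≥0∞) := by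
        have := (encard_le_encard hTinr).trans (encard_image_le _ _)
        exact_mod_cast this
      refine hcard.trans ?_
      rw [← ENNReal.tsum_set_one, tsum_subtype (Sum.inr ⁻¹' T) (fun _ => (1 : ℝ≥0∞))]
      refine ENNReal.tsum_le_tsum fun q => ?_
      by_cases hq : q ∈ (Sum.inr ⁻¹' T : Set (ℕ × ℕ))
      · have hq' : Sum.inr q ∈ T := hq
        rw [indicator_of_mem hq, indicator_of_mem (s := {ω : Conf X | Sum.inr q ∈ ω.1})
          (hsub hq'.1), hf]
        simp only
        rw [indicator_of_mem (show ω ∈ S (Sum.inr q) from hq'.2.2)]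
        rfl
      · rw [indicator_of_notMem hq]
        exact bot_le
    · simp
  refine hle.trans ?_
  rw [hm]
  refine mul_le_mul' le_rfl ?_
  have hRm : MeasurableSet {y | (o, y) ∈ R} := measurable_prodMk_left hR
  rw [← lintegral_indicator_one hRm]
  refine lintegral_mono fun y => ?_
  set a : ℕ → X := Function.update (fun _ => o) 1 y with ha
  have l0 : ∀ c x u, (mkConf (insert 1 {0}) (pts c) a x u).2.1 (Sum.inl 0) = o := by
    intro c x u
    rw [loc_mkConf_inl _ _ _ _ (by simp)]
    simp [ha]
  have l1 : ∀ c x u, (mkConf (insert 1 {0}) (pts c) a x u).2.1 (Sum.inl 1) = y := by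
    intro c x u
    rw [loc_mkConf_inl _ _ _ _ (by simp)]
    simp [ha]
  refine (expect_mono ν lam (g := fun _ => {y | (o, y) ∈ R}.indicator 1 y) fun c x u => ?_).trans
    (expect_const ν lam _).le
  simp only [hf]
  by_cases h : mkConf (insert 1 {0}) (pts c) a x u ∈ S (Sum.inl 1)
  · have h1 : ((mkConf (insert 1 {0}) (pts c) a x u).2.1 (Sum.inl 0),
      (mkConf (insert 1 {0}) (pts c) a x u).2.1 (Sum.inl 1)) ∈ R := h
    rw [l0, l1] at h1
    rw [indicator_of_mem h, indicator_of_mem (show y ∈ {y | (o, y) ∈ R} from h1)]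
    rfl
  · rw [indicator_of_notMem h]
    exact bot_le

end CrowdProbability

/-! ### Comparison with clusters in half-spaces -/

section HalfSpaceComparison

theorem Statistic.ofSet_congr {X : Type*} [MeasurableSpace X]
    {Q Q' : Set Node → (Node → X) → Node → Prop} {hm hm' hc hc' hp hp'} {C C' : Set Node}
    {x x' : Node → X} {r r' : Node} (h : Q C x r ↔ Q' C' x' r') :
    (Statistic.ofSet Q hm hc hp).toFun C x r = (Statistic.ofSet Q' hm' hc' hp').toFun C' x' r' := by
  simp only [Statistic.ofSet]
  split_ifs <;> tauto

variable {d : ℕ} (φ : ConnectionFn d)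

/-- A finite net of half-spaces. -/
theorem exists_halfSp_net (d : ℕ) {S : ℝ} (hS : 0 < S) :
    ∃ (S₁ : ℝ) (U : Finset (EuclideanSpace ℝ (Fin d))), 0 < S₁ ∧
      (∀ n ∈ U, ‖n‖ ^ 2 = 1 + S₁ ^ 2) ∧
      ∀ (C : Set Node) (x : Node → Hyp d) (r : Node), r ∈ C → x r = origin d →
        NearSupport S C x r → ∃ n ∈ U, ∀ q ∈ C, x q ∈ halfSp n (-S₁) := by
  classical
  set f := S / √(1 + S ^ 2) with hf
  have hsq : 0 < √(1 + S ^ 2) := by positivity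
  have hf0 : 0 < f := div_pos hS hsq
  have hf2 : f ^ 2 = S ^ 2 / (1 + S ^ 2) := by rw [hf, div_pow, Real.sq_sqrt (by positivity)]
  have hf1 : f < 1 := by
    rw [hf, div_lt_one hsq]
    exact Real.lt_sqrt_of_sq_lt (by linarith)
  -- A hyperplane at signed distance with sinh below `S` has |b| / ‖n‖ at most `f < 1`. Enlarging
  -- this ratio to the midpoint `g` of `f` and 1 leaves room for replacing the unit normal by one
  -- from a net of mesh (1 - f)/2.
  set g := (1 + f) / 2 with hg
  have hg1 : g < 1 := by linarith
  have hg0 : 0 < g := by linarith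
  set k := √(1 - g ^ 2) with hk
  have hk0 : 0 < k := Real.sqrt_pos.2 (by nlinarith)
  have hk2 : k ^ 2 = 1 - g ^ 2 := Real.sq_sqrt (by nlinarith)
  obtain ⟨t, hts, htf, htc⟩ := (isCompact_sphere (0 : EuclideanSpace ℝ (Fin d)) 1).finite_cover_balls
    (show 0 < (1 - f) / 2 by linarith)
  refine ⟨g / k, htf.toFinset.image fun u => k⁻¹ • u, div_pos hg0 hk0, ?_, ?_⟩
  · intro n hn
    obtain ⟨u, hu, rfl⟩ := Finset.mem_image.1 hn
    have hu1 : ‖u‖ = 1 := mem_sphere_zero_iff_norm.1 (hts (htf.mem_toFinset.1 hu))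
    rw [norm_smul, hu1, mul_one, norm_inv, Real.norm_of_nonneg hk0.le, div_pow]
    field_simp
    linarith
  · rintro C x r hr hxr ⟨-, ⟨n, b⟩, h1, h2, h3⟩
    simp only at h1 h2 h3
    have hb0 := h2 r hr
    have h0 : ((origin d : Hyp d) : EuclideanSpace ℝ (Fin d)) = 0 := rfl
    rw [hxr, h0, sig_zero] at hb0 h3
    have hn0 : 0 < ‖n‖ := by
      by_contra h
      nlinarith [norm_nonneg n]
    have hbf : -b ≤ f * ‖n‖ := by
      refine le_of_sq_le_sq ?_ (by positivity)
      rw [mul_pow, hf2, div_mul_eq_mul_div, le_div_iff₀ (by positivity)]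
      have h4 : b ^ 2 ≤ S ^ 2 := by nlinarith
      nlinarith [sq_nonneg S, sq_nonneg b]
    obtain ⟨u, hu, hdist⟩ := mem_iUnion₂.1 (htc (show ‖n‖⁻¹ • n ∈ Metric.sphere
      (0 : EuclideanSpace ℝ (Fin d)) 1 by
        rw [mem_sphere_zero_iff_norm, norm_smul, norm_inv, norm_norm, inv_mul_cancel₀ hn0.ne']))
    refine ⟨k⁻¹ • u, Finset.mem_image.2 ⟨u, htf.mem_toFinset.2 hu, rfl⟩, fun q hq => ?_⟩
    have hX := (x q).norm_lt_one
    have hs := h2 q hq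
    rw [sig, lt_div_iff₀ (one_sub_norm_sq_pos hX), zero_mul, sub_pos] at hs
    rw [halfSp, mem_ofPred_eq, sig_nonneg_iff hX, inner_smul_left, conj_trivial]
    set y : EuclideanSpace ℝ (Fin d) := (x q : EuclideanSpace ℝ (Fin d)) with hy
    have h5 : inner ℝ (‖n‖⁻¹ • n - u) y ≤ (1 - f) / 2 * ‖y‖ := by
      rw [Metric.mem_ball, dist_eq_norm] at hdist
      exact (real_inner_le_norm _ _).trans (mul_le_mul_of_nonneg_right hdist.le (norm_nonneg _))
    rw [inner_sub_left, inner_smul_left, conj_trivial] at h5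
    have h6 : -f * (1 + ‖y‖ ^ 2) ≤ 2 * (‖n‖⁻¹ * inner ℝ n y) := by
      have h7 : -(f * ‖n‖) * (1 + ‖y‖ ^ 2) ≤ 2 * inner ℝ n y :=
        (mul_le_mul_of_nonneg_right (by linarith) (by positivity)).trans hs.le
      have h8 := mul_le_mul_of_nonneg_left h7 (inv_nonneg.2 hn0.le)
      have h9 : ‖n‖⁻¹ * (-(f * ‖n‖) * (1 + ‖y‖ ^ 2)) = -f * (1 + ‖y‖ ^ 2) := by
        field_simp
      linarith
    -- The error of the net is at most (1 - f)‖y‖ ≤ (1 - f)/2 · (1 + ‖y‖²), and f + (1 - f)/2 = g.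
    have h10 : -g * (1 + ‖y‖ ^ 2) ≤ 2 * inner ℝ u y := by
      have := sq_nonneg (1 - ‖y‖)
      nlinarith
    have h11 := mul_le_mul_of_nonneg_left h10 (inv_nonneg.2 hk0.le)
    calc -(g / k) * (1 + ‖y‖ ^ 2) = k⁻¹ * (-g * (1 + ‖y‖ ^ 2)) := by
          rw [div_eq_mul_inv]
          ring
      _ ≤ _ := h11.trans_eq (by ring)

/-- A cluster which is close to a supporting hyperplane is likely to be in a given half-space. -/
theorem exists_sizeMean_nearSupport_le {S : ℝ} (hS : 0 < S) : ∃ (S₁ : ℝ) (J : ℕ), 0 < S₁ ∧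
    ∀ (lam : ℝ≥0) (n : EuclideanSpace ℝ (Fin d)) (b : ℝ), ‖n‖ ^ 2 = 1 + b ^ 2 → b ≤ -S₁ →
      ∀ M, sizeMean φ.kernel (layer d) lam (.nearSupport d S) M (origin d)
        ≤ J * sizeMean φ.kernel (layer d) lam
            (.inside _ (measurableSet_halfSp n b)) M (origin d) := by
  obtain ⟨S₁, U, hS₁, hU, hnet⟩ := exists_halfSp_net d hS
  refine ⟨S₁, U.card, hS₁, fun lam n b hn hb M => ?_⟩
  -- A union bound over the net. Each half-space of the net can be rotated into the given one, which
  -- is at least as far away.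
  have h1 : sizeMean φ.kernel (layer d) lam (.nearSupport d S) M (origin d)
      ≤ ∑ m ∈ U, sizeMean φ.kernel (layer d) lam
          (.inside _ (measurableSet_halfSp m (-S₁))) M (origin d) := by
    simp only [sizeMean_eq]
    rw [← expect_finset_sum _ _ _ fun m => (Statistic.measurable_eval _ _ _).indicator
      (measurableSet_encard_eq (measurableSet_mem_clus _ _) _)]
    refine expect_mono _ _ fun c x u => ?_
    set ω := mkConf {0} (pts c) (fun _ => origin d) x u with hω
    by_cases h : ω ∈ {ω : Conf (Hyp d) | (rootClus φ.kernel ω).encard = M + 1}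
    · simp only [indicator_of_mem h]
      by_cases hs : NearSupport S (rootClus φ.kernel ω) ω.2.1 (Sum.inl 0)
      · obtain ⟨m, hm, hin⟩ := hnet _ _ _ (self_mem_clus _ _ _)
          (loc_mkConf_inl (D := {0}) _ _ _ _ rfl) hs
        refine le_trans ?_ (Finset.single_le_sum (fun _ _ => bot_le) hm)
        refine (Statistic.ofSet_le_one ..).trans_eq (Eq.symm ?_)
        exact if_pos hin
      · refine le_trans (le_of_eq ?_) bot_le
        exact if_neg hs
    · rw [indicator_of_notMem h]
      exact bot_le
  refine h1.trans ((Finset.sum_le_sum fun m hm => sizeMean_halfSp_mono φ lam (n' := n) (b' := b)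
    (by rw [hU m hm, neg_sq]) hn hb (neg_nonpos.2 hS₁.le) M).trans_eq ?_)
  rw [Finset.sum_const, nsmul_eq_mul]

theorem relatedTo_transl (D : ℝ) (w : Hyp d) (C : Set Node) (x : Node → Hyp d) (r : Node) :
    relatedTo (nearRel d D) C (transl w ∘ x) r = relatedTo (nearRel d D) C x r := by
  ext q
  refine and_congr_right fun _ => and_congr_right fun _ => transl_mem_nearRel w _ _

theorem crowd_transl (D : ℝ) (K : ℕ) (w : Hyp d) (C : Set Node) (x : Node → Hyp d) (r : Node) :
    (Statistic.crowd _ (measurableSet_nearRel d D) K).toFun C (transl w ∘ x) r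
      = (Statistic.crowd _ (measurableSet_nearRel d D) K).toFun C x r := by
  exact Statistic.ofSet_congr (by rw [relatedTo_transl])

/-- Mass transport applied to the pointwise bound for finite sets; both statistics are invariant
under translations. -/
theorem sizeMean_one_le_nearSupport (hd : 2 ≤ d) (lam : ℝ≥0) (K M : ℕ) :
    sizeMean φ.kernel (layer d) lam (.one _) M (origin d)
      ≤ (K + 1) * sizeMean φ.kernel (layer d) lam (.nearSupport d (8 * d + 9)) M (origin d)
        + sizeMean φ.kernel (layer d) lam (.crowd _ (measurableSet_nearRel d d) K) M
          (origin d) := by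
  refine sizeMean_one_le_of_pointwise φ.kernel (layer d) lam (T := fun y => transl (negPt y))
    (inv := negPt) (fun y => isAut_transl φ _) transl_neg_self (fun y => transl_origin _)
    ?_ (fun y C x r => ?_) (fun y C x r => crowd_transl _ _ _ C x r)
    (encard_le_nearSupport hd K) M
  · rw [baseMeasure_layer]
    exact measurePreserving_negPt d
  · exact Statistic.ofSet_congr (nearSupport_transl_iff _)

theorem sizeSum_crowd_le_volume (lam : ℝ≥0) (D : ℝ) (K N : ℕ) (w : Hyp d) :
    K * sizeSum φ.kernel (layer d) lam (.crowd _ (measurableSet_nearRel d D) K) N w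
      ≤ 2 * lam * hvol d {y | (origin d, y) ∈ nearRel d D}
        * sizeSum φ.kernel (layer d) lam (.one _) N (origin d) := by
  rw [sizeSum_transl φ lam (crowd_transl D K w)]
  refine (sizeSum_crowd_le φ.kernel (layer d) lam _ K N _).trans (le_of_eq ?_)
  simp only [sizeSum_one_eq_origin φ lam N]
  rw [setLIntegral_const, baseMeasure_layer]
  ring

/-- The comparison of the clusters with the clusters in the half-spaces at distance at least
`arsinh s` from the origin, for intensities up to `Λ`. -/
def HalfSpaceBound (Λ : ℝ≥0) (s : ℝ) : Prop :=
  ∃ c : ℝ≥0∞, c ≠ 0 ∧ c ≠ ∞ ∧ ∀ lam : ℝ≥0, lam ≤ Λ → ∀ (n : EuclideanSpace ℝ (Fin d)) (b : ℝ),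
    ‖n‖ ^ 2 = 1 + b ^ 2 → b ≤ -s → ∀ N,
      c * sizeSum φ.kernel (layer d) lam (.one _) N (origin d)
        ≤ sizeSum φ.kernel (layer d) lam (.inside _ (measurableSet_halfSp n b)) N (origin d)

/-- Far half-spaces: the root is near a supporting hyperplane with probability comparable to 1
unless it is crowded, and then the cluster lies in a given far half-space up to a constant factor.
-/
theorem exists_halfSpaceBound (hd : 2 ≤ d) (Λ : ℝ≥0) : ∃ s, HalfSpaceBound φ Λ s := by
  obtain ⟨S₁, J, -, hJ⟩ := exists_sizeMean_nearSupport_le φ (S := 8 * d + 9) (by positivity)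
  have hV := hvol_nearRel_lt_top (d := d) (D := d) (Nat.cast_nonneg d)
  set V := hvol d {y | (origin d, y) ∈ nearRel d d} with hVdef
  -- With K > 4 Λ V the crowded part is at most half of the truncated mean, so it can be absorbed.
  -- Below, `J + 1` replaces `J` to keep the constant invertible.
  obtain ⟨K, hK⟩ := ENNReal.exists_nat_gt
    (ENNReal.mul_ne_top (ENNReal.mul_ne_top (by simp : (4 : ℝ≥0∞) ≠ ∞)
      (ENNReal.coe_ne_top (r := Λ))) hV.ne)
  have hK0 : (K : ℝ≥0∞) ≠ 0 := (bot_le.trans_lt hK).ne'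
  have hKt : (K : ℝ≥0∞) ≠ ∞ := ENNReal.natCast_ne_top K
  have ha : (2 : ℝ≥0∞) * ((K + 1) * (J + 1)) ≠ ∞ := by finiteness
  have ha0 : (2 : ℝ≥0∞) * ((K + 1) * (J + 1)) ≠ 0 := by positivity
  refine ⟨S₁, (2 * ((K + 1) * (J + 1)))⁻¹, ENNReal.inv_ne_zero.2 ha, ENNReal.inv_ne_top.2 ha0,
    fun lam hlam n b hn hb N => ?_⟩
  set s := sizeSum φ.kernel (layer d) lam (.one _) N (origin d) with hs
  set W := sizeSum φ.kernel (layer d) lam (.inside _ (measurableSet_halfSp n b)) N (origin d)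
    with hW
  set cr := sizeSum φ.kernel (layer d) lam (.crowd _ (measurableSet_nearRel d d) K) N (origin d)
    with hcr
  have hst : s ≠ ∞ := sizeSum_one_ne_top _ _ _ N _
  have h1 : s ≤ (K + 1) * (J + 1) * W + cr := by
    rw [hs, hW, hcr, sizeSum, sizeSum, sizeSum, Finset.mul_sum, ← Finset.sum_add_distrib]
    refine Finset.sum_le_sum fun M _ => ?_
    rw [mul_left_comm, ← mul_add]
    refine mul_le_mul' le_rfl ((sizeMean_one_le_nearSupport φ hd lam K M).trans ?_)
    have hJ' := (hJ lam n b hn hb M).trans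
      (mul_le_mul' (le_self_add : (J : ℝ≥0∞) ≤ J + 1) le_rfl)
    refine add_le_add ((mul_le_mul' le_rfl hJ').trans_eq ?_) le_rfl
    rw [mul_assoc]
  have h2 : 2 * cr ≤ s := by
    have h3 := sizeSum_crowd_le_volume φ lam d K N (origin d)
    rw [← hcr, ← hs, ← hVdef] at h3
    have h4 : 2 * (2 * (lam : ℝ≥0∞) * V) ≤ K := by
      refine le_trans ?_ hK.le
      rw [← mul_assoc, ← mul_assoc]
      norm_num
      gcongr
    rw [← ENNReal.mul_le_mul_iff_right hK0 hKt, mul_left_comm]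
    calc 2 * (K * cr) ≤ 2 * (2 * lam * V * s) := mul_le_mul' le_rfl h3
      _ = 2 * (2 * lam * V) * s := by ring
      _ ≤ K * s := mul_le_mul' h4 le_rfl
  have h5 : s ≤ 2 * ((K + 1) * (J + 1)) * W := by
    have h6 : s + s ≤ 2 * ((K + 1) * (J + 1)) * W + s := by
      calc s + s = 2 * s := (two_mul s).symm
        _ ≤ 2 * ((K + 1) * (J + 1) * W + cr) := mul_le_mul' le_rfl h1
        _ = 2 * ((K + 1) * (J + 1)) * W + 2 * cr := by ring
        _ ≤ _ := add_le_add le_rfl h2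
    exact (ENNReal.add_le_add_iff_right hst).1 h6
  rw [mul_comm, ← div_eq_mul_inv]
  exact ENNReal.div_le_of_le_mul (by rwa [mul_comm W])

/-- A neighbour in the cap around the inward normal sees the half-space at depth at least s + 2τ,
where the comparison is known; `sizeSum_compare` passes it to the root. -/
theorem HalfSpaceBound.step {Λ : ℝ≥0} {s τ ρ : ℝ} {β : ℝ≥0∞} (hs : 0 ≤ s) (hτ : 0 < τ)
    (hρ : ρ < 1) (hβ : β ≠ 0) (hcap : ∀ u : EuclideanSpace ℝ (Fin d), ‖u‖ = 1 →
      ∫⁻ y in cap u τ ρ, uval (φ.toFun (origin d) y) ∂hvol d = β)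
    (hΦ : degMass φ.kernel (layer d) (origin d) ≠ ∞)
    (hΦ0 : degMass φ.kernel (layer d) (origin d) ≠ 0)
    (h : HalfSpaceBound φ Λ (s + 2 * τ)) : HalfSpaceBound φ Λ s := by
  obtain ⟨c₁, hc0, hct, hc₁⟩ := h
  set Φ := degMass φ.kernel (layer d) (origin d) with hΦdef
  set D : ℝ := 4 / (1 - ρ ^ 2) ^ 2 with hD
  have hV := hvol_nearRel_lt_top (d := d) (D := D) (by positivity)
  set V := hvol d {y | (origin d, y) ∈ nearRel d D} with hVdef
  set c := c₁ / 2 with hc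
  have hcc : c + c = c₁ := ENNReal.add_halves c₁
  have hc0' : c ≠ 0 := by simp [hc, hc0]
  have hct' : c ≠ ∞ := ne_top_of_le_ne_top hct (hcc ▸ le_self_add)
  -- K > 2 Λ V / c bounds the crowded part at every point of the cap by `c` times the truncated
  -- mean.
  obtain ⟨K, hK⟩ := ENNReal.exists_nat_gt (ENNReal.div_ne_top (ENNReal.mul_ne_top
    (ENNReal.mul_ne_top (by simp : (2 : ℝ≥0∞) ≠ ∞) (ENNReal.coe_ne_top (r := Λ))) hV.ne) hc0')
  have hK0 : (K : ℝ≥0∞) ≠ 0 := (bot_le.trans_lt hK).ne'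
  have hKt : (K : ℝ≥0∞) ≠ ∞ := ENNReal.natCast_ne_top K
  -- The two bounds are the two requirements on `c'` in `sizeSum_compare`: one for the singleton
  -- cluster, one for the mass of the cap against the full degree.
  set c' := min (K : ℝ≥0∞) (c * β / Φ) with hc'
  have hc'0 : c' ≠ 0 := by
    rw [hc', ← pos_iff_ne_zero, lt_min_iff]
    exact ⟨pos_iff_ne_zero.2 hK0, ENNReal.div_pos (mul_ne_zero hc0' hβ) hΦ⟩
  have hc't : c' ≠ ∞ := ne_top_of_le_ne_top hKt (min_le_left _ _)
  have hexp : expNeg (Λ * Φ) ≠ 0 := (expNeg_pos (ENNReal.mul_ne_top ENNReal.coe_ne_top hΦ)).ne'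
  refine ⟨c' * expNeg (Λ * Φ) / K, (ENNReal.div_pos (mul_ne_zero hc'0 hexp) hKt).ne',
    ENNReal.div_ne_top (ENNReal.mul_ne_top hc't
      (ne_top_of_le_ne_top ENNReal.one_ne_top (expNeg_le_one _))) hK0,
    fun lam hlam n b hn hb N => ?_⟩
  cases N with
  | zero => simp [sizeSum]
  | succ N =>
  have hn1 : 0 < ‖n‖ := by
    by_contra h0
    nlinarith [norm_nonneg n]
  set u := ‖n‖⁻¹ • n with hu
  have hu1 : ‖u‖ = 1 := by rw [hu, norm_smul, norm_inv, norm_norm, inv_mul_cancel₀ hn1.ne']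
  have hlamΛ : (lam : ℝ≥0∞) ≤ Λ := by exact_mod_cast hlam
  have key := sizeSum_compare φ.kernel (layer d) lam (measurableSet_nearRel d D)
    (measurableSet_halfSp n b) (o := origin d) ?_ (measurableSet_cap u τ ρ) ?_ K N (c := c)
    (c' := c') hct' (sizeSum_one_eq_origin φ lam N) ?_ ?_ (min_le_left _ _) ?_
  · have h1 : ∀ z : ℝ≥0∞, c' * expNeg (Λ * Φ) / K * z = c' * expNeg (Λ * Φ) * z / K := by
      intro z
      rw [div_eq_mul_inv, div_eq_mul_inv]
      ring
    rw [h1]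
    refine ENNReal.div_le_of_le_mul' (le_trans ?_ key)
    gcongr
    exact expNeg_anti (mul_le_mul' hlamΛ le_rfl)
  · change 0 ≤ sig n b 0
    rw [sig_zero]
    linarith
  · exact fun w hw w' hw' => mem_nearRel_of_norm_le hρ hw.1 hw'.1
  · intro w hw
    obtain ⟨n', b', h1, h2, h3⟩ := exists_inside_transl hn w
    -- The offset seen from `w` is minus the value of `sig` at `w`, hence at most -(s + 2τ).
    have h4 := sig_add_le hn (by linarith) w.norm_lt_one hτ hw.2
    rw [hcc]
    refine (hc₁ lam hlam n' b' h1 (by linarith) N).trans_eq (Eq.symm ?_)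
    refine sizeSum_transl φ lam (fun C x r => ?_) N
    refine Statistic.ofSet_congr (forall₂_congr fun p _ => ?_)
    simp only [halfSp, mem_ofPred_eq, Function.comp_apply, h2]
  · intro w _
    rw [← ENNReal.mul_le_mul_iff_right hK0 hKt]
    refine (sizeSum_crowd_le_volume φ lam D K N w).trans ?_
    rw [← mul_assoc]
    refine mul_le_mul' ?_ le_rfl
    have h1 := (ENNReal.div_le_iff hc0' hct').1 hK.le
    exact (mul_le_mul' (mul_le_mul' le_rfl hlamΛ) le_rfl).trans h1
  · rw [baseMeasure_layer]
    have h1 := hcap u hu1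
    change c' * Φ ≤ c * ∫⁻ w in cap u τ ρ, uval (φ.toFun (origin d) w) ∂hvol d
    rw [h1]
    refine (mul_le_mul' (min_le_right _ _) le_rfl).trans ?_
    exact (ENNReal.div_mul_cancel hΦ0 hΦ).le

theorem HalfSpaceBound.mono {Λ : ℝ≥0} {s s' : ℝ} (h : HalfSpaceBound φ Λ s) (hs : s ≤ s') :
    HalfSpaceBound φ Λ s' := by
  obtain ⟨c, h0, ht, h⟩ := h
  exact ⟨c, h0, ht, fun lam hlam n b hn hb => h lam hlam n b hn (by linarith)⟩

/-- Finitely many steps of the fixed size 2τ lead from the far half-spaces to depth 0. -/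
theorem halfSpaceBound_zero (hd : 2 ≤ d) (Λ : ℝ≥0)
    (hΦ : degMass φ.kernel (layer d) (origin d) ≠ ∞)
    (hΦ0 : degMass φ.kernel (layer d) (origin d) ≠ 0) : HalfSpaceBound φ Λ 0 := by
  obtain ⟨τ, ρ, β, hτ, hρ, hβ, hcap⟩ := exists_cap_mass φ (by omega) hΦ0
  obtain ⟨s, hs⟩ := exists_halfSpaceBound φ hd Λ
  obtain ⟨k, hk⟩ := exists_nat_ge (s / (2 * τ))
  rw [div_le_iff₀ (by linarith)] at hk
  have hall : ∀ k : ℕ, HalfSpaceBound φ Λ (k * (2 * τ)) → HalfSpaceBound φ Λ 0 := by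
    intro k
    induction k with
    | zero => intro h; simpa using h
    | succ k ih =>
      intro h
      refine ih (HalfSpaceBound.step φ (by positivity) hτ hρ hβ hcap hΦ hΦ0 ?_)
      convert h using 1
      push_cast
      ring
  exact hall k (hs.mono φ hk)

end HalfSpaceComparison

/-! ### An upper bound for the intensities with almost surely finite clusters -/

section CriticalIntensity

variable {d : ℕ} (φ : ConnectionFn d)

theorem exists_norm_sq_eq (hd : 2 ≤ d) {r : ℝ} (hr : 0 ≤ r) :
    ∃ n : EuclideanSpace ℝ (Fin d), ‖n‖ ^ 2 = r :=
  ⟨EuclideanSpace.single ⟨0, by omega⟩ √r, by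
    rw [PiLp.norm_single, Real.norm_eq_abs, sq_abs, Real.sq_sqrt hr]⟩

/-- The neighbours which are much closer to a given hyperplane. -/
def descendRel (n : EuclideanSpace ℝ (Fin d)) (b τ κ : ℝ) : Set (Hyp d × Hyp d) :=
  {z | sig n b z.2 ≤ sig n b z.1 - 2 * τ ∧
    κ * (1 - ‖(z.1 : EuclideanSpace ℝ (Fin d))‖ ^ 2)
      ≤ 1 - ‖(z.2 : EuclideanSpace ℝ (Fin d))‖ ^ 2}

theorem measurableSet_descendRel (n : EuclideanSpace ℝ (Fin d)) (b τ κ : ℝ) :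
    MeasurableSet (descendRel n b τ κ) := by
  have h1 : MeasurableSet {z : Hyp d × Hyp d | sig n b (z.2 : EuclideanSpace ℝ (Fin d))
      ≤ sig n b (z.1 : EuclideanSpace ℝ (Fin d)) - 2 * τ} :=
    measurableSet_le ((measurable_sig n b).comp measurable_snd)
      (((measurable_sig n b).comp measurable_fst).sub_const _)
  have h2 : MeasurableSet {z : Hyp d × Hyp d |
      κ * (1 - ‖(z.1 : EuclideanSpace ℝ (Fin d))‖ ^ 2)
        ≤ 1 - ‖(z.2 : EuclideanSpace ℝ (Fin d))‖ ^ 2} :=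
    measurableSet_le (by fun_prop) (by fun_prop)
  exact h1.inter h2

theorem moebiusDenom_le_four (a x : Hyp d) :
    moebiusDenom (a : EuclideanSpace ℝ (Fin d)) x ≤ 4 := by
  have h1 := a.norm_lt_one
  have h2 := x.norm_lt_one
  have h3 := real_inner_le_norm (a : EuclideanSpace ℝ (Fin d)) x
  have h4 : ‖(a : EuclideanSpace ℝ (Fin d))‖ * ‖(x : EuclideanSpace ℝ (Fin d))‖ ≤ 1 :=
    mul_le_one₀ h1.le (norm_nonneg _) h2.le
  have h5 := mul_nonneg (norm_nonneg (a : EuclideanSpace ℝ (Fin d)))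
    (norm_nonneg (x : EuclideanSpace ℝ (Fin d)))
  unfold moebiusDenom
  nlinarith

/-- After translating `w` to the origin, the cap around the outward normal consists of such
neighbours. The factor (1 - ρ²)/4 is the least ratio of 1 - ‖·‖² after and before the step, because
the Möbius denominator is at most 4. -/
theorem le_lintegral_descendRel {τ ρ : ℝ} {β : ℝ≥0∞} (hτ : 0 < τ) (hρ : ρ < 1)
    (hcap : ∀ u : EuclideanSpace ℝ (Fin d), ‖u‖ = 1 →
      ∫⁻ y in cap u τ ρ, uval (φ.toFun (origin d) y) ∂hvol d = β)
    {n : EuclideanSpace ℝ (Fin d)} {b : ℝ} (hn : ‖n‖ ^ 2 = 1 + b ^ 2) (w : Hyp d) :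
    β ≤ ∫⁻ y in {y | (w, y) ∈ descendRel n b τ ((1 - ρ ^ 2) / 4)}, uval (φ.toFun w y) ∂hvol d := by
  obtain ⟨n', b', h1, h2, h3⟩ := exists_inside_transl hn w
  have hn1 : 0 < ‖n'‖ := by
    by_contra h0
    nlinarith [norm_nonneg n']
  have hu : ‖-(‖n'‖⁻¹ • n')‖ = 1 := by
    rw [norm_neg, norm_smul, norm_inv, norm_norm, inv_mul_cancel₀ hn1.ne']
  have hm : MeasurableSet {y | (w, y) ∈ descendRel n b τ ((1 - ρ ^ 2) / 4)} :=
    measurable_prodMk_left (measurableSet_descendRel n b τ _)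
  have hmφ : Measurable fun y => uval (φ.toFun w y) :=
    measurable_uval.comp (φ.measurable_toFun.comp measurable_prodMk_left)
  rw [← hcap _ hu, ← (measurePreserving_transl w).setLIntegral_comp_preimage hm hmφ]
  have hval : ∀ y, uval (φ.toFun w (transl w y)) = uval (φ.toFun (origin d) y) := by
    intro y
    conv_lhs => rw [← transl_origin w]
    rw [transl_origin, ← φ.transl_inv w (origin d) y, transl_origin]
  simp only [hval]
  refine lintegral_mono_set fun y hy => ⟨?_, ?_⟩
  · simp only
    rw [h2, h3]
    exact sig_le_sub h1 y.norm_lt_one hτ hy.2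
  · have hD := w.moebiusDenom_pos y
    have hD4 := moebiusDenom_le_four w y
    have hw := w.one_sub_norm_sq_pos
    have hy2 : 1 - ρ ^ 2 ≤ 1 - ‖(y : EuclideanSpace ℝ (Fin d))‖ ^ 2 := by
      have := pow_le_pow_left₀ (norm_nonneg _) hy.1 2
      linarith
    have hρ0 := (norm_nonneg _).trans hy.1
    have hρ2 : 0 ≤ 1 - ρ ^ 2 := by nlinarith
    simp only [transl_apply]
    rw [one_sub_norm_sq_moebiusAdd hD.ne', div_mul_eq_mul_div, div_mul_eq_mul_div,
      div_le_div_iff₀ (by norm_num) hD, mul_comm (1 - ρ ^ 2)]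
    have h4 := mul_le_mul_of_nonneg_left hy2 hw.le
    have h5 := mul_nonneg hw.le hρ2
    nlinarith

/-- Clusters in a half-space are unlikely for large intensities. -/
theorem exists_sum_sizeMean_halfSp_le {τ ρ : ℝ} {β : ℝ≥0∞} (hτ : 0 < τ) (hρ : ρ < 1)
    (hcap : ∀ u : EuclideanSpace ℝ (Fin d), ‖u‖ = 1 →
      ∫⁻ y in cap u τ ρ, uval (φ.toFun (origin d) y) ∂hvol d = β)
    (hρ0 : 0 ≤ ρ) {n : EuclideanSpace ℝ (Fin d)} {b : ℝ} (hn : ‖n‖ ^ 2 = 1 + b ^ 2) (hb : b ≤ 0) :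
    ∃ A : ℝ≥0, ∀ (lam : ℝ≥0) (N : ℕ), ∑ M ∈ Finset.range N, sizeMean φ.kernel (layer d) lam
        (.inside _ (measurableSet_halfSp n b)) M (origin d)
      ≤ (1 + lam * A) * expNeg (lam * β) := by
  set κ := (1 - ρ ^ 2) / 4 with hκ
  have hκ0 : 0 < κ := by
    have : ρ ^ 2 < 1 := by nlinarith
    rw [hκ]
    linarith
  -- Where a descent can be after `i` steps: at most 2τ i below the starting value of `sig`, and not
  -- too close to the unit sphere. The second condition keeps the volume finite, as required for the
  -- union bound.
  set U : ℕ → Set (Hyp d) := fun i => {x | κ ^ i ≤ 1 - ‖(x : EuclideanSpace ℝ (Fin d))‖ ^ 2} ∩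
    {x | sig n b x ≤ -b - i * (2 * τ)} with hU
  have hUm : ∀ i, MeasurableSet (U i) := fun i =>
    MeasurableSet.inter (measurableSet_le measurable_const (by fun_prop))
      (measurableSet_le (measurable_sig n b) measurable_const)
  -- After `m` steps `sig` is negative, so the descent has left the half-space.
  obtain ⟨m, hm⟩ := exists_nat_gt (-b / (2 * τ))
  rw [div_lt_iff₀ (by linarith)] at hm
  have hfin : ∑ i ∈ Finset.range m, baseMeasure (layer d) (U i ∩ halfSp n b) ≠ ∞ := by
    refine ENNReal.sum_ne_top.2 fun i _ => ne_top_of_le_ne_top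
      (hvol_lt_top (d := d) (pow_pos hκ0 i)).ne ?_
    rw [baseMeasure_layer]
    exact measure_mono fun x hx => hx.1.1
  refine ⟨(∑ i ∈ Finset.range m, baseMeasure (layer d) (U i ∩ halfSp n b)).toNNReal,
    fun lam N => ?_⟩
  rw [ENNReal.coe_toNNReal hfin]
  refine sum_sizeMean_inside_le φ.kernel (layer d) lam (measurableSet_descendRel n b τ κ)
    (measurableSet_halfSp n b) hUm m ?_ ?_ ?_ ?_ ?_ N
  · refine ⟨?_, ?_⟩
    · have h0 : ((origin d : Hyp d) : EuclideanSpace ℝ (Fin d)) = 0 := rfl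
      rw [mem_ofPred_eq, h0]
      simp
    · change sig n b 0 ≤ _
      rw [sig_zero]
      simp
  · refine eq_empty_of_forall_notMem fun x hx => ?_
    have h1 : sig n b (x : EuclideanSpace ℝ (Fin d)) ≤ -b - m * (2 * τ) := hx.1.2
    have h2 : 0 ≤ sig n b (x : EuclideanSpace ℝ (Fin d)) := hx.2
    linarith
  · rintro i w ⟨⟨hw1, hw2⟩, -⟩ y ⟨hy1, hy2⟩
    refine ⟨?_, ?_⟩
    · rw [mem_ofPred_eq] at hw1 ⊢
      rw [pow_succ']
      exact (mul_le_mul_of_nonneg_left hw1 hκ0.le).trans hy2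
    · rw [mem_ofPred_eq] at hw2 ⊢
      push_cast
      simp only at hy1
      linarith
  · change 0 ≤ sig n b 0
    rw [sig_zero]
    linarith
  · intro w _
    rw [baseMeasure_layer]
    exact le_lintegral_descendRel φ hτ hρ hcap hn w

/-- Two factors linear in `x` are at most of order x² for x ≥ 1, whereas exp(x t) ≥ (x t)³ / 6. The
constant 12 is 2 · 6. -/
theorem le_of_le_poly_mul_exp {V J A t x : ℝ} (hV : 0 ≤ V) (hJ : 0 ≤ J) (hA : 0 ≤ A) (ht : 0 < t)
    (h : 1 / 2 ≤ (2 * x * V + 3) * J * ((1 + x * A) * Real.exp (-(x * t)))) :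
    x ≤ max 1 (12 * ((2 * V + 3) * J * (1 + A)) / t ^ 3) := by
  rcases le_or_gt x 1 with h1 | h1
  · exact h1.trans (le_max_left _ _)
  refine le_max_of_le_right ?_
  have hexp := Real.pow_div_factorial_le_exp (x * t) (by positivity) 3
  rw [Real.exp_neg, ← mul_assoc, ← div_eq_mul_inv, le_div_iff₀ (Real.exp_pos _)] at h
  have hp : (2 * x * V + 3) * J * (1 + x * A) ≤ (2 * V + 3) * J * (1 + A) * x ^ 2 := by
    have e1 : 2 * x * V + 3 ≤ (2 * V + 3) * x := by nlinarith
    have e2 : 1 + x * A ≤ (1 + A) * x := by nlinarith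
    calc (2 * x * V + 3) * J * (1 + x * A)
        ≤ (2 * V + 3) * x * J * ((1 + A) * x) := by gcongr
      _ = _ := by ring
  have h6 : ((Nat.factorial 3 : ℕ) : ℝ) = 6 := by norm_num [Nat.factorial]
  rw [h6] at hexp
  rw [le_div_iff₀ (by positivity)]
  have h7 : x ^ 2 * (x * t ^ 3) ≤ x ^ 2 * (12 * ((2 * V + 3) * J * (1 + A))) := by
    have h8 : (x * t) ^ 3 = x ^ 2 * (x * t ^ 3) := by ring
    rw [h8] at hexp
    nlinarith
  exact le_of_mul_le_mul_left h7 (by positivity)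

/-- For large intensities the cluster is infinite with positive probability. -/
theorem exists_intensity_bound (hd : 2 ≤ d) (hΦ : degMass φ.kernel (layer d) (origin d) ≠ ∞)
    (hΦ0 : degMass φ.kernel (layer d) (origin d) ≠ 0) :
    ∃ Λ : ℝ≥0, ∀ lam : ℝ≥0,
      1 ≤ ∑' M, sizeMean φ.kernel (layer d) lam (.one _) M (origin d) → lam ≤ Λ := by
  obtain ⟨τ, ρ, β, hτ, hρ, hβ, hcap⟩ := exists_cap_mass φ (by omega) hΦ0
  obtain ⟨S₁, J, hS₁, hJ⟩ := exists_sizeMean_nearSupport_le φ (S := 8 * d + 9) (by positivity)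
  obtain ⟨n, hn⟩ := exists_norm_sq_eq (d := d) hd (r := 1 + (-S₁) ^ 2) (by positivity)
  obtain ⟨u, hu⟩ := exists_norm_sq_eq (d := d) hd (r := 1) zero_le_one
  have hu1 : ‖u‖ = 1 := by
    nlinarith [norm_nonneg u]
  have hβt : β ≠ ∞ := by
    refine ne_top_of_le_ne_top hΦ ?_
    rw [← hcap u hu1]
    refine (setLIntegral_le_lintegral _ _).trans_eq ?_
    rw [degMass, baseMeasure_layer]
    rfl
  have hρ0 : 0 ≤ ρ := by
    by_contra! h0
    refine hβ ?_
    rw [← hcap u hu1]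
    have : cap u τ ρ = ∅ := eq_empty_of_forall_notMem fun x hx =>
      absurd (hx.1.trans_lt h0) (not_lt.2 (norm_nonneg _))
    rw [this, setLIntegral_empty]
  obtain ⟨A, hA⟩ := exists_sum_sizeMean_halfSp_le φ hτ hρ hcap hρ0 hn (neg_nonpos.2 hS₁.le)
  have hV := (hvol_nearRel_lt_top (d := d) (D := d) (Nat.cast_nonneg d)).ne
  set V := (hvol d {y | (origin d, y) ∈ nearRel d d}).toNNReal with hVdef
  set t := β.toNNReal with htdef
  have ht0 : 0 < t := ENNReal.toNNReal_pos hβ hβt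
  refine ⟨Real.toNNReal (max 1 (12 * ((2 * (V : ℝ) + 3) * J * (1 + A)) / (t : ℝ) ^ 3)),
    fun lam h => ?_⟩
  -- Here `K` grows linearly with the intensity: K ≥ 2 lam V makes crowding have probability at most
  -- 1/2, and K + 1 ≤ 2 lam V + 3 keeps the bound polynomial.
  set K := ⌈2 * lam * V⌉₊ + 1 with hK
  have hKr : ((K : ℕ) : ℝ≥0) + 1 ≤ 2 * lam * V + 3 := by
    have := (Nat.ceil_lt_add_one (show 0 ≤ 2 * lam * V from bot_le)).le
    rw [hK]
    push_cast
    linarith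
  have hcrowd : ∀ N, ∑ M ∈ Finset.range N, sizeMean φ.kernel (layer d) lam
      (.crowd _ (measurableSet_nearRel d d) K) M (origin d) ≤ 1 / 2 := by
    intro N
    have h1 := sum_sizeMean_crowd_le φ.kernel (layer d) lam (measurableSet_nearRel d d) K N
      (origin d)
    rw [baseMeasure_layer, ← ENNReal.coe_toNNReal hV, ← hVdef] at h1
    have h2 : 2 * ((lam : ℝ≥0∞) * V) ≤ K := by
      have : 2 * lam * V ≤ (K : ℝ≥0) := by
        refine (Nat.le_ceil _).trans ?_
        rw [hK]
        push_cast
        exact le_self_add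
      rw [← mul_assoc]
      exact_mod_cast this
    have hK0 : (K : ℝ≥0∞) ≠ 0 := by simp [hK]
    have hKt : (K : ℝ≥0∞) ≠ ∞ := ENNReal.natCast_ne_top K
    rw [ENNReal.le_div_iff_mul_le (by simp) (by simp), mul_comm,
      ← ENNReal.mul_le_mul_iff_right hK0 hKt, mul_one, mul_left_comm]
    exact (mul_le_mul' le_rfl h1).trans h2
  -- All of the mass of the finite clusters is bounded by that of clusters in one fixed half-space,
  -- which is exponentially small in `lam`, plus 1/2.
  have hbound : (1 : ℝ≥0∞) ≤ (K + 1) * (J * ((1 + lam * A) * expNeg (lam * β))) + 1 / 2 := by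
    refine h.trans (ENNReal.tsum_le_of_sum_range_le fun N => ?_)
    refine (Finset.sum_le_sum fun M _ => sizeMean_one_le_nearSupport φ hd lam K M).trans ?_
    rw [Finset.sum_add_distrib, ← Finset.mul_sum]
    refine add_le_add (mul_le_mul' le_rfl ?_) (hcrowd N)
    refine (Finset.sum_le_sum fun M _ => hJ lam n (-S₁) hn le_rfl M).trans ?_
    rw [← Finset.mul_sum]
    exact mul_le_mul' le_rfl (hA lam N)
  have hexp : expNeg (lam * β) = ENNReal.ofReal (Real.exp (-(lam * t))) := by
    rw [← expNeg_ofReal (by positivity), ENNReal.ofReal_mul (by positivity),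
      ENNReal.ofReal_coe_nnreal, ENNReal.ofReal_coe_nnreal, htdef, ENNReal.coe_toNNReal hβt]
  have hreal : (1 : ℝ) / 2 ≤ (2 * (lam : ℝ) * V + 3) * J
      * ((1 + lam * A) * Real.exp (-(lam * t))) := by
    rw [hexp] at hbound
    have h1 := ENNReal.toReal_mono (by finiteness) hbound
    rw [ENNReal.toReal_add (by finiteness) (by finiteness)] at h1
    simp only [ENNReal.toReal_one, ENNReal.toReal_mul, ENNReal.toReal_natCast, ENNReal.toReal_div,
      ENNReal.toReal_ofNat] at h1
    rw [ENNReal.toReal_add (by finiteness) (by finiteness),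
      ENNReal.toReal_add (by finiteness) (by finiteness),
      ENNReal.toReal_ofReal (Real.exp_pos _).le] at h1
    simp only [ENNReal.toReal_one, ENNReal.toReal_mul, ENNReal.toReal_natCast,
      ENNReal.coe_toReal] at h1
    have h2 : ((K : ℝ) + 1) ≤ 2 * (lam : ℝ) * V + 3 := by exact_mod_cast hKr
    have h3 : 0 ≤ J * ((1 + (lam : ℝ) * A) * Real.exp (-(lam * t))) := by positivity
    have h4 := mul_le_mul_of_nonneg_right h2 h3
    rw [mul_assoc (2 * (lam : ℝ) * V + 3)]
    linarith
  have := le_of_le_poly_mul_exp V.coe_nonneg (Nat.cast_nonneg J) A.coe_nonneg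
    (NNReal.coe_pos.2 ht0) hreal
  rw [← NNReal.coe_le_coe]
  exact this.trans (Real.le_coe_toNNReal _)

end CriticalIntensity

/-! ### Transfer to the sample space of the statement -/

section Law

variable {d : ℕ}

/-- The label of the added point is `Sum.inl 0`. -/
def toNode : Label → Node
  | none => Sum.inl 0
  | some q => Sum.inr q

/-- A left inverse of `toNode`. -/
def ofNode : Node → Label
  | Sum.inl _ => none
  | Sum.inr q => some q

@[simp] theorem ofNode_toNode (a : Label) : ofNode (toNode a) = a := by
  cases a <;> rfl

theorem toNode_injective : Function.Injective toNode :=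
  Function.LeftInverse.injective ofNode_toNode

theorem toNode_ofNode {X : Type*} [Nonempty X] {P : Set (ℕ × ℕ)} {a : ℕ → X} {x : ℕ × ℕ → X}
    {u : Sym2 Node → unitInterval} {p : Node} (hp : p ∈ (mkConf {0} P a x u).1) :
    toNode (ofNode p) = p := by
  rcases p with j | q
  · rw [inl_mem_mkConf] at hp
    rw [mem_singleton_iff.1 hp]
    rfl
  · rfl

/-- The configuration of a sample. -/
def sampleConf (ω : Sample d) : Conf (Hyp d) :=
  mkConf {0} (pts ω.1) (fun _ => origin d) ω.2.1 (ω.2.2.1 ∘ Sym2.map ofNode)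

theorem measurable_sampleConf : Measurable (sampleConf : Sample d → Conf (Hyp d)) :=
  measurable_conf {0} measurable_const (measurable_pts.comp measurable_fst)
    (by fun_prop) (by fun_prop)

theorem toNode_mem_sampleConf (ω : Sample d) (a : Label) :
    toNode a ∈ (sampleConf ω).1 ↔ present ω a := by
  cases a with
  | none => simp [toNode, sampleConf, present]
  | some q => simp [toNode, sampleConf, present]

theorem loc_sampleConf {ω : Sample d} {a : Label} (ha : present ω a) :
    (sampleConf ω).2.1 (toNode a) = position ω a := by
  cases a with
  | none => exact loc_mkConf_inl (D := {0}) _ _ _ _ rfl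
  | some q => exact loc_mkConf_inr _ _ _ _ ha

variable (φ : ConnectionFn d)

theorem adj_sampleConf (ω : Sample d) (a b : Label) :
    (cgraph φ.kernel (sampleConf ω)).Adj (toNode a) (toNode b) ↔ (graph φ ω).Adj a b := by
  have hm : (sampleConf ω).2.2 s(toNode a, toNode b) = ω.2.2.1 s(a, b) := by
    simp [sampleConf]
  rw [cgraph_adj, toNode_mem_sampleConf, toNode_mem_sampleConf, toNode_injective.ne_iff, hm]
  refine and_congr_right fun _ => and_congr_right fun ha => and_congr_right fun hb => ?_
  rw [loc_sampleConf ha, loc_sampleConf hb]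
  rfl

theorem clus_sampleConf (ω : Sample d) :
    clus φ.kernel (sampleConf ω) (Sum.inl 0) = toNode '' cluster φ ω := by
  ext p
  constructor
  · refine fun h => reachable_closed ⟨none, .refl _, rfl⟩ ?_ h
    rintro _ b ⟨a, ha, rfl⟩ hab
    have hb := toNode_ofNode hab.2.2.1
    rw [← hb, adj_sampleConf] at hab
    exact ⟨ofNode b, SimpleGraph.Reachable.trans ha hab.reachable, hb⟩
  · rintro ⟨a, ha, rfl⟩
    exact SimpleGraph.Reachable.map
      (⟨toNode, fun h => (adj_sampleConf φ ω _ _).2 h⟩ :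
        graph φ ω →g cgraph φ.kernel (sampleConf ω)) ha

theorem present_of_mem_cluster {ω : Sample d} {a : Label} (h : a ∈ cluster φ ω) :
    present ω a := by
  rw [← toNode_mem_sampleConf]
  refine clus_subset φ.kernel (p := Sum.inl 0) (by simp [sampleConf]) ?_
  rw [clus_sampleConf]
  exact mem_image_of_mem _ h

theorem encard_clus_sampleConf (ω : Sample d) :
    (clus φ.kernel (sampleConf ω) (Sum.inl 0)).encard = (cluster φ ω).encard := by
  rw [clus_sampleConf, toNode_injective.encard_image]

theorem measurableSet_mem_cluster (a : Label) : MeasurableSet {ω : Sample d | a ∈ cluster φ ω} := by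
  have h := measurable_sampleConf (measurableSet_mem_clus φ.kernel (Sum.inl 0) (toNode a))
  convert h using 1
  ext ω
  simp [clus_sampleConf, toNode_injective.eq_iff]

theorem measurable_clusterSize : Measurable (clusterSize φ) :=
  measurable_encard _ (measurableSet_mem_cluster φ)

theorem measurableSet_clusterSize_eq (n : ℕ∞) :
    MeasurableSet {ω : Sample d | (cluster φ ω).encard = n} := by
  have h := measurable_clusterSize φ (measurableSet_singleton (n : ℝ≥0∞))
  convert h using 1
  ext ω
  simp [clusterSize]

theorem measurableSet_ghostFree (q : ℝ) : MeasurableSet (ghostFree φ q) := by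
  have : ghostFree φ q = ⋂ a : Label, {ω | a ∈ cluster φ ω}ᶜ ∪ {ω | (ω.2.2.2 a : ℝ) < q}ᶜ := by
    ext ω
    simp only [ghostFree, ghosts, eq_empty_iff_forall_notMem, mem_ofPred_eq, mem_inter_iff,
      mem_iInter, mem_union, mem_compl_iff, not_and_or]
  rw [this]
  refine MeasurableSet.iInter fun a => (measurableSet_mem_cluster φ a).compl.union ?_
  have h : MeasurableSet {ω : Sample d | (ω.2.2.2 a : ℝ) < q} :=
    measurableSet_lt (by fun_prop) measurable_const
  exact h.compl

theorem mem_clusterIn_iff (A : Set (Hyp d)) (ω : Sample d) : ω ∈ clusterIn φ A ↔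
    ∀ p ∈ clus φ.kernel (sampleConf ω) (Sum.inl 0), (sampleConf ω).2.1 p ∈ A := by
  rw [clus_sampleConf, forall_mem_image]
  refine forall₂_congr fun a ha => ?_
  rw [loc_sampleConf (present_of_mem_cluster φ ha)]

open Classical in
theorem eval_inside_sampleConf {A : Set (Hyp d)} (hA : MeasurableSet A) (ω : Sample d) :
    (Statistic.inside A hA).eval φ.kernel (sampleConf ω) (Sum.inl 0)
      = if ω ∈ clusterIn φ A then 1 else 0 := by
  rw [mem_clusterIn_iff]
  simp only [Statistic.eval, Statistic.inside, Statistic.ofSet]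

theorem measurableSet_clusterIn {A : Set (Hyp d)} (hA : MeasurableSet A) :
    MeasurableSet (clusterIn φ A) := by
  have h := ((Statistic.inside A hA).measurable_eval φ.kernel (Sum.inl 0)).comp
    measurable_sampleConf (measurableSet_singleton 1)
  convert h using 1
  ext ω
  simp [eval_inside_sampleConf]

/-- Only marks of pairs of present nodes matter, and on present nodes passing to labels and back is
the identity. -/
theorem cgraph_mkConf_marks (P : Set (ℕ × ℕ)) (a : ℕ → Hyp d) (x : ℕ × ℕ → Hyp d)
    (v : Sym2 Node → unitInterval) :
    cgraph φ.kernel (mkConf {0} P a x ((v ∘ Sym2.map toNode) ∘ Sym2.map ofNode))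
      = cgraph φ.kernel (mkConf {0} P a x v) := by
  ext p q
  rw [cgraph_adj, cgraph_adj]
  refine and_congr_right fun _ => and_congr_right fun hp => and_congr_right fun hq => ?_
  have hp := toNode_ofNode hp
  have hq := toNode_ofNode hq
  simp only [marks_mkConf, Function.comp_apply, Sym2.map_mk, hp, hq]
  exact Iff.rfl

theorem measure_ghosts {C : Set Label} {n : ℕ} (hC : C.encard = n) (q : unitInterval) :
    (Measure.infinitePi fun _ : Label => (volume : Measure unitInterval))
      {g | ∀ a ∈ C, q ≤ g a} = ENNReal.ofReal (1 - q) ^ n := by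
  have hfin : C.Finite := finite_of_encard_eq_coe hC
  have h : {g : Label → unitInterval | ∀ a ∈ C, q ≤ g a}
      = Set.pi (hfin.toFinset : Set Label) fun _ => Ici q := by
    ext g
    simp [Set.mem_pi]
  rw [h, Measure.infinitePi_pi _ fun _ _ => measurableSet_Ici]
  have hcard : hfin.toFinset.card = n := by
    rw [hfin.encard_eq_coe_toFinset_card] at hC
    exact_mod_cast hC
  simp [hcard]

/-- The ghost marks are independent of the graph, so given a cluster with M + 1 vertices none is a
ghost with probability (1 - q)^(M+1), whether or not the cluster lies in `A`. -/
theorem law_cluster_event (lam : ℝ≥0) {A : Set (Hyp d)} (hA : MeasurableSet A) (q : unitInterval)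
    (M : ℕ) :
    law d lam ({ω | (cluster φ ω).encard = M + 1} ∩ clusterIn φ A ∩ ghostFree φ q)
      = ENNReal.ofReal (1 - q) ^ (M + 1)
        * sizeMean φ.kernel (layer d) lam (.inside A hA) M (origin d) := by
  classical
  set f : Conf (Hyp d) → ℝ≥0∞ := {ω | (rootClus φ.kernel ω).encard = M + 1}.indicator
    fun ω => (Statistic.inside A hA).eval φ.kernel ω (Sum.inl 0) with hfdef
  have hf : Measurable f := ((Statistic.inside A hA).measurable_eval φ.kernel _).indicator
    (measurableSet_encard_eq (measurableSet_mem_clus φ.kernel _) _)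
  have hfm : ∀ P a x v, f (mkConf {0} P a x ((v ∘ Sym2.map toNode) ∘ Sym2.map ofNode))
      = f (mkConf {0} P a x v) := by
    intro P a x v
    have h : clus φ.kernel (mkConf {0} P a x ((v ∘ Sym2.map toNode) ∘ Sym2.map ofNode)) (Sum.inl 0)
        = clus φ.kernel (mkConf {0} P a x v) (Sum.inl 0) := by
      unfold clus
      rw [cgraph_mkConf_marks]
    simp only [hfdef, indicator_apply, mem_ofPred_eq, rootClus, Statistic.eval, h]
    rfl
  have hE : MeasurableSet ({ω | (cluster φ ω).encard = M + 1} ∩ clusterIn φ A ∩ ghostFree φ q) :=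
    ((measurableSet_clusterSize_eq φ _).inter (measurableSet_clusterIn φ hA)).inter
      (measurableSet_ghostFree φ q)
  have hfω : ∀ ω : Sample d,
      ({ω | (cluster φ ω).encard = M + 1} ∩ clusterIn φ A ∩ ghostFree φ q).indicator 1 ω
        = f (sampleConf ω) * {g : Label → unitInterval | ∀ a ∈ cluster φ ω, q ≤ g a}.indicator 1
            ω.2.2.2 := by
    intro ω
    have h1 : ω ∈ ghostFree φ q ↔ ∀ a ∈ cluster φ ω, q ≤ ω.2.2.2 a := by
      simp only [ghostFree, ghosts, eq_empty_iff_forall_notMem, mem_ofPred_eq, mem_inter_iff,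
        not_and, not_lt, Subtype.coe_le_coe]
    simp only [hfdef, indicator_apply, mem_ofPred_eq, mem_inter_iff, h1, rootClus,
      encard_clus_sampleConf, eval_inside_sampleConf]
    split_ifs <;> simp_all
  rw [← lintegral_indicator_one hE, sizeMean_eq, ← hfdef, law, lintegral_prod _
    (measurable_one.indicator hE).aemeasurable]
  unfold expect
  have hmI : Measurable (({ω | (cluster φ ω).encard = M + 1} ∩ clusterIn φ A
      ∩ ghostFree φ q).indicator (1 : Sample d → ℝ≥0∞)) := measurable_one.indicator hE
  rw [← lintegral_const_mul _ (measurable_count_integrand (layer d) hf _), countLaw]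
  refine lintegral_congr fun c => ?_
  have hmc : Measurable fun y => ({ω | (cluster φ ω).encard = M + 1} ∩ clusterIn φ A
      ∩ ghostFree φ q).indicator (1 : Sample d → ℝ≥0∞) (c, y) := hmI.comp measurable_prodMk_left
  rw [lintegral_prod _ hmc.aemeasurable]
  have hpm := measurable_pos_integrand (D := {0}) hf (pts c) (fun _ => origin d)
  rw [← lintegral_const_mul _ hpm, posLaw]
  refine lintegral_congr fun x => ?_
  have hmx : Measurable fun y => ({ω | (cluster φ ω).encard = M + 1} ∩ clusterIn φ A
      ∩ ghostFree φ q).indicator (1 : Sample d → ℝ≥0∞) (c, x, y) :=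
    hmc.comp measurable_prodMk_left
  rw [lintegral_prod _ hmx.aemeasurable]
  have hF : Measurable fun u : Sym2 Label → unitInterval =>
      f (mkConf {0} (pts c) (fun _ => origin d) x (u ∘ Sym2.map ofNode)) :=
    hf.comp (measurable_conf {0} measurable_const measurable_const measurable_const (by fun_prop))
  have hmarks : ∫⁻ u, f (mkConf {0} (pts c) (fun _ => origin d) x u) ∂markLaw
      = ∫⁻ u : Sym2 Label → unitInterval,
          f (mkConf {0} (pts c) (fun _ => origin d) x (u ∘ Sym2.map ofNode))
          ∂(Measure.infinitePi fun _ => (volume : Measure unitInterval)) := by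
    rw [← lintegral_infinitePi_comp_injective (fun _ : Sym2 Node => (volume : Measure unitInterval))
      (Sym2.map toNode) (Sym2.map.injective toNode_injective) hF]
    exact lintegral_congr fun v => (hfm _ _ _ v).symm
  rw [hmarks, ← lintegral_const_mul _ hF]
  refine lintegral_congr fun u => ?_
  have hcl : ∀ g g' : Label → unitInterval,
      cluster φ ((c, x, u, g) : Sample d) = cluster φ ((c, x, u, g') : Sample d) := fun _ _ => rfl
  obtain ⟨g₀⟩ : Nonempty (Label → unitInterval) := inferInstance
  have hg : ∀ g, ({ω | (cluster φ ω).encard = M + 1} ∩ clusterIn φ A ∩ ghostFree φ q).indicator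
      (1 : Sample d → ℝ≥0∞) (c, x, u, g)
      = f (mkConf {0} (pts c) (fun _ => origin d) x (u ∘ Sym2.map ofNode))
        * {g : Label → unitInterval | ∀ a ∈ cluster φ ((c, x, u, g₀) : Sample d),
            q ≤ g a}.indicator 1 g := fun g => hfω (c, x, u, g)
  simp only [hg]
  have hmg : MeasurableSet {g : Label → unitInterval |
      ∀ a ∈ cluster φ ((c, x, u, g₀) : Sample d), q ≤ g a} := by
    simp only [ofPred_forall]
    exact MeasurableSet.iInter fun a => MeasurableSet.iInter fun _ =>
      measurableSet_le measurable_const (measurable_pi_apply a)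
  rw [lintegral_const_mul _ (measurable_one.indicator hmg), lintegral_indicator_one hmg, mul_comm]
  by_cases hC : (cluster φ ((c, x, u, g₀) : Sample d)).encard = ((M + 1 : ℕ) : ℕ∞)
  · rw [measure_ghosts hC]
  · have : f (mkConf {0} (pts c) (fun _ => origin d) x (u ∘ Sym2.map ofNode)) = 0 := by
      refine indicator_of_notMem (fun h => hC ?_) _
      have h2 := encard_clus_sampleConf φ ((c, x, u, g₀) : Sample d)
      rw [← h2]
      exact_mod_cast h
    rw [this, mul_zero, mul_zero]

end Law

/-! ### Abel summation -/

section AbelSummation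

/-- Abel summation: domination of partial sums is inherited by sums with antitone weights. -/
theorem sum_mul_le_of_antitone {a b h : ℕ → ℝ≥0∞} (ha : ∀ M, a M ≠ ∞) (hb : ∀ M, b M ≠ ∞)
    (hab : ∀ N, ∑ M ∈ Finset.range N, a M ≤ ∑ M ∈ Finset.range N, b M) (hh : Antitone h)
    (hfin : ∀ M, h M ≠ ∞) (N : ℕ) :
    ∑ M ∈ Finset.range N, h M * a M ≤ ∑ M ∈ Finset.range N, h M * b M := by
  have hA : ∀ N, ∑ M ∈ Finset.range N, a M ≠ ∞ := fun N => ENNReal.sum_ne_top.2 fun M _ => ha M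
  have hB : ∀ N, ∑ M ∈ Finset.range N, b M ≠ ∞ := fun N => ENNReal.sum_ne_top.2 fun M _ => hb M
  -- This says that the sum of (h M - t)(a M - b M) is at most 0, written without subtraction; the
  -- level `t` is the induction parameter and the claim is the case `t = 0`.
  have key : ∀ N t, (∀ M < N, t ≤ h M) →
      ∑ M ∈ Finset.range N, h M * a M + t * ∑ M ∈ Finset.range N, b M
        ≤ ∑ M ∈ Finset.range N, h M * b M + t * ∑ M ∈ Finset.range N, a M := by
    intro N
    induction N with
    | zero => simp
    | succ N ih =>
      intro t ht
      have h1 := ih (h N) fun M hM => hh hM.le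
      -- With s = h N - t, the induction hypothesis at level `h N` is combined with `s` times the
      -- domination of the partial sums up to N + 1; finiteness permits cancelling the extra terms.
      obtain ⟨s, hs⟩ := exists_add_of_le (ht N N.lt_succ_self)
      have htt : t ≠ ∞ := ne_top_of_le_ne_top (hfin N) (ht N N.lt_succ_self)
      have hst : s ≠ ∞ := ne_top_of_le_ne_top (hfin N) (hs ▸ le_add_self)
      have hAB := mul_le_mul' (le_refl s) (hab (N + 1))
      have hsB : s * ∑ M ∈ Finset.range (N + 1), b M ≠ ∞ := ENNReal.mul_ne_top hst (hB _)
      rw [← ENNReal.add_le_add_iff_right hsB]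
      calc _ = (∑ M ∈ Finset.range N, h M * a M + h N * ∑ M ∈ Finset.range N, b M)
            + (h N * a N + h N * b N) := by
              rw [Finset.sum_range_succ, Finset.sum_range_succ b, hs]
              ring
        _ ≤ (∑ M ∈ Finset.range N, h M * b M + h N * ∑ M ∈ Finset.range N, a M)
            + (h N * a N + h N * b N) := by gcongr
        _ = ∑ M ∈ Finset.range (N + 1), h M * b M + t * ∑ M ∈ Finset.range (N + 1), a M
            + s * ∑ M ∈ Finset.range (N + 1), a M := by
              rw [Finset.sum_range_succ _ N, Finset.sum_range_succ a, hs]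
              ring
        _ ≤ _ := by gcongr
  simpa using key N 0 fun M _ => bot_le

theorem tsum_mul_le_of_antitone {a b h : ℕ → ℝ≥0∞} (ha : ∀ M, a M ≠ ∞) (hb : ∀ M, b M ≠ ∞)
    (hab : ∀ N, ∑ M ∈ Finset.range N, a M ≤ ∑ M ∈ Finset.range N, b M) (hh : Antitone h)
    (hfin : ∀ M, h M ≠ ∞) : ∑' M, h M * a M ≤ ∑' M, h M * b M :=
  le_of_tendsto_of_tendsto' ENNReal.summable.hasSum.tendsto_sum_nat
    ENNReal.summable.hasSum.tendsto_sum_nat (sum_mul_le_of_antitone ha hb hab hh hfin)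

/-- The quotient is 1 - x times the average of the powers x^0, …, x^n. The inequality `hpow` is what
monotonicity amounts to after clearing denominators. -/
theorem antitone_one_sub_pow_div {x : ℝ} (h0 : 0 ≤ x) :
    Antitone fun n : ℕ => (1 - x ^ (n + 1)) / ((n : ℝ) + 1) := by
  have hpow : ∀ n : ℕ, ((n : ℝ) + 1) * x ^ n - n * x ^ (n + 1) ≤ 1 := by
    intro n
    induction n with
    | zero => simp
    | succ n ih =>
      have h2 : 0 ≤ ((n : ℝ) + 1) * (x ^ n * (1 - x) ^ 2) := by positivity
      have h3 : ((n : ℝ) + 1) * (x ^ n * (1 - x) ^ 2)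
          = (((n : ℝ) + 1) * x ^ n - n * x ^ (n + 1))
            - (((n : ℝ) + 1 + 1) * x ^ (n + 1) - (n + 1) * x ^ (n + 1 + 1)) := by ring
      push_cast
      linarith
  refine antitone_nat_of_succ_le fun n => ?_
  have h := hpow (n + 1)
  push_cast at h ⊢
  rw [div_le_div_iff₀ (by positivity) (by positivity)]
  have h3 : (n + 1 + 1 : ℝ) * (1 - x ^ (n + 1)) - (1 - x ^ (n + 1 + 1)) * (n + 1)
      = 1 - (((n : ℝ) + 1 + 1) * x ^ (n + 1) - (n + 1) * x ^ (n + 1 + 1)) := by ring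
  linarith

theorem antitone_ofReal_one_sub_pow_div {x : ℝ} (h0 : 0 ≤ x) :
    Antitone fun n : ℕ => (1 - ENNReal.ofReal x ^ (n + 1)) / ((n : ℝ≥0∞) + 1) := by
  have h : ∀ n : ℕ, (1 - ENNReal.ofReal x ^ (n + 1)) / ((n : ℝ≥0∞) + 1)
      = ENNReal.ofReal ((1 - x ^ (n + 1)) / ((n : ℝ) + 1)) := by
    intro n
    rw [ENNReal.ofReal_div_of_pos (by positivity), ENNReal.ofReal_sub _ (by positivity),
      ENNReal.ofReal_pow h0, ENNReal.ofReal_one, ENNReal.ofReal_add (by positivity) zero_le_one,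
      ENNReal.ofReal_natCast, ENNReal.ofReal_one]
  intro m n hmn
  simp only [h]
  exact ENNReal.ofReal_le_ofReal (antitone_one_sub_pow_div h0 hmn)

end AbelSummation

/-! ### Infinite expected degree -/

section Degree

variable {X : Type*} [MeasurableSpace X] [Nonempty X] (φ : SymKernel X)
  (ν : ℕ → FiniteMeasure X) (lam : ℝ≥0)

theorem degMass_le_hitMass {J : Finset ℕ} {j : ℕ} (hj : j ∈ J) (a : ℕ → X) :
    degMass φ ν (a j) ≤ hitMass φ ν J a := by
  refine lintegral_mono fun y => ?_
  have h : missProb J (fun j => φ.toFun (a j)) y ≤ 1 - uval (φ.toFun (a j) y) := by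
    rw [missProb, ← Finset.mul_prod_erase J _ hj]
    exact mul_le_of_le_one_right' (Finset.prod_le_one' fun _ _ => tsub_le_self)
  calc uval (φ.toFun (a j) y) = 1 - (1 - uval (φ.toFun (a j) y)) :=
        (ENNReal.sub_sub_cancel ENNReal.one_ne_top (uval_le_one _)).symm
    _ ≤ _ := tsub_le_tsub_left h 1

/-- If all degrees are infinite, then there are no finite clusters. -/
theorem sizeMean_eq_zero_of_degMass_eq_top (hlam : lam ≠ 0) (hΦ : ∀ x, degMass φ ν x = ∞)
    (G : Statistic X) (M : ℕ) (x : X) : sizeMean φ ν lam G M x = 0 := by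
  have h := peel_compare lam (A := fun _ _ => 0) (B := peelMean φ ν lam G M) (M := M)
    (r := fun _ => 1) (MeasurePreserving.id (baseMeasure ν)) (by simp)
    (fun k hk a => peelMean_step φ ν lam G hk a)
    (fun k a => measurable_peelMean_update φ ν lam G M k k a) (by simp) ?_ 0 M.zero_le
    (fun _ => x)
  · simpa [sizeMean] using h
  · intro a
    -- Each void probability is exp(-∞) = 0, so the cluster almost surely never consists of
    -- prescribed points only, and the recursion carries this down to every finite cluster size.
    have hhit : hitMass φ ν (Finset.Iic M) a = ∞ :=
      top_le_iff.1 ((hΦ (a 0)).symm.le.trans (degMass_le_hitMass φ ν (by simp) a))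
    simp [peelMean_top, hhit, ENNReal.mul_top (ENNReal.coe_ne_zero.2 hlam), expNeg_top]

end Degree

/-! ### The three inequalities from the comparison of truncated sizes -/

section Comparison

variable {d : ℕ} (φ : ConnectionFn d)

theorem degMass_eq_origin (x : Hyp d) :
    degMass φ.kernel (layer d) x = degMass φ.kernel (layer d) (origin d) := by
  have h := hitMass_comp φ.kernel (layer d) (isAut_transl φ x).toFun_apply
    (isAut_transl φ x).measurePreserving (Finset.Iic 0) fun _ => origin d
  rw [hitMass_singleton, hitMass_singleton] at h
  simpa [transl_origin] using h

theorem law_encard_inter_clusterIn (lam : ℝ≥0) {A : Set (Hyp d)} (hA : MeasurableSet A) (M : ℕ) :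
    law d lam ({ω | (cluster φ ω).encard = M + 1} ∩ clusterIn φ A)
      = sizeMean φ.kernel (layer d) lam (.inside A hA) M (origin d) := by
  have h := law_cluster_event φ lam hA 0 M
  have h0 : ghostFree φ ((0 : unitInterval) : ℝ) = univ := by
    refine eq_univ_of_forall fun ω => eq_empty_of_forall_notMem fun a ha => ?_
    exact absurd ha.2 (not_lt.2 (ω.2.2.2 a).2.1)
  rw [h0, inter_univ] at h
  simpa using h

theorem sizeMean_inside_univ (lam : ℝ≥0) (M : ℕ) (x : Hyp d) :
    sizeMean φ.kernel (layer d) lam (.inside univ .univ) M x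
      = sizeMean φ.kernel (layer d) lam (.one _) M x := by
  refine le_antisymm ?_ ?_ <;> refine sizeMean_mono _ _ _ (fun C x r => ?_) M x
  · exact Statistic.ofSet_le_one _ _ _
  · exact (Statistic.ofSet_eq_one fun p _ => mem_univ _).ge

theorem clusterIn_univ : clusterIn φ univ = univ :=
  eq_univ_of_forall fun _ _ _ => mem_univ _

theorem law_encard (lam : ℝ≥0) (M : ℕ) : law d lam {ω | (cluster φ ω).encard = M + 1}
    = sizeMean φ.kernel (layer d) lam (.one _) M (origin d) := by
  have h := law_encard_inter_clusterIn φ lam MeasurableSet.univ M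
  rwa [clusterIn_univ, inter_univ, sizeMean_inside_univ] at h

theorem connectedToGhost_eq (q : ℝ) : connectedToGhost φ q = (ghostFree φ q)ᶜ := by
  ext ω
  simp only [connectedToGhost, ghostFree, mem_compl_iff, mem_ofPred_eq,
    ← nonempty_iff_ne_empty, cluster, ← ne_eq]
  exact ⟨fun ⟨a, h1, h2⟩ => ⟨a, h2, h1⟩, fun ⟨a, h1, h2⟩ => ⟨a, h2, h1⟩⟩

theorem law_connectedToGhost (lam : ℝ≥0) {A : Set (Hyp d)} (hA : MeasurableSet A)
    (q : unitInterval) (M : ℕ) :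
    law d lam ({ω | (cluster φ ω).encard = M + 1} ∩ (connectedToGhost φ q ∩ clusterIn φ A))
      = (1 - ENNReal.ofReal (1 - q) ^ (M + 1))
        * sizeMean φ.kernel (layer d) lam (.inside A hA) M (origin d) := by
  have hs : {ω | (cluster φ ω).encard = M + 1} ∩ (connectedToGhost φ q ∩ clusterIn φ A)
      = ({ω | (cluster φ ω).encard = M + 1} ∩ clusterIn φ A)
        \ ({ω | (cluster φ ω).encard = M + 1} ∩ clusterIn φ A ∩ ghostFree φ q) := by
    rw [connectedToGhost_eq]
    ext ω
    simp only [mem_inter_iff, Set.mem_sdiff, mem_compl_iff]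
    tauto
  rw [hs, measure_sdiff inter_subset_left (((measurableSet_clusterSize_eq φ _).inter
    (measurableSet_clusterIn φ hA)).inter (measurableSet_ghostFree φ q)).nullMeasurableSet
    (measure_ne_top _ _), law_cluster_event φ lam hA q, law_encard_inter_clusterIn φ lam hA,
    ENNReal.sub_mul, one_mul]
  rintro - -
  rw [← law_encard_inter_clusterIn φ lam hA]
  exact measure_ne_top _ _

theorem cluster_encard_cases (ω : Sample d) :
    (cluster φ ω).encard = ⊤ ∨ ∃ M : ℕ, (cluster φ ω).encard = M + 1 := by
  rcases eq_or_ne (cluster φ ω).encard ⊤ with h | h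
  · exact .inl h
  · right
    obtain ⟨n, hn⟩ := ENat.ne_top_iff_exists.1 h
    have h0 : (cluster φ ω).encard ≠ 0 :=
      encard_ne_zero.2 ⟨none, SimpleGraph.Reachable.refl (G := graph φ ω) none⟩
    rw [← hn] at h0 ⊢
    obtain ⟨m, rfl⟩ := Nat.exists_eq_succ_of_ne_zero (n := n) (by exact_mod_cast h0)
    exact ⟨m, by push_cast; rfl⟩

/-- Below the critical intensity, the cluster is almost surely finite. -/
theorem ae_cluster_encard {lam : ℝ≥0} (hlam : (lam : ℝ≥0∞) < criticalIntensity φ) :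
    ∀ᵐ ω ∂law d lam, ∃ M : ℕ, (cluster φ ω).encard = M + 1 := by
  -- The critical intensity is an infimum over positive intensities only; at intensity 0 the cluster
  -- is the root alone.
  rcases eq_or_ne lam 0 with rfl | h0
  · have h := law_encard φ 0 0
    rw [sizeMean_zero] at h
    have h1 : ∀ᵐ ω ∂law d 0, (cluster φ ω).encard = (0 : ℕ) + 1 := by
      have h2 := (prob_compl_eq_zero_iff (measurableSet_clusterSize_eq φ ((0 : ℕ) + 1))).2
        (h.trans (by simp [Statistic.one, expNeg_zero]))
      exact h2
    filter_upwards [h1] with ω hω using ⟨0, hω⟩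
  · have hp : percolation φ lam = 0 := by
      by_contra hp
      have h : criticalIntensity φ ≤ lam :=
        sInf_le (by exact ⟨lam, rfl, pos_iff_ne_zero.2 h0, pos_iff_ne_zero.2 hp⟩)
      exact h.not_gt hlam
    have : ∀ᵐ ω ∂law d lam, clusterSize φ ω ≠ ∞ := by
      rw [ae_iff]
      simpa [percolation] using hp
    filter_upwards [this] with ω hω
    refine (cluster_encard_cases φ ω).resolve_left fun h => hω ?_
    simp [clusterSize, h]

theorem lintegral_eq_tsum {lam : ℝ≥0} (hlam : (lam : ℝ≥0∞) < criticalIntensity φ)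
    {T : Set (Sample d)} (hT : MeasurableSet T) {F : Sample d → ℝ≥0∞} {g : ℕ → ℝ≥0∞}
    (hF : ∀ ω M, (cluster φ ω).encard = ((M : ℕ) : ℕ∞) + 1 → F ω = g M) :
    ∫⁻ ω, T.indicator F ω ∂law d lam
      = ∑' M, g M * law d lam ({ω | (cluster φ ω).encard = M + 1} ∩ T) := by
  have hm : ∀ M : ℕ, MeasurableSet ({ω | (cluster φ ω).encard = M + 1} ∩ T) := fun M =>
    (measurableSet_clusterSize_eq φ _).inter hT
  have h : ∀ᵐ ω ∂law d lam, T.indicator F ω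
      = ∑' M : ℕ, ({ω | (cluster φ ω).encard = M + 1} ∩ T).indicator (fun _ => g M) ω := by
    filter_upwards [ae_cluster_encard φ hlam] with ω ⟨M, hM⟩
    rw [tsum_eq_single M]
    · by_cases hωT : ω ∈ T
      · rw [indicator_of_mem hωT, indicator_of_mem
          (show ω ∈ {ω | (cluster φ ω).encard = M + 1} ∩ T from ⟨hM, hωT⟩), hF ω M hM]
      · rw [indicator_of_notMem hωT, indicator_of_notMem fun h => hωT h.2]
    · intro M' hM'
      refine indicator_of_notMem (fun h => hM' ?_) _
      have := hM.symm.trans h.1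
      norm_cast at this
      omega
  rw [lintegral_congr_ae h, lintegral_tsum fun M => (measurable_const.indicator (hm M)).aemeasurable]
  exact tsum_congr fun M => lintegral_indicator_const (hm M) _

theorem tsum_sizeMean_one {lam : ℝ≥0} (hlam : (lam : ℝ≥0∞) < criticalIntensity φ) :
    ∑' M, sizeMean φ.kernel (layer d) lam (.one _) M (origin d) = 1 := by
  have h := lintegral_eq_tsum φ hlam MeasurableSet.univ (F := 1) (g := fun _ => 1)
    fun _ _ _ => rfl
  simpa [law_encard] using h.symm

theorem origin_mem_halfSp {n : EuclideanSpace ℝ (Fin d)} {b : ℝ} (hb : b ≤ 0) :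
    origin d ∈ halfSp n b := by
  simp [halfSp, sig, origin, hb]

/-- The comparison of truncated cluster sizes, uniformly in the half-space and in the
subcritical intensity. -/
theorem exists_sizeSum_le (hd : 2 ≤ d) : ∃ c : ℝ≥0∞, c ≠ 0 ∧ c ≠ ∞ ∧
    ∀ lam : ℝ≥0, (lam : ℝ≥0∞) < criticalIntensity φ → ∀ (n : EuclideanSpace ℝ (Fin d)) (b : ℝ),
      ‖n‖ ^ 2 = 1 + b ^ 2 → b ≤ 0 → ∀ N,
        c * sizeSum φ.kernel (layer d) lam (.one _) N (origin d)
          ≤ sizeSum φ.kernel (layer d) lam (.inside _ (measurableSet_halfSp n b)) N (origin d) := by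
  -- When the root has no neighbours its cluster is a singleton and lies in every half-space
  -- containing the origin.
  have isolated : ∀ lam : ℝ≥0, (lam : ℝ≥0∞) * degMass φ.kernel (layer d) (origin d) = 0 →
      ∀ (n : EuclideanSpace ℝ (Fin d)) (b : ℝ), b ≤ 0 → ∀ N,
        sizeSum φ.kernel (layer d) lam (.one _) N (origin d)
          ≤ sizeSum φ.kernel (layer d) lam (.inside _ (measurableSet_halfSp n b)) N (origin d) := by
    intro lam h0 n b hb N
    rcases N with - | N
    · simp [sizeSum]
    have h1 := sizeSum_succ_le φ.kernel (layer d) lam N (origin d)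
    have hm : Measurable fun y => uval (φ.kernel.toFun (origin d) y) :=
      measurable_uval.comp (measurable_kernel_right φ.kernel _)
    simp only [sizeSum_one_eq_origin φ lam N] at h1
    rw [lintegral_mul_const _ hm, ← mul_assoc] at h1
    change _ ≤ 1 + lam * degMass φ.kernel (layer d) (origin d) * _ at h1
    rw [h0, zero_mul, add_zero] at h1
    refine h1.trans ?_
    have h2 : sizeMean φ.kernel (layer d) lam (.inside _ (measurableSet_halfSp n b)) 0 (origin d)
        = 1 := by
      rw [sizeMean_zero, h0, expNeg_zero, mul_one]
      exact Statistic.ofSet_eq_one fun p _ => origin_mem_halfSp hb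
    rw [sizeSum, Finset.sum_range_succ', h2]
    simp
  rcases eq_or_ne (degMass φ.kernel (layer d) (origin d)) 0 with hΦ0 | hΦ0
  · refine ⟨1, one_ne_zero, ENNReal.one_ne_top, fun lam _ n b _ hb N => ?_⟩
    rw [one_mul]
    exact isolated lam (by rw [hΦ0, mul_zero]) n b hb N
  -- With infinite expected degree there are no finite clusters at positive intensity, so only
  -- intensity 0 is subcritical.
  rcases eq_or_ne (degMass φ.kernel (layer d) (origin d)) ∞ with hΦ | hΦ
  · refine ⟨1, one_ne_zero, ENNReal.one_ne_top, fun lam hlam n b _ hb N => ?_⟩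
    rcases eq_or_ne lam 0 with rfl | h0
    · rw [one_mul]
      exact isolated 0 (by simp) n b hb N
    · have h := tsum_sizeMean_one φ hlam
      simp [sizeMean_eq_zero_of_degMass_eq_top φ.kernel (layer d) lam h0
        fun x => (degMass_eq_origin φ x).trans hΦ] at h
  · obtain ⟨Λ, hΛ⟩ := exists_intensity_bound φ hd hΦ hΦ0
    obtain ⟨c, hc0, hct, hc⟩ := halfSpaceBound_zero φ hd Λ hΦ hΦ0
    refine ⟨c, hc0, hct, fun lam hlam n b hn hb N => ?_⟩
    exact hc lam (hΛ lam (tsum_sizeMean_one φ hlam).ge) n b hn (by simpa using hb) N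

/-- Abel summation with the factor M + 1 left in the summands: the partial sums are then exactly the
truncated means `sizeSum`. -/
theorem tsum_sizeMean_le {lam : ℝ≥0} {A : Set (Hyp d)} (hA : MeasurableSet A) {c : ℝ≥0∞}
    (hc : c ≠ ∞) (h : ∀ N, c * sizeSum φ.kernel (layer d) lam (.one _) N (origin d)
      ≤ sizeSum φ.kernel (layer d) lam (.inside A hA) N (origin d)) {w : ℕ → ℝ≥0∞}
    (hw : Antitone w) (hw' : ∀ M, w M ≠ ∞) :
    c * ∑' M : ℕ, (w M * ((M : ℝ≥0∞) + 1)) * sizeMean φ.kernel (layer d) lam (.one _) M (origin d)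
      ≤ ∑' M : ℕ, (w M * ((M : ℝ≥0∞) + 1))
          * sizeMean φ.kernel (layer d) lam (.inside A hA) M (origin d) := by
  have hfin : ∀ G : Statistic (Hyp d), (∀ C x r, G.toFun C x r ≤ 1) → ∀ M : ℕ,
      ((M : ℝ≥0∞) + 1) * sizeMean φ.kernel (layer d) lam G M (origin d) ≠ ∞ := fun G hG M =>
    ENNReal.mul_ne_top (by finiteness) (ne_top_of_le_ne_top ENNReal.one_ne_top
      ((sizeMean_mono φ.kernel (layer d) lam (G' := .one _) hG M _).trans
        (sizeMean_one_le_one _ _ _ M _)))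
  have key := tsum_mul_le_of_antitone
    (a := fun M => c * (((M : ℝ≥0∞) + 1)
      * sizeMean φ.kernel (layer d) lam (.one _) M (origin d)))
    (b := fun M => ((M : ℝ≥0∞) + 1)
      * sizeMean φ.kernel (layer d) lam (.inside A hA) M (origin d))
    (fun M => ENNReal.mul_ne_top hc (hfin _ (fun _ _ _ => le_rfl) M))
    (fun M => hfin _ Statistic.ofSet_le_one M)
    (fun N => by
      rw [← Finset.mul_sum]
      exact h N) hw hw'
  rw [← ENNReal.tsum_mul_left]
  calc _ = _ := tsum_congr fun M => by ring
    _ ≤ _ := key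
    _ = _ := tsum_congr fun M => by ring

/-- The comparison of the expectations of a function of the cluster size on an event whose
conditional probability, given the cluster, depends on its size only. -/
theorem lintegral_le_of_sizeSum_le {lam : ℝ≥0} (hlam : (lam : ℝ≥0∞) < criticalIntensity φ)
    {A : Set (Hyp d)} (hA : MeasurableSet A) {c : ℝ≥0∞} (hc0 : c ≠ 0) (hc : c ≠ ∞)
    (h : ∀ N, c * sizeSum φ.kernel (layer d) lam (.one _) N (origin d)
      ≤ sizeSum φ.kernel (layer d) lam (.inside A hA) N (origin d))
    {T : Set (Sample d)} (hT : MeasurableSet T) {F : Sample d → ℝ≥0∞} {g k w : ℕ → ℝ≥0∞}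
    (hF : ∀ ω M, (cluster φ ω).encard = ((M : ℕ) : ℕ∞) + 1 → F ω = g M)
    (hk : ∀ (B : Set (Hyp d)) (hB : MeasurableSet B) (M : ℕ),
      law d lam ({ω | (cluster φ ω).encard = M + 1} ∩ (T ∩ clusterIn φ B))
        = k M * sizeMean φ.kernel (layer d) lam (.inside B hB) M (origin d))
    (hgk : ∀ M, g M * k M = w M * ((M : ℝ≥0∞) + 1)) (hw : Antitone w) (hw' : ∀ M, w M ≠ ∞) :
    ∫⁻ ω, T.indicator F ω ∂law d lam
      ≤ c⁻¹ * ∫⁻ ω, (T ∩ clusterIn φ A).indicator F ω ∂law d lam := by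
  have hk1 : ∀ M : ℕ, law d lam ({ω | (cluster φ ω).encard = M + 1} ∩ T)
      = k M * sizeMean φ.kernel (layer d) lam (.one _) M (origin d) := by
    intro M
    have h1 := hk univ .univ M
    rwa [clusterIn_univ, inter_univ, sizeMean_inside_univ] at h1
  rw [lintegral_eq_tsum φ hlam hT hF,
    lintegral_eq_tsum φ hlam (hT.inter (measurableSet_clusterIn φ hA)) hF]
  simp only [hk _ hA, hk1, ← mul_assoc (g _), hgk]
  have key := tsum_sizeMean_le φ hA hc h hw hw'
  rw [← ENNReal.div_eq_inv_mul, ENNReal.le_div_iff_mul_le (.inl hc0) (.inl hc), mul_comm]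
  exact key

end Comparison

end HypRCM
end

theorem proposition4p2 (d : ℕ) (hd : d = 2 ∨ d = 3)
    (φ : HypRCM.ConnectionFn d) (hφ : φ.LongDistance) (r : ℝ) (hr : 0 < r) :
    ∃ κ : ℝ≥0, 0 < κ ∧
      ∀ H : HypRCM.HalfSpace d, HypRCM.origin d ∈ H.carrier →
        HypRCM.hinfDist (HypRCM.origin d) H.boundary = r →
        ∀ lam : ℝ≥0, (lam : ℝ≥0∞) < HypRCM.criticalIntensity φ →
        ∀ q ∈ Ioo (0 : ℝ) 1,
          (∫⁻ ω, HypRCM.clusterSize φ ω ∂(HypRCM.law d lam)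
            ≤ κ * ∫⁻ ω, (HypRCM.clusterIn φ H.carrier).indicator (HypRCM.clusterSize φ) ω
                ∂(HypRCM.law d lam)) ∧
          (∫⁻ ω, (HypRCM.ghostFree φ q).indicator (HypRCM.clusterSize φ) ω
                ∂(HypRCM.law d lam)
            ≤ κ * ∫⁻ ω, (HypRCM.ghostFree φ q ∩ HypRCM.clusterIn φ H.carrier).indicator
                (HypRCM.clusterSize φ) ω ∂(HypRCM.law d lam)) ∧
          (HypRCM.law d lam (HypRCM.connectedToGhost φ q)
            ≤ κ * HypRCM.law d lam
                (HypRCM.connectedToGhost φ q ∩ HypRCM.clusterIn φ H.carrier)) := by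
  obtain ⟨c, hc0, hct, hc⟩ := HypRCM.exists_sizeSum_le φ (by omega : 2 ≤ d)
  have hκ : ((c⁻¹.toNNReal : ℝ≥0) : ℝ≥0∞) = c⁻¹ := ENNReal.coe_toNNReal (ENNReal.inv_ne_top.2 hc0)
  refine ⟨c⁻¹.toNNReal, ENNReal.toNNReal_pos (ENNReal.inv_ne_zero.2 hct)
    (ENNReal.inv_ne_top.2 hc0), fun H ho _ lam hlam q hq => ?_⟩
  obtain ⟨n, b, hn, hb, hH⟩ := H.exists_carrier_eq ho
  have hA := HypRCM.measurableSet_halfSp n b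
  have hsum := hc lam hlam n b hn hb
  obtain ⟨q, rfl⟩ : ∃ q' : unitInterval, (q' : ℝ) = q := ⟨⟨q, hq.1.le, hq.2.le⟩, rfl⟩
  have hgf := HypRCM.measurableSet_ghostFree φ q
  have hq1 : ENNReal.ofReal (1 - q) ≤ 1 := by simpa using hq.1.le
  have hsize : ∀ (ω : HypRCM.Sample d) (M : ℕ), (HypRCM.cluster φ ω).encard = (M : ℕ∞) + 1 →
      HypRCM.clusterSize φ ω = (M : ℝ≥0∞) + 1 := by
    intro ω M h
    simp [HypRCM.clusterSize, h]
  rw [hκ, hH]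
  refine ⟨?_, ?_, ?_⟩
  -- Mean cluster size: weight 1.
  · have h := HypRCM.lintegral_le_of_sizeSum_le φ hlam hA hc0 hct hsum MeasurableSet.univ hsize
      (k := fun _ => 1) (w := fun _ => 1)
      (fun B hB M => by rw [univ_inter, HypRCM.law_encard_inter_clusterIn φ lam hB, one_mul])
      (fun M => by rw [mul_one, one_mul]) antitone_const fun _ => ENNReal.one_ne_top
    simpa using h
  -- Mean size of ghost-free clusters: weight (1 - q)^(M+1).
  · refine HypRCM.lintegral_le_of_sizeSum_le φ hlam hA hc0 hct hsum hgf hsize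
      (k := fun M => ENNReal.ofReal (1 - q) ^ (M + 1))
      (w := fun M => ENNReal.ofReal (1 - q) ^ (M + 1))
      (fun B hB M => ?_) (fun M => mul_comm _ _)
      (fun M N hMN => pow_le_pow_right_of_le_one' hq1 (by omega))
      fun M => ENNReal.pow_ne_top ENNReal.ofReal_ne_top
    rw [← HypRCM.law_cluster_event φ lam hB q M, inter_comm (HypRCM.ghostFree φ _), inter_assoc]
  · have hcm : MeasurableSet (HypRCM.connectedToGhost φ (q : ℝ)) := by
      rw [HypRCM.connectedToGhost_eq]
      exact hgf.compl
    -- The probability of meeting a ghost carries no factor M + 1; dividing by M + 1 yields the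
    -- weight, which is still antitone.
    have h := HypRCM.lintegral_le_of_sizeSum_le φ hlam hA hc0 hct hsum hcm (F := 1)
      (g := fun _ => 1) (k := fun M => 1 - ENNReal.ofReal (1 - q) ^ (M + 1))
      (w := fun M => (1 - ENNReal.ofReal (1 - q) ^ (M + 1)) / ((M : ℝ≥0∞) + 1))
      (fun _ _ _ => rfl) (fun B hB M => HypRCM.law_connectedToGhost φ lam hB q M)
      (fun M => by
        rw [one_mul, ENNReal.div_mul_cancel (by simp) (by finiteness)])
      (HypRCM.antitone_ofReal_one_sub_pow_div (by linarith [hq.2]))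
      fun M => ENNReal.div_ne_top (by finiteness) (by simp)
    rwa [lintegral_indicator_one hcm,
      lintegral_indicator_one (hcm.inter (HypRCM.measurableSet_clusterIn φ hA))] at h
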